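/- Let $(\mathcal S,h_{ab},K_{ab})$ consist of a connected (Hausdorff, second countable) smooth 3-manifold $\mathcal S$ with a spin structure, a smooth negative definite metric $h_{ab}$ and a smooth symmetric tensor $K_{ab}$. Assume it is asymptotically Euclidean with two ends: $\mathcal S$ is the union of a compact set and two disjoint open sets, each diffeomorphic to the complement of a closed ball in $\mathbb R^3$ through coordinates $x^i$ in which, with $r=|x|$, $$h_{ij}=-\delta_{ij}+o_\infty(r^{-1/2}),\qquad K_{ij}=o_\infty(r^{-3/2}).$$ Here $u\in H^\infty_\delta$ means that $u$ is smooth and, for every $k\ge 0$, $\int |D^k u|^2\sigma^{-2(\delta-k)-3}\,d\mu<\infty$, where $\sigma=(1+d(O,\cdot)^2)^{1/2}$, $O\in\mathcal S$ is a fixed point and $d$ and $d\mu$ are the Riemannian distance and volume of $-h$; and $f=o_\infty(r^\delta)$ means that $f\in H^\infty_\delta$ near infinity in the end, with coordinate derivatives and weight $r$ in place of $\sigma$. Let $D_{AB}$ be the spinorial Levi-Civita connection of $h_{ab}$, let $K_{ABCD}$ be the spinor counterpart of $K_{ab}$, $\Omega_{ABCD}=K_{(ABCD)}$, and let $\nabla_{AB}$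 be the Sen connection, acting on spinors by $\nabla_{AB}\pi_C=D_{AB}\pi_C+\tfrac12K_{ABC}{}^{D}\pi_D$ and correspondingly on higher valence. For symmetric spinors put $$\Phi(\kappa)_{ABCD}=\nabla_{(AB}\kappa_{CD)},\qquad \Phi^*(\zeta)_{CD}=\nabla^{AB}\zeta_{ABCD}-2\,\Omega^{ABF}{}_{(C}\zeta_{D)ABF},\qquad L=\Phi^*\circ\Phi .$$ Let $\nu_{AB}=\nu_{(AB)}$ be a spinor field on $\mathcal S$ with $\nu_{AB}\in H^\infty_{-1/2}$. Then: 1. if $\nabla_{(AB}\nu_{CD)}=0$ on $\mathcal S$, then $\nu_{AB}=0$ on $\mathcal S$; 2. if $L(\nu_{AB})=0$ on $\mathcal S$, then $\nu_{AB}=0$ on $\mathcal S$. -/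

import Mathlib

open scoped Manifold ContDiff Bundle ENNReal
open Bundle MeasureTheory

noncomputable section

namespace KillingSpinor

/-- The model space `ℝ³`. -/
abbrev E3 : Type := EuclideanSpace ℝ (Fin 3)

/-! ### Spinor algebra in a spin frame

A spinor of valence `n` has components `T_{A₁⋯Aₙ}` with `Aᵢ ∈ {0,1}`.  Indices are moved with
`ε_{AB}`, `ε_{01} = ε^{01} = 1`, by `T^A = ε^{AB} T_B`. -/

/-- Components (all indices down) of a spinor of valence `n` in a spin frame. -/
abbrev Comp (n : ℕ) : Type := (Fin n → Fin 2) → ℂ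

/-- `ε^{AB}`. -/
def eps : Matrix (Fin 2) (Fin 2) ℂ := !![0, 1; -1, 0]

/-- The spatial Infeld-van der Waerden symbols `σ^i_{AB}`: a covector with components `ξ_i` in an
orthonormal frame has spinor components
`ξ_{AB} = (1/√2) [[-ξ₁ - iξ₂, ξ₃], [ξ₃, ξ₁ - iξ₂]]`. -/
def sigma (i : Fin 3) : Matrix (Fin 2) (Fin 2) ℂ :=
  ((Real.sqrt 2 : ℝ) : ℂ)⁻¹ •
    (![!![-1, 0; 0, 1], !![-Complex.I, 0; 0, -Complex.I], !![0, 1; 1, 0]] :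
      Fin 3 → Matrix (Fin 2) (Fin 2) ℂ) i

/-- `σ^i_A{}^B = ε^{BC} σ^i_{AC}`, as a matrix with row `A` and column `B`. -/
def sigmaMixed (i : Fin 3) : Matrix (Fin 2) (Fin 2) ℂ :=
  Matrix.of fun A B => ∑ C, eps B C * sigma i A C

/-- Total symmetrisation `T_{(A₁⋯Aₙ)}`. -/
def symmetrize {n : ℕ} (T : Comp n) : Comp n :=
  fun c => ((n.factorial : ℂ))⁻¹ * ∑ p : Equiv.Perm (Fin n), T (c ∘ p)

/-- The pointwise norm `|T|² = ∑ |T_{A₁⋯Aₙ}|²`; this is the norm obtained from Hermitian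
conjugation, e.g. `ν_{AB} ν̂^{AB}` in valence two. -/
def normSq {n : ℕ} (T : Comp n) : ℝ := ∑ c, ‖T c‖ ^ 2

/-! ### The Riemannian 3-manifold

The 3-metric `h` is negative definite; `⟪v, w⟫ = -h(v, w)` is the Riemannian structure carried by
the tangent bundle. -/

section Manifold

variable {S : Type*} [TopologicalSpace S] [ChartedSpace E3 S]

/-- A field of covariant 2-tensors. -/
abbrev TwoTensor (S : Type*) [TopologicalSpace S] [ChartedSpace E3 S] : Type _ :=
  (x : S) → TangentSpace (𝓡 3) x →L[ℝ] TangentSpace (𝓡 3) x →L[ℝ] ℝ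

/-- The `i`-th coordinate vector of a chart `φ`, at the point with coordinates `y`. -/
def coordVec (φ : OpenPartialHomeomorph S E3) (i : Fin 3) (y : E3) :
    TangentSpace (𝓡 3) (φ.symm y) :=
  mfderiv (𝓡 3) (𝓡 3) φ.symm y (EuclideanSpace.single i (1 : ℝ) : E3)

/-- The directional derivative `X f` at `x` of a complex function along a tangent vector. -/
def dirDeriv (f : S → ℂ) (x : S) (X : TangentSpace (𝓡 3) x) : ℂ :=
  mfderiv (𝓡 3) 𝓘(ℝ, ℂ) f x X

/-- Three vector fields (a local frame when they are linearly independent). -/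
abbrev Frame (S : Type*) [TopologicalSpace S] [ChartedSpace E3 S] : Type _ :=
  Fin 3 → (x : S) → TangentSpace (𝓡 3) x

variable [RiemannianBundle (fun x : S => TangentSpace (𝓡 3) x)]

/-- The positive inner product `-h(v, w)` on a tangent space. -/
def ip {x : S} (v w : TangentSpace (𝓡 3) x) : ℝ := inner ℝ v w

/-- Components `h_{ij}` of the negative definite metric in a chart. -/
def metricCoeff (φ : OpenPartialHomeomorph S E3) (i j : Fin 3) (y : E3) : ℝ :=
  -ip (coordVec φ i y) (coordVec φ j y)

/-- Components of a 2-tensor in a chart. -/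
def tensorCoeff (K : TwoTensor S) (φ : OpenPartialHomeomorph S E3) (i j : Fin 3) (y : E3) : ℝ :=
  K (φ.symm y) (coordVec φ i y) (coordVec φ j y)

/-- The part of the Riemannian volume measure carried by a chart:
`√|det h_{ij}| dy¹dy²dy³` on the chart domain. -/
def chartVolume [MeasurableSpace S] (φ : OpenPartialHomeomorph S E3) : Measure S :=
  ((volume.restrict φ.target).withDensity fun y =>
    ENNReal.ofReal (Real.sqrt |(Matrix.of fun i j => metricCoeff φ i j y).det|)).map φ.symm

/-- The Riemannian volume measure `dμ`: the least measure that dominates its part in every chart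
domain. -/
def riemannianVolume (S : Type*) [TopologicalSpace S] [ChartedSpace E3 S]
    [RiemannianBundle (fun x : S => TangentSpace (𝓡 3) x)] [MeasurableSpace S] : Measure S :=
  ⨆ x : S, chartVolume (chartAt E3 x)

/-- The weight `σ(x) = (1 + d(O, x)²)^{1/2}`, `d` the Riemannian distance. -/
def weight (O x : S) : ℝ :=
  Real.sqrt (1 + (Manifold.riemannianEDist (𝓡 3) O x).toReal ^ 2)

/-- The weighted `L²` norm `‖u‖_δ = (∫ |u|² σ^{-2δ-3} dμ)^{1/2}`. -/
def weightedNorm [MeasurableSpace S] (O : S) (δ : ℝ) (u : S → ℝ) : ℝ≥0∞ :=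
  (∫⁻ x, ENNReal.ofReal (u x ^ 2 * weight O x ^ (-2 * δ - 3)) ∂(riemannianVolume S)) ^ (1 / 2 : ℝ)

/-! ### Covariant derivatives of spinors in a spin frame over an orthonormal frame -/

/-- The connection coefficients `ω_{ijk} = ⟪D_{e_i} e_j, e_k⟫` of the Levi-Civita connection in an
orthonormal frame, from the Koszul formula. -/
def connCoeff (e : Frame S) (i j k : Fin 3) (x : S) : ℝ :=
  (1 / 2) * (ip (VectorField.mlieBracket (𝓡 3) (e i) (e j) x) (e k x)
    - ip (VectorField.mlieBracket (𝓡 3) (e j) (e k) x) (e i x)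
    + ip (VectorField.mlieBracket (𝓡 3) (e k) (e i) x) (e j x))

/-- The spin connection coefficients `Γ_i{}_A{}^B = ½ ω_{ijk} σ^j_A{}^C σ^k_C{}^B`; they are the
trace-free ones for which `σ^j_{AB} ω_{ijk} = Γ_i{}_A{}^C σ^k_{CB} + Γ_i{}_B{}^C σ^k_{AC}`. -/
def spinCoeff (e : Frame S) (i : Fin 3) (x : S) : Matrix (Fin 2) (Fin 2) ℂ :=
  (1 / 2 : ℂ) • ∑ j, ∑ k, (connCoeff e i j k x : ℂ) • (sigmaMixed j * sigmaMixed k)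

/-- The spinorial Levi-Civita derivative `D_{AB} T_{C₁⋯Cₙ} = σ^i_{AB} D_i T_{C₁⋯Cₙ}`; the two new
indices come first. -/
def leviCivitaD (e : Frame S) {n : ℕ} (T : S → Comp n) : S → Comp (n + 2) := fun x c =>
  ∑ i, sigma i (c 0) (c 1) *
    (dirDeriv (fun y => T y fun k => c k.succ.succ) x (e i x)
      - ∑ k : Fin n, ∑ B, spinCoeff e i x (c k.succ.succ) B *
          T x (Function.update (fun l : Fin n => c l.succ.succ) k B))

/-- The iterated derivatives `D_{A_kB_k} ⋯ D_{A_1B_1} T`. -/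
def iterD (e : Frame S) {n : ℕ} (T : S → Comp n) : (k : ℕ) → S → Comp (n + 2 * k)
  | 0 => T
  | k + 1 => leviCivitaD e (iterD e T k)

/-- `K_{ABCD} = σ^i_{AB} σ^j_{CD} K_{ij}`. -/
def extrinsicSpinor (e : Frame S) (K : TwoTensor S) (x : S) : Comp 4 := fun c =>
  ∑ i, ∑ j, sigma i (c 0) (c 1) * sigma j (c 2) (c 3) * (K x (e i x) (e j x) : ℂ)

/-- `Ω_{ABCD} = K_{(ABCD)}`. -/
def omegaSpinor (e : Frame S) (K : TwoTensor S) (x : S) : Comp 4 :=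
  symmetrize (extrinsicSpinor e K x)

/-- The Sen connection: `∇_{AB} T_{C₁⋯Cₙ} = D_{AB} T_{C₁⋯Cₙ} + ½ ∑ₖ K_{ABCₖ}{}^F T_{⋯F⋯}`. -/
def senD (e : Frame S) (K : TwoTensor S) {n : ℕ} (T : S → Comp n) : S → Comp (n + 2) := fun x c =>
  leviCivitaD e T x c + (1 / 2) * ∑ k : Fin n, ∑ F, ∑ G,
    eps F G * extrinsicSpinor e K x ![c 0, c 1, c k.succ.succ, G] *
      T x (Function.update (fun l : Fin n => c l.succ.succ) k F)

/-- The spatial Killing spinor operator `Φ(κ)_{ABCD} = ∇_{(AB} κ_{CD)}`. -/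
def killingOp (e : Frame S) (K : TwoTensor S) (κ : S → Comp 2) : S → Comp 4 := fun x =>
  symmetrize (senD e K κ x)

/-- The formal adjoint
`Φ*(ζ)_{CD} = ∇^{AB} ζ_{ABCD} - 2 Ω^{ABF}{}_{(C} ζ_{D)ABF}`. -/
def killingAdj (e : Frame S) (K : TwoTensor S) (ζ : S → Comp 4) : S → Comp 2 := fun x c =>
  (∑ A, ∑ B, ∑ A', ∑ B', eps A A' * eps B B' * senD e K ζ x ![A', B', A, B, c 0, c 1])
    - 2 * symmetrize (fun d : Fin 2 → Fin 2 =>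
        ∑ A, ∑ B, ∑ F, ∑ A', ∑ B', ∑ F', eps A A' * eps B B' * eps F F' *
          omegaSpinor e K x ![A', B', F', d 0] * ζ x ![d 1, A, B, F]) c

/-- The approximate Killing spinor operator `L = Φ* ∘ Φ`. -/
def approxKillingOp (e : Frame S) (K : TwoTensor S) (κ : S → Comp 2) : S → Comp 2 :=
  killingAdj e K (killingOp e K κ)

/-! ### Spin structures and spinor fields -/

/-- A spin structure on `(S, h)`: an open cover by domains of smooth orthonormal frames
together with smooth `SU(2)`-valued transition functions that satisfy the cocycle condition and lift
the changes of frame through `SU(2) → SO(3)`. -/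
structure SpinStructure (S : Type*) [TopologicalSpace S] [ChartedSpace E3 S] [IsManifold (𝓡 3) ∞ S]
    [RiemannianBundle (fun x : S => TangentSpace (𝓡 3) x)] (ι : Type*) where
  /-- domains of the local spin frames -/
  dom : ι → Set S
  isOpen_dom : ∀ a, IsOpen (dom a)
  /-- a spin frame defined near a given point -/
  indexAt : S → ι
  mem_indexAt : ∀ x, x ∈ dom (indexAt x)
  /-- the orthonormal frames -/
  frame : ι → Frame S
  frame_smooth : ∀ a i, ContMDiffOn (𝓡 3) (𝓡 3).tangent ∞
    (fun x => (⟨x, frame a i x⟩ : TangentBundle (𝓡 3) S)) (dom a)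
  frame_orthonormal : ∀ a, ∀ x ∈ dom a, ∀ i j,
    ip (frame a i x) (frame a j x) = if i = j then 1 else 0
  /-- transition functions of the spinor bundle: `π^a_A = g^{ab}_A{}^B π^b_B` -/
  trans : ι → ι → S → Matrix (Fin 2) (Fin 2) ℂ
  trans_mem : ∀ a b, ∀ x ∈ dom a ∩ dom b,
    trans a b x ∈ Matrix.specialUnitaryGroup (Fin 2) ℂ
  trans_smooth : ∀ a b A B,
    ContMDiffOn (𝓡 3) 𝓘(ℝ, ℂ) ∞ (fun x => trans a b x A B) (dom a ∩ dom b)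
  trans_cocycle : ∀ a b c, ∀ x ∈ dom a ∩ dom b ∩ dom c,
    trans a b x * trans b c x = trans a c x
  /-- the transition functions carry `σ^k_{AB}` to `σ^i_{AB}` according to the change of frame -/
  trans_frame : ∀ a b, ∀ x ∈ dom a ∩ dom b, ∀ k,
    trans a b x * sigma k * (trans a b x).transpose
      = ∑ i, (ip (frame a i x) (frame b k x) : ℂ) • sigma i

variable [IsManifold (𝓡 3) ∞ S] {ι : Type*}

/-- A smooth totally symmetric spinor field of valence `n`: smooth components in every local spin
frame, related by the transition functions of the spinor bundle. -/
structure SpinorField (𝔰 : SpinStructure S ι) (n : ℕ) where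
  comp : ι → S → Comp n
  smooth : ∀ a c, ContMDiffOn (𝓡 3) 𝓘(ℝ, ℂ) ∞ (fun x => comp a x c) (𝔰.dom a)
  symm : ∀ a, ∀ x ∈ 𝔰.dom a, ∀ (p : Equiv.Perm (Fin n)) (c : Fin n → Fin 2),
    comp a x (c ∘ p) = comp a x c
  compat : ∀ a b, ∀ x ∈ 𝔰.dom a ∩ 𝔰.dom b, ∀ c,
    comp a x c = ∑ d : Fin n → Fin 2, (∏ k, 𝔰.trans a b x (c k) (d k)) * comp b x d

variable {𝔰 : SpinStructure S ι}

/-- The spinor field vanishes on `S`. -/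
def SpinorField.IsZero {n : ℕ} (ν : SpinorField 𝔰 n) : Prop :=
  ∀ a, ∀ x ∈ 𝔰.dom a, ν.comp a x = 0

/-- The spatial Killing spinor equation `∇_{(AB} ν_{CD)} = 0` on `S`. -/
def SpinorField.IsSpatialKilling (ν : SpinorField 𝔰 2) (K : TwoTensor S) : Prop :=
  ∀ a, ∀ x ∈ 𝔰.dom a, killingOp (𝔰.frame a) K (ν.comp a) x = 0

/-- The approximate Killing spinor equation `L(ν) = 0` on `S`. -/
def SpinorField.IsApproxKilling (ν : SpinorField 𝔰 2) (K : TwoTensor S) : Prop :=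
  ∀ a, ∀ x ∈ 𝔰.dom a, approxKillingOp (𝔰.frame a) K (ν.comp a) x = 0

/-- The norm `|D^k ν|` at a point; it does not depend on the spin frame in which it is computed. -/
def SpinorField.derivNorm {n : ℕ} (ν : SpinorField 𝔰 n) (k : ℕ) (x : S) : ℝ :=
  Real.sqrt (normSq (iterD (𝔰.frame (𝔰.indexAt x)) (ν.comp (𝔰.indexAt x)) k x))

/-- The weighted Sobolev norm `‖ν‖_{s,δ} = ∑_{k ≤ s} ‖D^k ν‖_{δ-k}`. -/
def SpinorField.sobolevNorm [MeasurableSpace S] {n : ℕ} (ν : SpinorField 𝔰 n)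
    (O : S) (s : ℕ) (δ : ℝ) : ℝ≥0∞ :=
  ∑ k ∈ Finset.range (s + 1), weightedNorm O (δ - k) (ν.derivNorm k)

/-- `ν ∈ H^∞_δ`: every norm `‖ν‖_{s,δ}` is finite. -/
def SpinorField.MemHInfty [MeasurableSpace S] {n : ℕ} (ν : SpinorField 𝔰 n)
    (O : S) (δ : ℝ) : Prop :=
  ∀ s : ℕ, ν.sobolevNorm O s δ < ⊤

end Manifold

/-! ### Asymptotically Euclidean data -/

/-- `f = o_∞(r^δ)` on `{r > ρ} ⊆ ℝ³`: `f` is in the weighted Sobolev space `H^∞_δ` there. -/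
def DecaysInfty (ρ δ : ℝ) (f : E3 → ℝ) : Prop :=
  ∀ k : ℕ, IntegrableOn
    (fun y => ‖iteratedFDeriv ℝ k f y‖ ^ 2 * ‖y‖ ^ (-2 * (δ - k) - 3)) {y : E3 | ρ < ‖y‖}

section Data

variable {S : Type*} [TopologicalSpace S] [ChartedSpace E3 S] [IsManifold (𝓡 3) ∞ S]
  [RiemannianBundle (fun x : S => TangentSpace (𝓡 3) x)]

/-- `φ` maps the open set `φ.source` diffeomorphically onto the complement of a closed ball in `ℝ³`
and gives asymptotically Cartesian coordinates there:
`h_{ij} = -δ_{ij} + o_∞(r^{-1/2})`, `K_{ij} = o_∞(r^{-3/2})`. -/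
def IsAsymptoticEnd (K : TwoTensor S) (φ : OpenPartialHomeomorph S E3) : Prop :=
  φ ∈ IsManifold.maximalAtlas (𝓡 3) ∞ S ∧
  ∃ R ρ : ℝ, 0 < R ∧ R < ρ ∧ φ.target = (Metric.closedBall (0 : E3) R)ᶜ ∧
    (∀ i j, DecaysInfty ρ (-1 / 2)
      (fun y => metricCoeff φ i j y - (-(if i = j then 1 else 0)))) ∧
    (∀ i j, DecaysInfty ρ (-3 / 2) (tensorCoeff K φ i j))

/-- `(S, h, K)` is asymptotically Euclidean with two ends: `K` is a smooth symmetric 2-tensor and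
`S` is the union of a compact set and two disjoint asymptotically Euclidean ends. -/
structure IsAsymptoticallyEuclidean (K : TwoTensor S) : Prop where
  smooth : ContMDiff (𝓡 3) ((𝓡 3).prod 𝓘(ℝ, E3 →L[ℝ] E3 →L[ℝ] ℝ)) ∞
    (fun x => TotalSpace.mk' (E3 →L[ℝ] E3 →L[ℝ] ℝ)
      (E := fun x : S => TangentSpace (𝓡 3) x →L[ℝ] TangentSpace (𝓡 3) x →L[ℝ] ℝ) x (K x))
  symm : ∀ x v w, K x v w = K x w v
  ends : ∃ (C : Set S) (φ₁ φ₂ : OpenPartialHomeomorph S E3), IsCompact C ∧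
    IsAsymptoticEnd K φ₁ ∧ IsAsymptoticEnd K φ₂ ∧ Disjoint φ₁.source φ₂.source ∧
    C ∪ φ₁.source ∪ φ₂.source = Set.univ

end Data

end KillingSpinor

end

noncomputable section

namespace KillingSpinor

/-! Through the symbols σ^i_{AB} a symmetric valence-two spinor is a complex vector z, and a totally
symmetric valence-four spinor is a trace-free symmetric complex tensor. In these terms Φ(ν) is the
trace-free symmetric part of D_i z_j − β ε_{jkl} K_{ik} z_l with β = i/√2: the conformal Killing
operator plus a zeroth-order term. Because β is imaginary, Φ* becomes the formal adjoint of Φ for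
the Hermitian product, and L(ν) = 0 makes the flux J_i = Re(Φ(ν)_{ij} \bar z_j) satisfy div J =
|Φ(ν)|² (`divergence_identity`).

From L(ν) = 0 to Φ(ν) = 0. Integrating div(f J) for compactly supported f gives ∫ df(J) + f|Φ(ν)|² =
0 (`green_identity`). Take f = χ², where χ is 1 up to radius R in each end, 0 beyond 2R, and |dχ| =
O(1/R). As |J| ≤ |Φ(ν)||ν|, half of the energy absorbs the cross term (`half_coreCutoff_mul_le`),
and the other half is bounded by a multiple of ∫_{r ≥ R} |ν|²/r². For δ = −1/2 the weight σ^{−2δ−3}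
is σ^{−2}, comparable from below with r^{−2} in an end, so this tail is finite and tends to 0. That
χ has compact support is a topological fact about the ends, `IsAsymptoticallyEuclidean.exists_ends`.

From Φ(ν) = 0 to ν = 0. The conformal Killing equation in dimension three is of finite type: third
derivatives of a vector field are linear combinations of second derivatives of its conformal Killing
form (`norm_third_le`). Where the metric is ε-close to δ_ij and K is ε-small at scale r, third
derivatives of a solution are therefore at most Cε times its second-order jet
(`norm_chartZ_three_le`). This is used twice.

In an end the data are nearly flat at scale r = |y|. Jets grow at most exponentially along segments
(Gronwall) and are controlled by values at finitely many points, hence by local L² norms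
(`ofReal_norm_jet2_sq_le`); the weighted bound then gives jets of size O(r^{−1/2}). Integrating the
third-derivative bound inwards from infinity three times reproduces the decay estimate with half the
constant, so the jet vanishes for large r (`jet2_eq_zero_of_decay`).

Near any point, coordinates orthonormal at the point make the data nearly flat on small balls, and
Gronwall shows that a solution whose two-jet vanishes at the centre vanishes nearby. The interior of
the zero set is thus closed as well as open, and connectedness spreads the zero from the end to all
of the manifold (`isZero_of_chartZ_eq_zero`). -/

lemma clm_apply_eq_sum {F : Type*} [NormedAddCommGroup F] [NormedSpace ℝ F] (L : E3 →L[ℝ] F)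
    (v : E3) : L v = ∑ p, v p • L (EuclideanSpace.single p 1) := by
  have : v = ∑ p, v p • (EuclideanSpace.single p (1 : ℝ) : E3) := by
    ext q
    simp [Finset.sum_apply, Pi.single_apply]
  conv_lhs => rw [this]
  simp

/-! ### Spinor algebra: symmetric spinors as complex vectors and tensors -/

/-- The Levi-Civita symbol `ε_{ijk}`. -/
def levi : Fin 3 → Fin 3 → Fin 3 → ℂ :=
  ![![![0, 0, 0], ![0, 0, 1], ![0, -1, 0]], ![![0, 0, -1], ![0, 0, 0], ![1, 0, 0]],
    ![![0, 1, 0], ![-1, 0, 0], ![0, 0, 0]]]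

/-- The constant `i/√2`. -/
def beta : ℂ := Complex.I * ((Real.sqrt 2 : ℝ) : ℂ)⁻¹

lemma inv_sqrt_two_mul_self : ((Real.sqrt 2 : ℝ) : ℂ)⁻¹ * ((Real.sqrt 2 : ℝ) : ℂ)⁻¹ = 1 / 2 := by
  rw [← mul_inv, ← Complex.ofReal_mul, Real.mul_self_sqrt (by norm_num)]
  norm_num

lemma sigma_symm (i : Fin 3) (A B : Fin 2) : sigma i A B = sigma i B A := by
  fin_cases i <;> fin_cases A <;> fin_cases B <;> simp [sigma]

/-- The sign reflects that h is negative definite: full contraction with two ε's returns −δ_ij. It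
is the source of the minus sign in front of the divergence in `adjVec`. -/
lemma sigma_contract (i j : Fin 3) :
    ∑ A, ∑ B, ∑ A', ∑ B', eps A A' * eps B B' * (sigma i A' B' * sigma j A B)
      = if i = j then -1 else 0 := by
  have h := inv_sqrt_two_mul_self
  generalize hs : ((Real.sqrt 2 : ℝ) : ℂ)⁻¹ = s at h
  fin_cases i <;> fin_cases j <;> simp [sigma, eps, Fin.sum_univ_two, hs] <;>
    first
    | linear_combination (-2 : ℂ) * h
    | linear_combination (-2 : ℂ) * h + 2 * s * s * Complex.I_mul_I

/-- The σ's are essentially Pauli matrices, and contracting one index and symmetrising the other two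
takes their commutator, that is, a cross product. Every term in K of the Sen connection enters
through this identity. -/
lemma sigma_cross (j k : Fin 3) (C D : Fin 2) :
    ∑ F, ∑ G, eps F G * (sigma j C G * sigma k F D + sigma j D G * sigma k C F)
      = -(2 * beta) * ∑ l, levi j k l * sigma l C D := by
  have h := inv_sqrt_two_mul_self
  generalize hs : ((Real.sqrt 2 : ℝ) : ℂ)⁻¹ = s at h
  fin_cases j <;> fin_cases k <;> fin_cases C <;> fin_cases D <;>
    simp [sigma, eps, Fin.sum_univ_two, Fin.sum_univ_three, hs, levi, beta] <;>
    first
    | ring1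
    | linear_combination 2 * s * s * Complex.I_mul_I
    | linear_combination (-2) * s * s * Complex.I_mul_I

/-- The isomorphism of Lie algebras behind the double cover: the quadratic expression ½ w_{jk} σ^j
σ^k, acting on both indices of σ^k, is the infinitesimal rotation w. Once antisymmetry leaves three
independent entries it is a finite check. -/
lemma spinCoeff_action (w : Fin 3 → Fin 3 → ℂ) (hw : ∀ j k, w j k = -w k j) (k : Fin 3)
    (C D : Fin 2) :
    ∑ B, (((1 / 2 : ℂ) • ∑ j, ∑ k, w j k • (sigmaMixed j * sigmaMixed k)) C B * sigma k B D
      + ((1 / 2 : ℂ) • ∑ j, ∑ k, w j k • (sigmaMixed j * sigmaMixed k)) D B * sigma k C B)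
      = ∑ j, w j k * sigma j C D := by
  have h := inv_sqrt_two_mul_self
  have hI := Complex.I_mul_I
  have h0 : ∀ j, w j j = 0 := fun j => by
    have := hw j j
    linear_combination this / 2
  rw [Fin.sum_univ_two]
  simp only [Matrix.smul_apply, Matrix.sum_apply, Matrix.mul_apply, Fin.sum_univ_three,
    Fin.sum_univ_two, h0, hw 1 0, hw 2 0, hw 2 1, smul_eq_mul, sigmaMixed, Matrix.of_apply]
  generalize hs : ((Real.sqrt 2 : ℝ) : ℂ)⁻¹ = s at h
  fin_cases k <;> fin_cases C <;> fin_cases D <;>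
    simp [sigma, eps, hs, Matrix.mul_apply, Fin.sum_univ_two, Fin.sum_univ_three, h0, hw 1 0, hw 2 0, hw 2 1] <;> grind

/-- Lists the 24 permutations as the 4-tuples with distinct entries, a form in which a sum over the
symmetric group expands into explicit terms. -/
lemma sum_perm_four {M : Type*} [AddCommMonoid M] (F : Fin 4 → Fin 4 → Fin 4 → Fin 4 → M) :
    ∑ p : Equiv.Perm (Fin 4), F (p 0) (p 1) (p 2) (p 3) =
      ∑ a, ∑ b, ∑ d, ∑ e, if a ≠ b ∧ a ≠ d ∧ a ≠ e ∧ b ≠ d ∧ b ≠ e ∧ d ≠ e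
        then F a b d e else 0 := by
  simp only [← Fintype.sum_prod_type']
  rw [← Finset.sum_filter]
  refine Finset.sum_bij (fun p _ => (p 0, p 1, p 2, p 3)) ?_ ?_ ?_ (fun _ _ => rfl)
  · intro p _
    simp
  · intro p _ q _ h
    simp only [Prod.mk.injEq] at h
    ext i
    fin_cases i <;> simp [h]
  · rintro ⟨a, b, d, e⟩ h
    simp only [Finset.mem_filter, Finset.mem_univ, true_and] at h
    obtain ⟨h1, h2, h3, h4, h5, h6⟩ := h
    have hi : Function.Injective ![a, b, d, e] := by
      intro i j hij
      fin_cases i <;> fin_cases j <;> simp_all [eq_comm]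
    exact ⟨Equiv.ofBijective _ (Finite.injective_iff_bijective.1 hi), Finset.mem_univ _, rfl⟩

/-- The trace-free symmetric part of a matrix. -/
def tfSym (M : Fin 3 → Fin 3 → ℂ) (i j : Fin 3) : ℂ :=
  (M i j + M j i) / 2 - if i = j then (∑ k, M k k) / 3 else 0

/-- The valence two spinor of a complex vector. -/
def vecSpinor (z : Fin 3 → ℂ) : Comp 2 := fun c => ∑ i, z i * sigma i (c 0) (c 1)

/-- The valence four spinor of a complex 2-tensor. -/
def tensorSpinor (M : Fin 3 → Fin 3 → ℂ) : Comp 4 :=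
  fun c => ∑ i, ∑ j, M i j * (sigma i (c 0) (c 1) * sigma j (c 2) (c 3))

/-- A product of two symmetric spin spaces Sym² ⊗ Sym² splits as Sym⁴ ⊕ Sym² ⊕ Sym⁰, matching the
trace-free symmetric, antisymmetric and trace parts of a 2-tensor. Total symmetrisation is the
projection onto the first summand. -/
lemma symmetrize_tensorSpinor (M : Fin 3 → Fin 3 → ℂ) :
    symmetrize (tensorSpinor M) = tensorSpinor (tfSym M) := by
  funext c
  have hI := Complex.I_mul_I
  have h := inv_sqrt_two_mul_self
  have e := sum_perm_four (fun a b d f => ∑ i, ∑ j,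
    M i j * (sigma i (c a) (c b) * sigma j (c d) (c f)))
  simp only [symmetrize, tensorSpinor, Function.comp_apply]
  rw [e]
  clear e
  simp only [Fin.sum_univ_four (M := ℂ), ne_eq, Fin.reduceEq, not_true_eq_false, not_false_eq_true,
    and_self, and_true, and_false, if_true, if_false, zero_add, add_zero]
  generalize h0 : c 0 = c0
  generalize h1 : c 1 = c1
  generalize h2 : c 2 = c2
  generalize h3 : c 3 = c3
  simp only [tfSym, Fin.sum_univ_three]
  generalize hs : ((Real.sqrt 2 : ℝ) : ℂ)⁻¹ = s at h
  fin_cases c0 <;> fin_cases c1 <;> fin_cases c2 <;> fin_cases c3 <;>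
    simp [sigma, hs, Nat.factorial] <;> ring_nf <;> try (simp only [Complex.I_sq]; ring_nf)

/-! ### The Sen connection and the Killing operator on complex vectors -/

section

variable {S : Type*} [TopologicalSpace S] [ChartedSpace E3 S]

lemma dirDeriv_congr {f g : S → ℂ} {x : S} (h : f =ᶠ[nhds x] g) (X : TangentSpace (𝓡 3) x) :
    dirDeriv f x X = dirDeriv g x X := by
  rw [dirDeriv, dirDeriv, h.mfderiv_eq]
  rfl

lemma dirDeriv_sum {α : Type} {t : Finset α} {f : α → S → ℂ} {x : S}
    (hf : ∀ i ∈ t, MDifferentiableAt (𝓡 3) 𝓘(ℝ, ℂ) (f i) x) (X : TangentSpace (𝓡 3) x) :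
    dirDeriv (fun y => ∑ i ∈ t, f i y) x X = ∑ i ∈ t, dirDeriv (f i) x X := by
  have h : HasMFDerivAt (𝓡 3) 𝓘(ℝ, ℂ) (∑ i ∈ t, f i) x
      (∑ i ∈ t, (mfderiv (𝓡 3) 𝓘(ℝ, ℂ) (f i) x : E3 →L[ℝ] ℂ)) :=
    HasMFDerivAt.sum fun i hi => (hf i hi).hasMFDerivAt
  have e : (∑ i ∈ t, f i) = fun y => ∑ i ∈ t, f i y := by ext; simp
  rw [e] at h
  rw [dirDeriv, h.mfderiv]
  exact sum_apply _ _ _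

lemma dirDeriv_mul {f g : S → ℂ} {x : S} (hf : MDifferentiableAt (𝓡 3) 𝓘(ℝ, ℂ) f x)
    (hg : MDifferentiableAt (𝓡 3) 𝓘(ℝ, ℂ) g x) (X : TangentSpace (𝓡 3) x) :
    dirDeriv (fun y => f y * g y) x X = f x * dirDeriv g x X + g x * dirDeriv f x X := by
  have h := hf.hasMFDerivAt.mul hg.hasMFDerivAt
  rw [dirDeriv, show (fun y => f y * g y) = f * g from rfl, h.mfderiv]
  rfl

lemma dirDeriv_mul_const {f : S → ℂ} {x : S} (hf : MDifferentiableAt (𝓡 3) 𝓘(ℝ, ℂ) f x) (a : ℂ)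
    (X : TangentSpace (𝓡 3) x) :
    dirDeriv (fun y => f y * a) x X = dirDeriv f x X * a := by
  rw [dirDeriv_mul hf (mdifferentiableAt_const), mul_comm a]
  simp only [dirDeriv, mfderiv_const]
  exact (congrArg (· + _) (mul_zero _)).trans (zero_add _)

variable [RiemannianBundle (fun x : S => TangentSpace (𝓡 3) x)]

lemma connCoeff_antisymm (e : Frame S) (i j k : Fin 3) (x : S) :
    connCoeff e i j k x = -connCoeff e i k j x := by
  simp only [connCoeff]
  rw [VectorField.mlieBracket_swap_apply (V := e k) (W := e j),
    VectorField.mlieBracket_swap_apply (V := e i) (W := e k),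
    VectorField.mlieBracket_swap_apply (V := e j) (W := e i)]
  simp only [ip, inner_neg_left]
  ring

/-- The components `D_i z_j` of the covariant derivative of a vector in an orthonormal frame. -/
def covVec (e : Frame S) (z : S → Fin 3 → ℂ) (x : S) (i j : Fin 3) : ℂ :=
  dirDeriv (fun y => z y j) x (e i x) - ∑ k, (connCoeff e i j k x : ℂ) * z x k

/-- The components `D_i Q_{jk}` of the covariant derivative of a 2-tensor. -/
def covTensor (e : Frame S) (Q : S → Fin 3 → Fin 3 → ℂ) (x : S) (i j k : Fin 3) : ℂ :=
  dirDeriv (fun y => Q y j k) x (e i x) - ∑ l, (connCoeff e i j l x : ℂ) * Q x l k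
    - ∑ l, (connCoeff e i k l x : ℂ) * Q x j l

/-- Covariant constancy of the σ's. It is what turns spinorial derivatives into ordinary Levi-Civita
derivatives of the vector or tensor components. -/
lemma spinCoeff_sigma (e : Frame S) (x : S) (i k : Fin 3) (C D : Fin 2) :
    ∑ B, spinCoeff e i x C B * sigma k B D + ∑ B, spinCoeff e i x D B * sigma k C B
      = ∑ j, (connCoeff e i j k x : ℂ) * sigma j C D := by
  rw [← Finset.sum_add_distrib]
  refine spinCoeff_action (fun j k => (connCoeff e i j k x : ℂ)) (fun j k => ?_) k C D
  rw [connCoeff_antisymm]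
  push_cast
  ring

lemma leviCivitaD_vecSpinor (e : Frame S) {κ : S → Comp 2} {z : S → Fin 3 → ℂ} {x : S}
    (hκ : κ =ᶠ[nhds x] fun y => vecSpinor (z y))
    (hz : ∀ i, MDifferentiableAt (𝓡 3) 𝓘(ℝ, ℂ) (fun y => z y i) x) :
    leviCivitaD e κ x = tensorSpinor (covVec e z x) := by
  funext c
  simp only [leviCivitaD, tensorSpinor]
  refine Finset.sum_congr rfl fun i _ => ?_
  have h1 : dirDeriv (fun y => κ y fun k => c k.succ.succ) x (e i x)
      = ∑ j, dirDeriv (fun y => z y j) x (e i x) * sigma j (c 2) (c 3) := by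
    rw [dirDeriv_congr (g := fun y => ∑ j, z y j * sigma j (c 2) (c 3))
      (hκ.mono fun y hy => by simp only [hy]; rfl), dirDeriv_sum]
    · exact Finset.sum_congr rfl fun j _ => dirDeriv_mul_const (hz j) _ _
    · exact fun j _ => (hz j).mul mdifferentiableAt_const
  rw [h1, hκ.eq_of_nhds]
  simp only [vecSpinor, Fin.sum_univ_two (M := ℂ) (f := fun k : Fin 2 => ∑ B, _)]
  have e0 := fun k => spinCoeff_sigma e x i k (c 2) (c 3)
  have hk : ∑ j, ∑ k, (connCoeff e i j k x : ℂ) * z x k * sigma j (c 2) (c 3)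
      = ∑ k, z x k * (∑ B, spinCoeff e i x (c 2) B * sigma k B (c 3)
        + ∑ B, spinCoeff e i x (c 3) B * sigma k (c 2) B) := by
    rw [Finset.sum_comm]
    refine Finset.sum_congr rfl fun k _ => ?_
    rw [e0 k, Finset.mul_sum]
    exact Finset.sum_congr rfl fun j _ => by ring
  simp only [covVec, sub_mul, Finset.sum_mul, mul_sub]
  have hk' : ∑ j, ∑ k, (connCoeff e i j k x : ℂ) * z x k *
      (sigma i (c 0) (c 1) * sigma j (c 2) (c 3))
      = sigma i (c 0) (c 1) * ∑ j, ∑ k, (connCoeff e i j k x : ℂ) * z x k * sigma j (c 2) (c 3) := by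
    simp only [Finset.mul_sum]
    exact Finset.sum_congr rfl fun j _ => Finset.sum_congr rfl fun k _ => by ring
  rw [Finset.sum_sub_distrib, hk', hk]
  simp [Fin.sum_univ_two, Fin.sum_univ_three, Function.update]
  ring

lemma leviCivitaD_tensorSpinor (e : Frame S) {ζ : S → Comp 4} {Q : S → Fin 3 → Fin 3 → ℂ} {x : S}
    (hζ : ζ =ᶠ[nhds x] fun y => tensorSpinor (Q y))
    (hQ : ∀ i j, MDifferentiableAt (𝓡 3) 𝓘(ℝ, ℂ) (fun y => Q y i j) x) (c : Fin 6 → Fin 2) :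
    leviCivitaD e ζ x c = ∑ i, sigma i (c 0) (c 1) *
      tensorSpinor (covTensor e Q x i) ![c 2, c 3, c 4, c 5] := by
  simp only [leviCivitaD, tensorSpinor]
  refine Finset.sum_congr rfl fun i _ => ?_
  have h1 : dirDeriv (fun y => ζ y fun k => c k.succ.succ) x (e i x)
      = ∑ j, ∑ k, dirDeriv (fun y => Q y j k) x (e i x) *
        (sigma j (c 2) (c 3) * sigma k (c 4) (c 5)) := by
    rw [dirDeriv_congr (g := fun y => ∑ j, ∑ k, Q y j k * (sigma j (c 2) (c 3) * sigma k (c 4) (c 5)))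
      (hζ.mono fun y hy => by simp only [hy]; rfl), dirDeriv_sum]
    · refine Finset.sum_congr rfl fun j _ => ?_
      rw [dirDeriv_sum]
      · exact Finset.sum_congr rfl fun k _ => dirDeriv_mul_const (hQ j k) _ _
      · exact fun k _ => (hQ j k).mul mdifferentiableAt_const
    · intro j _
      have := MDifferentiableAt.sum (t := Finset.univ) (f := fun k y => Q y j k *
        (sigma j (c 2) (c 3) * sigma k (c 4) (c 5)))
        (fun k _ => (hQ j k).mul mdifferentiableAt_const)
      rwa [show (∑ k, fun y => Q y j k * (sigma j (c 2) (c 3) * sigma k (c 4) (c 5)))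
        = fun y => ∑ k, Q y j k * (sigma j (c 2) (c 3) * sigma k (c 4) (c 5)) from by
          funext y; exact Finset.sum_apply _ _ _] at this
  rw [h1, hζ.eq_of_nhds]
  simp only [tensorSpinor]
  have hk : ∑ j, ∑ k, (∑ l, (connCoeff e i j l x : ℂ) * Q x l k) *
        (sigma j (c 2) (c 3) * sigma k (c 4) (c 5))
      = ∑ l, ∑ k, Q x l k * (∑ B, spinCoeff e i x (c 2) B * sigma l B (c 3)
        + ∑ B, spinCoeff e i x (c 3) B * sigma l (c 2) B) * sigma k (c 4) (c 5) := by
    simp only [spinCoeff_sigma, Finset.mul_sum, Finset.sum_mul]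
    rw [Finset.sum_comm_cycle]
    refine Finset.sum_congr rfl fun l _ => ?_
    rw [Finset.sum_comm]
    exact Finset.sum_congr rfl fun k _ => Finset.sum_congr rfl fun j _ => by ring
  have hk' : ∑ j, ∑ k, (∑ l, (connCoeff e i k l x : ℂ) * Q x j l) *
        (sigma j (c 2) (c 3) * sigma k (c 4) (c 5))
      = ∑ j, ∑ l, Q x j l * (∑ B, spinCoeff e i x (c 4) B * sigma l B (c 5)
        + ∑ B, spinCoeff e i x (c 5) B * sigma l (c 4) B) * sigma j (c 2) (c 3) := by
    simp only [spinCoeff_sigma, Finset.mul_sum, Finset.sum_mul]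
    refine Finset.sum_congr rfl fun j _ => ?_
    rw [Finset.sum_comm]
    exact Finset.sum_congr rfl fun k _ => Finset.sum_congr rfl fun l _ => by ring
  simp only [covTensor, sub_mul, Finset.sum_sub_distrib, Matrix.cons_val]
  rw [hk, hk']
  congr 1
  simp [Fin.sum_univ_two, Fin.sum_univ_four, Fin.sum_univ_three, Function.update]
  ring

/-- The action of the Sen connection on vectors: `D_i z_j - (i/√2) ε_{jkl} K_{ik} z_l`. -/
def senVec (e : Frame S) (K : TwoTensor S) (z : S → Fin 3 → ℂ) (x : S) (i j : Fin 3) : ℂ :=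
  covVec e z x i j - beta * ∑ k, ∑ l, levi j k l * (K x (e i x) (e k x) : ℂ) * z x l

/-- The action of the Sen connection on 2-tensors. -/
def senTensor (e : Frame S) (K : TwoTensor S) (Q : S → Fin 3 → Fin 3 → ℂ) (x : S)
    (i j k : Fin 3) : ℂ :=
  covTensor e Q x i j k
    - beta * ∑ a, ∑ b, levi j a b * (K x (e i x) (e a x) : ℂ) * Q x b k
    - beta * ∑ a, ∑ b, levi k a b * (K x (e i x) (e a x) : ℂ) * Q x j b

omit [RiemannianBundle (fun x : S => TangentSpace (𝓡 3) x)] in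
-- By `sigma_cross`, the term of the Sen connection in K acts on a vector as the cross product with
-- the rows of K. The factor −2β, halved by the ½ in the connection, becomes the −β of `senVec`.
lemma extrinsic_action (e : Frame S) (K : TwoTensor S) (x : S) (A B C D : Fin 2) (l : Fin 3) :
    ∑ F, ∑ G, eps F G * extrinsicSpinor e K x ![A, B, C, G] * sigma l F D
      + ∑ F, ∑ G, eps F G * extrinsicSpinor e K x ![A, B, D, G] * sigma l C F
      = -(2 * beta) * ∑ i, ∑ k, sigma i A B * (K x (e i x) (e k x) : ℂ) *
        ∑ j, levi j k l * sigma j C D := by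
  have h : ∀ k, ∑ j, levi j k l * sigma j C D = ∑ j, levi k l j * sigma j C D := fun k => by
    fin_cases k <;> fin_cases l <;> simp [levi, Fin.sum_univ_three]
  have h2 : ∀ k, -(2 * beta) * ∑ j, levi k l j * sigma j C D = _ := fun k =>
    (sigma_cross k l C D).symm
  have h3 : -(2 * beta) * ∑ i, ∑ k, sigma i A B * (K x (e i x) (e k x) : ℂ) *
        ∑ j, levi j k l * sigma j C D = ∑ i, ∑ k, sigma i A B * (K x (e i x) (e k x) : ℂ) *
        (-(2 * beta) * ∑ j, levi k l j * sigma j C D) := by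
    simp only [Finset.mul_sum, h]
    refine Finset.sum_congr rfl fun i _ => Finset.sum_congr rfl fun k _ =>
      Finset.sum_congr rfl fun j _ => by ring
  rw [h3]
  simp only [h2]
  simp [extrinsicSpinor, Fin.sum_univ_two, Fin.sum_univ_three]
  ring

lemma senD_vecSpinor (e : Frame S) (K : TwoTensor S) {κ : S → Comp 2} {z : S → Fin 3 → ℂ} {x : S}
    (hκ : κ =ᶠ[nhds x] fun y => vecSpinor (z y))
    (hz : ∀ i, MDifferentiableAt (𝓡 3) 𝓘(ℝ, ℂ) (fun y => z y i) x) :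
    senD e K κ x = tensorSpinor (senVec e K z x) := by
  funext c
  have hA := fun l => extrinsic_action e K x (c 0) (c 1) (c 2) (c 3) l
  simp only [senD, leviCivitaD_vecSpinor e hκ hz, hκ.eq_of_nhds]
  have h : ∑ k : Fin 2, ∑ F, ∑ G, eps F G * extrinsicSpinor e K x ![c 0, c 1, c k.succ.succ, G] *
      vecSpinor (z x) (Function.update (fun l : Fin 2 => c l.succ.succ) k F)
      = ∑ l, z x l * (∑ F, ∑ G, eps F G * extrinsicSpinor e K x ![c 0, c 1, c 2, G] * sigma l F (c 3)
      + ∑ F, ∑ G, eps F G * extrinsicSpinor e K x ![c 0, c 1, c 3, G] * sigma l (c 2) F) := by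
    simp [vecSpinor, Fin.sum_univ_two, Fin.sum_univ_three, Function.update]
    ring
  rw [h]
  simp only [hA]
  simp only [tensorSpinor, senVec, Fin.sum_univ_three]
  ring

lemma senD_tensorSpinor (e : Frame S) (K : TwoTensor S) {ζ : S → Comp 4}
    {Q : S → Fin 3 → Fin 3 → ℂ} {x : S} (hζ : ζ =ᶠ[nhds x] fun y => tensorSpinor (Q y))
    (hQ : ∀ i j, MDifferentiableAt (𝓡 3) 𝓘(ℝ, ℂ) (fun y => Q y i j) x) (c : Fin 6 → Fin 2) :
    senD e K ζ x c = ∑ i, sigma i (c 0) (c 1) *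
      tensorSpinor (senTensor e K Q x i) ![c 2, c 3, c 4, c 5] := by
  have hA := fun l => extrinsic_action e K x (c 0) (c 1) (c 2) (c 3) l
  have hB := fun l => extrinsic_action e K x (c 0) (c 1) (c 4) (c 5) l
  simp only [senD, leviCivitaD_tensorSpinor e hζ hQ, hζ.eq_of_nhds]
  have h : ∑ k : Fin 4, ∑ F, ∑ G, eps F G * extrinsicSpinor e K x ![c 0, c 1, c k.succ.succ, G] *
      tensorSpinor (Q x) (Function.update (fun l : Fin 4 => c l.succ.succ) k F)
      = ∑ l, ∑ m, Q x l m * sigma m (c 4) (c 5) *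
        (∑ F, ∑ G, eps F G * extrinsicSpinor e K x ![c 0, c 1, c 2, G] * sigma l F (c 3)
      + ∑ F, ∑ G, eps F G * extrinsicSpinor e K x ![c 0, c 1, c 3, G] * sigma l (c 2) F)
      + ∑ l, ∑ m, Q x m l * sigma m (c 2) (c 3) *
        (∑ F, ∑ G, eps F G * extrinsicSpinor e K x ![c 0, c 1, c 4, G] * sigma l F (c 5)
      + ∑ F, ∑ G, eps F G * extrinsicSpinor e K x ![c 0, c 1, c 5, G] * sigma l (c 4) F) := by
    simp [tensorSpinor, Fin.sum_univ_two, Fin.sum_univ_four, Fin.sum_univ_three, Function.update]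
    ring
  rw [h]
  simp only [hA, hB]
  simp only [tensorSpinor, senTensor, Fin.sum_univ_three, Matrix.cons_val]
  ring

/-- The spatial Killing operator in vector form. -/
def killVec (e : Frame S) (K : TwoTensor S) (z : S → Fin 3 → ℂ) (x : S) : Fin 3 → Fin 3 → ℂ :=
  tfSym (senVec e K z x)

lemma killingOp_vecSpinor (e : Frame S) (K : TwoTensor S) {κ : S → Comp 2} {z : S → Fin 3 → ℂ}
    {x : S} (hκ : κ =ᶠ[nhds x] fun y => vecSpinor (z y))
    (hz : ∀ i, MDifferentiableAt (𝓡 3) 𝓘(ℝ, ℂ) (fun y => z y i) x) :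
    killingOp e K κ x = tensorSpinor (killVec e K z x) := by
  rw [killingOp, senD_vecSpinor e K hκ hz, symmetrize_tensorSpinor, killVec]

omit [RiemannianBundle (fun x : S => TangentSpace (𝓡 3) x)] in
lemma omegaSpinor_eq (e : Frame S) (K : TwoTensor S) (x : S) :
    omegaSpinor e K x = tensorSpinor (tfSym fun i j => (K x (e i x) (e j x) : ℂ)) := by
  rw [omegaSpinor, ← symmetrize_tensorSpinor]
  congr 1
  funext c
  simp only [extrinsicSpinor, tensorSpinor]
  exact Finset.sum_congr rfl fun i _ => Finset.sum_congr rfl fun j _ => by ring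

lemma tfSym_tfSym (M : Fin 3 → Fin 3 → ℂ) : tfSym (tfSym M) = tfSym M := by
  funext i j
  fin_cases i <;> fin_cases j <;> simp [tfSym, Fin.sum_univ_three] <;> ring

/-- A trace-free symmetric tensor corresponds to a totally symmetric spinor by
`symmetrize_tensorSpinor`; only cyclic rotation of the indices is needed below. -/
lemma tensorSpinor_rotate {Q : Fin 3 → Fin 3 → ℂ} (hQ : tfSym Q = Q) (a b c d : Fin 2) :
    tensorSpinor Q ![a, b, c, d] = tensorSpinor Q ![b, c, d, a] := by
  have h := inv_sqrt_two_mul_self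
  have e : ∀ i j, Q i j = tfSym Q i j := fun i j => by rw [hQ]
  have hI := Complex.I_mul_I
  generalize hs : ((Real.sqrt 2 : ℝ) : ℂ)⁻¹ = s at h
  have e1 : Q 1 0 = Q 0 1 := by rw [e 1 0, e 0 1]; simp [tfSym]; ring
  have e2 : Q 2 0 = Q 0 2 := by rw [e 2 0, e 0 2]; simp [tfSym]; ring
  have e3 : Q 2 1 = Q 1 2 := by rw [e 2 1, e 1 2]; simp [tfSym]; ring
  have e4 : Q 2 2 = -Q 0 0 - Q 1 1 := by
    rw [e 2 2, e 0 0, e 1 1]; simp [tfSym, Fin.sum_univ_three]; ring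
  simp only [tensorSpinor, Fin.sum_univ_three, e1, e2, e3, e4, Matrix.cons_val]
  fin_cases a <;> fin_cases b <;> fin_cases c <;> fin_cases d <;>
    simp [sigma, hs] <;> ring_nf <;> (try simp only [Complex.I_sq]) <;> (try ring_nf) <;>
    simp

lemma symmetrize_two (T : Comp 2) (c : Fin 2 → Fin 2) :
    symmetrize T c = (T ![c 0, c 1] + T ![c 1, c 0]) / 2 := by
  have h : ∀ p : Equiv.Perm (Fin 2), c ∘ p = ![c (p 0), c (p 1)] := fun p => by
    ext i; fin_cases i <;> rfl
  have hu : (Finset.univ : Finset (Equiv.Perm (Fin 2))) = {1, Equiv.swap 0 1} := by decide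
  simp only [symmetrize, h, hu]
  rw [Finset.sum_pair (by decide)]
  simp [Nat.factorial]
  ring

/-- After the free index of the second factor is rotated to the last slot, the contraction over A
and B pairs the first vector indices of the two tensors (`sigma_contract`), while the remaining
single contraction, symmetrised in the free indices, is a cross product of the second ones
(`sigma_cross`). -/
lemma omega_term {P Q : Fin 3 → Fin 3 → ℂ} (hQ : tfSym Q = Q) (c : Fin 2 → Fin 2) :
    symmetrize (fun d : Fin 2 → Fin 2 =>
        ∑ A, ∑ B, ∑ F, ∑ A', ∑ B', ∑ F', eps A A' * eps B B' * eps F F' *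
          tensorSpinor P ![A', B', F', d 0] * tensorSpinor Q ![d 1, A, B, F]) c
      = beta * vecSpinor (fun m => ∑ i, ∑ j, ∑ l, levi m j l * P i j * Q i l) c := by
  have key : ∀ a b : Fin 2, ∑ A, ∑ B, ∑ F, ∑ A', ∑ B', ∑ F', eps A A' * eps B B' * eps F F' *
          tensorSpinor P ![A', B', F', a] * tensorSpinor Q ![b, A, B, F]
      = ∑ i, ∑ j, ∑ k, ∑ l, P i j * Q k l *
        (∑ A, ∑ B, ∑ A', ∑ B', eps A A' * eps B B' * (sigma i A' B' * sigma k A B)) *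
        ∑ F, ∑ F', eps F F' * (sigma j a F' * sigma l F b) := by
    intro a b
    simp only [tensorSpinor_rotate hQ b]
    simp only [tensorSpinor, Matrix.cons_val, fun j F' => sigma_symm j F' a]
    simp only [Fin.sum_univ_two, eps, Matrix.of_apply, Matrix.cons_val, zero_mul, mul_zero, zero_add,
      add_zero, one_mul, mul_one]
    simp only [Fin.sum_univ_three]
    ring
  have hc : ∀ j l, (∑ F, ∑ F', eps F F' * (sigma j (c 0) F' * sigma l F (c 1))) +
      ∑ F, ∑ F', eps F F' * (sigma j (c 1) F' * sigma l F (c 0))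
      = -(2 * beta) * ∑ m, levi j l m * sigma m (c 0) (c 1) := by
    intro j l
    rw [← sigma_cross]
    simp only [mul_add, Finset.sum_add_distrib, fun F => sigma_symm l F (c 0)]
  rw [symmetrize_two]
  simp only [Matrix.cons_val, key, sigma_contract]
  have e : ∀ f g : Fin 3 → Fin 3 → ℂ, (∑ i, ∑ j, ∑ k, ∑ l, P i j * Q k l *
      (if i = k then (-1 : ℂ) else 0) * f j l + ∑ i, ∑ j, ∑ k, ∑ l, P i j * Q k l *
      (if i = k then (-1 : ℂ) else 0) * g j l) / 2
      = ∑ i, ∑ j, ∑ l, -(P i j * Q i l) * (f j l + g j l) / 2 := by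
    intro f g
    simp [Fin.sum_univ_three]
    ring
  rw [e]
  simp only [hc, vecSpinor]
  simp [levi, Fin.sum_univ_three]
  ring

end

/-! ### The adjoint operator and the divergence identity -/

section

variable {S : Type*} [TopologicalSpace S] [ChartedSpace E3 S]

lemma dirDeriv_conj {f : S → ℂ} {x : S} (hf : MDifferentiableAt (𝓡 3) 𝓘(ℝ, ℂ) f x)
    (X : TangentSpace (𝓡 3) x) :
    dirDeriv (fun y => (starRingEnd ℂ) (f y)) x X = (starRingEnd ℂ) (dirDeriv f x X) := by
  have h := (ContinuousLinearMap.hasMFDerivAt (Complex.conjCLE : ℂ →L[ℝ] ℂ) (x := f x)).comp x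
    hf.hasMFDerivAt
  have e : (fun y => (starRingEnd ℂ) (f y)) = (⇑(Complex.conjCLE : ℂ →L[ℝ] ℂ)) ∘ f := rfl
  rw [dirDeriv, e, h.mfderiv]
  rfl

variable [RiemannianBundle (fun x : S => TangentSpace (𝓡 3) x)]

/-- The formal adjoint of the spatial Killing operator in vector form. -/
def adjVec (e : Frame S) (K : TwoTensor S) (Q : S → Fin 3 → Fin 3 → ℂ) (x : S) (k : Fin 3) : ℂ :=
  -∑ i, covTensor e Q x i i k
    - beta * ∑ i, ∑ a, ∑ b, levi k a b * (K x (e i x) (e a x) : ℂ) * Q x i b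

/-- The divergence of the Sen connection produces two terms in K: one contracts ε_{iab} with the
symmetric K_{ia} and vanishes, the other is +β ε_{kab} K_{ia} Q_{ib}. The Ω term contributes −2β
times the same expression, the trace removed from K being irrelevant because Q is symmetric. The net
coefficient −β is the one that makes `adjVec` the formal adjoint. -/
lemma killingAdj_tensorSpinor (e : Frame S) {K : TwoTensor S} (hK : ∀ x v w, K x v w = K x w v)
    {ζ : S → Comp 4} {Q : S → Fin 3 → Fin 3 → ℂ} {x : S}
    (hζ : ζ =ᶠ[nhds x] fun y => tensorSpinor (Q y))
    (hQ : ∀ i j, MDifferentiableAt (𝓡 3) 𝓘(ℝ, ℂ) (fun y => Q y i j) x)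
    (hs : tfSym (Q x) = Q x) :
    killingAdj e K ζ x = vecSpinor (adjVec e K Q x) := by
  have e1 : Q x 1 0 = Q x 0 1 := by rw [← hs]; simp [tfSym]; ring
  have e2 : Q x 2 0 = Q x 0 2 := by rw [← hs]; simp [tfSym]; ring
  have e3 : Q x 2 1 = Q x 1 2 := by rw [← hs]; simp [tfSym]; ring
  funext c
  simp only [killingAdj, hζ.eq_of_nhds, omegaSpinor_eq]
  rw [omega_term hs]
  have key : ∑ A, ∑ B, ∑ A', ∑ B', eps A A' * eps B B' * senD e K ζ x ![A', B', A, B, c 0, c 1]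
      = ∑ i, ∑ j, ∑ k, senTensor e K Q x i j k * sigma k (c 0) (c 1) *
        ∑ A, ∑ B, ∑ A', ∑ B', eps A A' * eps B B' * (sigma i A' B' * sigma j A B) := by
    simp only [senD_tensorSpinor e K hζ hQ, tensorSpinor, Matrix.cons_val]
    simp only [Fin.sum_univ_two, eps, Matrix.of_apply, Matrix.cons_val, zero_mul, mul_zero, zero_add,
      add_zero, one_mul, mul_one]
    simp only [Fin.sum_univ_three]
    ring
  rw [key]
  simp only [sigma_contract]
  have hcon : ∀ f : Fin 3 → Fin 3 → Fin 3 → ℂ, ∑ i, ∑ j, ∑ k, f i j k * sigma k (c 0) (c 1) *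
      (if i = j then -1 else 0) = vecSpinor (fun k => -∑ i, f i i k) c := by
    intro f
    simp [vecSpinor, Fin.sum_univ_three]
    ring
  have hlin : ∀ f g h : Fin 3 → ℂ, (∀ k, f k - 2 * (beta * g k) = h k) →
      vecSpinor f c - 2 * (beta * vecSpinor g c) = vecSpinor h c := by
    intro f g h hh
    simp only [vecSpinor, Fin.sum_univ_three, ← hh]
    ring
  rw [hcon]
  have e5 : (K x (e 1 x) (e 0 x)) = K x (e 0 x) (e 1 x) := hK _ _ _
  have e6 : (K x (e 2 x) (e 0 x)) = K x (e 0 x) (e 2 x) := hK _ _ _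
  have e7 : (K x (e 2 x) (e 1 x)) = K x (e 1 x) (e 2 x) := hK _ _ _
  refine hlin _ _ _ fun k => ?_
  simp only [senTensor, adjVec, tfSym]
  fin_cases k <;> simp [levi, Fin.sum_univ_three, e1, e2, e3, e5, e6, e7] <;> ring

/-- Integration by parts before integrating. In the derivative of Q_{kj} \bar z_j, the divergence of
Q is replaced by means of Φ*(Q) = 0 and the derivative of z by its Sen derivative. The connection
terms cancel by antisymmetry of ω_{ijk} in j, k, the terms in K cancel because the conjugate of β is
−β, and the pairing of Q with the Sen derivative is left. -/
lemma divergence_identity (e : Frame S) (K : TwoTensor S) {z : S → Fin 3 → ℂ} {x : S}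
    (hz : ∀ i, MDifferentiableAt (𝓡 3) 𝓘(ℝ, ℂ) (fun y => z y i) x)
    (hQ : ∀ i j, MDifferentiableAt (𝓡 3) 𝓘(ℝ, ℂ) (fun y => killVec e K z y i j) x)
    (h0 : adjVec e K (killVec e K z) x = 0) :
    ∑ k, (dirDeriv (fun y => ∑ j, killVec e K z y k j * (starRingEnd ℂ) (z y j)) x (e k x)
      - (∑ i, (connCoeff e i i k x : ℂ)) * ∑ j, killVec e K z x k j * (starRingEnd ℂ) (z x j))
      = ∑ i, ∑ j, killVec e K z x i j * (starRingEnd ℂ) (killVec e K z x i j) := by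
  have hd : ∀ k, dirDeriv (fun y => ∑ j, killVec e K z y k j * (starRingEnd ℂ) (z y j)) x (e k x)
      = ∑ j, (killVec e K z x k j * (starRingEnd ℂ) (dirDeriv (fun y => z y j) x (e k x))
        + (starRingEnd ℂ) (z x j) * dirDeriv (fun y => killVec e K z y k j) x (e k x)) := by
    intro k
    have hc : ∀ j, MDifferentiableAt (𝓡 3) 𝓘(ℝ, ℂ) (fun y => (starRingEnd ℂ) (z y j)) x := fun j =>
      (ContinuousLinearMap.mdifferentiableAt (Complex.conjCLE : ℂ →L[ℝ] ℂ)).comp x (hz j)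
    rw [dirDeriv_sum]
    · refine Finset.sum_congr rfl fun j _ => ?_
      rw [dirDeriv_mul (hQ k j) (hc j), dirDeriv_conj (hz j)]
    · exact fun j _ => (hQ k j).mul (hc j)
  have hK : ∀ i j, dirDeriv (fun y => z y j) x (e i x) = senVec e K z x i j
      + (beta * ∑ k, ∑ l, levi j k l * (K x (e i x) (e k x) : ℂ) * z x l)
      + ∑ k, (connCoeff e i j k x : ℂ) * z x k := by
    intro i j
    simp only [senVec, covVec]
    ring
  have hA : ∀ k, ∑ i, dirDeriv (fun y => killVec e K z y i k) x (e i x)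
      = (∑ i, ∑ l, (connCoeff e i i l x : ℂ) * killVec e K z x l k)
        + (∑ i, ∑ l, (connCoeff e i k l x : ℂ) * killVec e K z x i l)
        - beta * ∑ i, ∑ a, ∑ b, levi k a b * (K x (e i x) (e a x) : ℂ) * killVec e K z x i b := by
    intro k
    have h := congrFun h0 k
    simp only [adjVec, covTensor, Finset.sum_sub_distrib, Pi.zero_apply] at h
    linear_combination -h
  have hb : (starRingEnd ℂ) beta = -beta := by simp [beta]
  -- Q is the orthogonal projection of the Sen derivative to trace-free symmetric tensors, so
  -- pairing with either gives the same number.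
  have hq : ∑ i, ∑ j, killVec e K z x i j * (starRingEnd ℂ) (senVec e K z x i j)
      = ∑ i, ∑ j, killVec e K z x i j * (starRingEnd ℂ) (killVec e K z x i j) := by
    simp [killVec, tfSym, Fin.sum_univ_three, map_ofNat]
    ring
  have hw : ∀ i j k, connCoeff e i j k x = -connCoeff e i k j x := fun i j k =>
    connCoeff_antisymm e i j k x
  have hsum : ∑ k, ∑ j, (starRingEnd ℂ) (z x j) * dirDeriv (fun y => killVec e K z y k j) x (e k x)
      = ∑ j, (starRingEnd ℂ) (z x j) *
        ∑ i, dirDeriv (fun y => killVec e K z y i j) x (e i x) := by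
    rw [Finset.sum_comm]
    simp only [Finset.mul_sum]
  have w0 : ∀ i j, connCoeff e i j j x = 0 := fun i j => by linarith [hw i j j]
  rw [← hq]
  simp only [hd, Finset.sum_sub_distrib, Finset.sum_add_distrib]
  rw [hsum]
  simp only [hA, hK, map_add, map_mul, map_sum, hb, Complex.conj_ofReal]
  generalize killVec e K z x = q
  generalize senVec e K z x = s
  simp only [Fin.sum_univ_three, hw _ 1 0, hw _ 2 0, hw _ 2 1, w0]
  simp [levi, Fin.sum_univ_three]
  ring

end

section

variable {S : Type*} [TopologicalSpace S] [ChartedSpace E3 S] [IsManifold (𝓡 3) ∞ S]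

/-! ### Coordinate expressions in a chart -/

/-- The coordinate components of a vector field in a chart. -/
def chartField (φ : OpenPartialHomeomorph S E3) (V : (x : S) → TangentSpace (𝓡 3) x) : E3 → E3 :=
  VectorField.mpullback (𝓡 3) (𝓡 3) φ.symm V

variable {φ : OpenPartialHomeomorph S E3} (hφ : φ ∈ IsManifold.maximalAtlas (𝓡 3) ∞ S) {y : E3}
  (hy : y ∈ φ.target)

include hφ

omit [IsManifold (𝓡 3) ∞ S] in
lemma chart_mdifferentiable : φ.MDifferentiable (𝓡 3) (𝓡 3) :=
  ⟨(contMDiffOn_of_mem_maximalAtlas hφ).mdifferentiableOn (by simp),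
    (contMDiffOn_symm_of_mem_maximalAtlas hφ).mdifferentiableOn (by simp)⟩

include hy

omit [IsManifold (𝓡 3) ∞ S] in
lemma chart_symm_contMDiffAt : ContMDiffAt (𝓡 3) (𝓡 3) ∞ φ.symm y :=
  contMDiffAt_symm_of_mem_maximalAtlas hφ hy

omit [IsManifold (𝓡 3) ∞ S] in
lemma mfderiv_chart_symm_isInvertible : (mfderiv (𝓡 3) (𝓡 3) φ.symm y).IsInvertible :=
  ⟨(chart_mdifferentiable hφ).symm.mfderiv hy, rfl⟩

omit [IsManifold (𝓡 3) ∞ S] in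
lemma mfderiv_chartField (V : (x : S) → TangentSpace (𝓡 3) x) :
    mfderiv (𝓡 3) (𝓡 3) φ.symm y (chartField φ V y) = V (φ.symm y) := by
  obtain ⟨L, hL⟩ := mfderiv_chart_symm_isInvertible hφ hy
  rw [chartField, VectorField.mpullback_apply, ← hL, ContinuousLinearMap.inverse_equiv]
  exact L.apply_symm_apply _

omit [IsManifold (𝓡 3) ∞ S] in
lemma dirDeriv_chart {f : S → ℂ} (hf : MDifferentiableAt (𝓡 3) 𝓘(ℝ, ℂ) f (φ.symm y))
    (V : (x : S) → TangentSpace (𝓡 3) x) :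
    dirDeriv f (φ.symm y) (V (φ.symm y)) = fderiv ℝ (f ∘ φ.symm) y (chartField φ V y) := by
  have h := hf.hasMFDerivAt.comp y
    ((chart_symm_contMDiffAt hφ hy).mdifferentiableAt (by simp)).hasMFDerivAt
  have h3 := HasFDerivAt.fderiv (𝕜 := ℝ) (E := E3) (F := ℂ) h.hasFDerivAt
  rw [h3, dirDeriv, ← mfderiv_chartField hφ hy V]
  rfl

lemma chartField_mlieBracket {V W : (x : S) → TangentSpace (𝓡 3) x}
    (hV : MDifferentiableAt (𝓡 3) (𝓡 3).tangent
      (fun x => (⟨x, V x⟩ : TangentBundle (𝓡 3) S)) (φ.symm y))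
    (hW : MDifferentiableAt (𝓡 3) (𝓡 3).tangent
      (fun x => (⟨x, W x⟩ : TangentBundle (𝓡 3) S)) (φ.symm y)) :
    chartField φ (VectorField.mlieBracket (𝓡 3) V W) y
      = VectorField.lieBracket ℝ (chartField φ V) (chartField φ W) y := by
  have h2 : (2 : ℕ∞ω) ≤ (∞ : ℕ∞ω) := ENat.LEInfty.out
  have : IsManifold (𝓡 3) (minSmoothness ℝ 2) S := by
    rw [minSmoothness_of_isRCLikeNormedField]
    exact IsManifold.of_le h2
  have := VectorField.mpullback_mlieBracket (n := ∞) hV hW (chart_symm_contMDiffAt hφ hy)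
    (by rwa [minSmoothness_of_isRCLikeNormedField])
  rw [chartField, this, ← VectorField.mlieBracketWithin_univ,
    VectorField.mlieBracketWithin_eq_lieBracketWithin]
  exact congrFun (VectorField.lieBracketWithin_univ (V := chartField φ V)
    (W := chartField φ W)) y

lemma chartField_contDiffAt {V : (x : S) → TangentSpace (𝓡 3) x}
    (hV : ContMDiffAt (𝓡 3) (𝓡 3).tangent ∞
      (fun x => (⟨x, V x⟩ : TangentBundle (𝓡 3) S)) (φ.symm y)) :
    ContDiffAt ℝ ∞ (chartField φ V) y := by
  refine contMDiffAt_vectorSpace_iff_contDiffAt.1 ?_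
  exact ContMDiffAt.mpullback_vectorField_preimage hV (chart_symm_contMDiffAt hφ hy)
    (mfderiv_chart_symm_isInvertible hφ hy) (by simp)

lemma coordVec_contMDiffAt (i : Fin 3) : ContMDiffAt (𝓡 3) (𝓡 3).tangent ∞
    (fun y => (⟨φ.symm y, coordVec φ i y⟩ : TangentBundle (𝓡 3) S)) y := by
  have h1 := (contMDiffOn_symm_of_mem_maximalAtlas hφ).contMDiffOn_tangentMapWithin (m := ∞)
    (by simp) φ.open_target.uniqueMDiffOn
  have h2 : ContMDiffAt (𝓡 3) (𝓡 3).tangent ∞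
      (fun y : E3 => (⟨y, EuclideanSpace.single i (1 : ℝ)⟩ : TangentBundle (𝓡 3) E3)) y :=
    contMDiffAt_vectorSpace_iff_contDiffAt.2 contDiffAt_const
  have h3 := (h1.contMDiffAt (x := (⟨y, EuclideanSpace.single i (1 : ℝ)⟩ : TangentBundle (𝓡 3) E3))
    ((φ.open_target.preimage (FiberBundle.continuous_proj E3 _)).mem_nhds hy)).comp y h2
  refine h3.congr_of_eventuallyEq ?_
  filter_upwards [φ.open_target.mem_nhds hy] with w hw
  simp only [coordVec, tangentMapWithin, Function.comp_apply,
    mfderivWithin_of_isOpen φ.open_target hw]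

lemma bilinear_contDiffAt
    {g : (x : S) → TangentSpace (𝓡 3) x →L[ℝ] TangentSpace (𝓡 3) x →L[ℝ] ℝ}
    (hg : ContMDiff (𝓡 3) ((𝓡 3).prod 𝓘(ℝ, E3 →L[ℝ] E3 →L[ℝ] ℝ)) ∞
    (fun x => TotalSpace.mk' (E3 →L[ℝ] E3 →L[ℝ] ℝ)
      (E := fun x : S => TangentSpace (𝓡 3) x →L[ℝ] TangentSpace (𝓡 3) x →L[ℝ] ℝ) x (g x)))
    (i j : Fin 3) :
    ContDiffAt ℝ ∞ (fun y => g (φ.symm y) (coordVec φ i y) (coordVec φ j y)) y := by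
  have : ContMDiffAt (𝓡 3) ((𝓡 3).prod 𝓘(ℝ)) ∞
      (fun m ↦ TotalSpace.mk' ℝ (E := Bundle.Trivial S ℝ) (φ.symm m)
        (g (φ.symm m) (coordVec φ i m) (coordVec φ j m))) y := by
    apply ContMDiffAt.clm_bundle_apply₂ (F₁ := E3) (F₂ := E3)
    · exact hg.contMDiffAt.comp y (chart_symm_contMDiffAt hφ hy)
    · exact coordVec_contMDiffAt hφ hy i
    · exact coordVec_contMDiffAt hφ hy j
  simp only [contMDiffAt_totalSpace] at this
  exact this.2.contDiffAt

omit hy in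
lemma tensorCoeff_contDiffAt {K : TwoTensor S} [RiemannianBundle (fun x : S => TangentSpace (𝓡 3) x)]
    (hK : IsAsymptoticallyEuclidean K) (hy : y ∈ φ.target) (i j : Fin 3) :
    ContDiffAt ℝ ∞ (tensorCoeff K φ i j) y :=
  bilinear_contDiffAt hφ hy hK.smooth i j

variable [RiemannianBundle (fun x : S => TangentSpace (𝓡 3) x)]
  [hR : IsContMDiffRiemannianBundle (𝓡 3) ∞ E3 (fun x : S => TangentSpace (𝓡 3) x)]

include hR in
lemma metricCoeff_contDiffAt (i j : Fin 3) : ContDiffAt ℝ ∞ (metricCoeff φ i j) y := by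
  obtain ⟨g, hg, hg'⟩ := hR.exists_contMDiff
  have h := (bilinear_contDiffAt hφ hy hg i j).neg
  refine h.congr_of_eventuallyEq (Filter.Eventually.of_forall fun w => ?_)
  simp only [metricCoeff, ip, hg']

omit hφ hy [IsManifold (𝓡 3) ∞ S]
  [RiemannianBundle (fun x : S => TangentSpace (𝓡 3) x)] hR

lemma mfderiv_eq_sum (y v : E3) :
    mfderiv (𝓡 3) (𝓡 3) φ.symm y v = ∑ i, v i • coordVec φ i y := by
  have hv : v = ∑ i, v i • (EuclideanSpace.single i (1 : ℝ) : E3) := by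
    ext j
    simp [Finset.sum_apply, Pi.single_apply]
  conv_lhs => rw [hv]
  exact (map_sum _ _ _).trans (Finset.sum_congr rfl fun i _ => map_smul _ _ _)

end

/-! ### Change of frame -/

lemma levi_det (M : Matrix (Fin 3) (Fin 3) ℂ) (a k l : Fin 3) :
    ∑ i, ∑ m, ∑ p, levi i m p * M a i * M k m * M l p = M.det * levi a k l := by
  rw [Matrix.det_fin_three]
  fin_cases a <;> fin_cases k <;> fin_cases l <;> simp [levi, Fin.sum_univ_three] <;> ring

lemma transpose_mul_eps_mul (g : Matrix (Fin 2) (Fin 2) ℂ) :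
    g.transpose * eps * g = g.det • eps := by
  rw [Matrix.det_fin_two]
  ext i j
  fin_cases i <;> fin_cases j <;> simp [eps, Matrix.mul_apply, Fin.sum_univ_two] <;> ring

lemma trace_sigma_triple (i j k : Fin 3) :
    (sigma i * eps * (sigma j * eps) * (sigma k * eps)).trace
      = beta * levi i j k := by
  have h := inv_sqrt_two_mul_self
  have hI := Complex.I_mul_I
  simp only [Matrix.trace_fin_two, Matrix.mul_apply, Fin.sum_univ_two, beta]
  generalize hs : ((Real.sqrt 2 : ℝ) : ℂ)⁻¹ = s at h
  fin_cases i <;> fin_cases j <;> fin_cases k <;> simp [sigma, eps, hs, levi] <;> grind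

lemma trace_triple_sum (A : Fin 3 → Matrix (Fin 2) (Fin 2) ℂ) (N : Matrix (Fin 2) (Fin 2) ℂ)
    (a b c : Fin 3 → ℂ) :
    ((∑ i, a i • A i) * N * ((∑ i, b i • A i) * N) * ((∑ i, c i • A i) * N)).trace
      = ∑ i, ∑ j, ∑ k, a i * b j * c k * (A i * N * (A j * N) * (A k * N)).trace := by
  have e : ∀ a : Fin 3 → ℂ, (∑ i, a i • A i) * N = ∑ i, a i • (A i * N) := fun a => by
    rw [Finset.sum_mul]
    simp only [smul_mul_assoc]
  simp only [e]
  generalize hB : (fun i => A i * N) = B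
  have hB' : ∀ i, A i * N = B i := fun i => by rw [← hB]
  simp only [hB', Finset.sum_mul, Finset.mul_sum, smul_mul_assoc, mul_smul_comm, smul_smul,
    Matrix.trace_sum, Matrix.trace_smul, smul_eq_mul]
  rw [Finset.sum_comm_cycle]
  refine Finset.sum_congr rfl fun i _ => ?_
  rw [Finset.sum_comm]
  refine Finset.sum_congr rfl fun j _ => Finset.sum_congr rfl fun k _ => ?_
  ring

lemma trace_conj_triple {g N : Matrix (Fin 2) (Fin 2) ℂ} (e : g.transpose * N * g = N)
    (A B C : Matrix (Fin 2) (Fin 2) ℂ) :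
    ((g * A * g.transpose) * N * ((g * B * g.transpose) * N) * ((g * C * g.transpose) * N)).trace
      = (A * N * (B * N) * (C * N)).trace := by
  have h1 : (g * A * g.transpose) * N * ((g * B * g.transpose) * N) * ((g * C * g.transpose) * N)
      = g * (A * (g.transpose * N * g) * (B * (g.transpose * N * g)) * (C * g.transpose * N)) := by
    simp only [Matrix.mul_assoc]
  have h2 : (A * (g.transpose * N * g) * (B * (g.transpose * N * g)) * (C * g.transpose * N)) * g
      = A * (g.transpose * N * g) * (B * (g.transpose * N * g)) * (C * (g.transpose * N * g)) := by
    simp only [Matrix.mul_assoc]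
  rw [h1, Matrix.trace_mul_comm, h2, e]

/-- The double cover lands in SO(3), not merely O(3). The trace of a triple product of σ's is β
ε_{ijk}, and it is invariant under A ↦ g A gᵀ because gᵀ ε g = ε when det g = 1. Expanding the
transformed triple product multiplies the trace by det O. -/
lemma det_eq_one_of_sigma {g : Matrix (Fin 2) (Fin 2) ℂ} (hg : g.det = 1)
    {O : Matrix (Fin 3) (Fin 3) ℂ}
    (h : ∀ k, g * sigma k * g.transpose = ∑ i, O i k • sigma i) : O.det = 1 := by
  have e := transpose_mul_eps_mul g
  rw [hg, one_smul] at e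
  have key := trace_conj_triple e (sigma 0) (sigma 1) (sigma 2)
  rw [h, h, h, trace_triple_sum] at key
  simp only [trace_sigma_triple] at key
  have hb : beta ≠ 0 := by
    simp [beta]
  have := levi_det O.transpose 0 1 2
  rw [Matrix.det_transpose] at this
  simp only [Matrix.transpose_apply] at this
  have h1 : levi 0 1 2 = 1 := by simp [levi]
  rw [h1, mul_one] at this
  rw [← this]
  refine mul_left_cancel₀ hb ?_
  rw [h1] at key
  simp only [Finset.mul_sum, Fin.sum_univ_three] at key ⊢
  linear_combination key

/-- The vector of a symmetric valence two spinor. -/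
def spinorVec (T : Comp 2) (i : Fin 3) : ℂ :=
  ∑ A, ∑ B, (starRingEnd ℂ) (sigma i A B) * T ![A, B]

lemma conj_sigma_contract (i j : Fin 3) :
    ∑ A, ∑ B, (starRingEnd ℂ) (sigma i A B) * sigma j A B = if i = j then 1 else 0 := by
  have h := inv_sqrt_two_mul_self
  have hI := Complex.I_mul_I
  fin_cases i <;> fin_cases j <;> simp [sigma, Fin.sum_univ_two] <;>
    generalize hs : ((Real.sqrt 2 : ℝ) : ℂ)⁻¹ = s at h <;> grind

lemma spinorVec_vecSpinor (z : Fin 3 → ℂ) : spinorVec (vecSpinor z) = z := by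
  funext i
  have : spinorVec (vecSpinor z) i
      = ∑ j, z j * ∑ A, ∑ B, (starRingEnd ℂ) (sigma i A B) * sigma j A B := by
    simp only [spinorVec, vecSpinor, Fin.sum_univ_two, Fin.sum_univ_three, Matrix.cons_val]
    ring
  rw [this]
  simp only [conj_sigma_contract]
  simp

lemma vecSpinor_spinorVec {T : Comp 2} (hT : T ![1, 0] = T ![0, 1]) :
    vecSpinor (spinorVec T) = T := by
  funext c
  have h := inv_sqrt_two_mul_self
  have hI := Complex.I_mul_I
  have hc : c = ![c 0, c 1] := by ext i; fin_cases i <;> rfl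
  rw [hc]
  generalize c 0 = A
  generalize c 1 = B
  simp only [vecSpinor, spinorVec, Fin.sum_univ_two, Fin.sum_univ_three, Matrix.cons_val]
  fin_cases A <;> fin_cases B <;> simp [sigma, hT] <;>
    generalize hs : ((Real.sqrt 2 : ℝ) : ℂ)⁻¹ = s at h <;> grind

lemma normSq_vecSpinor (z : Fin 3 → ℂ) : normSq (vecSpinor z) = ∑ i, ‖z i‖ ^ 2 := by
  have h := inv_sqrt_two_mul_self
  have hs : ∀ T : Comp 2, normSq T = ‖T ![0,0]‖^2 + ‖T ![0,1]‖^2 + ‖T ![1,0]‖^2 + ‖T ![1,1]‖^2 := by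
    intro T
    rw [normSq, Fintype.sum_equiv (finTwoArrowEquiv (Fin 2)) _ (fun p => ‖T ![p.1, p.2]‖ ^ 2),
      Fintype.sum_prod_type]
    · simp [Fin.sum_univ_two]; ring
    · intro c
      congr 3
      ext i; fin_cases i <;> rfl
  have hr : ((Real.sqrt 2)⁻¹ : ℝ) * (Real.sqrt 2)⁻¹ = 1 / 2 := by
    rw [← mul_inv, Real.mul_self_sqrt (by norm_num)]; norm_num
  rw [hs]
  generalize hq : (Real.sqrt 2)⁻¹ = s at hr
  have e : ((Real.sqrt 2 : ℝ) : ℂ)⁻¹ = ((s : ℝ) : ℂ) := by rw [← hq]; simp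
  simp only [vecSpinor, sigma, e, Fin.sum_univ_three, ← Complex.normSq_eq_norm_sq,
    Complex.normSq_apply]
  simp
  linear_combination (2 * ((z 0).re ^ 2 + (z 0).im ^ 2 + (z 1).re ^ 2 + (z 1).im ^ 2
    + (z 2).re ^ 2 + (z 2).im ^ 2)) * hr

/-! ### Algebra of orthonormal frames in coordinates -/

/-- The 1-jet of a metric and of an orthonormal frame at a point: `e i k` is the `k`-th component
of the `i`-th frame vector, and the last index of `de` and `dG` is that of the derivative. -/
structure FrameJet where
  e : Fin 3 → Fin 3 → ℝ
  de : Fin 3 → Fin 3 → Fin 3 → ℝ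
  G : Fin 3 → Fin 3 → ℝ
  dG : Fin 3 → Fin 3 → Fin 3 → ℝ
  symm : ∀ k l, G k l = G l k
  orth : ∀ i j, ∑ k, ∑ l, G k l * e i k * e j l = if i = j then 1 else 0
  dorth : ∀ i j m, ∑ k, ∑ l,
    (dG k l m * e i k * e j l + G k l * (de i k m * e j l + e i k * de j l m)) = 0

namespace FrameJet

variable (F : FrameJet)

/-- Structure functions `⟪[e_i, e_j], e_k⟫`. -/
def c (i j k : Fin 3) : ℝ :=
  ∑ m, ∑ n, F.G m n * (∑ a, (F.de j m a * F.e i a - F.de i m a * F.e j a)) * F.e k n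

/-- Connection coefficients. -/
def w (i j k : Fin 3) : ℝ := (1 / 2) * (F.c i j k - F.c j k i + F.c k i j)

/-- The determinant of the frame. -/
def det : ℝ := (Matrix.of F.e).det

lemma c_antisymm (i j k : Fin 3) : F.c i j k = -F.c j i k := by
  simp only [c, ← Finset.sum_neg_distrib]
  refine Finset.sum_congr rfl fun m _ => Finset.sum_congr rfl fun n _ => ?_
  simp only [Finset.sum_sub_distrib]
  ring

/-- The left side is (ℒ_{e_p} G)(e_i, e_j). Since G(e_i, e_j) is constant, it equals ⟨[e_i, e_p],
e_j⟩ + ⟨[e_j, e_p], e_i⟩; differentiated orthonormality is contracted with e_p. -/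
lemma lie_frame (i j p : Fin 3) :
    ∑ k, ∑ l, F.e i k * F.e j l *
      (∑ m, (F.dG k l m * F.e p m + F.G m l * F.de p m k + F.G k m * F.de p m l))
      = -(F.w i j p + F.w j i p) := by
  have h1 : -(F.w i j p + F.w j i p) = F.c i p j + F.c j p i := by
    simp only [w]
    linarith [F.c_antisymm i j p, F.c_antisymm j p i, F.c_antisymm i p j]
  have h := F.dorth i j
  rw [h1]
  simp only [c, Fin.sum_univ_three] at h ⊢
  have s1 := F.symm 1 0
  have s2 := F.symm 2 0
  have s3 := F.symm 2 1
  simp only [s1, s2, s3] at h ⊢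
  linear_combination F.e p 0 * h 0 + F.e p 1 * h 1 + F.e p 2 * h 2

variable (z : Fin 3 → ℂ) (dz : Fin 3 → Fin 3 → ℂ)

/-- Coordinate components of the vector with frame components `z`. -/
def Z (m : Fin 3) : ℂ := ∑ i, z i * F.e i m

/-- Coordinate derivatives of the components of the vector with frame components `z`. -/
def dZ (m k : Fin 3) : ℂ := ∑ i, (dz i k * F.e i m + z i * F.de i m k)

set_option maxRecDepth 4000 in
-- The formula (ℒ_Z G)_{ij} = D_i z_j + D_j z_i. By the Leibniz rule it reduces to `lie_frame` for
-- the frame vectors plus derivatives of the coefficients. The left side mentions no connection,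
-- which makes it the convenient form in coordinates.
lemma lie_eq (i j : Fin 3) :
    ∑ k, ∑ l, (F.e i k : ℂ) * F.e j l *
      (∑ m, (F.dG k l m * F.Z z m + F.G m l * F.dZ z dz m k + F.G k m * F.dZ z dz m l))
      = (∑ m, dz j m * F.e i m - ∑ k, (F.w i j k : ℂ) * z k)
        + (∑ m, dz i m * F.e j m - ∑ k, (F.w j i k : ℂ) * z k) := by
  have h : ∀ p, (∑ k, ∑ l, (F.e i k : ℂ) * F.e j l *
      (∑ m, (F.dG k l m * F.e p m + F.G m l * F.de p m k + F.G k m * F.de p m l)))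
      = -(F.w i j p + F.w j i p) := fun p => by exact_mod_cast F.lie_frame i j p
  have e1 : ∑ k, ∑ l, (F.e i k : ℂ) * F.e j l *
      (∑ m, (F.dG k l m * F.Z z m + F.G m l * F.dZ z dz m k + F.G k m * F.dZ z dz m l))
      = ∑ p, z p * (∑ k, ∑ l, (F.e i k : ℂ) * F.e j l *
      (∑ m, (F.dG k l m * F.e p m + F.G m l * F.de p m k + F.G k m * F.de p m l)))
      + ∑ p, (∑ k, dz p k * F.e i k) * (∑ k, ∑ l, F.G k l * F.e p k * F.e j l)
      + ∑ p, (∑ k, dz p k * F.e j k) * (∑ k, ∑ l, F.G k l * F.e i k * F.e p l) := by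
    push_cast
    simp only [Z, dZ, Fin.sum_univ_three]
    ring
  rw [e1]
  simp only [h, F.orth, apply_ite (fun t : ℝ => (t : ℂ)), Complex.ofReal_one, Complex.ofReal_zero]
  simp only [mul_ite, mul_one, mul_zero, Finset.sum_ite_eq, Finset.sum_ite_eq', Finset.mem_univ,
    if_true]
  simp only [Fin.sum_univ_three]
  ring

lemma mul_transpose_mul : Matrix.of F.e * Matrix.of F.G * (Matrix.of F.e).transpose = 1 := by
  ext i j
  have := F.orth i j
  rw [Matrix.one_apply, ← this]
  simp only [Matrix.mul_apply, Matrix.transpose_apply, Matrix.of_apply, Fin.sum_univ_three]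
  ring

lemma det_sq_mul : F.det ^ 2 * (Matrix.of F.G).det = 1 := by
  have := congrArg Matrix.det F.mul_transpose_mul
  rw [Matrix.det_mul, Matrix.det_mul, Matrix.det_transpose, Matrix.det_one] at this
  rw [det, ← this]
  ring

lemma det_ne_zero : F.det ≠ 0 := by
  intro h
  have := F.det_sq_mul
  simp [h] at this

/-- The inverse metric is ∑ e_c ⊗ e_c and det G is the inverse square of the frame determinant; the
adjugate is their product. -/
lemma adjugate_eq : (Matrix.of F.G).adjugate
    = (F.det ^ 2)⁻¹ • ((Matrix.of F.e).transpose * Matrix.of F.e) := by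
  have h1 : (Matrix.of F.G) * ((Matrix.of F.e).transpose * Matrix.of F.e) = 1 := by
    have h2 : Matrix.of F.e * (Matrix.of F.G * (Matrix.of F.e).transpose) = 1 := by
      rw [← Matrix.mul_assoc]; exact F.mul_transpose_mul
    rw [← Matrix.mul_assoc]
    exact mul_eq_one_comm.1 h2
  have h3 := F.det_sq_mul
  have h4 : (Matrix.of F.G).det = (F.det ^ 2)⁻¹ := by
    field_simp [F.det_ne_zero]; linarith
  calc (Matrix.of F.G).adjugate = (Matrix.of F.G).adjugate *
        ((Matrix.of F.G) * ((Matrix.of F.e).transpose * Matrix.of F.e)) := by rw [h1, mul_one]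
    _ = _ := by rw [← Matrix.mul_assoc, Matrix.adjugate_mul, h4, Matrix.smul_mul, one_mul]

/-- The term of the Sen connection that involves the extrinsic curvature, in coordinates. -/
def _root_.KillingSpinor.crossTerm (G : Fin 3 → Fin 3 → ℝ) (d : ℝ) (k : Fin 3 → Fin 3 → ℝ)
    (Z : Fin 3 → ℂ) (i j : Fin 3) : ℂ :=
  ∑ m, ∑ p, ∑ n, levi i m p * Z p * (d * (Matrix.of G).adjugate m n * k j n : ℝ)

/-- With d the frame determinant, d·adj G = d⁻¹ G⁻¹, so `crossTerm` is built from the volume form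
with signed density d⁻¹ and an index raised by G⁻¹: the coordinate form of the cross product.
Writing it with the adjugate avoids division and keeps the coefficients polynomial in G, d and K. -/
lemma crossTerm_eq (k : Fin 3 → Fin 3 → ℝ) (a b : Fin 3) :
    ∑ i, ∑ j, (F.e a i : ℂ) * F.e b j * crossTerm F.G F.det k (F.Z z) i j
      = ∑ c, ∑ l, levi a c l * ((∑ j, ∑ n, F.e b j * F.e c n * k j n : ℝ) : ℂ) * z l := by
  have hd : (F.det : ℂ) ≠ 0 := by exact_mod_cast F.det_ne_zero
  have key : ∀ c l, ∑ i, ∑ m, ∑ p, levi i m p * (F.e a i : ℂ) * F.e c m * F.e l p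
      = F.det * levi a c l := by
    intro c l
    have := levi_det ((Matrix.of F.e).map (fun t : ℝ => (t : ℂ))) a c l
    simp only [Matrix.map_apply, Matrix.of_apply] at this
    rw [this]
    congr 1
    exact (RingHom.map_det Complex.ofRealHom (Matrix.of F.e)).symm
  have e1 : ∑ i, ∑ j, (F.e a i : ℂ) * F.e b j * crossTerm F.G F.det k (F.Z z) i j
      = (F.det : ℂ)⁻¹ * ∑ c, ∑ l, (∑ i, ∑ m, ∑ p, levi i m p * (F.e a i : ℂ) * F.e c m * F.e l p)
         * ((∑ j, ∑ n, F.e b j * F.e c n * k j n : ℝ) : ℂ) * z l := by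
    have : ∀ m n, F.det * (Matrix.of F.G).adjugate m n = F.det⁻¹ * ∑ c, F.e c m * F.e c n := by
      intro m n
      rw [F.adjugate_eq]
      simp only [Matrix.smul_apply, Matrix.mul_apply, Matrix.transpose_apply, Matrix.of_apply,
        smul_eq_mul]
      field_simp [F.det_ne_zero]
    have h2 : ∀ i j, crossTerm F.G F.det k (F.Z z) i j = (F.det : ℂ)⁻¹ * ∑ c, ∑ l,
        (∑ m, ∑ p, levi i m p * F.e c m * F.e l p) * ((∑ n, F.e c n * k j n : ℝ) : ℂ) * z l := by
      intro i j
      have h3 : ∀ m, ∑ n, F.det * (Matrix.of F.G).adjugate m n * k j n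
          = F.det⁻¹ * ∑ c, F.e c m * ∑ n, F.e c n * k j n := by
        intro m
        simp only [this, Fin.sum_univ_three]
        ring
      have h4 : crossTerm F.G F.det k (F.Z z) i j = ∑ m, ∑ p, levi i m p * F.Z z p *
          ((∑ n, F.det * (Matrix.of F.G).adjugate m n * k j n : ℝ) : ℂ) := by
        simp only [crossTerm, Complex.ofReal_sum, Finset.mul_sum]
      rw [h4]
      simp only [h3]
      generalize hκ : (fun c => ∑ n, F.e c n * k j n) = κ
      have hκ' : ∀ c, ∑ n, F.e c n * k j n = κ c := fun c => by rw [← hκ]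
      simp only [hκ']
      push_cast
      simp only [Z, Fin.sum_univ_three]
      ring
    simp only [h2]
    have h5 : ∀ c, ∑ j, ∑ n, F.e b j * F.e c n * k j n
        = ∑ j, F.e b j * ∑ n, F.e c n * k j n := by
      intro c
      simp only [Finset.mul_sum, mul_assoc]
    simp only [h5]
    have h6 : ∀ c l, ∑ i, ∑ m, ∑ p, levi i m p * (F.e a i : ℂ) * F.e c m * F.e l p
        = ∑ i, F.e a i * ∑ m, ∑ p, levi i m p * F.e c m * F.e l p := by
      intro c l
      simp only [Finset.mul_sum]
      refine Finset.sum_congr rfl fun i _ => Finset.sum_congr rfl fun m _ =>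
        Finset.sum_congr rfl fun p _ => by ring
    simp only [h6]
    generalize hX : (fun i c l => ∑ m, ∑ p, levi i m p * (F.e c m : ℂ) * F.e l p) = X
    have hX' : ∀ i c l, ∑ m, ∑ p, levi i m p * (F.e c m : ℂ) * F.e l p = X i c l := fun i c l => by
      rw [← hX]
    generalize hκ : (fun c j => ∑ n, F.e c n * k j n) = κ
    have hκ' : ∀ c j, ∑ n, F.e c n * k j n = κ c j := fun c j => by rw [← hκ]
    simp only [hX', hκ']
    push_cast
    simp only [Fin.sum_univ_three]
    ring
  rw [e1]
  simp only [key, Finset.mul_sum]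
  refine Finset.sum_congr rfl fun c _ => Finset.sum_congr rfl fun l _ => ?_
  field_simp

/-- The dual coframe. -/
def dual (i m : Fin 3) : ℝ := ∑ n, F.G m n * F.e i n

/-- The trace of the connection in coordinates. Jacobi's formula turns the subtracted sum into the
derivative of log d along e_k, d the frame determinant; together they say div V = d ∂_m(d⁻¹ V^m),
which is how the divergence theorem will be applied. -/
lemma neg_sum_w (k : Fin 3) :
    -∑ i, F.w i i k = ∑ m, F.de k m m - ∑ i, ∑ m, F.dual i m * ∑ a, F.de i m a * F.e k a := by
  have h1 : ∀ i, F.w i i k = F.c k i i := fun i => by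
    simp only [w]
    linarith [F.c_antisymm i i k, F.c_antisymm k i i, F.c_antisymm i k i]
  have hd : ∀ m a, ∑ i, F.dual i m * F.e i a = if m = a then 1 else 0 := by
    intro m a
    have h2 : Matrix.of F.G * (Matrix.of F.e).transpose * Matrix.of F.e = 1 := by
      have h3 : Matrix.of F.e * (Matrix.of F.G * (Matrix.of F.e).transpose) = 1 := by
        rw [← Matrix.mul_assoc]; exact F.mul_transpose_mul
      exact mul_eq_one_comm.1 h3
    have h4 := congrFun (congrFun h2 m) a
    rw [Matrix.one_apply] at h4
    rw [← h4]
    simp only [Matrix.mul_apply, Matrix.transpose_apply, Matrix.of_apply, dual]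
  have h5 : ∑ i, F.c k i i = ∑ i, ∑ m, F.dual i m * ∑ a, F.de i m a * F.e k a
      - ∑ m, ∑ a, F.de k m a * ∑ i, F.dual i m * F.e i a := by
    simp only [c, dual, Fin.sum_univ_three]
    ring
  simp only [h1, h5, hd]
  simp

lemma det_mul_dual (i m : Fin 3) : F.det * F.dual i m = (Matrix.of F.e).adjugate m i := by
  have h3 : Matrix.of F.e * (Matrix.of F.G * (Matrix.of F.e).transpose) = 1 := by
    rw [← Matrix.mul_assoc]; exact F.mul_transpose_mul
  have h4 : (Matrix.of F.e).adjugate = F.det • (Matrix.of F.G * (Matrix.of F.e).transpose) := by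
    calc (Matrix.of F.e).adjugate = (Matrix.of F.e).adjugate *
          (Matrix.of F.e * (Matrix.of F.G * (Matrix.of F.e).transpose)) := by rw [h3, mul_one]
      _ = _ := by rw [← Matrix.mul_assoc, Matrix.adjugate_mul, Matrix.smul_mul, one_mul]; rfl
  rw [h4]
  simp only [Matrix.smul_apply, Matrix.mul_apply, Matrix.transpose_apply, Matrix.of_apply, dual,
    smul_eq_mul]

end FrameJet

/-- Jacobi's formula in dimension three. -/
lemma hasFDerivAt_det {E : Type*} [NormedAddCommGroup E] [NormedSpace ℝ E]
    {f : Fin 3 → Fin 3 → E → ℝ} {f' : Fin 3 → Fin 3 → E →L[ℝ] ℝ} {y : E}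
    (hf : ∀ i k, HasFDerivAt (f i k) (f' i k) y) :
    HasFDerivAt (fun w => (Matrix.of fun i k => f i k w).det)
      (∑ i, ∑ k, (Matrix.of fun i k => f i k y).adjugate k i • f' i k) y := by
  simp only [Matrix.det_fin_three, Matrix.of_apply]
  have h : ∀ a b c a' b' c' : Fin 3, HasFDerivAt (fun w => f a a' w * f b b' w * f c c' w)
      ((f a a' y * f b b' y) • f' c c' + f c c' y • (f a a' y • f' b b' + f b b' y • f' a a')) y :=
    fun a b c a' b' c' => ((hf a a').mul (hf b b')).mul (hf c c')
  refine ((((((h 0 1 2 0 1 2).sub (h 0 1 2 0 2 1)).sub (h 0 1 2 1 0 2)).add (h 0 1 2 1 2 0)).add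
    (h 0 1 2 2 0 1)).sub (h 0 1 2 2 1 0)).congr_fderiv ?_
  ext v
  simp [Fin.sum_univ_three, Matrix.adjugate_fin_three]
  ring

/-! ### Metric, spin frames and connection coefficients in a chart -/

section

variable {S : Type*} [TopologicalSpace S] [ChartedSpace E3 S] [IsManifold (𝓡 3) ∞ S]
  [RiemannianBundle (fun x : S => TangentSpace (𝓡 3) x)]

lemma frame_eq_sum {φ : OpenPartialHomeomorph S E3} (hφ : φ ∈ IsManifold.maximalAtlas (𝓡 3) ∞ S)
    {y : E3} (hy : y ∈ φ.target) (V : (x : S) → TangentSpace (𝓡 3) x) :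
    V (φ.symm y) = ∑ k, chartField φ V y k • coordVec φ k y := by
  rw [← mfderiv_chartField hφ hy V, mfderiv_eq_sum]

lemma ip_eq_sum {φ : OpenPartialHomeomorph S E3} (hφ : φ ∈ IsManifold.maximalAtlas (𝓡 3) ∞ S)
    {y : E3} (hy : y ∈ φ.target) (V W : (x : S) → TangentSpace (𝓡 3) x) :
    ip (V (φ.symm y)) (W (φ.symm y))
      = ∑ k, ∑ l, -metricCoeff φ k l y * chartField φ V y k * chartField φ W y l := by
  rw [frame_eq_sum hφ hy V, frame_eq_sum hφ hy W]
  simp only [ip, metricCoeff, sum_inner, inner_sum, real_inner_smul_left, real_inner_smul_right]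
  rw [Finset.sum_comm]
  refine Finset.sum_congr rfl fun k _ => Finset.sum_congr rfl fun l _ => by ring

lemma tensor_eq_sum {φ : OpenPartialHomeomorph S E3} (hφ : φ ∈ IsManifold.maximalAtlas (𝓡 3) ∞ S)
    {y : E3} (hy : y ∈ φ.target) (K : TwoTensor S) (V W : (x : S) → TangentSpace (𝓡 3) x) :
    K (φ.symm y) (V (φ.symm y)) (W (φ.symm y))
      = ∑ k, ∑ l, chartField φ V y k * chartField φ W y l * tensorCoeff K φ k l y := by
  rw [frame_eq_sum hφ hy V, frame_eq_sum hφ hy W]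
  simp only [tensorCoeff, map_sum, map_smul, ContinuousLinearMap.sum_apply,
    ContinuousLinearMap.smul_apply, smul_eq_mul, Finset.mul_sum]
  rw [Finset.sum_comm]
  refine Finset.sum_congr rfl fun k _ => Finset.sum_congr rfl fun l _ => by ring

variable [hR : IsContMDiffRiemannianBundle (𝓡 3) ∞ E3 (fun x : S => TangentSpace (𝓡 3) x)]
  {ι : Type*} (𝔰 : SpinStructure S ι) (φ : OpenPartialHomeomorph S E3) (a : ι)

/-- The coordinate components of the vectors of a spin frame. -/
def frameField (i : Fin 3) : E3 → E3 := chartField φ (𝔰.frame a i)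

variable {φ} (hφ : φ ∈ IsManifold.maximalAtlas (𝓡 3) ∞ S) {y : E3} (hy : y ∈ φ.target)
  (ha : φ.symm y ∈ 𝔰.dom a)

include hφ hy ha

omit hφ in
lemma eventually_mem_dom : ∀ᶠ w in nhds y, w ∈ φ.target ∧ φ.symm w ∈ 𝔰.dom a :=
  (φ.open_target.eventually_mem hy).and
    ((φ.continuousAt_symm hy).eventually ((𝔰.isOpen_dom a).mem_nhds ha))

lemma frameField_contDiffAt (i : Fin 3) : ContDiffAt ℝ ∞ (frameField 𝔰 φ a i) y :=
  chartField_contDiffAt hφ hy ((𝔰.frame_smooth a i).contMDiffAt ((𝔰.isOpen_dom a).mem_nhds ha))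

omit hR in
lemma frameField_orth (i j : Fin 3) : ∑ k, ∑ l, -metricCoeff φ k l y *
    frameField 𝔰 φ a i y k * frameField 𝔰 φ a j y l = if i = j then 1 else 0 := by
  rw [← 𝔰.frame_orthonormal a _ ha i j, ip_eq_sum hφ hy]
  rfl

lemma frameField_hasFDerivAt (i k : Fin 3) : HasFDerivAt (fun w => frameField 𝔰 φ a i w k)
    (EuclideanSpace.proj k ∘L fderiv ℝ (frameField 𝔰 φ a i) y) y :=
  (EuclideanSpace.proj (𝕜 := ℝ) k).hasFDerivAt.comp y
    ((frameField_contDiffAt 𝔰 a hφ hy ha i).differentiableAt (by simp)).hasFDerivAt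

/-- The 1-jet of the metric and of a spin frame in a chart. -/
def frameJet : FrameJet where
  e i k := frameField 𝔰 φ a i y k
  de i k m := fderiv ℝ (frameField 𝔰 φ a i) y (EuclideanSpace.single m 1) k
  G k l := -metricCoeff φ k l y
  dG k l m := -fderiv ℝ (metricCoeff φ k l) y (EuclideanSpace.single m 1)
  symm k l := by simp only [metricCoeff, ip, real_inner_comm]
  orth i j := frameField_orth 𝔰 a hφ hy ha i j
  dorth i j m := by
    have hG : ∀ k l, HasFDerivAt (fun w => -metricCoeff φ k l w) (-fderiv ℝ (metricCoeff φ k l) y) y :=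
      fun k l => ((metricCoeff_contDiffAt hφ hy k l).differentiableAt (by simp)).hasFDerivAt.neg
    have hE := frameField_hasFDerivAt 𝔰 a hφ hy ha
    have h := HasFDerivAt.fun_sum (u := Finset.univ) fun k _ =>
      HasFDerivAt.fun_sum (u := Finset.univ) fun l _ => ((hG k l).mul (hE i k)).mul (hE j l)
    -- Orthonormality holds on a neighbourhood, so the identity can be differentiated.
    have h0 : (fun w => ∑ k, ∑ l, -metricCoeff φ k l w *
        frameField 𝔰 φ a i w k * frameField 𝔰 φ a j w l) =ᶠ[nhds y]
        fun _ => if i = j then 1 else 0 := by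
      filter_upwards [eventually_mem_dom 𝔰 a hy ha] with w hw
      exact frameField_orth 𝔰 a hφ hw.1 hw.2 i j
    have h1 := (h.congr_of_eventuallyEq h0.symm).unique (hasFDerivAt_const _ _)
    have h2 := congrArg (fun L : E3 →L[ℝ] ℝ => L (EuclideanSpace.single m 1)) h1
    simp only [ContinuousLinearMap.sum_apply, ContinuousLinearMap.add_apply,
      ContinuousLinearMap.smul_apply, ContinuousLinearMap.neg_apply,
      ContinuousLinearMap.comp_apply, smul_eq_mul, ContinuousLinearMap.zero_apply] at h2
    rw [← h2]
    refine Finset.sum_congr rfl fun k _ => Finset.sum_congr rfl fun l _ => ?_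
    have hp : ∀ (v : E3) (k : Fin 3), EuclideanSpace.proj (𝕜 := ℝ) k v = v k := fun _ _ => rfl
    simp only [Pi.mul_apply, hp]
    ring

lemma frame_mdifferentiableAt (i : Fin 3) : MDifferentiableAt (𝓡 3) (𝓡 3).tangent
    (fun x => (⟨x, 𝔰.frame a i x⟩ : TangentBundle (𝓡 3) S)) (φ.symm y) :=
  ((𝔰.frame_smooth a i).contMDiffAt ((𝔰.isOpen_dom a).mem_nhds ha)).mdifferentiableAt (by simp)

lemma connCoeff_frame (i j k : Fin 3) :
    connCoeff (𝔰.frame a) i j k (φ.symm y) = (frameJet 𝔰 a hφ hy ha).w i j k := by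
  have h : ∀ i j k, ip (VectorField.mlieBracket (𝓡 3) (𝔰.frame a i) (𝔰.frame a j) (φ.symm y))
      (𝔰.frame a k (φ.symm y)) = (frameJet 𝔰 a hφ hy ha).c i j k := by
    intro i j k
    rw [ip_eq_sum hφ hy (VectorField.mlieBracket (𝓡 3) (𝔰.frame a i) (𝔰.frame a j)),
      chartField_mlieBracket hφ hy (frame_mdifferentiableAt 𝔰 a hφ hy ha i)
        (frame_mdifferentiableAt 𝔰 a hφ hy ha j)]
    simp only [FrameJet.c, frameJet]
    refine Finset.sum_congr rfl fun m _ => Finset.sum_congr rfl fun n _ => ?_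
    have hv : ∀ (L : E3 →L[ℝ] E3) (v : E3), L v m = ∑ p, L (EuclideanSpace.single p 1) m * v p := by
      intro L v
      have : v = ∑ p, v p • (EuclideanSpace.single p (1 : ℝ) : E3) := by
        ext q
        simp [Finset.sum_apply, Pi.single_apply]
      conv_lhs => rw [this]
      simp [Finset.sum_apply, mul_comm]
    have hbr : ∀ V W : E3 → E3, VectorField.lieBracket ℝ V W y m
        = ∑ p, (fderiv ℝ W y (EuclideanSpace.single p 1) m * V y p
          - fderiv ℝ V y (EuclideanSpace.single p 1) m * W y p) := by
      intro V W
      rw [Finset.sum_sub_distrib, ← hv, ← hv]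
      rfl
    rw [hbr]
    rfl
  simp only [connCoeff, FrameJet.w, h]

end

/-- The symmetrised derivative of a vector field `Z` in coordinates, corrected by the extrinsic
curvature; its trace-free part is twice the spatial Killing operator. -/
def killForm (G : Fin 3 → Fin 3 → ℝ) (dG : Fin 3 → Fin 3 → Fin 3 → ℝ) (d : ℝ)
    (k : Fin 3 → Fin 3 → ℝ) (Z : Fin 3 → ℂ) (dZ : Fin 3 → Fin 3 → ℂ) (i j : Fin 3) : ℂ :=
  ∑ m, (dG i j m * Z m + G m j * dZ m i + G i m * dZ m j)
    - beta * (crossTerm G d k Z i j + crossTerm G d k Z j i)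

/-! ### The complex vector field of a spinor and its Killing form in a chart -/

section

variable {S : Type*} [TopologicalSpace S] [ChartedSpace E3 S] [IsManifold (𝓡 3) ∞ S]
  [RiemannianBundle (fun x : S => TangentSpace (𝓡 3) x)]
  {ι : Type*} {𝔰 : SpinStructure S ι}

/-- The frame components of the complex vector of a valence two spinor field. -/
def spinVec (ν : SpinorField 𝔰 2) (a : ι) (x : S) : Fin 3 → ℂ := spinorVec (ν.comp a x)

lemma comp_eq_vecSpinor (ν : SpinorField 𝔰 2) {a : ι} {x : S} (hx : x ∈ 𝔰.dom a) :
    ν.comp a x = vecSpinor (spinVec ν a x) := by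
  refine (vecSpinor_spinorVec ?_).symm
  have := ν.symm a x hx (Equiv.swap 0 1) ![0, 1]
  rw [← this]
  congr 1
  ext i; fin_cases i <;> rfl

lemma spinVec_contMDiffOn (ν : SpinorField 𝔰 2) (a : ι) (i : Fin 3) :
    ContMDiffOn (𝓡 3) 𝓘(ℝ, ℂ) ∞ (fun x => spinVec ν a x i) (𝔰.dom a) := by
  simp only [spinVec, spinorVec, Fin.sum_univ_two]
  have h : ∀ A B, ContMDiffOn (𝓡 3) 𝓘(ℝ, ℂ) ∞
      (fun x => (starRingEnd ℂ) (sigma i A B) * ν.comp a x ![A, B]) (𝔰.dom a) := fun A B =>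
    (ContinuousLinearMap.mul ℝ ℂ ((starRingEnd ℂ) (sigma i A B))).contMDiff.comp_contMDiffOn
      (ν.smooth a ![A, B])
  exact ((h 0 0).add (h 0 1)).add ((h 1 0).add (h 1 1))

/-- The lifting condition `trans_frame` rewrites g σ^k gᵀ as a rotation of the σ's, so the spinor
transition law becomes the change of orthonormal frame on vectors. -/
lemma spinVec_trans (ν : SpinorField 𝔰 2) {a b : ι} {x : S} (ha : x ∈ 𝔰.dom a)
    (hb : x ∈ 𝔰.dom b) (i : Fin 3) :
    spinVec ν a x i = ∑ k, (ip (𝔰.frame a i x) (𝔰.frame b k x) : ℂ) * spinVec ν b x k := by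
  have h : ν.comp a x = vecSpinor fun i =>
      ∑ k, (ip (𝔰.frame a i x) (𝔰.frame b k x) : ℂ) * spinVec ν b x k := by
    funext c
    rw [ν.compat a b x ⟨ha, hb⟩ c, comp_eq_vecSpinor ν hb]
    have e : ∀ k, (𝔰.trans a b x * sigma k * (𝔰.trans a b x).transpose) (c 0) (c 1)
        = ∑ i, (ip (𝔰.frame a i x) (𝔰.frame b k x) : ℂ) * sigma i (c 0) (c 1) := fun k => by
      rw [𝔰.trans_frame a b x ⟨ha, hb⟩ k, Matrix.sum_apply]
      rfl
    rw [Fintype.sum_equiv (finTwoArrowEquiv (Fin 2)) _ (fun p =>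
      (𝔰.trans a b x (c 0) p.1 * 𝔰.trans a b x (c 1) p.2) *
        ∑ k, spinVec ν b x k * sigma k p.1 p.2), Fintype.sum_prod_type]
    · have e2 : ∑ A, ∑ B, (𝔰.trans a b x (c 0) A * 𝔰.trans a b x (c 1) B) *
        ∑ k, spinVec ν b x k * sigma k A B = ∑ k, spinVec ν b x k *
          (𝔰.trans a b x * sigma k * (𝔰.trans a b x).transpose) (c 0) (c 1) := by
        simp only [Matrix.mul_apply, Matrix.transpose_apply, Fin.sum_univ_two, Fin.sum_univ_three]
        ring
      rw [e2]
      simp only [e, vecSpinor, Fin.sum_univ_three]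
      ring
    · intro d
      simp [vecSpinor, Fin.prod_univ_two, finTwoArrowEquiv]
  have h2 := congrArg spinorVec h
  rw [spinorVec_vecSpinor] at h2
  exact congrFun h2 i

variable [hR : IsContMDiffRiemannianBundle (𝓡 3) ∞ E3 (fun x : S => TangentSpace (𝓡 3) x)]
  {φ : OpenPartialHomeomorph S E3} (hφ : φ ∈ IsManifold.maximalAtlas (𝓡 3) ∞ S) {y : E3}
  (hy : y ∈ φ.target) {a b : ι} (ha : φ.symm y ∈ 𝔰.dom a) (hb : φ.symm y ∈ 𝔰.dom b)

/-- The change of frame. -/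
def frameChange (𝔰 : SpinStructure S ι) (a b : ι) (x : S) : Matrix (Fin 3) (Fin 3) ℝ :=
  Matrix.of fun i k => ip (𝔰.frame a i x) (𝔰.frame b k x)

omit hR in
lemma frameChange_det {x : S} (ha : x ∈ 𝔰.dom a) (hb : x ∈ 𝔰.dom b) :
    (frameChange 𝔰 a b x).det = 1 := by
  have h := det_eq_one_of_sigma (O := (frameChange 𝔰 a b x).map (fun t : ℝ => (t : ℂ)))
    (Matrix.mem_specialUnitaryGroup_iff.1 (𝔰.trans_mem a b x ⟨ha, hb⟩)).2
    (𝔰.trans_frame a b x ⟨ha, hb⟩)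
  have h2 := RingHom.map_det Complex.ofRealHom (frameChange 𝔰 a b x)
  have h3 : ((frameChange 𝔰 a b x).det : ℂ) = 1 := h2.trans h
  exact_mod_cast h3

omit hR in
lemma frameChange_eq (hφ : φ ∈ IsManifold.maximalAtlas (𝓡 3) ∞ S) (hy : y ∈ φ.target) :
    frameChange 𝔰 a b (φ.symm y) = Matrix.of (fun i k => frameField 𝔰 φ a i y k) *
      Matrix.of (fun k l => -metricCoeff φ k l y) *
      (Matrix.of (fun i k => frameField 𝔰 φ b i y k)).transpose := by
  ext i k
  simp only [frameChange, Matrix.of_apply, ip_eq_sum hφ hy, Matrix.mul_apply,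
    Matrix.transpose_apply, Finset.sum_mul]
  rw [Finset.sum_comm]
  refine Finset.sum_congr rfl fun m _ => Finset.sum_congr rfl fun n _ => ?_
  simp only [frameField]
  ring

include hφ hy hb

lemma frameField_change : Matrix.of (fun i k => frameField 𝔰 φ a i y k)
    = frameChange 𝔰 a b (φ.symm y) * Matrix.of (fun i k => frameField 𝔰 φ b i y k) := by
  have h := (frameJet 𝔰 b hφ hy hb).mul_transpose_mul
  rw [Matrix.mul_assoc] at h
  have h2 := mul_eq_one_comm.1 h
  rw [frameChange_eq hφ hy, Matrix.mul_assoc, Matrix.mul_assoc]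
  rw [Matrix.mul_assoc] at h2
  exact ((congrArg (fun M => Matrix.of (fun i k => frameField 𝔰 φ a i y k) * M) h2).trans
    (mul_one _)).symm

include ha

lemma frameChange_mul_transpose :
    frameChange 𝔰 a b (φ.symm y) * (frameChange 𝔰 a b (φ.symm y)).transpose = 1 := by
  have h := (frameJet 𝔰 a hφ hy ha).mul_transpose_mul
  have h1 : (frameChange 𝔰 a b (φ.symm y)).transpose
      = Matrix.of (fun i k => frameField 𝔰 φ b i y k) *
      Matrix.of (fun k l => -metricCoeff φ k l y) *
      (Matrix.of (fun i k => frameField 𝔰 φ a i y k)).transpose := by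
    rw [← frameChange_eq hφ hy]
    ext i j
    exact real_inner_comm (F := TangentSpace (𝓡 3) (φ.symm y)) _ _
  rw [h1, ← Matrix.mul_assoc, ← Matrix.mul_assoc, ← frameField_change hφ hy hb]
  exact h

/-- All spin frames induce one orientation. This makes the signed determinant `chartDet`, and with
it the cross term, a function of the point alone. -/
lemma frameField_det_eq : (Matrix.of (fun i k => frameField 𝔰 φ a i y k)).det
    = (Matrix.of (fun i k => frameField 𝔰 φ b i y k)).det := by
  rw [frameField_change hφ hy hb, Matrix.det_mul, frameChange_det ha hb, one_mul]

lemma sum_spinVec_frame (ν : SpinorField 𝔰 2) (m : Fin 3) :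
    ∑ i, spinVec ν a (φ.symm y) i * (frameField 𝔰 φ a i y m : ℂ)
      = ∑ i, spinVec ν b (φ.symm y) i * (frameField 𝔰 φ b i y m : ℂ) := by
  have h1 := frameField_change (a := a) hφ hy hb
  have h2 := mul_eq_one_comm.1 (frameChange_mul_transpose hφ hy ha hb)
  have e1 : ∀ i, (frameField 𝔰 φ a i y m : ℂ)
      = ∑ k, (frameChange 𝔰 a b (φ.symm y) i k : ℂ) * frameField 𝔰 φ b k y m := by
    intro i
    have := congrFun (congrFun h1 i) m
    rw [Matrix.mul_apply] at this
    exact_mod_cast this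
  have e2 : ∀ k l, ∑ i, (frameChange 𝔰 a b (φ.symm y) i k : ℂ) * frameChange 𝔰 a b (φ.symm y) i l
      = if k = l then 1 else 0 := by
    intro k l
    have := congrFun (congrFun h2 k) l
    rw [Matrix.mul_apply, Matrix.one_apply] at this
    have := congrArg (fun t : ℝ => (t : ℂ)) this
    simp only [Complex.ofReal_sum, Complex.ofReal_mul, Matrix.transpose_apply] at this
    rw [this]
    split_ifs <;> simp
  have e3 : ∀ i, spinVec ν a (φ.symm y) i
      = ∑ k, (frameChange 𝔰 a b (φ.symm y) i k : ℂ) * spinVec ν b (φ.symm y) k :=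
    fun i => spinVec_trans ν ha hb i
  calc _ = ∑ k, ∑ l, spinVec ν b (φ.symm y) k * frameField 𝔰 φ b l y m *
        ∑ i, (frameChange 𝔰 a b (φ.symm y) i k : ℂ) * frameChange 𝔰 a b (φ.symm y) i l := by
        simp only [e1, e3, Fin.sum_univ_three]
        ring
    _ = _ := by simp [e2]

omit hφ hy ha hb

/-- The coordinate components of the complex vector field of a valence two spinor field. -/
def chartZ (ν : SpinorField 𝔰 2) (φ : OpenPartialHomeomorph S E3) (m : Fin 3) (y : E3) : ℂ :=
  ∑ i, spinVec ν (𝔰.indexAt (φ.symm y)) (φ.symm y) i *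
    (frameField 𝔰 φ (𝔰.indexAt (φ.symm y)) i y m : ℂ)

/-- The determinant of the oriented orthonormal frames in a chart. -/
def chartDet (𝔰 : SpinStructure S ι) (φ : OpenPartialHomeomorph S E3) (y : E3) : ℝ :=
  (Matrix.of fun i k => frameField 𝔰 φ (𝔰.indexAt (φ.symm y)) i y k).det

include hφ hy ha

lemma chartZ_eq (ν : SpinorField 𝔰 2) (m : Fin 3) : chartZ ν φ m y
    = ∑ i, spinVec ν a (φ.symm y) i * (frameField 𝔰 φ a i y m : ℂ) :=
  sum_spinVec_frame hφ hy (𝔰.mem_indexAt _) ha ν m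

lemma chartDet_eq : chartDet 𝔰 φ y = (Matrix.of fun i k => frameField 𝔰 φ a i y k).det :=
  frameField_det_eq hφ hy (𝔰.mem_indexAt _) ha

lemma spinVec_chart_contDiffAt (ν : SpinorField 𝔰 2) (i : Fin 3) :
    ContDiffAt ℝ ∞ (fun w => spinVec ν a (φ.symm w) i) y :=
  (((spinVec_contMDiffOn ν a i).contMDiffAt ((𝔰.isOpen_dom a).mem_nhds ha)).comp y
    (chart_symm_contMDiffAt hφ hy)).contDiffAt

lemma frameField_comp_contDiffAt (i k : Fin 3) :
    ContDiffAt ℝ ∞ (fun w => frameField 𝔰 φ a i w k) y :=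
  (EuclideanSpace.proj (𝕜 := ℝ) k).contDiff.contDiffAt.comp y
    (frameField_contDiffAt 𝔰 a hφ hy ha i)

/-- The index `indexAt` may jump from point to point. Frame independence allows it to be replaced
near y by one fixed frame, and only then can derivatives be taken. -/
lemma chartZ_eventuallyEq (ν : SpinorField 𝔰 2) (m : Fin 3) : chartZ ν φ m
    =ᶠ[nhds y] fun w => ∑ i, spinVec ν a (φ.symm w) i * (frameField 𝔰 φ a i w m : ℂ) := by
  filter_upwards [eventually_mem_dom 𝔰 a hy ha] with w hw
  exact chartZ_eq hφ hw.1 hw.2 ν m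

omit ha in
lemma chartZ_contDiffAt (ν : SpinorField 𝔰 2) (m : Fin 3) : ContDiffAt ℝ ∞ (chartZ ν φ m) y := by
  have ha := 𝔰.mem_indexAt (φ.symm y)
  refine ContDiffAt.congr_of_eventuallyEq ?_ (chartZ_eventuallyEq hφ hy ha ν m)
  refine ContDiffAt.sum fun i _ => (spinVec_chart_contDiffAt hφ hy ha ν i).mul ?_
  exact Complex.ofRealCLM.contDiff.contDiffAt.comp y (frameField_comp_contDiffAt hφ hy ha i m)

omit ha in
lemma chartDet_contDiffAt : ContDiffAt ℝ ∞ (chartDet 𝔰 φ) y := by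
  have ha := 𝔰.mem_indexAt (φ.symm y)
  have h : chartDet 𝔰 φ =ᶠ[nhds y] fun w =>
      (Matrix.of fun i k => frameField 𝔰 φ (𝔰.indexAt (φ.symm y)) i w k).det := by
    filter_upwards [eventually_mem_dom 𝔰 _ hy ha] with w hw
    exact chartDet_eq hφ hw.1 hw.2
  refine ContDiffAt.congr_of_eventuallyEq ?_ h
  have := frameField_comp_contDiffAt hφ hy ha
  simp only [Matrix.det_fin_three, Matrix.of_apply]
  have h3 : ∀ p q r p' q' r', ContDiffAt ℝ ∞ (fun w =>
      frameField 𝔰 φ (𝔰.indexAt (φ.symm y)) p w p' * frameField 𝔰 φ (𝔰.indexAt (φ.symm y)) q w q' *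
      frameField 𝔰 φ (𝔰.indexAt (φ.symm y)) r w r') y := fun p q r p' q' r' =>
    ((this p p').mul (this q q')).mul (this r r')
  exact (((((h3 _ _ _ _ _ _).sub (h3 _ _ _ _ _ _)).sub (h3 _ _ _ _ _ _)).add
    (h3 _ _ _ _ _ _)).add (h3 _ _ _ _ _ _)).sub (h3 _ _ _ _ _ _)

omit ha in
lemma chartDet_sq : chartDet 𝔰 φ y ^ 2 * (Matrix.of fun k l => -metricCoeff φ k l y).det = 1 :=
  (frameJet 𝔰 _ hφ hy (𝔰.mem_indexAt _)).det_sq_mul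

omit hφ hy ha

/-- The Killing form of a spinor field in a chart. -/
def chartKillForm (K : TwoTensor S) (ν : SpinorField 𝔰 2) (φ : OpenPartialHomeomorph S E3)
    (y : E3) : Fin 3 → Fin 3 → ℂ :=
  killForm (fun k l => -metricCoeff φ k l y)
    (fun k l m => -fderiv ℝ (metricCoeff φ k l) y (EuclideanSpace.single m 1))
    (chartDet 𝔰 φ y) (fun k l => tensorCoeff K φ k l y) (fun m => chartZ ν φ m y)
    (fun m k => fderiv ℝ (chartZ ν φ m) y (EuclideanSpace.single k 1))

include hφ hy ha

/-- Combines `FrameJet.lie_eq` for the derivative terms with `FrameJet.crossTerm_eq` for the terms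
in K. It is the bridge between the equation in spin frames and its coordinate form, where the
analysis is done. -/
lemma chartKillForm_frame (K : TwoTensor S) (ν : SpinorField 𝔰 2) (i j : Fin 3) :
    ∑ k, ∑ l, (frameField 𝔰 φ a i y k : ℂ) * frameField 𝔰 φ a j y l * chartKillForm K ν φ y k l
      = senVec (𝔰.frame a) K (spinVec ν a) (φ.symm y) i j
        + senVec (𝔰.frame a) K (spinVec ν a) (φ.symm y) j i := by
  set F := frameJet 𝔰 a hφ hy ha with hF
  set dz : Fin 3 → Fin 3 → ℂ := fun i k =>
    fderiv ℝ (fun w => spinVec ν a (φ.symm w) i) y (EuclideanSpace.single k 1) with hdz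
  set z := spinVec ν a (φ.symm y) with hz
  have hZ : ∀ m, chartZ ν φ m y = F.Z z m := fun m => chartZ_eq hφ hy ha ν m
  have hdZ : ∀ m k, fderiv ℝ (chartZ ν φ m) y (EuclideanSpace.single k 1) = F.dZ z dz m k := by
    intro m k
    rw [(chartZ_eventuallyEq hφ hy ha ν m).fderiv_eq]
    have h1 : ∀ i, HasFDerivAt (fun w => spinVec ν a (φ.symm w) i) _ y := fun i =>
      ((spinVec_chart_contDiffAt hφ hy ha ν i).differentiableAt (by simp)).hasFDerivAt
    have h2 : ∀ i, HasFDerivAt (fun w => (frameField 𝔰 φ a i w m : ℂ)) _ y := fun i =>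
      Complex.ofRealCLM.hasFDerivAt.comp y (frameField_hasFDerivAt 𝔰 a hφ hy ha i m)
    have h3 := HasFDerivAt.fun_sum (u := Finset.univ) fun i _ => (h1 i).mul (h2 i)
    have h4 : (fun w => ∑ i, spinVec ν a (φ.symm w) i * (frameField 𝔰 φ a i w m : ℂ))
      = fun w => ∑ i, ((fun w => spinVec ν a (φ.symm w) i) *
        fun w => (frameField 𝔰 φ a i w m : ℂ)) w := rfl
    rw [h4, h3.fderiv, FrameJet.dZ]
    simp only [ContinuousLinearMap.sum_apply, ContinuousLinearMap.add_apply,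
      ContinuousLinearMap.smul_apply, smul_eq_mul]
    refine Finset.sum_congr rfl fun i _ => ?_
    rw [add_comm]
    congr 1
    exact mul_comm _ _
  have hdet : chartDet 𝔰 φ y = F.det := chartDet_eq hφ hy ha
  have hcov : ∀ i j, covVec (𝔰.frame a) (spinVec ν a) (φ.symm y) i j
      = ∑ m, dz j m * F.e i m - ∑ k, (F.w i j k : ℂ) * z k := by
    intro i j
    rw [covVec, dirDeriv_chart hφ hy (((spinVec_contMDiffOn ν a j).contMDiffAt
      ((𝔰.isOpen_dom a).mem_nhds ha)).mdifferentiableAt (by simp)), clm_apply_eq_sum]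
    simp only [connCoeff_frame 𝔰 a hφ hy ha]
    congr 1
    refine Finset.sum_congr rfl fun p _ => ?_
    rw [Complex.real_smul, mul_comm]
    rfl
  have hK : ∀ i j, ∑ k, ∑ l, levi j k l *
      (K (φ.symm y) (𝔰.frame a i (φ.symm y)) (𝔰.frame a k (φ.symm y)) : ℂ) * z l
      = ∑ k, ∑ l, (F.e j k : ℂ) * F.e i l *
        crossTerm F.G F.det (fun k l => tensorCoeff K φ k l y) (F.Z z) k l := by
    intro i j
    rw [F.crossTerm_eq]
    simp only [tensor_eq_sum hφ hy]
    rfl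
  set T : Fin 3 → Fin 3 → ℂ := fun i j => ∑ k, ∑ l, (F.e i k : ℂ) * F.e j l *
        crossTerm F.G F.det (fun k l => tensorCoeff K φ k l y) (F.Z z) k l with hT
  have hs : ∀ i j, senVec (𝔰.frame a) K (spinVec ν a) (φ.symm y) i j
      = (∑ m, dz j m * F.e i m - ∑ k, (F.w i j k : ℂ) * z k) - beta * T j i := by
    intro i j
    rw [senVec, hcov]
    exact congrArg (fun t => _ - beta * t) (hK i j)
  have hlie := F.lie_eq z dz i j
  rw [hs, hs]
  simp only [chartKillForm, killForm, hZ, hdZ, hdet]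
  have e : ∀ A B : Fin 3 → Fin 3 → ℂ, ∑ k, ∑ l, (F.e i k : ℂ) * F.e j l *
      (A k l - beta * (B k l + B l k)) = ∑ k, ∑ l, (F.e i k : ℂ) * F.e j l * A k l
        - beta * ∑ k, ∑ l, (F.e i k : ℂ) * F.e j l * B k l
        - beta * ∑ k, ∑ l, (F.e j k : ℂ) * F.e i l * B k l := by
    intro A B
    simp only [Fin.sum_univ_three]
    ring
  refine (e _ _).trans ?_
  have hlie2 : ∑ k, ∑ l, (F.e i k : ℂ) * F.e j l *
      (∑ m, (((-fderiv ℝ (metricCoeff φ k l) y (EuclideanSpace.single m 1) : ℝ) : ℂ) * F.Z z m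
        + ((-metricCoeff φ m l y : ℝ) : ℂ) * F.dZ z dz m k
        + ((-metricCoeff φ k m y : ℝ) : ℂ) * F.dZ z dz m l)) = _ := hlie
  rw [hlie2]
  change _ - beta * T i j - beta * T j i = _
  ring

end

/-! ### Independence of the spin frame; norms and flux -/

section

variable {S : Type*} [TopologicalSpace S] [ChartedSpace E3 S] [IsManifold (𝓡 3) ∞ S]
  [RiemannianBundle (fun x : S => TangentSpace (𝓡 3) x)]
  [hR : IsContMDiffRiemannianBundle (𝓡 3) ∞ E3 (fun x : S => TangentSpace (𝓡 3) x)]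
  {ι : Type*} {𝔰 : SpinStructure S ι}

/-- The vector form of the spatial Killing operator in a spin frame. -/
abbrev killFrame (K : TwoTensor S) (ν : SpinorField 𝔰 2) (a : ι) (x : S) : Fin 3 → Fin 3 → ℂ :=
  killVec (𝔰.frame a) K (spinVec ν a) x

section Chart

variable {φ : OpenPartialHomeomorph S E3} (hφ : φ ∈ IsManifold.maximalAtlas (𝓡 3) ∞ S) {y : E3}
  (hy : y ∈ φ.target) {a b : ι} (ha : φ.symm y ∈ 𝔰.dom a) (hb : φ.symm y ∈ 𝔰.dom b)
  (K : TwoTensor S) (ν : SpinorField 𝔰 2)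

include hφ hy ha

lemma killFrame_chart (i j : Fin 3) : killFrame K ν a (φ.symm y) i j
    = (∑ k, ∑ l, (frameField 𝔰 φ a i y k : ℂ) * frameField 𝔰 φ a j y l
        * chartKillForm K ν φ y k l) / 2
      - if i = j then (∑ c, ∑ k, ∑ l, (frameField 𝔰 φ a c y k : ℂ) * frameField 𝔰 φ a c y l
        * chartKillForm K ν φ y k l) / 6 else 0 := by
  simp only [chartKillForm_frame hφ hy ha]
  simp only [killFrame, killVec, tfSym, Fin.sum_univ_three]
  split_ifs <;> ring

include hb

/-- The chart Killing form does not refer to the chosen frame, so its components in two frames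
differ by the orthogonal change of frame. This bypasses the inhomogeneous transformation law of the
connection coefficients. -/
lemma killFrame_change (i j : Fin 3) : killFrame K ν a (φ.symm y) i j
    = ∑ k, ∑ l, (frameChange 𝔰 a b (φ.symm y) i k : ℂ) * frameChange 𝔰 a b (φ.symm y) j l *
      killFrame K ν b (φ.symm y) k l := by
  have h1 := frameField_change (a := a) hφ hy hb
  have h2 := frameChange_mul_transpose hφ hy ha hb
  have h3 := mul_eq_one_comm.1 h2
  generalize frameChange 𝔰 a b (φ.symm y) = O at h1 h2 h3 ⊢
  have e1 : ∀ i m, (frameField 𝔰 φ a i y m : ℂ)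
      = ∑ k, (O i k : ℂ) * frameField 𝔰 φ b k y m := by
    intro i m
    have := congrFun (congrFun h1 i) m
    rw [Matrix.mul_apply] at this
    exact_mod_cast this
  have e2 : ∀ k l, ∑ i, (O i k : ℂ) * O i l = if k = l then 1 else 0 := by
    intro k l
    have := congrFun (congrFun h3 k) l
    rw [Matrix.mul_apply, Matrix.one_apply] at this
    have := congrArg (fun t : ℝ => (t : ℂ)) this
    simp only [Complex.ofReal_sum, Complex.ofReal_mul, Matrix.transpose_apply] at this
    rw [this]
    split_ifs <;> simp
  have e3 : ∀ k l, ∑ i, (O k i : ℂ) * O l i = if k = l then 1 else 0 := by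
    intro k l
    have := congrFun (congrFun h2 k) l
    rw [Matrix.mul_apply, Matrix.one_apply] at this
    have := congrArg (fun t : ℝ => (t : ℂ)) this
    simp only [Complex.ofReal_sum, Complex.ofReal_mul, Matrix.transpose_apply] at this
    rw [this]
    split_ifs <;> simp
  generalize hT : (fun k l => ∑ p, ∑ q, (frameField 𝔰 φ b k y p : ℂ) * frameField 𝔰 φ b l y q
        * chartKillForm K ν φ y p q) = T
  have hT' : ∀ k l, ∑ p, ∑ q, (frameField 𝔰 φ b k y p : ℂ) * frameField 𝔰 φ b l y q
        * chartKillForm K ν φ y p q = T k l := fun k l => by rw [← hT]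
  have e4 : ∀ i j, ∑ p, ∑ q, (frameField 𝔰 φ a i y p : ℂ) * frameField 𝔰 φ a j y q
        * chartKillForm K ν φ y p q = ∑ k, ∑ l, (O i k : ℂ) * O j l * T k l := by
    intro i j
    simp only [← hT', e1, Fin.sum_univ_three]
    ring
  have e5 : ∑ c, ∑ k, ∑ l, (O c k : ℂ) * O c l * T k l = ∑ k, T k k := by
    calc _ = ∑ k, ∑ l, (∑ c, (O c k : ℂ) * O c l) * T k l := by
          simp only [Fin.sum_univ_three]; ring
      _ = _ := by simp [e2]
  simp only [killFrame_chart hφ hy ha, killFrame_chart hφ hy hb, e4, hT', e5]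
  have e6 : ∀ t : ℂ, (∑ k, ∑ l, (O i k : ℂ) * O j l * (if k = l then t else 0))
      = if i = j then t else 0 := by
    intro t
    calc _ = (∑ k, (O i k : ℂ) * O j k) * t := by
          simp [Finset.sum_mul]
      _ = _ := by rw [e3]; split_ifs <;> simp
  rw [← e6]
  simp only [mul_sub, Finset.sum_sub_distrib, Finset.sum_div]
  congr 1
  refine Finset.sum_congr rfl fun k _ => Finset.sum_congr rfl fun l _ => by ring

end Chart

lemma exists_chart_point (x : S) : ∃ φ ∈ IsManifold.maximalAtlas (𝓡 3) ∞ S, ∃ y ∈ φ.target,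
    φ.symm y = x :=
  ⟨chartAt E3 x, IsManifold.chart_mem_maximalAtlas x, chartAt E3 x x,
    mem_chart_target E3 x, (chartAt E3 x).left_inv (mem_chart_source E3 x)⟩

/-- The squared norm of `Φ(ν)` in a spin frame. -/
def killNormSq (K : TwoTensor S) (ν : SpinorField 𝔰 2) (a : ι) (x : S) : ℝ :=
  ∑ i, ∑ j, ‖killFrame K ν a x i j‖ ^ 2

/-- The frame components of the flux `Re (Φ(ν)_{ij} \bar ν_j)`. -/
def fluxComp (K : TwoTensor S) (ν : SpinorField 𝔰 2) (a : ι) (i : Fin 3) (x : S) : ℝ :=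
  (∑ j, killFrame K ν a x i j * (starRingEnd ℂ) (spinVec ν a x j)).re

/-- The flux vector `Re (Φ(ν)_{ij} \bar ν_j)`. -/
def flux (K : TwoTensor S) (ν : SpinorField 𝔰 2) (a : ι) (x : S) : TangentSpace (𝓡 3) x :=
  ∑ i, fluxComp K ν a i x • 𝔰.frame a i x

/-- The squared norm `|ν|²` in a spin frame. -/
def vecNormSq (ν : SpinorField 𝔰 2) (a : ι) (x : S) : ℝ := ∑ i, ‖spinVec ν a x i‖ ^ 2

lemma frameChange_data {a b : ι} {x : S} (ha : x ∈ 𝔰.dom a) (hb : x ∈ 𝔰.dom b)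
    (K : TwoTensor S) (ν : SpinorField 𝔰 2) : ∃ O : Fin 3 → Fin 3 → ℝ,
    (∀ k l, ∑ i, O i k * O i l = if k = l then 1 else 0) ∧
    (∀ i, 𝔰.frame a i x = ∑ k, O i k • 𝔰.frame b k x) ∧
    (∀ i, spinVec ν a x i = ∑ k, (O i k : ℂ) * spinVec ν b x k) ∧
    (∀ i j, killFrame K ν a x i j = ∑ k, ∑ l, (O i k : ℂ) * O j l * killFrame K ν b x k l) := by
  obtain ⟨φ, hφ, y, hy, rfl⟩ := exists_chart_point x
  refine ⟨frameChange 𝔰 a b (φ.symm y), fun k l => ?_, fun i => ?_, spinVec_trans ν ha hb,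
    killFrame_change hφ hy ha hb K ν⟩
  · have h := mul_eq_one_comm.1 (frameChange_mul_transpose hφ hy ha hb)
    have := congrFun (congrFun h k) l
    rw [Matrix.mul_apply, Matrix.one_apply] at this
    exact this
  · have h := frameField_change (a := a) hφ hy hb
    rw [frame_eq_sum hφ hy (𝔰.frame a i)]
    have e : ∀ k, 𝔰.frame b k (φ.symm y) = _ := fun k => frame_eq_sum hφ hy (𝔰.frame b k)
    simp only [e, Finset.smul_sum, smul_smul]
    rw [Finset.sum_comm]
    refine Finset.sum_congr rfl fun m _ => ?_
    rw [← Finset.sum_smul]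
    congr 1
    have := congrFun (congrFun h i) m
    rw [Matrix.mul_apply] at this
    exact this

lemma sum_norm_sq_orthogonal {O : Fin 3 → Fin 3 → ℝ}
    (hO : ∀ k l, ∑ i, O i k * O i l = if k = l then 1 else 0) (z : Fin 3 → ℂ) :
    ∑ i, ‖∑ k, (O i k : ℂ) * z k‖ ^ 2 = ∑ k, ‖z k‖ ^ 2 := by
  have h : ∀ w : ℂ, ‖w‖ ^ 2 = w.re * w.re + w.im * w.im := fun w => by
    rw [← Complex.normSq_eq_norm_sq, Complex.normSq_apply]
  calc _ = ∑ k, ∑ l, (∑ i, O i k * O i l) * ((z k).re * (z l).re + (z k).im * (z l).im) := by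
        simp only [h, Complex.re_sum, Complex.im_sum, Complex.re_ofReal_mul, Complex.im_ofReal_mul]
        simp only [Fin.sum_univ_three]
        ring
    _ = _ := by simp [hO, h]

lemma vecNormSq_change (ν : SpinorField 𝔰 2) {a b : ι} {x : S} (ha : x ∈ 𝔰.dom a)
    (hb : x ∈ 𝔰.dom b) : vecNormSq ν a x = vecNormSq ν b x := by
  -- The tensor K plays no role for the norm of ν; zero is inserted.
  obtain ⟨O, hO, -, hz, -⟩ := frameChange_data ha hb (fun _ => 0) ν
  simp only [vecNormSq, hz, sum_norm_sq_orthogonal hO]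

lemma killNormSq_change (K : TwoTensor S) (ν : SpinorField 𝔰 2) {a b : ι} {x : S}
    (ha : x ∈ 𝔰.dom a) (hb : x ∈ 𝔰.dom b) : killNormSq K ν a x = killNormSq K ν b x := by
  obtain ⟨O, hO, -, -, hQ⟩ := frameChange_data ha hb K ν
  have e : ∀ i j, killFrame K ν a x i j
      = ∑ l, (O j l : ℂ) * ∑ k, (O i k : ℂ) * killFrame K ν b x k l := fun i j => by
    rw [hQ, Finset.sum_comm]
    simp only [Finset.mul_sum]
    exact Finset.sum_congr rfl fun k _ => Finset.sum_congr rfl fun l _ => by ring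
  simp only [killNormSq, e, sum_norm_sq_orthogonal hO]
  rw [Finset.sum_comm]
  simp only [sum_norm_sq_orthogonal hO]
  rw [Finset.sum_comm]

lemma sum_smul_orthogonal {V : Type*} [AddCommGroup V] [Module ℝ V] {O : Fin 3 → Fin 3 → ℝ}
    (hO : ∀ k l, ∑ i, O i k * O i l = if k = l then 1 else 0) (f : Fin 3 → ℝ) (v : Fin 3 → V) :
    ∑ i, (∑ k, O i k * f k) • (∑ l, O i l • v l) = ∑ k, f k • v k := by
  calc _ = ∑ l, (∑ k, f k * ∑ i, O i k * O i l) • v l := by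
        simp only [Finset.smul_sum, smul_smul]
        rw [Finset.sum_comm]
        refine Finset.sum_congr rfl fun l _ => ?_
        rw [← Finset.sum_smul]
        congr 1
        simp only [Fin.sum_univ_three]
        ring
    _ = _ := by simp [hO]

lemma sum_conj_orthogonal {O : Fin 3 → Fin 3 → ℝ}
    (hO : ∀ k l, ∑ i, O i k * O i l = if k = l then 1 else 0) (q : Fin 3 → Fin 3 → ℂ)
    (z : Fin 3 → ℂ) (i : Fin 3) :
    ∑ j, (∑ k, ∑ l, (O i k : ℂ) * O j l * q k l) *
      (starRingEnd ℂ) (∑ m, (O j m : ℂ) * z m)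
      = ∑ k, (O i k : ℂ) * ∑ j, q k j * (starRingEnd ℂ) (z j) := by
  have hOc : ∀ k l, ∑ i, (O i k : ℂ) * O i l = if k = l then 1 else 0 := fun k l => by
    have := congrArg (fun t : ℝ => (t : ℂ)) (hO k l)
    simp only [Complex.ofReal_sum, Complex.ofReal_mul] at this
    rw [this]
    split_ifs <;> simp
  calc _ = ∑ k, ∑ l, ∑ m, (O i k : ℂ) * q k l * (starRingEnd ℂ) (z m) *
        ∑ j, (O j l : ℂ) * O j m := by
        simp only [map_sum, map_mul, Complex.conj_ofReal]
        simp only [Fin.sum_univ_three]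
        ring
    _ = _ := by
        simp only [hOc, mul_ite, mul_one, mul_zero, Finset.sum_ite_eq, Finset.mem_univ, if_true,
          Finset.mul_sum, mul_assoc]

lemma flux_change (K : TwoTensor S) (ν : SpinorField 𝔰 2) {a b : ι} {x : S}
    (ha : x ∈ 𝔰.dom a) (hb : x ∈ 𝔰.dom b) : flux K ν a x = flux K ν b x := by
  obtain ⟨O, hO, he, hz, hQ⟩ := frameChange_data ha hb K ν
  have e1 : ∀ i, fluxComp K ν a i x = ∑ k, O i k * fluxComp K ν b k x := by
    intro i
    have := sum_conj_orthogonal hO (killFrame K ν b x) (spinVec ν b x) i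
    simp only [← hQ, ← hz] at this
    simp only [fluxComp, this, Complex.re_sum, Complex.re_ofReal_mul]
  simp only [flux, e1, he]
  exact sum_smul_orthogonal hO _ _

lemma normSq_comp (ν : SpinorField 𝔰 2) {a : ι} {x : S} (ha : x ∈ 𝔰.dom a) :
    normSq (ν.comp a x) = vecNormSq ν a x := by
  rw [comp_eq_vecSpinor ν ha, normSq_vecSpinor, vecNormSq]

omit hR in
lemma tensorSpinor_injective {M : Fin 3 → Fin 3 → ℂ} (h : tensorSpinor M = 0) : M = 0 := by
  have e1 : ∀ c d : Fin 2, (fun i => ∑ j, M i j * sigma j c d) = 0 := by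
    intro c d
    rw [← spinorVec_vecSpinor (fun i => ∑ j, M i j * sigma j c d)]
    have : vecSpinor (fun i => ∑ j, M i j * sigma j c d) = 0 := by
      funext b
      refine Eq.trans ?_ (congrFun h ![b 0, b 1, c, d])
      simp only [vecSpinor, tensorSpinor, Finset.sum_mul, Matrix.cons_val]
      refine Finset.sum_congr rfl fun i _ => Finset.sum_congr rfl fun j _ => by ring
    rw [this]
    funext i
    simp [spinorVec]
  funext i
  have : vecSpinor (M i) = 0 := by
    funext b
    exact congrFun (e1 (b 0) (b 1)) i
  rw [← spinorVec_vecSpinor (M i), this]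
  funext j
  simp [spinorVec]

omit hR in
lemma spinVec_mdifferentiableAt (ν : SpinorField 𝔰 2) {a : ι} {x : S} (ha : x ∈ 𝔰.dom a)
    (i : Fin 3) : MDifferentiableAt (𝓡 3) 𝓘(ℝ, ℂ) (fun y => spinVec ν a y i) x :=
  ((spinVec_contMDiffOn ν a i).contMDiffAt ((𝔰.isOpen_dom a).mem_nhds ha)).mdifferentiableAt
    (by simp)

omit hR in
lemma killingOp_frame (K : TwoTensor S) (ν : SpinorField 𝔰 2) {a : ι} {x : S}
    (ha : x ∈ 𝔰.dom a) :
    killingOp (𝔰.frame a) K (ν.comp a) x = tensorSpinor (killFrame K ν a x) := by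
  refine killingOp_vecSpinor _ K ?_ (spinVec_mdifferentiableAt ν ha)
  filter_upwards [(𝔰.isOpen_dom a).mem_nhds ha] with y hy
  exact comp_eq_vecSpinor ν hy

omit hR in
lemma isSpatialKilling_of_killFrame {K : TwoTensor S} {ν : SpinorField 𝔰 2}
    (h : ∀ a, ∀ x ∈ 𝔰.dom a, killFrame K ν a x = 0) : ν.IsSpatialKilling K := by
  intro a x hx
  rw [killingOp_frame K ν hx, h a x hx]
  funext c
  simp [tensorSpinor]

omit hR in
lemma killFrame_eq_zero {K : TwoTensor S} {ν : SpinorField 𝔰 2} (h : ν.IsSpatialKilling K) {a : ι}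
    {x : S} (ha : x ∈ 𝔰.dom a) : killFrame K ν a x = 0 := by
  refine tensorSpinor_injective ?_
  rw [← killingOp_frame K ν ha, h a x ha]

section Chart

variable {φ : OpenPartialHomeomorph S E3} (hφ : φ ∈ IsManifold.maximalAtlas (𝓡 3) ∞ S) {y : E3}
  (hy : y ∈ φ.target) {a : ι} (ha : φ.symm y ∈ 𝔰.dom a)
  (K : TwoTensor S) (ν : SpinorField 𝔰 2)

include hφ hy ha

/-- Where the spatial Killing operator vanishes the Killing form is pure trace. -/
lemma chartKillForm_eq_of_killFrame_eq_zero (h : killFrame K ν a (φ.symm y) = 0) :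
    ∃ t : ℂ, ∀ k l, chartKillForm K ν φ y k l = t * (-metricCoeff φ k l y : ℝ) := by
  set F := frameJet 𝔰 a hφ hy ha with hF
  set t : ℂ := (∑ c, ∑ k, ∑ l, (F.e c k : ℂ) * F.e c l * chartKillForm K ν φ y k l) / 3 with ht
  refine ⟨t, ?_⟩
  set e : Matrix (Fin 3) (Fin 3) ℂ := (Matrix.of F.e).map Complex.ofRealHom with he
  set g : Matrix (Fin 3) (Fin 3) ℂ := (Matrix.of F.G).map Complex.ofRealHom with hg
  have h1 : e * g * e.transpose = 1 := by
    have := congrArg (fun M => M.map Complex.ofRealHom) F.mul_transpose_mul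
    simpa [Matrix.map_mul, Matrix.transpose_map] using this
  have h2 : e * Matrix.of (chartKillForm K ν φ y) * e.transpose = t • 1 := by
    ext i j
    have h3 := killFrame_chart hφ hy ha K ν i j
    rw [h] at h3
    have h4 : (e * Matrix.of (chartKillForm K ν φ y) * e.transpose) i j
        = ∑ k, ∑ l, (F.e i k : ℂ) * F.e j l * chartKillForm K ν φ y k l := by
      simp only [Matrix.mul_apply, Finset.sum_mul, Matrix.transpose_apply]
      rw [Finset.sum_comm]
      refine Finset.sum_congr rfl fun k _ => Finset.sum_congr rfl fun l _ => ?_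
      simp only [he, Matrix.map_apply, Matrix.of_apply, Complex.ofRealHom_eq_coe]
      ring
    have h5 : (0 : ℂ) = (∑ k, ∑ l, (F.e i k : ℂ) * F.e j l * chartKillForm K ν φ y k l) / 2
        - if i = j then (∑ c, ∑ k, ∑ l, (F.e c k : ℂ) * F.e c l * chartKillForm K ν φ y k l) / 6
          else 0 := h3
    rw [h4, Matrix.smul_apply, Matrix.one_apply, ht]
    split_ifs at h5 ⊢
    · simp only [smul_eq_mul, mul_one]
      linear_combination (-2) * h5
    · simp only [smul_eq_mul, mul_zero]
      linear_combination (-2) * h5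
  -- In the frame both sides are t times the identity, by `h1` and `h2`; invertibility of the frame
  -- matrix transfers the equality to coordinates.
  have hu : IsUnit e := by
    rw [Matrix.mul_assoc] at h1
    exact IsUnit.of_mul_eq_one _ h1
  have hu' : IsUnit e.transpose := IsUnit.of_mul_eq_one_right _ h1
  have h6 : e * Matrix.of (chartKillForm K ν φ y) * e.transpose = e * (t • g) * e.transpose := by
    rw [h2, ← h1]
    simp
  have h7 := hu.mul_left_cancel (hu'.mul_right_cancel h6)
  intro k l
  have := congrFun (congrFun h7 k) l
  simp only [hg, Matrix.smul_apply, Matrix.map_apply, Matrix.of_apply, smul_eq_mul] at this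
  exact this

end Chart

end

/-! ### The Riemannian volume in charts -/

section

variable {S : Type*} [TopologicalSpace S] [ChartedSpace E3 S] [IsManifold (𝓡 3) ∞ S]
  [RiemannianBundle (fun x : S => TangentSpace (𝓡 3) x)]
  [hR : IsContMDiffRiemannianBundle (𝓡 3) ∞ E3 (fun x : S => TangentSpace (𝓡 3) x)]
  [MeasurableSpace S] [BorelSpace S]

/-- The Riemannian volume density `√|det h_{ij}|` in a chart. -/
def volDensity (φ : OpenPartialHomeomorph S E3) (y : E3) : ℝ :=
  Real.sqrt |(Matrix.of fun i j => metricCoeff φ i j y).det|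

section

variable {φ ψ : OpenPartialHomeomorph S E3}

omit [IsManifold (𝓡 3) ∞ S] [RiemannianBundle (fun x : S => TangentSpace (𝓡 3) x)] hR in
lemma aemeasurable_chart_symm (φ : OpenPartialHomeomorph S E3) :
    AEMeasurable φ.symm (volume.restrict φ.target) :=
  φ.continuousOn_symm.aemeasurable φ.open_target.measurableSet

omit [ChartedSpace E3 S] [IsManifold (𝓡 3) ∞ S]
  [RiemannianBundle (fun x : S => TangentSpace (𝓡 3) x)] hR in
lemma measurableSet_chart_preimage [ChartedSpace E3 S] (φ : OpenPartialHomeomorph S E3) {s : Set S}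
    (hs : MeasurableSet s) : MeasurableSet (φ.target ∩ φ.symm ⁻¹' s) := by
  have h : Measurable (φ.target.restrict φ.symm) :=
    (continuousOn_iff_continuous_restrict.1 φ.continuousOn_symm).measurable
  have h2 := (MeasurableEmbedding.subtype_coe φ.open_target.measurableSet).measurableSet_image.2
    (h hs)
  convert h2 using 1
  ext y
  simp [Set.restrict, and_comm]

omit [IsManifold (𝓡 3) ∞ S] hR in
lemma chartVolume_apply (φ : OpenPartialHomeomorph S E3) {s : Set S} (hs : MeasurableSet s) :
    chartVolume φ s = ∫⁻ y in φ.target ∩ φ.symm ⁻¹' s, ENNReal.ofReal (volDensity φ y) := by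
  have h1 : AEMeasurable φ.symm ((volume.restrict φ.target).withDensity fun y =>
      ENNReal.ofReal (volDensity φ y)) :=
    (aemeasurable_chart_symm φ).mono_ac (withDensity_absolutelyContinuous _ _)
  have h2 : chartVolume φ s = ((volume.restrict φ.target).withDensity fun y =>
      ENNReal.ofReal (volDensity φ y)) (φ.symm ⁻¹' s) := by
    rw [chartVolume]
    exact Measure.map_apply_of_aemeasurable h1 hs
  have h3 : ((volume.restrict φ.target).withDensity fun y =>
      ENNReal.ofReal (volDensity φ y)) (φ.symm ⁻¹' s)
      = ((volume.restrict φ.target).withDensity fun y =>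
      ENNReal.ofReal (volDensity φ y)) (φ.target ∩ φ.symm ⁻¹' s) := by
    refine measure_congr ?_
    have : ∀ᵐ y ∂((volume.restrict φ.target).withDensity fun y =>
      ENNReal.ofReal (volDensity φ y)), y ∈ φ.target :=
      (withDensity_absolutelyContinuous _ _).ae_le (ae_restrict_mem φ.open_target.measurableSet)
    filter_upwards [this] with y hy
    exact propext ⟨fun h => ⟨hy, h⟩, fun h => h.2⟩
  rw [h2, h3, withDensity_apply _ (measurableSet_chart_preimage φ hs),
    Measure.restrict_restrict (measurableSet_chart_preimage φ hs)]
  congr 2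
  ext y
  simp +contextual

omit [IsManifold (𝓡 3) ∞ S] hR [MeasurableSpace S] [BorelSpace S] in
lemma ip_congr_point {x x' : S} (h : x = x') (v w : E3) :
    ip (x := x) (v : TangentSpace (𝓡 3) x) w = ip (x := x') (v : TangentSpace (𝓡 3) x') w := by
  subst h
  rfl

omit hR [MeasurableSpace S] [BorelSpace S] in
-- Under a change of coordinates the metric matrix becomes Mᵀ G M with M the Jacobian matrix, so its
-- determinant picks up the square of the Jacobian and the density its absolute value.
lemma volDensity_transition (hφ : φ ∈ IsManifold.maximalAtlas (𝓡 3) ∞ S)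
    (hψ : ψ ∈ IsManifold.maximalAtlas (𝓡 3) ∞ S) {y : E3} (hy : y ∈ φ.target)
    (hy' : φ.symm y ∈ ψ.source) :
    DifferentiableAt ℝ (ψ ∘ φ.symm) y ∧
    volDensity φ y = |(fderiv ℝ (ψ ∘ φ.symm) y).det| * volDensity ψ (ψ (φ.symm y)) := by
  have h1 := (chart_mdifferentiable hφ).symm.mdifferentiableAt hy
  have h2 := (chart_mdifferentiable hψ).mdifferentiableAt hy'
  have h12 := h2.comp y h1
  have hd : DifferentiableAt ℝ (ψ ∘ φ.symm) y := h12.differentiableAt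
  refine ⟨hd, ?_⟩
  set A := fderiv ℝ (ψ ∘ φ.symm) y with hA
  have hz : ψ (φ.symm y) ∈ ψ.target := ψ.map_source hy'
  have h3 := (chart_mdifferentiable hψ).symm.mdifferentiableAt hz
  have hcv : ∀ i, mfderiv (𝓡 3) (𝓡 3) φ.symm y (EuclideanSpace.single i (1 : ℝ) : E3)
      = mfderiv (𝓡 3) (𝓡 3) ψ.symm (ψ (φ.symm y)) (A (EuclideanSpace.single i (1 : ℝ) : E3)) := by
    intro i
    have e : φ.symm =ᶠ[nhds y] ψ.symm ∘ (ψ ∘ φ.symm) := by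
      have : ∀ᶠ w in nhds y, φ.symm w ∈ ψ.source :=
        (φ.continuousAt_symm hy).eventually (ψ.open_source.mem_nhds hy')
      filter_upwards [this] with w hw
      exact (ψ.left_inv hw).symm
    have hc := (HasMFDerivAt.comp y (h3 : MDifferentiableAt _ _ ψ.symm ((ψ ∘ φ.symm) y)).hasMFDerivAt
      h12.hasMFDerivAt).congr_of_eventuallyEq e
    rw [hc.mfderiv]
    have : mfderiv (𝓡 3) (𝓡 3) (ψ ∘ φ.symm) y = A := mfderiv_eq_fderiv
    rw [this]
    rfl
  have hip : ∀ i j, metricCoeff φ i j y = ∑ k, ∑ l, A (EuclideanSpace.single i 1) k *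
      A (EuclideanSpace.single j 1) l * metricCoeff ψ k l (ψ (φ.symm y)) := by
    intro i j
    have h0 : ψ.symm (ψ (φ.symm y)) = φ.symm y := ψ.left_inv hy'
    have e1 : metricCoeff φ i j y = -ip (x := ψ.symm (ψ (φ.symm y)))
        (mfderiv (𝓡 3) (𝓡 3) ψ.symm (ψ (φ.symm y)) (A (EuclideanSpace.single i (1 : ℝ) : E3)))
        (mfderiv (𝓡 3) (𝓡 3) ψ.symm (ψ (φ.symm y)) (A (EuclideanSpace.single j (1 : ℝ) : E3))) := by
      refine congrArg Neg.neg ((ip_congr_point h0.symm _ _).trans ?_)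
      exact congrArg₂ (fun v w : E3 => ip (x := ψ.symm (ψ (φ.symm y)))
        (v : TangentSpace (𝓡 3) (ψ.symm (ψ (φ.symm y)))) w) (hcv i) (hcv j)
    rw [e1, mfderiv_eq_sum, mfderiv_eq_sum]
    simp only [ip, metricCoeff, sum_inner, inner_sum, real_inner_smul_left, real_inner_smul_right]
    rw [Finset.sum_comm, ← Finset.sum_neg_distrib]
    refine Finset.sum_congr rfl fun k _ => ?_
    rw [← Finset.sum_neg_distrib]
    refine Finset.sum_congr rfl fun l _ => by ring
  set M : Matrix (Fin 3) (Fin 3) ℝ := Matrix.of fun k i => A (EuclideanSpace.single i 1) k with hM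
  have hMA : M.det = A.det := by
    have : M = LinearMap.toMatrix (EuclideanSpace.basisFun (Fin 3) ℝ).toBasis
        (EuclideanSpace.basisFun (Fin 3) ℝ).toBasis (A : E3 →ₗ[ℝ] E3) := by
      ext k i
      simp [hM, LinearMap.toMatrix_apply]
    rw [this, LinearMap.det_toMatrix]
  have hmat : (Matrix.of fun i j => metricCoeff φ i j y)
      = M.transpose * (Matrix.of fun k l => metricCoeff ψ k l (ψ (φ.symm y))) * M := by
    ext i j
    simp only [Matrix.of_apply, hip, Matrix.mul_apply, Matrix.transpose_apply, Finset.sum_mul, hM]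
    rw [Finset.sum_comm]
    refine Finset.sum_congr rfl fun k _ => Finset.sum_congr rfl fun l _ => by ring
  rw [volDensity, hmat, Matrix.det_mul, Matrix.det_mul, Matrix.det_transpose, hMA, volDensity,
    show A.det * (Matrix.of fun k l => metricCoeff ψ k l (ψ (φ.symm y))).det * A.det
      = A.det ^ 2 * (Matrix.of fun k l => metricCoeff ψ k l (ψ (φ.symm y))).det by ring,
    abs_mul, abs_pow, Real.sqrt_mul (by positivity), Real.sqrt_sq (abs_nonneg _)]

omit hR in
lemma chartVolume_eq_of_subset (hφ : φ ∈ IsManifold.maximalAtlas (𝓡 3) ∞ S)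
    (hψ : ψ ∈ IsManifold.maximalAtlas (𝓡 3) ∞ S) {s : Set S} (hs : MeasurableSet s)
    (h1 : s ⊆ φ.source) (h2 : s ⊆ ψ.source) : chartVolume φ s = chartVolume ψ s := by
  rw [chartVolume_apply φ hs, chartVolume_apply ψ hs]
  set U := φ.target ∩ φ.symm ⁻¹' s with hU
  have himg : ψ.target ∩ ψ.symm ⁻¹' s = (ψ ∘ φ.symm) '' U := by
    ext z
    constructor
    · rintro ⟨hz, hz'⟩
      refine ⟨φ (ψ.symm z), ⟨φ.map_source (h1 hz'), ?_⟩, ?_⟩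
      · simpa [φ.left_inv (h1 hz')] using hz'
      · simp [φ.left_inv (h1 hz'), ψ.right_inv hz]
    · rintro ⟨y, ⟨hy, hy'⟩, rfl⟩
      refine ⟨ψ.map_source (h2 hy'), ?_⟩
      simpa [ψ.left_inv (h2 hy')] using hy'
  have hinj : Set.InjOn (ψ ∘ φ.symm) U := by
    intro y hy z hz hyz
    exact φ.symm.injOn hy.1 hz.1 (ψ.injOn (h2 hy.2) (h2 hz.2) hyz)
  have hUm : MeasurableSet U := measurableSet_chart_preimage φ hs
  rw [himg, lintegral_image_eq_lintegral_abs_det_fderiv_mul volume hUm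
    (fun y hy => (volDensity_transition hφ hψ hy.1 (h2 hy.2)).1.hasFDerivAt.hasFDerivWithinAt) hinj]
  refine setLIntegral_congr_fun hUm fun y hy => ?_
  simp only [Function.comp_apply]
  rw [(volDensity_transition hφ hψ hy.1 (h2 hy.2)).2, ENNReal.ofReal_mul (abs_nonneg _)]

omit hR [IsManifold (𝓡 3) ∞ S] in
lemma chartVolume_compl_source (φ : OpenPartialHomeomorph S E3) :
    chartVolume φ φ.sourceᶜ = 0 := by
  rw [chartVolume_apply φ φ.open_source.measurableSet.compl]
  have : φ.target ∩ φ.symm ⁻¹' φ.sourceᶜ = ∅ := by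
    ext y
    simp only [Set.mem_inter_iff, Set.mem_preimage, Set.mem_compl_iff, Set.mem_empty_iff_false,
      iff_false, not_and, not_not]
    exact fun hy => φ.map_target hy
  rw [this, setLIntegral_empty]

end

omit [ChartedSpace E3 S] [IsManifold (𝓡 3) ∞ S]
  [RiemannianBundle (fun x : S => TangentSpace (𝓡 3) x)] hR [TopologicalSpace S] [BorelSpace S] in
/-- The supremum of measures that are carried by measurable sets and agree on overlaps. -/
lemma iSup_measure_apply {κ : Type*} {m : κ → Measure S} {U : κ → Set S}
    (hU : ∀ i, MeasurableSet (U i)) (h0 : ∀ i, m i (U i)ᶜ = 0)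
    (hm : ∀ i j, ∀ s, MeasurableSet s → s ⊆ U i → s ⊆ U j → m i s = m j s) (i : κ) {s : Set S}
    (hs : MeasurableSet s) (hsU : s ⊆ U i) : (⨆ j, m j) s = m i s := by
  refine le_antisymm ?_ (Measure.le_iff'.1 (le_iSup m i) s)
  -- A common majorant of all the measures: on U_i it is m_i, and any nonempty set outside U_i has
  -- infinite mass. Only subsets of U_i then have to be compared, and on those the measures agree.
  set M : Measure S := m i + ((⊤ : ℝ≥0∞) • Measure.count).restrict (U i)ᶜ with hM
  have hle : ⨆ j, m j ≤ M := by
    refine iSup_le fun j => Measure.le_iff.2 fun t ht => ?_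
    by_cases hti : t ⊆ U i
    · calc m j t ≤ m j (t ∩ U j) + m j (t ∩ (U j)ᶜ) := by
            rw [← Set.diff_eq, measure_inter_add_sdiff _ (hU j)]
        _ ≤ m j (t ∩ U j) + m j (U j)ᶜ := by gcongr; exact Set.inter_subset_right
        _ = m i (t ∩ U j) := by
            rw [h0, add_zero, hm j i _ (ht.inter (hU j)) Set.inter_subset_right
              (Set.inter_subset_left.trans hti)]
        _ ≤ m i t := measure_mono Set.inter_subset_left
        _ ≤ M t := by rw [hM, Measure.add_apply]; exact le_self_add
    · obtain ⟨x, hx, hx'⟩ := Set.not_subset.1 hti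
      have : M t = ⊤ := by
        rw [hM, Measure.add_apply, Measure.restrict_apply ht, Measure.smul_apply, smul_eq_mul,
          ENNReal.top_mul, add_top]
        exact (Measure.count_ne_zero ⟨x, hx, hx'⟩)
      rw [this]
      exact le_top
  calc (⨆ j, m j) s ≤ M s := Measure.le_iff'.1 hle s
    _ = m i s := by
      rw [hM, Measure.add_apply, Measure.restrict_apply hs]
      have : s ∩ (U i)ᶜ = ∅ := by
        rw [← Set.diff_eq]; exact Set.sdiff_eq_empty.2 hsU
      simp [this]

omit hR in
lemma riemannianVolume_apply_chartAt (x : S) {s : Set S} (hs : MeasurableSet s)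
    (h : s ⊆ (chartAt E3 x).source) : riemannianVolume S s = chartVolume (chartAt E3 x) s :=
  iSup_measure_apply (U := fun x : S => (chartAt E3 x).source)
    (fun x => (chartAt E3 x).open_source.measurableSet) (fun _ => chartVolume_compl_source _)
    (fun x y _ hs h1 h2 => chartVolume_eq_of_subset (IsManifold.chart_mem_maximalAtlas x)
      (IsManifold.chart_mem_maximalAtlas y) hs h1 h2) x hs h

omit hR in
-- Extends the description of the volume from preferred charts to every chart of the maximal atlas.
-- A countable subcover by preferred charts, made disjoint, splits the measure into pieces on which
-- the change of variables formula applies.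
lemma riemannianVolume_restrict [SecondCountableTopology S] {φ : OpenPartialHomeomorph S E3}
    (hφ : φ ∈ IsManifold.maximalAtlas (𝓡 3) ∞ S) :
    (riemannianVolume S).restrict φ.source = chartVolume φ := by
  obtain ⟨t, htc, ht⟩ := TopologicalSpace.countable_cover_nhds
    (f := fun x : S => (chartAt E3 x).source) (fun x => chart_source_mem_nhds E3 x)
  have := htc.to_subtype
  rcases t.eq_empty_or_nonempty with rfl | hne
  · have : IsEmpty S := by
      refine ⟨fun x => ?_⟩
      have hx : x ∈ (⋃ x ∈ (∅ : Set S), (chartAt E3 x).source) := ht ▸ Set.mem_univ x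
      simp at hx
    exact Subsingleton.elim _ _
  obtain ⟨f, hf⟩ := htc.exists_eq_range hne
  refine Measure.ext fun s hs => ?_
  rw [Measure.restrict_apply hs]
  have e1 : chartVolume φ s = chartVolume φ (s ∩ φ.source) := by
    refine le_antisymm ?_ (measure_mono Set.inter_subset_left)
    rw [← measure_inter_add_sdiff s φ.open_source.measurableSet]
    calc _ ≤ chartVolume φ (s ∩ φ.source) + chartVolume φ φ.sourceᶜ := by
          gcongr; exact fun y hy => hy.2
      _ = _ := by rw [chartVolume_compl_source, add_zero]
  rw [e1]
  have hs' : MeasurableSet (s ∩ φ.source) := hs.inter φ.open_source.measurableSet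
  set d : ℕ → Set S := disjointed fun n => (chartAt E3 (f n)).source with hd
  have hdm : ∀ n, MeasurableSet (d n) := fun n =>
    MeasurableSet.disjointed (fun n => (chartAt E3 (f n)).open_source.measurableSet) n
  have hcov : (⋃ n, d n) = Set.univ := by
    rw [hd, iUnion_disjointed, ← ht, hf, Set.biUnion_range]
  have hsum : ∀ m : Measure S, m (s ∩ φ.source) = ∑' n, m (s ∩ φ.source ∩ d n) := by
    intro m
    rw [← measure_iUnion ((disjoint_disjointed _).mono fun i j h =>
      (Disjoint.mono Set.inter_subset_right Set.inter_subset_right h))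
      (fun n => hs'.inter (hdm n)), ← Set.inter_iUnion, hcov, Set.inter_univ]
  rw [hsum, hsum (chartVolume φ)]
  refine tsum_congr fun n => ?_
  have hsub : s ∩ φ.source ∩ d n ⊆ (chartAt E3 (f n)).source :=
    Set.inter_subset_right.trans (disjointed_subset _ _)
  rw [riemannianVolume_apply_chartAt (f n) (hs'.inter (hdm n)) hsub]
  exact chartVolume_eq_of_subset (IsManifold.chart_mem_maximalAtlas _) hφ (hs'.inter (hdm n)) hsub
    (Set.inter_subset_left.trans Set.inter_subset_right)

end

/-- The entries are cyclic 2×2 minors with indices modulo three, signs included. One formula for all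
entries lets smoothness and size be treated uniformly. -/
lemma adjugate_cyclic (G : Fin 3 → Fin 3 → ℝ) (m n : Fin 3) : (Matrix.of G).adjugate m n
    = G (n + 1) (m + 1) * G (n + 2) (m + 2) - G (n + 1) (m + 2) * G (n + 2) (m + 1) := by
  rw [Matrix.adjugate_fin_three]
  fin_cases m <;> fin_cases n <;> simp <;> ring

lemma contDiffAt_ofReal {E : Type*} [NormedAddCommGroup E] [NormedSpace ℝ E] {n : ℕ∞ω}
    {f : E → ℝ} {y : E} (hf : ContDiffAt ℝ n f y) : ContDiffAt ℝ n (fun w => (f w : ℂ)) y :=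
  Complex.ofRealCLM.contDiff.contDiffAt.comp y hf

lemma crossTerm_contDiffAt {G : Fin 3 → Fin 3 → E3 → ℝ} {d : E3 → ℝ} {k : Fin 3 → Fin 3 → E3 → ℝ}
    {Z : Fin 3 → E3 → ℂ} {y : E3} (hG : ∀ i j, ContDiffAt ℝ ∞ (G i j) y)
    (hd : ContDiffAt ℝ ∞ d y) (hk : ∀ i j, ContDiffAt ℝ ∞ (k i j) y)
    (hZ : ∀ i, ContDiffAt ℝ ∞ (Z i) y) (i j : Fin 3) :
    ContDiffAt ℝ ∞ (fun w => crossTerm (fun i j => G i j w) (d w) (fun i j => k i j w)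
      (fun i => Z i w) i j) y := by
  simp only [crossTerm, adjugate_cyclic]
  refine ContDiffAt.sum fun m _ => ContDiffAt.sum fun p _ => ContDiffAt.sum fun n _ => ?_
  refine (contDiffAt_const.mul (hZ p)).mul (contDiffAt_ofReal ?_)
  exact (hd.mul (((hG _ _).mul (hG _ _)).sub ((hG _ _).mul (hG _ _)))).mul (hk _ _)

/-! ### Smoothness and divergence of the flux -/

section

variable {S : Type*} [TopologicalSpace S] [ChartedSpace E3 S] [IsManifold (𝓡 3) ∞ S]
  [RiemannianBundle (fun x : S => TangentSpace (𝓡 3) x)]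
  [hR : IsContMDiffRiemannianBundle (𝓡 3) ∞ E3 (fun x : S => TangentSpace (𝓡 3) x)]
  {ι : Type*} {𝔰 : SpinStructure S ι}
  {φ : OpenPartialHomeomorph S E3} (hφ : φ ∈ IsManifold.maximalAtlas (𝓡 3) ∞ S) {y : E3}
  (hy : y ∈ φ.target) {a : ι} (ha : φ.symm y ∈ 𝔰.dom a)
  {K : TwoTensor S} (hK : IsAsymptoticallyEuclidean K) (ν : SpinorField 𝔰 2)

include hφ hy hK

lemma chartKillForm_contDiffAt (i j : Fin 3) :
    ContDiffAt ℝ ∞ (fun w => chartKillForm K ν φ w i j) y := by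
  have hg := metricCoeff_contDiffAt (S := S) hφ hy
  have hG : ∀ i j, ContDiffAt ℝ ∞ (fun w => -metricCoeff φ i j w) y := fun i j => (hg i j).neg
  have hZ := chartZ_contDiffAt hφ hy ν
  have hk := tensorCoeff_contDiffAt hφ hK hy
  have hd := chartDet_contDiffAt (𝔰 := 𝔰) hφ hy
  have hfd : ∀ {F : Type} [NormedAddCommGroup F] [NormedSpace ℝ F] {f : E3 → F} (v : E3),
      ContDiffAt ℝ ∞ f y → ContDiffAt ℝ ∞ (fun w => fderiv ℝ f w v) y := by
    intro F _ _ f v hf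
    exact (hf.fderiv_right (m := ∞) (by simp)).clm_apply contDiffAt_const
  simp only [chartKillForm, killForm]
  have hc := fun i j => crossTerm_contDiffAt hG hd hk hZ i j
  refine ContDiffAt.sub (ContDiffAt.sum fun m _ => ?_) (contDiffAt_const.mul ((hc i j).add (hc j i)))
  exact (((contDiffAt_ofReal (hfd _ (hg i j)).neg).mul (hZ m)).add
    ((contDiffAt_ofReal (hG m j)).mul (hfd _ (hZ m)))).add
    ((contDiffAt_ofReal (hG i m)).mul (hfd _ (hZ m)))

include ha

lemma killFrame_contDiffAt (i j : Fin 3) :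
    ContDiffAt ℝ ∞ (fun w => killFrame K ν a (φ.symm w) i j) y := by
  have h : (fun w => killFrame K ν a (φ.symm w) i j) =ᶠ[nhds y] fun w =>
      (∑ k, ∑ l, (frameField 𝔰 φ a i w k : ℂ) * frameField 𝔰 φ a j w l
        * chartKillForm K ν φ w k l) / 2
      - if i = j then (∑ c, ∑ k, ∑ l, (frameField 𝔰 φ a c w k : ℂ) * frameField 𝔰 φ a c w l
        * chartKillForm K ν φ w k l) / 6 else 0 := by
    filter_upwards [eventually_mem_dom 𝔰 a hy ha] with w hw
    exact killFrame_chart hφ hw.1 hw.2 K ν i j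
  refine ContDiffAt.congr_of_eventuallyEq ?_ h
  have hE := fun i k => contDiffAt_ofReal (frameField_comp_contDiffAt hφ hy ha i k)
  have hR := chartKillForm_contDiffAt hφ hy hK ν
  refine ContDiffAt.sub ?_ ?_
  · exact (ContDiffAt.sum fun k _ => ContDiffAt.sum fun l _ =>
      ((hE _ _).mul (hE _ _)).mul (hR _ _)).div_const _
  · split_ifs
    · exact (ContDiffAt.sum fun c _ => ContDiffAt.sum fun k _ => ContDiffAt.sum fun l _ =>
        ((hE _ _).mul (hE _ _)).mul (hR _ _)).div_const _
    · exact contDiffAt_const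

omit hK ha in
lemma mdifferentiableAt_of_chart {f : S → ℂ} (hf : DifferentiableAt ℝ (fun w => f (φ.symm w)) y) :
    MDifferentiableAt (𝓡 3) 𝓘(ℝ, ℂ) f (φ.symm y) := by
  have hx : φ.symm y ∈ φ.source := φ.map_target hy
  have h1 := (chart_mdifferentiable hφ).mdifferentiableAt hx
  have h2 : MDifferentiableAt (𝓡 3) 𝓘(ℝ, ℂ) (fun w => f (φ.symm w)) (φ (φ.symm y)) := by
    rw [φ.right_inv hy]
    exact hf.mdifferentiableAt
  refine (h2.comp _ h1).congr_of_eventuallyEq ?_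
  filter_upwards [φ.open_source.mem_nhds hx] with z hz
  simp [φ.left_inv hz]

omit hφ hy ha in
lemma adjVec_eq_zero (h : ν.IsApproxKilling K) {x : S} (hx : x ∈ 𝔰.dom a) :
    adjVec (𝔰.frame a) K (killFrame K ν a) x = 0 := by
  obtain ⟨φ, hφ, y, hy, rfl⟩ := exists_chart_point x
  have h1 := killingAdj_tensorSpinor (𝔰.frame a) hK.symm
    (ζ := killingOp (𝔰.frame a) K (ν.comp a)) (Q := killFrame K ν a) (x := φ.symm y)
    (by
      filter_upwards [(𝔰.isOpen_dom a).mem_nhds hx] with z hz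
      exact killingOp_frame K ν hz)
    (fun i j => mdifferentiableAt_of_chart hφ hy
      ((killFrame_contDiffAt hφ hy hx hK ν i j).differentiableAt (by simp)))
    (tfSym_tfSym _)
  have h2 : vecSpinor (adjVec (𝔰.frame a) K (killFrame K ν a) (φ.symm y)) = 0 := by
    rw [← h1]
    exact h a _ hx
  rw [← spinorVec_vecSpinor (adjVec (𝔰.frame a) K (killFrame K ν a) (φ.symm y)), h2]
  funext i
  simp [spinorVec]

lemma fluxComp_contDiffAt (i : Fin 3) :
    ContDiffAt ℝ ∞ (fun w => fluxComp K ν a i (φ.symm w)) y := by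
  simp only [fluxComp]
  have h : ContDiffAt ℝ ∞ (fun w => ∑ j, killFrame K ν a (φ.symm w) i j *
      (starRingEnd ℂ) (spinVec ν a (φ.symm w) j)) y :=
    ContDiffAt.sum fun j _ => (killFrame_contDiffAt hφ hy ha hK ν i j).mul
      ((Complex.conjCLE : ℂ →L[ℝ] ℂ).contDiff.contDiffAt.comp y
        (spinVec_chart_contDiffAt hφ hy ha ν j))
  exact Complex.reCLM.contDiff.contDiffAt.comp y h

/-- The divergence of the flux, in frame components. -/
lemma divergence_fluxComp (h : ν.IsApproxKilling K) :
    ∑ k, (fderiv ℝ (fun w => fluxComp K ν a k (φ.symm w)) y (frameField 𝔰 φ a k y)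
      - (∑ i, connCoeff (𝔰.frame a) i i k (φ.symm y)) * fluxComp K ν a k (φ.symm y))
      = killNormSq K ν a (φ.symm y) := by
  have hd : ∀ k, DifferentiableAt ℝ (fun w => ∑ j, killFrame K ν a (φ.symm w) k j *
      (starRingEnd ℂ) (spinVec ν a (φ.symm w) j)) y := fun k =>
    (ContDiffAt.sum fun j _ => (killFrame_contDiffAt hφ hy ha hK ν k j).mul
      ((Complex.conjCLE : ℂ →L[ℝ] ℂ).contDiff.contDiffAt.comp y
      (spinVec_chart_contDiffAt hφ hy ha ν j))).differentiableAt (n := ∞) (by simp)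
  have h1 := divergence_identity (𝔰.frame a) K (z := spinVec ν a) (x := φ.symm y)
    (spinVec_mdifferentiableAt ν ha)
    (fun i j => mdifferentiableAt_of_chart hφ hy
      ((killFrame_contDiffAt hφ hy ha hK ν i j).differentiableAt (by simp)))
    (adjVec_eq_zero hK ν h ha)
  have h2 := congrArg Complex.re h1
  rw [Complex.re_sum] at h2
  have h3 : killNormSq K ν a (φ.symm y) = (∑ i, ∑ j, killVec (𝔰.frame a) K (spinVec ν a) (φ.symm y) i j *
      (starRingEnd ℂ) (killVec (𝔰.frame a) K (spinVec ν a) (φ.symm y) i j)).re := by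
    simp only [killNormSq, Complex.re_sum, Complex.mul_conj, Complex.ofReal_re,
      Complex.normSq_eq_norm_sq]
  rw [h3, ← h2]
  refine Finset.sum_congr rfl fun k _ => ?_
  rw [Complex.sub_re]
  congr 1
  · rw [dirDeriv_chart hφ hy (mdifferentiableAt_of_chart hφ hy (hd k))]
    have h4 := (Complex.reCLM.hasFDerivAt.comp y (hd k).hasFDerivAt).fderiv
    have h5 : (fun w => fluxComp K ν a k (φ.symm w)) = Complex.reCLM ∘ fun w =>
      ∑ j, killFrame K ν a (φ.symm w) k j * (starRingEnd ℂ) (spinVec ν a (φ.symm w) j) := rfl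
    rw [h5, h4]
    rfl
  · rw [← Complex.ofReal_sum, Complex.re_ofReal_mul]
    rfl

end

/-- The divergence theorem for compactly supported vector fields. -/
lemma integral_divergence_eq_zero {X : E3 → E3} (hX : ContDiff ℝ 1 X) (hc : HasCompactSupport X) :
    ∫ y, ∑ m, fderiv ℝ X y (EuclideanSpace.single m 1) m = 0 := by
  have hf : Continuous (fderiv ℝ X) := hX.continuous_fderiv (by simp)
  have hcf : HasCompactSupport (fderiv ℝ X) := hc.fderiv (𝕜 := ℝ)
  have hi : ∀ m : Fin 3, Integrable fun y => fderiv ℝ X y (EuclideanSpace.single m 1) := by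
    intro m
    refine Continuous.integrable_of_hasCompactSupport (hf.clm_apply continuous_const) ?_
    exact hcf.comp_left (g := fun L : E3 →L[ℝ] E3 => L (EuclideanSpace.single m 1)) rfl
  have hz : ∀ m : Fin 3, ∫ y, fderiv ℝ X y (EuclideanSpace.single m 1) = 0 := by
    intro m
    -- Integration by parts against the constant function 1.
    have := integral_smul_fderiv_eq_neg_fderiv_smul_of_integrable (μ := (volume : Measure E3)) (𝕜 := ℝ)
      (f := fun _ => (1 : ℝ)) (g := X) (v := EuclideanSpace.single m 1) (by simp)
      (by simpa using hi m)
      (by simpa using hX.continuous.integrable_of_hasCompactSupport hc)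
      (fun _ _ => differentiableAt_const _) (fun x _ => hX.differentiable (by simp) x)
    simpa using this
  have hi' : ∀ m : Fin 3, Integrable fun y => fderiv ℝ X y (EuclideanSpace.single m 1) m :=
    fun m => (EuclideanSpace.proj (𝕜 := ℝ) m).integrable_comp (hi m)
  rw [integral_finsetSum _ fun m _ => hi' m]
  refine Finset.sum_eq_zero fun m _ => ?_
  have := (EuclideanSpace.proj (𝕜 := ℝ) m).integral_comp_comm (hi m)
  rw [hz m, map_zero] at this
  exact this

/-! ### Green's identity in a chart -/

section

variable {S : Type*} [TopologicalSpace S] [ChartedSpace E3 S] [IsManifold (𝓡 3) ∞ S]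
  [RiemannianBundle (fun x : S => TangentSpace (𝓡 3) x)]
  [hR : IsContMDiffRiemannianBundle (𝓡 3) ∞ E3 (fun x : S => TangentSpace (𝓡 3) x)]
  {ι : Type*} {𝔰 : SpinStructure S ι}
  {φ : OpenPartialHomeomorph S E3} (hφ : φ ∈ IsManifold.maximalAtlas (𝓡 3) ∞ S) {y : E3}
  (hy : y ∈ φ.target) {a : ι} (ha : φ.symm y ∈ 𝔰.dom a)
  {K : TwoTensor S} (hK : IsAsymptoticallyEuclidean K) (ν : SpinorField 𝔰 2)

/-- The derivative of a real function along a tangent vector. -/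
def realDeriv (f : S → ℝ) (x : S) (X : TangentSpace (𝓡 3) x) : ℝ :=
  mfderiv (𝓡 3) 𝓘(ℝ, ℝ) f x X

/-- The integrand `df(J) + f |Φ(ν)|²` of Green's identity. -/
def greenIntegrand (K : TwoTensor S) (ν : SpinorField 𝔰 2) (f : S → ℝ) (x : S) : ℝ :=
  realDeriv f x (flux K ν (𝔰.indexAt x) x) + f x * killNormSq K ν (𝔰.indexAt x) x

lemma greenIntegrand_eq (f : S → ℝ) {x : S} (hx : x ∈ 𝔰.dom a) : greenIntegrand K ν f x
    = realDeriv f x (flux K ν a x) + f x * killNormSq K ν a x := by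
  rw [greenIntegrand, flux_change K ν (𝔰.mem_indexAt x) hx,
    killNormSq_change K ν (𝔰.mem_indexAt x) hx]

include hφ hy

lemma realDeriv_chart {f : S → ℝ} (hf : MDifferentiableAt (𝓡 3) 𝓘(ℝ, ℝ) f (φ.symm y))
    (V : (x : S) → TangentSpace (𝓡 3) x) :
    realDeriv f (φ.symm y) (V (φ.symm y)) = fderiv ℝ (f ∘ φ.symm) y (chartField φ V y) := by
  have h := hf.hasMFDerivAt.comp y
    ((chart_symm_contMDiffAt hφ hy).mdifferentiableAt (by simp)).hasMFDerivAt
  have h3 := HasFDerivAt.fderiv (𝕜 := ℝ) (E := E3) (F := ℝ) h.hasFDerivAt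
  rw [h3, realDeriv, ← mfderiv_chartField hφ hy V]
  rfl

lemma volDensity_eq : volDensity φ y = |chartDet 𝔰 φ y|⁻¹ := by
  have h := chartDet_sq (𝔰 := 𝔰) hφ hy
  have h1 : (Matrix.of fun k l => -metricCoeff φ k l y)
      = -(Matrix.of fun k l => metricCoeff φ k l y) := by
    ext k l; simp
  rw [h1, Matrix.det_neg] at h
  have h0 : chartDet 𝔰 φ y ≠ 0 := by
    intro h'
    simp [h'] at h
  have h2 : |(Matrix.of fun k l => metricCoeff φ k l y).det| = |chartDet 𝔰 φ y|⁻¹ ^ 2 := by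
    have h3 := congrArg abs h
    rw [abs_mul, abs_mul] at h3
    simp only [Fintype.card_fin, abs_pow, abs_neg, abs_one, one_pow, one_mul] at h3
    have : |chartDet 𝔰 φ y| ≠ 0 := abs_ne_zero.2 h0
    field_simp
    linarith
  rw [volDensity, h2, Real.sqrt_sq (by positivity)]

include ha hK

/-- Green's identity in a chart, in divergence form. -/
lemma divergence_chart (h : ν.IsApproxKilling K) {f : S → ℝ}
    (hf : ContMDiffAt (𝓡 3) 𝓘(ℝ, ℝ) ∞ f (φ.symm y)) {s : ℝ} :
    ContDiffAt ℝ ∞ (fun w => ∑ i, (f (φ.symm w) * fluxComp K ν a i (φ.symm w) *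
      (s * (chartDet 𝔰 φ w)⁻¹)) • frameField 𝔰 φ a i w) y ∧
    ∑ m, fderiv ℝ (fun w => ∑ i, (f (φ.symm w) * fluxComp K ν a i (φ.symm w) *
      (s * (chartDet 𝔰 φ w)⁻¹)) • frameField 𝔰 φ a i w) y (EuclideanSpace.single m 1) m
      = s * (chartDet 𝔰 φ y)⁻¹ * greenIntegrand K ν f (φ.symm y) := by
  set F := frameJet 𝔰 a hφ hy ha with hF
  have hfc : ContDiffAt ℝ ∞ (fun w => f (φ.symm w)) y :=
    (hf.comp y (chart_symm_contMDiffAt hφ hy)).contDiffAt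
  have hw := fluxComp_contDiffAt hφ hy ha hK ν
  have hd := chartDet_contDiffAt (𝔰 := 𝔰) hφ hy
  have hdet : chartDet 𝔰 φ y = F.det := chartDet_eq hφ hy ha
  have hd0 : chartDet 𝔰 φ y ≠ 0 := hdet ▸ F.det_ne_zero
  have hE := frameField_contDiffAt 𝔰 a hφ hy ha
  have hdi : ContDiffAt ℝ ∞ (fun w => s * (chartDet 𝔰 φ w)⁻¹) y := contDiffAt_const.mul (hd.inv hd0)
  have hc : ∀ i, ContDiffAt ℝ ∞ (fun w => f (φ.symm w) * fluxComp K ν a i (φ.symm w) *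
      (s * (chartDet 𝔰 φ w)⁻¹)) y := fun i => (hfc.mul (hw i)).mul hdi
  refine ⟨ContDiffAt.sum fun i _ => (hc i).smul (hE i), ?_⟩
  have d1 : ∀ {g : E3 → ℝ}, ContDiffAt ℝ ∞ g y → HasFDerivAt g (fderiv ℝ g y) y := fun hg =>
    (hg.differentiableAt (by simp)).hasFDerivAt
  have d2 : ∀ i, HasFDerivAt (frameField 𝔰 φ a i) (fderiv ℝ (frameField 𝔰 φ a i) y) y := fun i =>
    ((hE i).differentiableAt (by simp)).hasFDerivAt
  -- Jacobi's formula: the derivative of the frame determinant contracts the dual coframe with the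
  -- derivatives of the frame. Through d⁻¹ it supplies the term that turns the coordinate divergence
  -- into the trace of the connection given by `FrameJet.neg_sum_w`.
  have hdd : HasFDerivAt (chartDet 𝔰 φ) (∑ i, ∑ k, (F.det * F.dual i k) •
      (EuclideanSpace.proj k ∘L fderiv ℝ (frameField 𝔰 φ a i) y)) y := by
    have h1 := hasFDerivAt_det (f := fun i k w => frameField 𝔰 φ a i w k)
      (frameField_hasFDerivAt 𝔰 a hφ hy ha)
    have h2 : chartDet 𝔰 φ =ᶠ[nhds y] fun w =>
        (Matrix.of fun i k => frameField 𝔰 φ a i w k).det := by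
      filter_upwards [eventually_mem_dom 𝔰 a hy ha] with w hw
      exact chartDet_eq hφ hw.1 hw.2
    refine (h1.congr_of_eventuallyEq h2).congr_fderiv ?_
    simp only [F.det_mul_dual]
    rfl
  have hdinv : HasFDerivAt (fun w => s * (chartDet 𝔰 φ w)⁻¹)
      (s • ((-(chartDet 𝔰 φ y ^ 2)⁻¹) • (∑ i, ∑ k, (F.det * F.dual i k) •
      (EuclideanSpace.proj k ∘L fderiv ℝ (frameField 𝔰 φ a i) y)))) y :=
    ((hasDerivAt_inv hd0).comp_hasFDerivAt y hdd).const_mul s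
  have hX := HasFDerivAt.fun_sum (u := Finset.univ) fun i _ =>
    (((d1 hfc).mul (d1 (hw i))).mul hdinv).smul (d2 i)
  have hX' : HasFDerivAt (fun w => ∑ i, (f (φ.symm w) * fluxComp K ν a i (φ.symm w) *
      (s * (chartDet 𝔰 φ w)⁻¹)) • frameField 𝔰 φ a i w) _ y := hX
  rw [hX'.fderiv]
  have hG := divergence_fluxComp hφ hy ha hK ν h
  have hconn : ∀ k, -∑ i, connCoeff (𝔰.frame a) i i k (φ.symm y) = _ := fun k => by
    simp only [connCoeff_frame 𝔰 a hφ hy ha]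
    exact F.neg_sum_w k
  have hflux : realDeriv f (φ.symm y) (flux K ν a (φ.symm y))
      = ∑ i, fluxComp K ν a i (φ.symm y) *
        fderiv ℝ (fun w => f (φ.symm w)) y (frameField 𝔰 φ a i y) := by
    have : ∀ i, realDeriv f (φ.symm y) (𝔰.frame a i (φ.symm y))
        = fderiv ℝ (fun w => f (φ.symm w)) y (frameField 𝔰 φ a i y) := fun i =>
      realDeriv_chart hφ hy (hf.mdifferentiableAt (by simp)) (𝔰.frame a i)
    simp only [← this, realDeriv, flux]
    rw [map_sum]
    exact Finset.sum_congr rfl fun i _ => map_smul _ _ _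
  rw [greenIntegrand_eq ν f ha, hflux, ← hG]
  have hG2 : ∀ k, fderiv ℝ (fun w => fluxComp K ν a k (φ.symm w)) y (frameField 𝔰 φ a k y)
      - (∑ i, connCoeff (𝔰.frame a) i i k (φ.symm y)) * fluxComp K ν a k (φ.symm y)
      = fderiv ℝ (fun w => fluxComp K ν a k (φ.symm w)) y (frameField 𝔰 φ a k y)
      + (∑ m, F.de k m m - ∑ i, ∑ m, F.dual i m * ∑ a, F.de i m a * F.e k a)
        * fluxComp K ν a k (φ.symm y) := fun k => by rw [← hconn]; ring
  simp only [hG2]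
  simp only [ContinuousLinearMap.sum_apply, WithLp.ofLp_sum, Finset.sum_apply]
  rw [Finset.sum_comm, mul_add, Finset.mul_sum, ← mul_assoc, Finset.mul_sum,
    ← Finset.sum_add_distrib]
  refine Finset.sum_congr rfl fun i _ => ?_
  have hv : ∀ L : E3 →L[ℝ] ℝ, L (frameField 𝔰 φ a i y)
      = ∑ p, F.e i p * L (EuclideanSpace.single p 1) := fun L => clm_apply_eq_sum L _
  rw [hv, hv]
  have hr : (chartDet 𝔰 φ y ^ 2)⁻¹ * F.det = (chartDet 𝔰 φ y)⁻¹ := by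
    rw [← hdet]; field_simp
  have hde : ∀ j k m, (fderiv ℝ (frameField 𝔰 φ a j) y (EuclideanSpace.single m 1)) k = F.de j k m :=
    fun _ _ _ => rfl
  have he : ∀ m, (frameField 𝔰 φ a i y) m = F.e i m := fun _ => rfl
  have hp : ∀ (v : E3) (k : Fin 3), EuclideanSpace.proj (𝕜 := ℝ) k v = v k := fun _ _ => rfl
  simp only [ContinuousLinearMap.add_apply, ContinuousLinearMap.smul_apply,
    ContinuousLinearMap.smulRight_apply, ContinuousLinearMap.sum_apply, PiLp.add_apply,
    PiLp.smul_apply, smul_eq_mul, ContinuousLinearMap.comp_apply, hp, hde, he, Pi.mul_apply]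
  obtain ⟨D, hD⟩ : ∃ D : Fin 3 → ℝ, ∀ m, D m = ∑ j, ∑ k, F.dual j k * F.de j k m :=
    ⟨_, fun _ => rfl⟩
  have hD1 : ∀ m, ∑ j, ∑ k, F.det * F.dual j k * F.de j k m = F.det * D m := fun m => by
    simp only [hD, Finset.mul_sum, mul_assoc]
  have hD2 : ∑ j, ∑ m, F.dual j m * ∑ a, F.de j m a * F.e i a = ∑ a, D a * F.e i a := by
    simp only [hD, Finset.mul_sum, Finset.sum_mul]
    rw [Finset.sum_comm_cycle]
    refine Finset.sum_congr rfl fun a _ => Finset.sum_congr rfl fun j _ =>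
      Finset.sum_congr rfl fun k _ => by ring
  simp only [hD1, hD2]
  simp only [Fin.sum_univ_three]
  linear_combination (-(f (φ.symm y) * fluxComp K ν a i (φ.symm y) * s) *
    (D 0 * F.e i 0 + D 1 * F.e i 1 + D 2 * F.e i 2)) * hr

end

/-! ### Integration over charts and the global Green identity -/

section

variable {S : Type*} [TopologicalSpace S] [ChartedSpace E3 S] [IsManifold (𝓡 3) ∞ S]
  [RiemannianBundle (fun x : S => TangentSpace (𝓡 3) x)]
  [hR : IsContMDiffRiemannianBundle (𝓡 3) ∞ E3 (fun x : S => TangentSpace (𝓡 3) x)]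
  [MeasurableSpace S] [BorelSpace S] [SecondCountableTopology S]
  {φ : OpenPartialHomeomorph S E3} (hφ : φ ∈ IsManifold.maximalAtlas (𝓡 3) ∞ S)

include hφ

lemma volDensity_continuousOn : ContinuousOn (volDensity φ) φ.target := by
  have h : ∀ i j, ContinuousOn (metricCoeff φ i j) φ.target := fun i j y hy =>
    (metricCoeff_contDiffAt hφ hy i j).continuousAt.continuousWithinAt
  unfold volDensity
  simp only [Matrix.det_fin_three, Matrix.of_apply]
  fun_prop

omit hR [RiemannianBundle (fun x : S => TangentSpace (𝓡 3) x)] hφ [IsManifold (𝓡 3) ∞ S]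
  [ChartedSpace E3 S] [MeasurableSpace S] [BorelSpace S] [SecondCountableTopology S] in
lemma continuousOn_source {F : S → ℝ} (hF : ContinuousOn (fun y => F (φ.symm y)) φ.target) :
    ContinuousOn F φ.source := by
  refine (hF.comp φ.continuousOn fun x hx => φ.map_source hx).congr fun x hx => ?_
  simp [φ.left_inv hx]

/-- Integration over a chart domain. -/
lemma lintegral_chart {F : S → ℝ} (hF : ContinuousOn (fun y => F (φ.symm y)) φ.target) :
    ∫⁻ x in φ.source, ENNReal.ofReal (F x) ∂(riemannianVolume S)
      = ∫⁻ y in φ.target, ENNReal.ofReal (volDensity φ y) * ENNReal.ofReal (F (φ.symm y)) := by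
  have h1 : AEMeasurable (fun x => ENNReal.ofReal (F x)) ((riemannianVolume S).restrict φ.source) :=
    ((continuousOn_source hF).aemeasurable φ.open_source.measurableSet).ennreal_ofReal
  have hd : AEMeasurable (fun y => ENNReal.ofReal (volDensity φ y)) (volume.restrict φ.target) :=
    ((volDensity_continuousOn hφ).aemeasurable φ.open_target.measurableSet).ennreal_ofReal
  rw [riemannianVolume_restrict hφ, chartVolume] at *
  have h2 : AEMeasurable φ.symm ((volume.restrict φ.target).withDensity fun y =>
      ENNReal.ofReal (volDensity φ y)) :=
    (aemeasurable_chart_symm φ).mono_ac (withDensity_absolutelyContinuous _ _)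
  rw [lintegral_map' h1 h2]
  refine (lintegral_withDensity_eq_lintegral_mul₀ hd ?_).trans rfl
  exact (hF.aemeasurable φ.open_target.measurableSet).ennreal_ofReal

lemma integral_chart {F : S → ℝ} (hF : ContinuousOn (fun y => F (φ.symm y)) φ.target) :
    (IntegrableOn F φ.source (riemannianVolume S) ↔
      IntegrableOn (fun y => volDensity φ y * F (φ.symm y)) φ.target) ∧
    ∫ x in φ.source, F x ∂(riemannianVolume S) = ∫ y in φ.target, volDensity φ y * F (φ.symm y) := by
  have h1 : AEStronglyMeasurable F ((riemannianVolume S).restrict φ.source) :=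
    ((continuousOn_source hF).aemeasurable φ.open_source.measurableSet).aestronglyMeasurable
  have hd : AEMeasurable (fun y => ENNReal.ofReal (volDensity φ y)) (volume.restrict φ.target) :=
    ((volDensity_continuousOn hφ).aemeasurable φ.open_target.measurableSet).ennreal_ofReal
  have hnn : ∀ y, (ENNReal.ofReal (volDensity φ y)).toReal = volDensity φ y := fun y =>
    ENNReal.toReal_ofReal (Real.sqrt_nonneg _)
  unfold IntegrableOn
  rw [riemannianVolume_restrict hφ, chartVolume] at *
  have h2 : AEMeasurable φ.symm ((volume.restrict φ.target).withDensity fun y =>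
      ENNReal.ofReal (volDensity φ y)) :=
    (aemeasurable_chart_symm φ).mono_ac (withDensity_absolutelyContinuous _ _)
  constructor
  · refine (integrable_map_measure h1 h2).trans ?_
    refine (integrable_withDensity_iff_integrable_smul₀' hd
      (Filter.Eventually.of_forall fun _ => ENNReal.ofReal_lt_top)).trans ?_
    simp only [hnn, smul_eq_mul, Function.comp_apply]
  · refine (integral_map h2 h1).trans ?_
    refine (integral_withDensity_eq_integral_toReal_smul₀ hd
      (Filter.Eventually.of_forall fun _ => ENNReal.ofReal_lt_top) _).trans ?_
    simp only [hnn, smul_eq_mul]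

variable [T2Space S] {ι : Type*} {𝔰 : SpinStructure S ι} {a : ι}
  {K : TwoTensor S} (hK : IsAsymptoticallyEuclidean K) (ν : SpinorField 𝔰 2)

omit hφ hR [MeasurableSpace S] [BorelSpace S] [SecondCountableTopology S] [T2Space S] in
lemma greenIntegrand_eq_zero {f : S → ℝ} {x : S} (hx : x ∉ tsupport f) :
    greenIntegrand K ν f x = 0 := by
  have h : f =ᶠ[nhds x] fun _ => 0 := notMem_tsupport_iff_eventuallyEq.1 hx
  rw [greenIntegrand, realDeriv, h.mfderiv_eq, h.eq_of_nhds, mfderiv_const]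
  exact (congrArg₂ (· + ·) (rfl : _ = (0 : ℝ)) (zero_mul _)).trans (add_zero 0)

include hK

/-- Green's identity for functions supported in the domain of a chart and of a spin frame. -/
lemma green_chart (h : ν.IsApproxKilling K) {f : S → ℝ} (hf : ContMDiff (𝓡 3) 𝓘(ℝ, ℝ) ∞ f)
    (hc : HasCompactSupport f) (hs : tsupport f ⊆ φ.source ∩ 𝔰.dom a) :
    Integrable (greenIntegrand K ν f) (riemannianVolume S) ∧
      ∫ x, greenIntegrand K ν f x ∂(riemannianVolume S) = 0 := by
  classical
  set C : Set E3 := φ '' tsupport f with hC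
  have hCc : IsCompact C := hc.image_of_continuousOn
    (φ.continuousOn.mono (hs.trans Set.inter_subset_left))
  set U : Set E3 := φ.target ∩ φ.symm ⁻¹' 𝔰.dom a with hU
  have hCU : C ⊆ U := by
    rintro _ ⟨x, hx, rfl⟩
    refine ⟨φ.map_source (hs hx).1, ?_⟩
    simpa [φ.left_inv (hs hx).1] using (hs hx).2
  have hUo : IsOpen U := φ.isOpen_inter_preimage_symm (𝔰.isOpen_dom a)
  have hnot : ∀ y ∈ φ.target, y ∉ C → φ.symm y ∉ tsupport f := fun y hy hyC hx =>
    hyC ⟨φ.symm y, hx, φ.right_inv hy⟩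
  -- The coordinate expression has no meaning off the chart. Setting it to zero off the compact
  -- image of the support of f changes nothing near that image, since f vanishes there, and gives a
  -- smooth compactly supported field on ℝ³.
  set X : E3 → E3 := fun w => if w ∈ C then ∑ i, (f (φ.symm w) * fluxComp K ν a i (φ.symm w) *
      |chartDet 𝔰 φ w|⁻¹) • frameField 𝔰 φ a i w else 0 with hX
  have hXloc : ∀ y ∈ U, ∃ s : ℝ, s * (chartDet 𝔰 φ y)⁻¹ = volDensity φ y ∧ X =ᶠ[nhds y] fun w =>
      ∑ i, (f (φ.symm w) * fluxComp K ν a i (φ.symm w) * (s * (chartDet 𝔰 φ w)⁻¹)) •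
        frameField 𝔰 φ a i w := by
    intro y hy
    have hcont : ContinuousAt (chartDet 𝔰 φ) y := (chartDet_contDiffAt hφ hy.1).continuousAt
    have hd0 : chartDet 𝔰 φ y ≠ 0 := by
      rw [chartDet_eq hφ hy.1 hy.2]; exact (frameJet 𝔰 a hφ hy.1 hy.2).det_ne_zero
    -- The frame determinant does not vanish, so its sign is locally constant and the density |d|⁻¹
    -- is locally ±d⁻¹, a smooth function.
    obtain ⟨s, hsw⟩ : ∃ s : ℝ, ∀ᶠ w in nhds y, |chartDet 𝔰 φ w|⁻¹ = s * (chartDet 𝔰 φ w)⁻¹ := by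
      rcases lt_or_gt_of_ne hd0 with h1 | h1
      · refine ⟨-1, ?_⟩
        filter_upwards [hcont.eventually (gt_mem_nhds h1)] with w hw
        rw [abs_of_neg hw, inv_neg]; ring
      · refine ⟨1, ?_⟩
        filter_upwards [hcont.eventually (lt_mem_nhds h1)] with w hw
        rw [abs_of_pos hw]; ring
    refine ⟨s, ?_, ?_⟩
    · rw [volDensity_eq (𝔰 := 𝔰) hφ hy.1, hsw.self_of_nhds]
    · filter_upwards [hsw, hUo.mem_nhds hy] with w hw hwU
      simp only [hX, ← hw]
      split_ifs with hwC
      · rfl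
      · have : f (φ.symm w) = 0 := image_eq_zero_of_notMem_tsupport (hnot w hwU.1 hwC)
        simp [this]
  have hX0 : ∀ y ∉ C, X =ᶠ[nhds y] fun _ => 0 := fun y hy => by
    filter_upwards [hCc.isClosed.isOpen_compl.mem_nhds hy] with w hw
    exact if_neg hw
  have hXsmooth : ContDiff ℝ ∞ X := by
    refine contDiff_iff_contDiffAt.2 fun y => ?_
    by_cases hy : y ∈ C
    · obtain ⟨s, -, he⟩ := hXloc y (hCU hy)
      exact (divergence_chart hφ (hCU hy).1 (hCU hy).2 hK ν h (hf.contMDiffAt)).1.congr_of_eventuallyEq he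
    · exact contDiffAt_const.congr_of_eventuallyEq (hX0 y hy)
  have hXc : HasCompactSupport X := HasCompactSupport.intro hCc fun y hy => if_neg hy
  have hdiv : ∀ y ∈ φ.target, ∑ m, fderiv ℝ X y (EuclideanSpace.single m 1) m
      = volDensity φ y * greenIntegrand K ν f (φ.symm y) := by
    intro y hy
    by_cases hyC : y ∈ C
    · obtain ⟨s, hsv, he⟩ := hXloc y (hCU hyC)
      rw [he.fderiv_eq, ← hsv]
      exact (divergence_chart hφ (hCU hyC).1 (hCU hyC).2 hK ν h (hf.contMDiffAt)).2
    · rw [(hX0 y hyC).fderiv_eq, greenIntegrand_eq_zero ν (hnot y hy hyC)]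
      simp
  have hdiv0 : ∀ y ∉ φ.target, ∑ m, fderiv ℝ X y (EuclideanSpace.single m 1) m = 0 := by
    intro y hy
    rw [(hX0 y fun hyC => hy (hCU hyC).1).fderiv_eq]
    simp
  have hDc : Continuous fun y => ∑ m, fderiv ℝ X y (EuclideanSpace.single m 1) m := by
    have h1 := hXsmooth.continuous_fderiv (by simp)
    fun_prop
  have hDs : HasCompactSupport fun y => ∑ m, fderiv ℝ X y (EuclideanSpace.single m 1) m :=
    (hXc.fderiv (𝕜 := ℝ)).comp_left
      (g := fun L : E3 →L[ℝ] E3 => ∑ m, L (EuclideanSpace.single m 1) m) (by simp)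
  have hpos : ∀ y ∈ φ.target, volDensity φ y ≠ 0 := by
    intro y hy
    rw [volDensity_eq (𝔰 := 𝔰) hφ hy]
    exact inv_ne_zero (abs_ne_zero.2 (frameJet 𝔰 _ hφ hy (𝔰.mem_indexAt _)).det_ne_zero)
  have hFc : ContinuousOn (fun y => greenIntegrand K ν f (φ.symm y)) φ.target := by
    refine ((hDc.continuousOn).div (volDensity_continuousOn hφ) hpos).congr fun y hy => ?_
    change _ = (∑ m, fderiv ℝ X y (EuclideanSpace.single m 1) m) / volDensity φ y
    rw [hdiv y hy, mul_div_cancel_left₀ _ (hpos y hy)]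
  obtain ⟨h1, h2⟩ := integral_chart hφ hFc
  have hi : IntegrableOn (greenIntegrand K ν f) φ.source (riemannianVolume S) := by
    refine h1.2 (((hDc.integrable_of_hasCompactSupport hDs).integrableOn (s := φ.target)).congr_fun
      hdiv φ.open_target.measurableSet)
  have h3 : ∀ x ∉ φ.source, greenIntegrand K ν f x = 0 := fun x hx =>
    greenIntegrand_eq_zero ν fun hx' => hx (hs hx').1
  refine ⟨(integrableOn_iff_integrable_of_support_subset ?_).1 hi, ?_⟩
  · exact fun x hx => by_contra fun hx' => hx (h3 x hx')
  · rw [← setIntegral_eq_integral_of_forall_compl_eq_zero h3, h2,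
      setIntegral_congr_fun φ.open_target.measurableSet (fun y hy => (hdiv y hy).symm),
      setIntegral_eq_integral_of_forall_compl_eq_zero hdiv0]
    exact integral_divergence_eq_zero (hXsmooth.of_le (by simp)) hXc

omit hφ in
/-- Green's identity for compactly supported functions. -/
lemma green_identity (h : ν.IsApproxKilling K) {f : S → ℝ} (hf : ContMDiff (𝓡 3) 𝓘(ℝ, ℝ) ∞ f)
    (hc : HasCompactSupport f) :
    Integrable (greenIntegrand K ν f) (riemannianVolume S) ∧
      ∫ x, greenIntegrand K ν f x ∂(riemannianVolume S) = 0 := by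
  classical
  have : LocallyCompactSpace S := Manifold.locallyCompact_of_finiteDimensional (𝓡 3)
  obtain ⟨p, hp⟩ := SmoothPartitionOfUnity.exists_isSubordinate (𝓡 3) (s := Set.univ) isClosed_univ
    (fun x : S => (chartAt E3 x).source ∩ 𝔰.dom (𝔰.indexAt x))
    (fun x => (chartAt E3 x).open_source.inter (𝔰.isOpen_dom _))
    (fun x _ => Set.mem_iUnion.2 ⟨x, mem_chart_source E3 x, 𝔰.mem_indexAt x⟩)
  have hfin : {x | (Function.support (p x) ∩ tsupport f).Nonempty}.Finite :=
    p.locallyFinite.finite_nonempty_inter_compact hc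
  set T := hfin.toFinset with hT
  -- By local finiteness only finitely many members of the partition of unity meet the compact
  -- support of f.
  have hsum : f = fun y => ∑ x ∈ T, p x y * f y := by
    funext y
    by_cases hy : y ∈ tsupport f
    · have h1 := p.sum_eq_one (Set.mem_univ y)
      rw [finsum_eq_sum_of_support_subset (s := T) _ ?_] at h1
      · rw [← Finset.sum_mul, h1, one_mul]
      · intro x hx
        simp only [hT, Set.Finite.coe_toFinset, Set.mem_setOf_eq]
        exact ⟨y, hx, hy⟩
    · simp [image_eq_zero_of_notMem_tsupport hy]
  have hps : ∀ x, ContMDiff (𝓡 3) 𝓘(ℝ, ℝ) ∞ fun y => p x y * f y := fun x =>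
    (p x).contMDiff.mul hf
  -- The integrand is linear in f, so the identity for f follows from the identity for its finitely
  -- many pieces.
  have hgreen : greenIntegrand K ν f
      = fun y => ∑ x ∈ T, greenIntegrand K ν (fun y => p x y * f y) y := by
    funext y
    have hd : HasMFDerivAt (𝓡 3) 𝓘(ℝ, ℝ) (fun y => ∑ x ∈ T, p x y * f y) y
        (∑ x ∈ T, (mfderiv (𝓡 3) 𝓘(ℝ, ℝ) (fun y => p x y * f y) y : E3 →L[ℝ] ℝ)) := by
      have key : ∀ (T : Finset S) (L : S → E3 →L[ℝ] ℝ),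
          (∀ x, HasMFDerivAt (𝓡 3) 𝓘(ℝ, ℝ) (fun y => p x y * f y) y (L x)) →
          HasMFDerivAt (𝓡 3) 𝓘(ℝ, ℝ) (fun y => ∑ x ∈ T, p x y * f y) y
            (∑ x ∈ T, L x : E3 →L[ℝ] ℝ) := by
        intro T L hL
        induction T using Finset.induction_on with
        | empty => exact hasMFDerivAt_const (I := 𝓡 3) (I' := 𝓘(ℝ, ℝ)) (0 : ℝ) y
        | insert x T hx ih =>
          have e1 : (∑ x ∈ insert x T, L x) = L x + ∑ x ∈ T, L x := Finset.sum_insert hx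
          have e2 : (fun y => ∑ x ∈ insert x T, p x y * f y)
              = (fun y => p x y * f y) + fun y => ∑ x ∈ T, p x y * f y := by
            funext z
            exact Finset.sum_insert hx
          rw [e1, e2]
          exact (hL x).add ih
      exact key T _ fun x => ((hps x).mdifferentiableAt (by simp)).hasMFDerivAt
    have h1 : ∀ v, realDeriv f y v = ∑ x ∈ T, realDeriv (fun y => p x y * f y) y v := by
      intro v
      have : mfderiv (𝓡 3) 𝓘(ℝ, ℝ) f y
          = ∑ x ∈ T, (mfderiv (𝓡 3) 𝓘(ℝ, ℝ) (fun y => p x y * f y) y : E3 →L[ℝ] ℝ) := by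
        conv_lhs => rw [hsum]
        exact hd.mfderiv
      rw [realDeriv, this]
      exact ContinuousLinearMap.sum_apply _ _ _
    have h2 : f y = ∑ x ∈ T, p x y * f y := congrFun hsum y
    simp only [greenIntegrand, h1, Finset.sum_add_distrib, ← Finset.sum_mul]
    rw [← Finset.sum_mul] at h2
    rw [← h2]
  have hloc : ∀ x, Integrable (greenIntegrand K ν fun y => p x y * f y) (riemannianVolume S) ∧
      ∫ y, greenIntegrand K ν (fun y => p x y * f y) y ∂(riemannianVolume S) = 0 := by
    intro x
    refine green_chart (a := 𝔰.indexAt x) (IsManifold.chart_mem_maximalAtlas x) hK ν h (hps x) hc.mul_left ?_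
    exact (tsupport_mul_subset_left).trans (hp x)
  rw [hgreen]
  refine ⟨integrable_finsetSum _ fun x _ => (hloc x).1, ?_⟩
  rw [integral_finsetSum _ fun x _ => (hloc x).1]
  exact Finset.sum_eq_zero fun x _ => (hloc x).2

end

/-! ### Pointwise decay from weighted Sobolev bounds -/

lemma lintegral_e3_iterated {G : E3 → ℝ≥0∞} (hG : Measurable G) :
    ∫⁻ t₁ in Set.Icc (0 : ℝ) 1, ∫⁻ t₂ in Set.Icc (0 : ℝ) 1, ∫⁻ t₃ in Set.Icc (0 : ℝ) 1,
      G !₂[t₁, t₂, t₃] ≤ ∫⁻ z, G z := by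
  have h1 : ∫⁻ z, G z = ∫⁻ p : ℝ × ℝ × ℝ, G !₂[p.1, p.2.1, p.2.2] := by
    have m1 := PiLp.volume_preserving_toLp (Fin 3)
    have m2 := (volume_preserving_piFinSuccAbove (fun _ : Fin 3 => ℝ) 0).symm
    have m3 := (MeasurePreserving.id (volume : Measure ℝ)).prod
      (volume_preserving_finTwoArrow ℝ).symm
    have m := (m1.comp m2).comp m3
    rw [← m.lintegral_comp hG]
    refine lintegral_congr fun p => ?_
    congr 1
    ext i
    fin_cases i <;> rfl
  have hm : Measurable fun p : ℝ × ℝ × ℝ => G !₂[p.1, p.2.1, p.2.2] := by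
    refine hG.comp ?_
    refine (PiLp.volume_preserving_toLp (Fin 3)).measurable.comp (measurable_pi_lambda _ fun i => ?_)
    fin_cases i
    · exact measurable_fst
    · exact measurable_fst.comp measurable_snd
    · exact measurable_snd.comp measurable_snd
  rw [h1, Measure.volume_eq_prod, lintegral_prod _ hm.aemeasurable]
  refine (setLIntegral_le_lintegral _ _).trans (lintegral_mono fun t₁ => ?_)
  have hm2 : Measurable fun p : ℝ × ℝ => G !₂[t₁, p.1, p.2] := hm.comp (by fun_prop : Measurable
    fun p : ℝ × ℝ => ((t₁, p) : ℝ × ℝ × ℝ))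
  rw [Measure.volume_eq_prod, lintegral_prod _ hm2.aemeasurable]
  exact (setLIntegral_le_lintegral _ _).trans (lintegral_mono fun t₂ =>
    setLIntegral_le_lintegral _ _)

/-- The fundamental theorem of calculus bounds |F(x)| by |F(x+tv)| plus the integral of |dF(v)| over
the segment; averaging over t in [0,1] gives the claim. -/
lemma sobolev_line {f : E3 → ℝ} {U : Set E3} (hU : IsOpen U) (hf : ContDiffOn ℝ ∞ f U) (j : ℕ)
    {x v : E3} (hx : ∀ t ∈ Set.Icc (0 : ℝ) 1, x + t • v ∈ U) :
    ‖iteratedFDeriv ℝ j f x‖ₑ ≤ ∫⁻ t in Set.Icc (0 : ℝ) 1,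
      (‖iteratedFDeriv ℝ j f (x + t • v)‖ₑ + ‖v‖ₑ * ‖iteratedFDeriv ℝ (j + 1) f (x + t • v)‖ₑ) := by
  set F := iteratedFDeriv ℝ j f with hF
  have hc : ∀ y ∈ U, ContDiffAt ℝ ∞ f y := fun y hy => hf.contDiffAt (hU.mem_nhds hy)
  have hFc : ∀ y ∈ U, ContDiffAt ℝ 1 F y := fun y hy =>
    (hc y hy).iteratedFDeriv_right (by exact_mod_cast le_top)
  have hd : ∀ t ∈ Set.Icc (0 : ℝ) 1, HasDerivAt (fun t : ℝ => F (x + t • v))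
      (fderiv ℝ F (x + t • v) v) t := by
    intro t ht
    have h1 := ((hFc _ (hx t ht)).differentiableAt (by simp)).hasFDerivAt
    have h2 : HasDerivAt (fun t : ℝ => x + t • v) v t := by
      simpa using ((hasDerivAt_id t).smul_const v).const_add x
    exact h1.comp_hasDerivAt t h2
  have hxc : Continuous fun t : ℝ => (x + t • v : E3) := by fun_prop
  have hcont : ContinuousOn (fun t : ℝ => fderiv ℝ F (x + t • v) v) (Set.Icc 0 1) := by
    intro t ht
    have h1 : ContinuousAt (fderiv ℝ F) (x + t • v) :=
      ((hFc _ (hx t ht)).fderiv_right (m := 0) (by simp)).continuousAt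
    have h2 : ContinuousAt (fun t : ℝ => fderiv ℝ F (x + t • v)) t :=
      ContinuousAt.comp (g := fderiv ℝ F) (f := fun t : ℝ => (x + t • v : E3)) h1
        hxc.continuousAt
    exact (h2.clm_apply continuousAt_const).continuousWithinAt
  have hb : ∀ t : ℝ, ‖fderiv ℝ F (x + t • v) v‖ₑ ≤ ‖v‖ₑ * ‖iteratedFDeriv ℝ (j + 1) f (x + t • v)‖ₑ := by
    intro t
    rw [← ofReal_norm, ← ofReal_norm, ← ofReal_norm, ← ENNReal.ofReal_mul (norm_nonneg _)]
    refine ENNReal.ofReal_le_ofReal ?_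
    rw [mul_comm, ← norm_fderiv_iteratedFDeriv]
    exact ContinuousLinearMap.le_opNorm _ _
  set J := ∫⁻ t in Set.Icc (0 : ℝ) 1, ‖v‖ₑ * ‖iteratedFDeriv ℝ (j + 1) f (x + t • v)‖ₑ with hJ
  have hp : ∀ t ∈ Set.Icc (0 : ℝ) 1, ‖F x‖ₑ ≤ ‖F (x + t • v)‖ₑ + J := by
    intro t ht
    have hsub : Set.uIcc 0 t ⊆ Set.Icc (0 : ℝ) 1 := by
      rw [Set.uIcc_of_le ht.1]; exact Set.Icc_subset_Icc le_rfl ht.2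
    have h1 := intervalIntegral.integral_eq_sub_of_hasDerivAt (fun s hs => hd s (hsub hs))
      ((hcont.mono hsub).intervalIntegrable)
    have h2 : F x = F (x + t • v) - ∫ s in (0 : ℝ)..t, fderiv ℝ F (x + s • v) v := by
      rw [h1]; simp
    rw [h2]
    refine (enorm_sub_le).trans ?_
    gcongr
    rw [intervalIntegral.integral_of_le ht.1]
    refine (enorm_integral_le_lintegral_enorm _).trans ?_
    refine (lintegral_mono fun s => hb s).trans ?_
    exact lintegral_mono_set (fun s hs => ⟨hs.1.le, hs.2.trans ht.2⟩)
  have h1 : ‖F x‖ₑ = ∫⁻ t in Set.Icc (0 : ℝ) 1, ‖F x‖ₑ := by simp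
  have h2 : J = ∫⁻ t in Set.Icc (0 : ℝ) 1, J := by simp
  rw [h1]
  calc _ ≤ ∫⁻ t in Set.Icc (0 : ℝ) 1, (‖F (x + t • v)‖ₑ + J) :=
        setLIntegral_mono' measurableSet_Icc hp
    _ = (∫⁻ t in Set.Icc (0 : ℝ) 1, ‖F (x + t • v)‖ₑ) + J := by
        rw [lintegral_add_right _ measurable_const, ← h2]
    _ ≤ _ := le_lintegral_add _ _

lemma rpow_compare {s r q : ℝ} (hr : 0 < r) (h1 : r / 2 ≤ s) (h2 : s ≤ 2 * r) :
    r ^ q ≤ (2 : ℝ) ^ |q| * s ^ q := by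
  have hs : 0 < s := by linarith
  rcases le_total 0 q with hq | hq
  · rw [abs_of_nonneg hq, ← Real.mul_rpow (by norm_num) hs.le]
    exact Real.rpow_le_rpow hr.le (by linarith) hq
  · rw [abs_of_nonpos hq, Real.rpow_neg (by norm_num), ← Real.inv_rpow (by norm_num),
      ← Real.mul_rpow (by norm_num) hs.le]
    exact Real.rpow_le_rpow_of_nonpos (by positivity) (by linarith) hq

/-- The elementary inequality B ≤ 1 + B² with B = r^{−p} A. It trades the linear quantity of the
Sobolev inequality for the quadratic density of the weighted L² norm, with r and s comparable up to
a factor two. -/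
lemma weighted_young {A r s p : ℝ} {i : ℕ} (hA : 0 ≤ A) (hr : 0 < r) (h1 : r / 2 ≤ s)
    (h2 : s ≤ 2 * r) :
    r ^ i * A ≤ r ^ (p + i) * (1 + (2 : ℝ) ^ |-2 * p - 3| * r ^ 3 * (A ^ 2 * s ^ (-2 * p - 3))) := by
  have hs : 0 < s := by linarith
  have e1 : r ^ (p + i) = r ^ p * r ^ i := by rw [Real.rpow_add hr, Real.rpow_natCast]
  have h3 := rpow_compare (q := -2 * p - 3) hr h1 h2
  have e2 : r ^ (-2 * p - 3) * r ^ 3 = r ^ (-p) * r ^ (-p) := by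
    rw [← Real.rpow_natCast r 3, ← Real.rpow_add hr, ← Real.rpow_add hr]
    congr 1
    push_cast
    ring
  have e3 : r ^ p * r ^ (-p) = 1 := by rw [← Real.rpow_add hr]; simp
  have hp := Real.rpow_pos_of_pos hr p
  set B := r ^ (-p) * A with hB
  have h4 : B ^ 2 ≤ (2 : ℝ) ^ |-2 * p - 3| * r ^ 3 * (A ^ 2 * s ^ (-2 * p - 3)) := by
    calc B ^ 2 = (r ^ (-p) * r ^ (-p)) * A ^ 2 := by rw [hB]; ring
      _ = r ^ (-2 * p - 3) * (r ^ 3 * A ^ 2) := by rw [← e2]; ring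
      _ ≤ ((2 : ℝ) ^ |-2 * p - 3| * s ^ (-2 * p - 3)) * (r ^ 3 * A ^ 2) := by gcongr
      _ = _ := by ring
  have h5 : B ≤ 1 + B ^ 2 := by nlinarith [sq_nonneg (B - 1)]
  calc r ^ i * A = r ^ p * r ^ i * B := by
        rw [hB, show r ^ p * r ^ i * (r ^ (-p) * A) = (r ^ p * r ^ (-p)) * r ^ i * A by ring, e3]
        ring
    _ ≤ _ := by
        rw [e1]
        gcongr
        linarith

lemma norm_vec3_le {t₁ t₂ t₃ : ℝ} (h₁ : t₁ ∈ Set.Icc (0 : ℝ) 1) (h₂ : t₂ ∈ Set.Icc (0 : ℝ) 1)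
    (h₃ : t₃ ∈ Set.Icc (0 : ℝ) 1) : ‖(!₂[t₁, t₂, t₃] : E3)‖ ≤ 2 := by
  rw [EuclideanSpace.norm_eq]
  refine Real.sqrt_le_iff.2 ⟨by norm_num, ?_⟩
  simp [Fin.sum_univ_three]
  nlinarith [h₁.1, h₁.2, h₂.1, h₂.2, h₃.1, h₃.2]

lemma lintegral_affine_e3 {G : E3 → ℝ≥0∞} (x : E3) {h : ℝ} (hh : 0 < h) :
    ∫⁻ z, G (x + h • z) = ENNReal.ofReal (h ^ 3)⁻¹ * ∫⁻ z, G z := by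
  have h1 : MeasurableEmbedding (fun z : E3 => h • z) :=
    (Homeomorph.smulOfNeZero h hh.ne').isClosedEmbedding.measurableEmbedding
  have h2 := h1.lintegral_map (μ := volume) (fun w => G (x + w))
  rw [Measure.map_addHaar_smul volume hh.ne', lintegral_smul_measure,
    lintegral_add_left_eq_self] at h2
  rw [← h2]
  simp only [finrank_euclideanSpace, Fintype.card_fin, smul_eq_mul]
  rw [abs_of_pos (by positivity)]

/-- A Sobolev inequality by hand: `sobolev_line` along each of the three axes costs one derivative
per axis. The coefficients are those of (1 + h∂)³, bounded by 3. -/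
lemma sobolev_cube {f : E3 → ℝ} {U : Set E3} (hU : IsOpen U) (hf : ContDiffOn ℝ ∞ f U) (k : ℕ)
    {x : E3} {h : ℝ} (hh : 0 < h)
    (hx : ∀ t₁ ∈ Set.Icc (0 : ℝ) 1, ∀ t₂ ∈ Set.Icc (0 : ℝ) 1, ∀ t₃ ∈ Set.Icc (0 : ℝ) 1,
      x + h • (!₂[t₁, t₂, t₃] : E3) ∈ U) :
    ‖iteratedFDeriv ℝ k f x‖ₑ ≤
      ∫⁻ t₁ in Set.Icc (0 : ℝ) 1, ∫⁻ t₂ in Set.Icc (0 : ℝ) 1, ∫⁻ t₃ in Set.Icc (0 : ℝ) 1,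
        ENNReal.ofReal (∑ i ∈ Finset.range 4, 3 * h ^ i *
          ‖iteratedFDeriv ℝ (k + i) f (x + h • (!₂[t₁, t₂, t₃] : E3))‖) := by
  have h0 : (0 : ℝ) ∈ Set.Icc (0 : ℝ) 1 := by simp
  set a : ℕ → E3 → ℝ≥0∞ := fun j y => ‖iteratedFDeriv ℝ j f y‖ₑ with ha
  set H : ℝ≥0∞ := ENNReal.ofReal h with hH
  have line : ∀ (j : ℕ) (y : E3) (i : Fin 3),
      (∀ t ∈ Set.Icc (0 : ℝ) 1, y + t • (h • EuclideanSpace.single i (1 : ℝ)) ∈ U) →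
      a j y ≤ ∫⁻ t in Set.Icc (0 : ℝ) 1, (a j (y + t • (h • EuclideanSpace.single i (1 : ℝ)))
        + H * a (j + 1) (y + t • (h • EuclideanSpace.single i (1 : ℝ)))) := by
    intro j y i hy
    have := sobolev_line hU hf j hy
    have e : ‖(h • EuclideanSpace.single i (1 : ℝ) : E3)‖ₑ = H := by
      rw [← ofReal_norm, norm_smul, Real.norm_of_nonneg hh.le]
      simp [hH]
    rwa [e] at this
  have e1 : ∀ t₁ : ℝ, x + t₁ • (h • EuclideanSpace.single 0 (1 : ℝ)) = x + h • (!₂[t₁, 0, 0] : E3) := by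
    intro t₁; ext i; fin_cases i <;> simp [mul_comm]
  have e2 : ∀ t₁ t₂ : ℝ, x + h • (!₂[t₁, 0, 0] : E3) + t₂ • (h • EuclideanSpace.single 1 (1 : ℝ))
      = x + h • (!₂[t₁, t₂, 0] : E3) := by
    intro t₁ t₂; ext i; fin_cases i <;> simp [mul_comm]
  have e3 : ∀ t₁ t₂ t₃ : ℝ, x + h • (!₂[t₁, t₂, 0] : E3) + t₃ • (h • EuclideanSpace.single 2 (1 : ℝ))
      = x + h • (!₂[t₁, t₂, t₃] : E3) := by
    intro t₁ t₂ t₃; ext i; fin_cases i <;> simp [mul_comm]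
  have l1 : ∀ j, a j x ≤ ∫⁻ t in Set.Icc (0 : ℝ) 1,
      (a j (x + h • (!₂[t, 0, 0] : E3)) + H * a (j + 1) (x + h • (!₂[t, 0, 0] : E3))) := by
    intro j
    have := line j x 0 (fun t ht => by rw [e1]; exact hx t ht 0 h0 0 h0)
    simpa only [e1] using this
  have l2 : ∀ j, ∀ t₁ ∈ Set.Icc (0 : ℝ) 1, a j (x + h • (!₂[t₁, 0, 0] : E3)) ≤
      ∫⁻ t in Set.Icc (0 : ℝ) 1,
      (a j (x + h • (!₂[t₁, t, 0] : E3)) + H * a (j + 1) (x + h • (!₂[t₁, t, 0] : E3))) := by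
    intro j t₁ h₁
    have := line j (x + h • (!₂[t₁, 0, 0] : E3)) 1
      (fun t ht => by rw [e2]; exact hx t₁ h₁ t ht 0 h0)
    simpa only [e2] using this
  have l3 : ∀ j, ∀ t₁ ∈ Set.Icc (0 : ℝ) 1, ∀ t₂ ∈ Set.Icc (0 : ℝ) 1,
      a j (x + h • (!₂[t₁, t₂, 0] : E3)) ≤ ∫⁻ t in Set.Icc (0 : ℝ) 1,
      (a j (x + h • (!₂[t₁, t₂, t] : E3)) + H * a (j + 1) (x + h • (!₂[t₁, t₂, t] : E3))) := by
    intro j t₁ h₁ t₂ h₂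
    have := line j (x + h • (!₂[t₁, t₂, 0] : E3)) 2
      (fun t ht => by rw [e3]; exact hx t₁ h₁ t₂ h₂ t ht)
    simpa only [e3] using this
  have hmul : ∀ (c : ℝ≥0∞) (g : ℝ → ℝ≥0∞), c * ∫⁻ t in Set.Icc (0 : ℝ) 1, g t
      ≤ ∫⁻ t in Set.Icc (0 : ℝ) 1, c * g t := fun c g => lintegral_const_mul_le _ _
  refine (l1 k).trans (setLIntegral_mono' measurableSet_Icc fun t₁ h₁ => ?_)
  refine (add_le_add (l2 k t₁ h₁) ((mul_le_mul_right (l2 (k + 1) t₁ h₁) H).trans (hmul _ _))).trans ?_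
  refine (le_lintegral_add _ _).trans (setLIntegral_mono' measurableSet_Icc fun t₂ h₂ => ?_)
  have key : ∀ j, a j (x + h • (!₂[t₁, t₂, 0] : E3)) + H * a (j + 1) (x + h • (!₂[t₁, t₂, 0] : E3))
      ≤ ∫⁻ t in Set.Icc (0 : ℝ) 1, (a j (x + h • (!₂[t₁, t₂, t] : E3))
        + H * a (j + 1) (x + h • (!₂[t₁, t₂, t] : E3))
        + H * (a (j + 1) (x + h • (!₂[t₁, t₂, t] : E3))
          + H * a (j + 2) (x + h • (!₂[t₁, t₂, t] : E3)))) := by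
    intro j
    refine (add_le_add (l3 j t₁ h₁ t₂ h₂)
      ((mul_le_mul_right (l3 (j + 1) t₁ h₁ t₂ h₂) H).trans (hmul _ _))).trans ?_
    exact le_lintegral_add _ _
  refine (add_le_add (key k) ((mul_le_mul_right (key (k + 1)) H).trans (hmul _ _))).trans ?_
  refine (le_lintegral_add _ _).trans (setLIntegral_mono' measurableSet_Icc fun t₃ h₃ => ?_)
  have hre : ∀ j y, a j y = ENNReal.ofReal ‖iteratedFDeriv ℝ j f y‖ := fun j y =>
    (ofReal_norm _).symm
  simp only [hre, hH]
  simp only [← ENNReal.ofReal_mul hh.le]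
  rw [← ENNReal.ofReal_add (by positivity) (by positivity)]
  rw [← ENNReal.ofReal_add (by positivity) (by positivity)]
  rw [← ENNReal.ofReal_mul hh.le]
  rw [← ENNReal.ofReal_add (by positivity) (by positivity)]
  rw [← ENNReal.ofReal_add (by positivity) (by positivity)]
  rw [← ENNReal.ofReal_mul hh.le]
  rw [← ENNReal.ofReal_add (by positivity) (by positivity)]
  rw [← ENNReal.ofReal_mul hh.le]
  rw [← ENNReal.ofReal_add (by positivity) (by positivity)]
  refine ENNReal.ofReal_le_ofReal ?_
  simp only [Finset.sum_range_succ, Finset.sum_range_zero, pow_zero, pow_one, mul_one, add_zero,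
    zero_add]
  have n0 := norm_nonneg (iteratedFDeriv ℝ k f (x + h • (!₂[t₁, t₂, t₃] : E3)))
  have n3 := mul_nonneg (pow_nonneg hh.le 3)
    (norm_nonneg (iteratedFDeriv ℝ (k + 3) f (x + h • (!₂[t₁, t₂, t₃] : E3))))
  have c1 : ‖iteratedFDeriv ℝ (k + 1 + 1) f (x + h • (!₂[t₁, t₂, t₃] : E3))‖
    = ‖iteratedFDeriv ℝ (k + 2) f (x + h • (!₂[t₁, t₂, t₃] : E3))‖ := rfl
  have c2 : ‖iteratedFDeriv ℝ (k + 1 + 2) f (x + h • (!₂[t₁, t₂, t₃] : E3))‖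
    = ‖iteratedFDeriv ℝ (k + 3) f (x + h • (!₂[t₁, t₂, t₃] : E3))‖ := rfl
  have c0 : ‖iteratedFDeriv ℝ (k + 0) f (x + h • (!₂[t₁, t₂, t₃] : E3))‖
    = ‖iteratedFDeriv ℝ k f (x + h • (!₂[t₁, t₂, t₃] : E3))‖ := rfl
  rw [c0, c1, c2]
  nlinarith [n0, n3]

set_option maxHeartbeats 800000 in
/-- Weighted Sobolev bounds of all orders give pointwise decay of all derivatives. -/
lemma decays_pointwise {f : E3 → ℝ} {R ρ δ : ℝ} (hR : 0 < R) (hRρ : R < ρ)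
    (hf : ContDiffOn ℝ ∞ f {y : E3 | R < ‖y‖}) (hd : DecaysInfty ρ δ f) (k : ℕ) :
    ∃ C : ℝ, 0 ≤ C ∧ ∀ y : E3, 4 * ρ ≤ ‖y‖ → ‖iteratedFDeriv ℝ k f y‖ ≤ C * ‖y‖ ^ (δ - k) := by
  set U : Set E3 := {y : E3 | ρ < ‖y‖} with hUdef
  have hU : IsOpen U := isOpen_lt continuous_const continuous_norm
  have hfU : ContDiffOn ℝ ∞ f U := hf.mono fun y hy => hRρ.trans hy
  set w : ℕ → E3 → ℝ := fun i y =>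
    ‖iteratedFDeriv ℝ (k + i) f y‖ ^ 2 * ‖y‖ ^ (-2 * (δ - (k + i : ℕ)) - 3) with hw
  have hw0 : ∀ i y, 0 ≤ w i y := fun i y => by positivity
  set W : E3 → ℝ≥0∞ := U.indicator fun y => ENNReal.ofReal (∑ i ∈ Finset.range 4, w i y) with hW
  have hwc : ∀ i, ContinuousOn (w i) U := by
    intro i y hy
    have hy0 : ‖y‖ ≠ 0 := ((hR.trans hRρ).trans hy).ne'
    have h1 : ContinuousAt (iteratedFDeriv ℝ (k + i) f) y :=
      ((hfU.contDiffAt (hU.mem_nhds hy)).iteratedFDeriv_right (m := 0)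
        (by exact_mod_cast le_top)).continuousAt
    exact ((h1.norm.pow 2).mul (continuous_norm.continuousAt.rpow_const (Or.inl hy0))).continuousWithinAt
  have hWm : Measurable W := by
    classical
    rw [hW, ← Set.piecewise_eq_indicator]
    refine ContinuousOn.measurable_piecewise ?_ continuousOn_const hU.measurableSet
    exact ENNReal.continuous_ofReal.comp_continuousOn (continuousOn_finsetSum _ fun i _ => hwc i)
  set I := ∫⁻ z, W z with hI
  have hIfin : I < ⊤ := by
    rw [hI, hW, lintegral_indicator hU.measurableSet]
    have h1 : IntegrableOn (fun y => ∑ i ∈ Finset.range 4, w i y) U :=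
      integrable_finsetSum _ fun i _ => hd (k + i)
    exact h1.lintegral_lt_top
  set M : ℝ := ∑ i ∈ Finset.range 4, (2 : ℝ) ^ |-2 * (δ - (k + i : ℕ)) - 3| with hM
  have hM0 : 0 ≤ M := Finset.sum_nonneg fun i _ => by positivity
  -- A cube of side r/4 with corner y stays where r/2 ≤ |z| ≤ 2r, inside the domain since r ≥ 4ρ.
  -- The 12 collects the four constant terms of `weighted_young` with coefficient 3, and 64 = 4³
  -- comes from the volume of the cube.
  refine ⟨12 + 3 * M * 64 * I.toReal, by positivity, fun y hy => ?_⟩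
  have hρ := hR.trans hRρ
  have hr : 0 < ‖y‖ := by linarith
  set r := ‖y‖ with hrdef
  have hz : ∀ t₁ ∈ Set.Icc (0 : ℝ) 1, ∀ t₂ ∈ Set.Icc (0 : ℝ) 1, ∀ t₃ ∈ Set.Icc (0 : ℝ) 1,
      r / 2 ≤ ‖y + (r / 4) • (!₂[t₁, t₂, t₃] : E3)‖ ∧
        ‖y + (r / 4) • (!₂[t₁, t₂, t₃] : E3)‖ ≤ 2 * r := by
    intro t₁ h₁ t₂ h₂ t₃ h₃
    have n1 : ‖(r / 4) • (!₂[t₁, t₂, t₃] : E3)‖ ≤ r / 2 := by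
      rw [norm_smul, Real.norm_of_nonneg (by positivity)]
      nlinarith [norm_vec3_le h₁ h₂ h₃]
    have n2 := norm_sub_norm_le y (-((r / 4) • (!₂[t₁, t₂, t₃] : E3)))
    rw [sub_neg_eq_add, norm_neg] at n2
    have n3 := norm_add_le y ((r / 4) • (!₂[t₁, t₂, t₃] : E3))
    constructor <;> linarith
  have hzU : ∀ t₁ ∈ Set.Icc (0 : ℝ) 1, ∀ t₂ ∈ Set.Icc (0 : ℝ) 1, ∀ t₃ ∈ Set.Icc (0 : ℝ) 1,
      y + (r / 4) • (!₂[t₁, t₂, t₃] : E3) ∈ U := fun t₁ h₁ t₂ h₂ t₃ h₃ => by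
    have := (hz t₁ h₁ t₂ h₂ t₃ h₃).1
    show ρ < _
    linarith
  have h1 := sobolev_cube hU hfU k (h := r / 4) (by positivity) hzU
  have hp := Real.rpow_pos_of_pos hr (δ - k)
  have h2 : ∀ z : E3, z ∈ U → r / 2 ≤ ‖z‖ → ‖z‖ ≤ 2 * r →
      ENNReal.ofReal (∑ i ∈ Finset.range 4, 3 * (r / 4) ^ i * ‖iteratedFDeriv ℝ (k + i) f z‖) ≤
        ENNReal.ofReal (12 * r ^ (δ - k)) + ENNReal.ofReal (3 * M * r ^ 3 * r ^ (δ - k)) * W z := by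
    intro z hzU h3 h4
    rw [hW, Set.indicator_of_mem hzU, ← ENNReal.ofReal_mul (by positivity),
      ← ENNReal.ofReal_add (by positivity)
        (mul_nonneg (by positivity) (Finset.sum_nonneg fun i _ => hw0 i z))]
    refine ENNReal.ofReal_le_ofReal ?_
    have h5 : ∀ i ∈ Finset.range 4, 3 * (r / 4) ^ i * ‖iteratedFDeriv ℝ (k + i) f z‖ ≤
        3 * r ^ (δ - k) + 3 * M * r ^ 3 * r ^ (δ - k) * w i z := by
      intro i hi
      have y1 := weighted_young (p := δ - (k + i : ℕ)) (i := i)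
        (norm_nonneg (iteratedFDeriv ℝ (k + i) f z)) hr h3 h4
      have y2 : (2 : ℝ) ^ |-2 * (δ - (k + i : ℕ)) - 3| ≤ M :=
        Finset.single_le_sum (f := fun i : ℕ => (2 : ℝ) ^ |-2 * (δ - (k + i : ℕ)) - 3|)
          (fun i _ => by positivity) hi
      have y3 : δ - (k + i : ℕ) + i = δ - k := by push_cast; ring
      rw [y3] at y1
      have y4 : (r / 4) ^ i ≤ r ^ i := by gcongr; linarith
      have y5 := norm_nonneg (iteratedFDeriv ℝ (k + i) f z)
      have y6 : r ^ 3 * w i z * (2 : ℝ) ^ |-2 * (δ - (k + i : ℕ)) - 3| ≤ r ^ 3 * w i z * M :=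
        mul_le_mul_of_nonneg_left y2 (mul_nonneg (by positivity) (hw0 i z))
      calc 3 * (r / 4) ^ i * ‖iteratedFDeriv ℝ (k + i) f z‖
          ≤ 3 * (r ^ i * ‖iteratedFDeriv ℝ (k + i) f z‖) := by
            rw [mul_assoc]; gcongr
        _ ≤ 3 * (r ^ (δ - k) * (1 + r ^ 3 * w i z * (2 : ℝ) ^ |-2 * (δ - (k + i : ℕ)) - 3|)) := by
            refine mul_le_mul_of_nonneg_left (y1.trans_eq ?_) (by norm_num)
            rw [hw]; ring
        _ ≤ 3 * (r ^ (δ - k) * (1 + r ^ 3 * w i z * M)) := by gcongr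
        _ = _ := by ring
    refine (Finset.sum_le_sum h5).trans_eq ?_
    rw [Finset.sum_add_distrib, Finset.sum_const, Finset.card_range]
    simp only [nsmul_eq_mul]
    rw [← Finset.mul_sum]
    push_cast
    ring
  set c1 := ENNReal.ofReal (12 * r ^ (δ - k)) with hc1
  set c2 := ENNReal.ofReal (3 * M * r ^ 3 * r ^ (δ - k)) with hc2
  have h3 : ‖iteratedFDeriv ℝ k f y‖ₑ ≤ c1 + c2 * (ENNReal.ofReal ((r / 4) ^ 3)⁻¹ * I) := by
    rw [hI, ← lintegral_affine_e3 y (by positivity : 0 < r / 4)]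
    refine h1.trans ?_
    have hGm : Measurable fun z : E3 => c2 * W (y + (r / 4) • z) :=
      (hWm.comp (by fun_prop)).const_mul _
    calc _ ≤ ∫⁻ t₁ in Set.Icc (0 : ℝ) 1, ∫⁻ t₂ in Set.Icc (0 : ℝ) 1, ∫⁻ t₃ in Set.Icc (0 : ℝ) 1,
          (c1 + c2 * W (y + (r / 4) • (!₂[t₁, t₂, t₃] : E3))) := by
          refine setLIntegral_mono' measurableSet_Icc fun t₁ h₁ => ?_
          refine setLIntegral_mono' measurableSet_Icc fun t₂ h₂ => ?_
          refine setLIntegral_mono' measurableSet_Icc fun t₃ h₃ => ?_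
          exact h2 _ (hzU t₁ h₁ t₂ h₂ t₃ h₃) (hz t₁ h₁ t₂ h₂ t₃ h₃).1 (hz t₁ h₁ t₂ h₂ t₃ h₃).2
      _ = c1 + ∫⁻ t₁ in Set.Icc (0 : ℝ) 1, ∫⁻ t₂ in Set.Icc (0 : ℝ) 1, ∫⁻ t₃ in Set.Icc (0 : ℝ) 1,
          c2 * W (y + (r / 4) • (!₂[t₁, t₂, t₃] : E3)) := by
          simp only [lintegral_add_left measurable_const, setLIntegral_const, Real.volume_Icc,
            sub_zero, ENNReal.ofReal_one, mul_one]
      _ ≤ c1 + ∫⁻ z, c2 * W (y + (r / 4) • z) := by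
          gcongr
          exact lintegral_e3_iterated hGm
      _ = _ := by 
          have hWm' : Measurable fun z : E3 => W (y + (r / 4) • z) := hWm.comp (by fun_prop)
          rw [lintegral_const_mul _ hWm']
  have h4 : ‖iteratedFDeriv ℝ k f y‖ₑ ≤
      ENNReal.ofReal ((12 + 3 * M * 64 * I.toReal) * r ^ (δ - k)) := by
    refine h3.trans_eq ?_
    rw [← ENNReal.ofReal_toReal hIfin.ne, ← ENNReal.ofReal_mul (by positivity), hc1, hc2,
      ← ENNReal.ofReal_mul (by positivity), ← ENNReal.ofReal_add (by positivity) (by positivity),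
      ENNReal.toReal_ofReal ENNReal.toReal_nonneg]
    congr 1
    generalize r ^ (δ - (k : ℝ)) = q
    generalize I.toReal = c
    have e : r ^ 3 * ((r / 4) ^ 3)⁻¹ = 64 := by
      rw [div_pow, inv_div, mul_div_assoc', mul_comm, mul_div_assoc, div_self (pow_pos hr 3).ne']
      norm_num
    linear_combination (3 * M * q * c) * e
  rw [← ofReal_norm] at h4
  exact (ENNReal.ofReal_le_ofReal_iff (by positivity)).1 h4

/-! ### Weighted bounds on partial derivatives at a point -/

section JetBounds

open Filter Topology

/-- The partial derivative `∂_i f`. -/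
def pd (i : Fin 3) (f : E3 → ℂ) (y : E3) : ℂ := fderiv ℝ f y (EuclideanSpace.single i (1 : ℝ))

/-- The partial derivatives of order `j ≤ N` of `f` at `y` are bounded by `B r^{-j}`. -/
def JetBound : ℕ → ℝ → ℝ → (E3 → ℂ) → E3 → Prop
  | 0, _, B, f, y => ‖f y‖ ≤ B
  | N + 1, r, B, f, y => ‖f y‖ ≤ B ∧ ∀ i, JetBound N r (B / r) (pd i f) y

lemma pd_contDiffAt {f : E3 → ℂ} {y : E3} (hf : ContDiffAt ℝ ∞ f y) (i : Fin 3) :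
    ContDiffAt ℝ ∞ (pd i f) y :=
  (hf.fderiv_right (m := ∞) (by simp)).clm_apply contDiffAt_const

lemma eventually_differentiableAt {f : E3 → ℂ} {y : E3} (hf : ContDiffAt ℝ ∞ f y) :
    ∀ᶠ z in 𝓝 y, DifferentiableAt ℝ f z :=
  ((hf.of_le (m := 1) (by exact_mod_cast le_top)).eventually (by simp)).mono
    fun _ h => h.differentiableAt (by simp)

lemma pd_congr {f g : E3 → ℂ} {y : E3} (h : f =ᶠ[𝓝 y] g) (i : Fin 3) :
    pd i f =ᶠ[𝓝 y] pd i g :=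
  (h.fderiv (𝕜 := ℝ)).mono fun z hz => by simp only [pd, hz]

lemma pd_add {f g : E3 → ℂ} {y : E3} (hf : ContDiffAt ℝ ∞ f y) (hg : ContDiffAt ℝ ∞ g y)
    (i : Fin 3) : pd i (fun z => f z + g z) =ᶠ[𝓝 y] fun z => pd i f z + pd i g z := by
  filter_upwards [eventually_differentiableAt hf, eventually_differentiableAt hg] with z h1 h2
  simp only [pd, fderiv_fun_add h1 h2, ContinuousLinearMap.add_apply]

lemma pd_mul {f g : E3 → ℂ} {y : E3} (hf : ContDiffAt ℝ ∞ f y) (hg : ContDiffAt ℝ ∞ g y)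
    (i : Fin 3) : pd i (fun z => f z * g z) =ᶠ[𝓝 y] fun z => f z * pd i g z + pd i f z * g z := by
  filter_upwards [eventually_differentiableAt hf, eventually_differentiableAt hg] with z h1 h2
  simp only [pd, fderiv_fun_mul h1 h2, ContinuousLinearMap.add_apply,
    ContinuousLinearMap.smul_apply, smul_eq_mul]
  ring

lemma pd_const (c : ℂ) (i : Fin 3) : pd i (fun _ => c) = fun _ => 0 := by
  funext z; simp [pd]

lemma pd_const_mul {f : E3 → ℂ} {y : E3} (c : ℂ) (hf : ContDiffAt ℝ ∞ f y)
    (i : Fin 3) : pd i (fun z => c * f z) =ᶠ[𝓝 y] fun z => c * pd i f z := by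
  refine (pd_mul contDiffAt_const hf i).trans (Eventually.of_forall fun z => ?_)
  simp [pd_const]

lemma pd_comm {f : E3 → ℂ} {y : E3} (hf : ContDiffAt ℝ 2 f y) (i j : Fin 3) :
    pd i (pd j f) y = pd j (pd i f) y := by
  have h1 := (hf.fderiv_right (m := 1) (by norm_num)).differentiableAt (by simp)
  have e : ∀ a b, pd a (pd b f) y
      = fderiv ℝ (fderiv ℝ f) y (EuclideanSpace.single a 1) (EuclideanSpace.single b 1) := by
    intro a b
    have h2 : fderiv ℝ (fun z => fderiv ℝ f z (EuclideanSpace.single b (1 : ℝ))) y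
      = (fderiv ℝ (fderiv ℝ f) y).flip (EuclideanSpace.single b (1 : ℝ)) := by
      rw [fderiv_clm_apply h1 (differentiableAt_const _)]
      simp
    unfold pd
    rw [h2]
    rfl
  rw [e, e]
  exact (hf.isSymmSndFDerivAt (by simp)).eq _ _

namespace JetBound

variable {N : ℕ} {r A B : ℝ} {f g : E3 → ℂ} {y : E3}

lemma norm_le (h : JetBound N r B f y) : ‖f y‖ ≤ B := by
  cases N
  · exact h
  · exact h.1

lemma nonneg (h : JetBound N r B f y) : 0 ≤ B := (norm_nonneg _).trans h.norm_le

lemma congr (h : JetBound N r B f y) (e : g =ᶠ[𝓝 y] f) : JetBound N r B g y := by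
  induction N generalizing f g B with
  | zero => exact (congrArg norm e.eq_of_nhds).trans_le h
  | succ N ih => exact ⟨(congrArg norm e.eq_of_nhds).trans_le h.1, fun i => ih (h.2 i) (pd_congr e i)⟩

lemma mono (h : JetBound N r A f y) (hr : 0 < r) (hAB : A ≤ B) : JetBound N r B f y := by
  induction N generalizing f A B with
  | zero => exact le_trans h hAB
  | succ N ih => exact ⟨h.1.trans hAB, fun i => ih (h.2 i) (by gcongr)⟩

lemma pred (h : JetBound (N + 1) r B f y) : JetBound N r B f y := by
  induction N generalizing f B with
  | zero => exact h.1
  | succ N ih => exact ⟨h.1, fun i => ih (h.2 i)⟩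

lemma const (c : ℂ) (hr : 0 < r) : JetBound N r ‖c‖ (fun _ => c) y := by
  induction N generalizing c with
  | zero => exact le_rfl
  | succ N ih =>
    refine ⟨le_rfl, fun i => ?_⟩
    rw [pd_const]
    exact (ih 0).mono hr (by simp; positivity)

lemma add (hf : ContDiffAt ℝ ∞ f y) (hg : ContDiffAt ℝ ∞ g y) (h1 : JetBound N r A f y)
    (h2 : JetBound N r B g y) : JetBound N r (A + B) (fun z => f z + g z) y := by
  induction N generalizing f g A B with
  | zero => exact (norm_add_le _ _).trans (add_le_add h1 h2)
  | succ N ih =>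
    refine ⟨(norm_add_le _ _).trans (add_le_add h1.1 h2.1), fun i => ?_⟩
    refine JetBound.congr ?_ (pd_add hf hg i)
    rw [add_div]
    exact ih (pd_contDiffAt hf i) (pd_contDiffAt hg i) (h1.2 i) (h2.2 i)

/-- Leibniz: each derivative splits the product in two, whence the factor 2^N. The bound scales
correctly because derivatives of order j carry r^{−j}. -/
lemma mul (hr : 0 < r) (hf : ContDiffAt ℝ ∞ f y) (hg : ContDiffAt ℝ ∞ g y)
    (h1 : JetBound N r A f y) (h2 : JetBound N r B g y) :
    JetBound N r (2 ^ N * (A * B)) (fun z => f z * g z) y := by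
  induction N generalizing f g A B with
  | zero =>
    simp only [JetBound, norm_mul, pow_zero, one_mul]
    exact mul_le_mul h1 h2 (norm_nonneg _) h1.nonneg
  | succ N ih =>
    have hA := h1.nonneg
    have hB := h2.nonneg
    refine ⟨?_, fun i => ?_⟩
    · rw [norm_mul]
      calc ‖f y‖ * ‖g y‖ ≤ A * B := mul_le_mul h1.1 h2.1 (norm_nonneg _) hA
        _ = 1 * (A * B) := (one_mul _).symm
        _ ≤ _ := by gcongr; exact one_le_pow₀ (by norm_num)
    refine JetBound.congr ?_ (pd_mul hf hg i)
    have e1 := ih hf (pd_contDiffAt hg i) h1.pred (h2.2 i)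
    have e2 := ih (pd_contDiffAt hf i) hg (h1.2 i) h2.pred
    refine (add (hf.mul (pd_contDiffAt hg i)) ((pd_contDiffAt hf i).mul hg) e1 e2).mono hr
      (le_of_eq ?_)
    ring

lemma const_mul (c : ℂ) (hf : ContDiffAt ℝ ∞ f y) (h1 : JetBound N r B f y) :
    JetBound N r (‖c‖ * B) (fun z => c * f z) y := by
  induction N generalizing f B with
  | zero =>
    simp only [JetBound, norm_mul]
    exact mul_le_mul_of_nonneg_left h1 (norm_nonneg _)
  | succ N ih =>
    refine ⟨?_, fun i => ?_⟩
    · rw [norm_mul]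
      exact mul_le_mul_of_nonneg_left h1.1 (norm_nonneg _)
    · refine JetBound.congr ?_ (pd_const_mul c hf i)
      rw [mul_div_assoc]
      exact ih (pd_contDiffAt hf i) (h1.2 i)

lemma neg (hf : ContDiffAt ℝ ∞ f y) (h1 : JetBound N r B f y) :
    JetBound N r B (fun z => -f z) y := by
  simpa using h1.const_mul (-1) hf

lemma sub (hf : ContDiffAt ℝ ∞ f y) (hg : ContDiffAt ℝ ∞ g y) (h1 : JetBound N r A f y)
    (h2 : JetBound N r B g y) : JetBound N r (A + B) (fun z => f z - g z) y := by
  simpa [sub_eq_add_neg] using h1.add hf hg.neg (h2.neg hg)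

lemma sum {F : Fin 3 → E3 → ℂ} (hF : ∀ m, ContDiffAt ℝ ∞ (F m) y)
    (h : ∀ m, JetBound N r B (F m) y) : JetBound N r (3 * B) (fun z => ∑ m, F m z) y := by
  simp only [Fin.sum_univ_three]
  have := (add ((hF 0).add (hF 1)) (hF 2) (add (hF 0) (hF 1) (h 0) (h 1)) (h 2))
  rwa [show B + B + B = 3 * B by ring] at this

lemma of_iteratedFDeriv (hr : 0 < r) (hf : ContDiffAt ℝ ∞ f y)
    (h : ∀ j ≤ N, r ^ j * ‖iteratedFDeriv ℝ j f y‖ ≤ B) : JetBound N r B f y := by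
  induction N generalizing f B with
  | zero => simpa [JetBound] using h 0 le_rfl
  | succ N ih =>
    refine ⟨by simpa using h 0 (Nat.zero_le _), fun i => ih (pd_contDiffAt hf i) fun j hj => ?_⟩
    have h1 : ‖iteratedFDeriv ℝ j (pd i f) y‖ ≤ ‖iteratedFDeriv ℝ (j + 1) f y‖ := by
      have e : pd i f = (ContinuousLinearMap.apply ℝ ℂ (EuclideanSpace.single i (1 : ℝ) : E3)) ∘
        fderiv ℝ f := rfl
      rw [e, ContinuousLinearMap.iteratedFDeriv_comp_left _
        (hf.fderiv_right (m := ∞) (by simp)) (by exact_mod_cast le_top)]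
      refine (ContinuousLinearMap.norm_compContinuousMultilinearMap_le _ _).trans ?_
      rw [norm_iteratedFDeriv_fderiv]
      refine mul_le_of_le_one_left (norm_nonneg _) ?_
      refine ContinuousLinearMap.opNorm_le_bound _ zero_le_one fun L => ?_
      rw [one_mul]
      exact (L.le_opNorm _).trans (by simp)
    rw [le_div_iff₀ hr]
    calc r ^ j * ‖iteratedFDeriv ℝ j (pd i f) y‖ * r
        ≤ r ^ j * ‖iteratedFDeriv ℝ (j + 1) f y‖ * r := by gcongr
      _ = r ^ (j + 1) * ‖iteratedFDeriv ℝ (j + 1) f y‖ := by ring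
      _ ≤ B := h _ (by omega)

end JetBound

/-! ### The flat conformal Killing operator is of finite type -/

/-- The third derivatives of a vector field are determined by the second derivatives of its
conformal Killing form. -/
lemma norm_third_le {T : Fin 3 → Fin 3 → Fin 3 → Fin 3 → ℂ} {M : ℝ}
    (h1 : ∀ a b i j, T a b i j = T b a i j) (h2 : ∀ a b i j, T a b i j = T a i b j)
    (h : ∀ a b i j, ‖T a b i j + T a b j i - (if i = j then 1 else 0) * (2 * T a b 0 0)‖ ≤ M)
    (a b i j : Fin 3) : ‖T a b i j‖ ≤ 60 * M := by
  set δ : Fin 3 → Fin 3 → ℂ := fun i j => if i = j then 1 else 0 with hδ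
  have hδs : ∀ i j, δ i j = δ j i := fun i j => by simp only [hδ, eq_comm]
  have hM : 0 ≤ M := (norm_nonneg _).trans (h 0 0 0 0)
  set f : Fin 3 → Fin 3 → Fin 3 → Fin 3 → ℂ :=
    fun a b i j => T a b i j + T a b j i - δ i j * (2 * T a b 0 0) with hf
  have hfM : ∀ a b i j, ‖f a b i j‖ ≤ M := h
  set ψ : Fin 3 → Fin 3 → ℂ := fun a b => T a b 0 0 with hψ
  -- T stands for ∂_a∂_b∂_i Z_j, symmetric in a, b, i. As for Christoffel symbols, this combination
  -- of the Killing forms isolates T itself, up to terms in the second derivatives ψ of the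
  -- conformal factor.
  set k : Fin 3 → Fin 3 → Fin 3 → Fin 3 → ℂ :=
    fun a b i j => (1 / 2 : ℂ) * (f a b i j + f a i b j - f a j b i) with hk
  have hkM : ∀ a b i j, ‖k a b i j‖ ≤ 3 / 2 * M := by
    intro a b i j
    rw [hk]
    have e1 := norm_sub_le (f a b i j + f a i b j) (f a j b i)
    have e2 := norm_add_le (f a b i j) (f a i b j)
    have e3 := hfM a b i j
    have e4 := hfM a i b j
    have e5 := hfM a j b i
    simp only [norm_mul]
    norm_num
    linarith
  have hT : ∀ a b i j, T a b i j = k a b i j + δ i j * ψ a b + δ b j * ψ a i - δ b i * ψ a j := by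
    intro a b i j
    simp only [hk, hf, hψ]
    linear_combination (1 / 2) * h2 a b i j - (1 / 2) * h2 a b j i - (1 / 2) * h2 a i j b
  have hψs : ∀ a b, ψ a b = ψ b a := fun a b => h1 a b 0 0
  have hψM : ∀ a b, ‖ψ a b‖ ≤ 12 * M := by
    -- Symmetry of T in a and b is an integrability condition on ψ. Evaluated on distinct indices it
    -- bounds every off-diagonal ψ_{bc} and every sum ψ_{aa} + ψ_{bb}; three indices are needed for
    -- both the former and for solving the latter for ψ_{aa}. In dimension two this fails.
    have key : ∀ a b i j, δ b j * ψ a i - δ b i * ψ a j - δ a j * ψ b i + δ a i * ψ b j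
        = k b a i j - k a b i j := by
      intro a b i j
      linear_combination hT b a i j - hT a b i j - h1 b a i j - δ i j * hψs a b
    have g : ∀ a b i j, ‖k b a i j - k a b i j‖ ≤ 3 * M := fun a b i j =>
      (norm_sub_le _ _).trans (by linarith [hkM b a i j, hkM a b i j])
    have diag : ∀ a b, a ≠ b → ‖ψ a a + ψ b b‖ ≤ 3 * M := by
      intro a b hab
      have := key a b a b
      simp only [hδ, hab, hab.symm, if_true, if_false] at this
      rw [show ψ a a + ψ b b = k b a a b - k a b a b by linear_combination this]
      exact g _ _ _ _
    have off : ∀ a b c, a ≠ b → a ≠ c → b ≠ c → ‖ψ b c‖ ≤ 3 * M := by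
      intro a b c hab hac hbc
      have := key a b a c
      simp only [hδ, hab, hab.symm, hac, hbc, if_true, if_false] at this
      rw [show ψ b c = k b a a c - k a b a c by linear_combination this]
      exact g _ _ _ _
    have tri : ∀ a b c, a ≠ b → a ≠ c → b ≠ c → ‖ψ a a‖ ≤ 12 * M := by
      intro a b c hab hac hbc
      have e : ψ a a = (1 / 2 : ℂ) * ((ψ a a + ψ b b) + (ψ a a + ψ c c) - (ψ b b + ψ c c)) := by ring
      rw [e, norm_mul]
      have e1 := norm_sub_le ((ψ a a + ψ b b) + (ψ a a + ψ c c)) (ψ b b + ψ c c)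
      have e2 := norm_add_le (ψ a a + ψ b b) (ψ a a + ψ c c)
      have e3 := diag a b hab
      have e4 := diag a c hac
      have e5 := diag b c hbc
      norm_num
      linarith
    intro a b
    rcases eq_or_ne a b with rfl | hab
    · obtain ⟨b, c, hb, hc, hbc⟩ : ∃ b c, a ≠ b ∧ a ≠ c ∧ b ≠ c := by
        revert a; decide
      exact tri a b c hb hc hbc
    · obtain ⟨c, hc, hc'⟩ : ∃ c, c ≠ a ∧ c ≠ b := by revert a b; decide
      linarith [off c a b hc hc' hab]
  have hδn : ∀ i j, ‖δ i j‖ ≤ 1 := by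
    intro i j; simp only [hδ]; split_ifs <;> simp
  have hp : ∀ i j a b, ‖δ i j * ψ a b‖ ≤ 12 * M := by
    intro i j a b
    rw [norm_mul]
    exact (mul_le_mul (hδn i j) (hψM a b) (norm_nonneg _) zero_le_one).trans_eq (one_mul _)
  rw [hT]
  have e1 := norm_sub_le (k a b i j + δ i j * ψ a b + δ b j * ψ a i) (δ b i * ψ a j)
  have e2 := norm_add_le (k a b i j + δ i j * ψ a b) (δ b j * ψ a i)
  have e3 := norm_add_le (k a b i j) (δ i j * ψ a b)
  linarith [hp i j a b, hp b j a i, hp b i a j, hkM a b i j]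

end JetBounds

/-! ### Third derivatives of solutions near the flat model -/

section ThirdOrder

open Filter Topology

lemma pd_comm_eventually {f : E3 → ℂ} {y : E3} (hf : ContDiffAt ℝ ∞ f y) (i j : Fin 3) :
    pd i (pd j f) =ᶠ[𝓝 y] pd j (pd i f) :=
  ((hf.of_le (m := 2) ENat.LEInfty.out).eventually (by simp)).mono
    fun _ h => pd_comm h i j

lemma JetBound.succ_three {r n B : ℝ} {f : E3 → ℂ} {y : E3} (hr : 0 < r) (hn : JetBound 2 r n f y)
    (hB : 0 ≤ B) (h : ∀ c b a, r ^ 3 * ‖pd c (pd b (pd a f)) y‖ ≤ B) :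
    JetBound 3 r (n + B) f y := by
  have h0 := hn.mono hr (le_add_of_nonneg_right hB)
  refine ⟨h0.1, fun a => ⟨(h0.2 a).1, fun b => ⟨(h0.2 a).2 b, fun c => ?_⟩⟩⟩
  show _ ≤ _
  rw [div_div, div_div, le_div_iff₀ (by positivity)]
  have := h c b a
  nlinarith [hn.nonneg]

/-- A vector field whose conformal Killing form, up to small terms of first order, is
proportional to a nearly Euclidean metric has small third derivatives. -/
lemma norm_pd_three_le {r ε n : ℝ} {y : E3} {H : Fin 3 → Fin 3 → E3 → ℂ}
    {A : Fin 3 → Fin 3 → Fin 3 → E3 → ℂ} {Z : Fin 3 → E3 → ℂ} (hr : 0 < r) (hε : 0 ≤ ε)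
    (hε1 : ε ≤ 1 / 45120)
    (cH : ∀ i j, ContDiffAt ℝ ∞ (H i j) y) (cA : ∀ i j p, ContDiffAt ℝ ∞ (A i j p) y)
    (cZ : ∀ m, ContDiffAt ℝ ∞ (Z m) y)
    (hH : ∀ i j, JetBound 2 r ε (H i j) y) (hA : ∀ i j p, JetBound 2 r (ε / r) (A i j p) y)
    (hZ : ∀ m, JetBound 2 r n (Z m) y)
    (heq : ∀ᶠ z in 𝓝 y, ∃ t : ℂ, ∀ i j, ∑ p, A i j p z * Z p z
      + ∑ m, (((if m = j then 1 else 0) + H m j z) * pd i (Z m) z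
        + ((if i = m then 1 else 0) + H i m z) * pd j (Z m) z)
      = t * ((if i = j then 1 else 0) + H i j z)) :
    ∀ c b a k, r ^ 3 * ‖pd c (pd b (pd a (Z k))) y‖ ≤ 45120 * ε * n := by
  -- The largest scaled third derivative B is kept as an unknown. The perturbation terms contain
  -- third derivatives with a factor ε, so B appears on both sides and is absorbed at the end.
  obtain ⟨q, hq⟩ := Finite.exists_max (fun q : Fin 3 × Fin 3 × Fin 3 × Fin 3 =>
    r ^ 3 * ‖pd q.1 (pd q.2.1 (pd q.2.2.1 (Z q.2.2.2))) y‖)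
  set B := r ^ 3 * ‖pd q.1 (pd q.2.1 (pd q.2.2.1 (Z q.2.2.2))) y‖ with hB
  have hB0 : 0 ≤ B := by positivity
  have hn0 : 0 ≤ n := (hZ 0).nonneg
  have hqB : ∀ c b a k, r ^ 3 * ‖pd c (pd b (pd a (Z k))) y‖ ≤ B := fun c b a k => hq (c, b, a, k)
  set P := n + B with hP
  have hP0 : 0 ≤ P := by positivity
  have hZ3 : ∀ m, JetBound 3 r P (Z m) y := fun m =>
    JetBound.succ_three hr (hZ m) hB0 fun c b a => hqB c b a m
  have hdZ : ∀ i m, JetBound 2 r (P / r) (pd i (Z m)) y := fun i m => (hZ3 m).2 i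
  have cdZ : ∀ i m, ContDiffAt ℝ ∞ (pd i (Z m)) y := fun i m => pd_contDiffAt (cZ m) i
  set E : Fin 3 → Fin 3 → E3 → ℂ := fun i j z => ∑ p, A i j p z * Z p z
      + ∑ m, (H m j z * pd i (Z m) z + H i m z * pd j (Z m) z) with hE
  have cAZ : ∀ i j p, ContDiffAt ℝ ∞ (fun z => A i j p z * Z p z) y := fun i j p =>
    (cA i j p).mul (cZ p)
  have cHZ : ∀ i j m, ContDiffAt ℝ ∞
      (fun z => H m j z * pd i (Z m) z + H i m z * pd j (Z m) z) y := fun i j m =>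
    ((cH m j).mul (cdZ i m)).add ((cH i m).mul (cdZ j m))
  have cE1 : ∀ i j, ContDiffAt ℝ ∞ (fun z => ∑ p, A i j p z * Z p z) y := fun i j =>
    ContDiffAt.sum fun p _ => cAZ i j p
  have cE2 : ∀ i j, ContDiffAt ℝ ∞
      (fun z => ∑ m, (H m j z * pd i (Z m) z + H i m z * pd j (Z m) z)) y := fun i j =>
    ContDiffAt.sum fun m _ => cHZ i j m
  have cE : ∀ i j, ContDiffAt ℝ ∞ (E i j) y := fun i j => (cE1 i j).add (cE2 i j)
  have hEb : ∀ i j, JetBound 2 r (36 * (ε * P / r)) (E i j) y := by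
    intro i j
    have b1 := JetBound.sum (cAZ i j) fun p => (hA i j p).mul hr (cA i j p) (cZ p) (hZ3 p).pred
    have b2 := JetBound.sum (cHZ i j) fun m => JetBound.add ((cH m j).mul (cdZ i m))
      ((cH i m).mul (cdZ j m)) ((hH m j).mul hr (cH m j) (cdZ i m) (hdZ i m))
      ((hH i m).mul hr (cH i m) (cdZ j m) (hdZ j m))
    refine (b1.add (cE1 i j) (cE2 i j) b2).mono hr (le_of_eq ?_)
    ring
  set M : Fin 3 → Fin 3 → E3 → ℂ := fun i j z => (pd i (Z j) z + pd j (Z i) z) + E i j z with hM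
  have cS : ∀ i j, ContDiffAt ℝ ∞ (fun z => pd i (Z j) z + pd j (Z i) z) y := fun i j =>
    (cdZ i j).add (cdZ j i)
  have cM : ∀ i j, ContDiffAt ℝ ∞ (M i j) y := fun i j => (cS i j).add (cE i j)
  have hMb : ∀ i j, JetBound 2 r (38 * (P / r)) (M i j) y := by
    intro i j
    refine (((hdZ i j).add (cdZ i j) (cdZ j i) (hdZ j i)).add (cS i j) (cE i j) (hEb i j)).mono hr ?_
    have : ε * P / r ≤ P / r := by
      rw [mul_div_assoc]
      exact mul_le_of_le_one_left (by positivity) (by linarith)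
    linarith
  set δ : Fin 3 → Fin 3 → ℂ := fun i j => if i = j then 1 else 0 with hδ
  set F : Fin 3 → Fin 3 → E3 → ℂ := fun i j z =>
    (pd i (Z j) z + pd j (Z i) z) - δ i j * (2 * pd 0 (Z 0) z) with hF
  -- M_{ij} = t(δ_{ij} + H_{ij}) with t unknown. Since M_{00}H_{ij} − M_{ij}H_{00} = t(H_{ij} −
  -- δ_{ij}H_{00}) = M_{ij} − δ_{ij}M_{00}, the flat conformal Killing form F is expressed without t
  -- and without division; no bound on t is required.
  have hFeq : ∀ i j, F i j =ᶠ[𝓝 y] fun z =>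
      (M 0 0 z * H i j z - M i j z * H 0 0 z) - (E i j z - δ i j * E 0 0 z) := by
    intro i j
    filter_upwards [heq] with z hz
    obtain ⟨t, ht⟩ := hz
    have h1 : ∀ i j, M i j z = t * (δ i j + H i j z) := by
      intro i j
      rw [← ht i j, hM, hE]
      simp only [add_mul, Finset.sum_add_distrib, ite_mul, one_mul, zero_mul, Finset.sum_ite_eq,
        Finset.sum_ite_eq', Finset.mem_univ, if_true]
      ring
    have e1 := h1 i j
    have e2 := h1 0 0
    have e3 : δ 0 0 = 1 := by simp [hδ]
    rw [e3] at e2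
    rw [e1, e2]
    simp only [hM] at e1 e2
    simp only [hF]
    linear_combination e1 - δ i j * e2
  have hFb : ∀ i j, JetBound 2 r (376 * (ε * P / r)) (F i j) y := by
    intro i j
    refine JetBound.congr ?_ (hFeq i j)
    have hδn : ‖δ i j‖ ≤ 1 := by simp only [hδ]; split_ifs <;> simp
    have b1 := (hMb 0 0).mul hr (cM 0 0) (cH i j) (hH i j)
    have b2 := (hMb i j).mul hr (cM i j) (cH 0 0) (hH 0 0)
    have b3 := (hEb 0 0).const_mul (δ i j) (cE 0 0)
    have b4 := (hEb i j).sub (cE i j) (contDiffAt_const.mul (cE 0 0)) b3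
    have b5 := b1.sub ((cM 0 0).mul (cH i j)) ((cM i j).mul (cH 0 0)) b2
    refine (b5.sub (((cM 0 0).mul (cH i j)).sub ((cM i j).mul (cH 0 0)))
      ((cE i j).sub (contDiffAt_const.mul (cE 0 0))) b4).mono hr ?_
    have : ‖δ i j‖ * (36 * (ε * P / r)) ≤ 36 * (ε * P / r) :=
      mul_le_of_le_one_left (by positivity) hδn
    calc _ ≤ 2 ^ 2 * (38 * (P / r) * ε) + 2 ^ 2 * (38 * (P / r) * ε)
          + (36 * (ε * P / r) + 36 * (ε * P / r)) := by gcongr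
      _ = _ := by ring
  have hT : ∀ c b i j, pd c (pd b (pd i (Z j))) y + pd c (pd b (pd j (Z i))) y
      - δ i j * (2 * pd c (pd b (pd 0 (Z 0))) y) = pd c (pd b (F i j)) y := by
    intro c b i j
    have c0 : ContDiffAt ℝ ∞ (fun z => (-(2 * δ i j)) * pd 0 (Z 0) z) y :=
      contDiffAt_const.mul (cdZ 0 0)
    have e0 : F i j = fun z => (pd i (Z j) z + pd j (Z i) z) + (-(2 * δ i j)) * pd 0 (Z 0) z := by
      funext z; simp only [hF]; ring
    have e1 : pd b (F i j) =ᶠ[𝓝 y] fun z => (pd b (pd i (Z j)) z + pd b (pd j (Z i)) z)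
        + (-(2 * δ i j)) * pd b (pd 0 (Z 0)) z := by
      rw [e0]
      filter_upwards [pd_add (cS i j) c0 b, pd_add (cdZ i j) (cdZ j i) b,
        pd_const_mul (-(2 * δ i j)) (cdZ 0 0) b] with z h1 h2 h3
      rw [h1, h2, h3]
    rw [(pd_congr e1 c).eq_of_nhds]
    have p1 := pd_contDiffAt (cdZ i j) b
    have p2 := pd_contDiffAt (cdZ j i) b
    have p3 := pd_contDiffAt (cdZ 0 0) b
    rw [(pd_add (p1.add p2) (contDiffAt_const.mul p3) c).eq_of_nhds,
      (pd_add p1 p2 c).eq_of_nhds, (pd_const_mul _ p3 c).eq_of_nhds]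
    ring
  have hfin := norm_third_le (T := fun c b i j => pd c (pd b (pd i (Z j))) y)
    (M := 376 * (ε * P / r) / r / r)
    (fun a b i j => pd_comm ((cdZ i j).of_le ENat.LEInfty.out) a b)
    (fun a b i j => (pd_congr (pd_comm_eventually (cZ j) b i) a).eq_of_nhds)
    (fun c b i j => by
      rw [hT c b i j]
      exact ((hFb i j).2 b).2 c)
  have hB1 : B ≤ 22560 * ε * P := by
    have := hfin q.1 q.2.1 q.2.2.1 q.2.2.2
    rw [hB]
    calc _ ≤ r ^ 3 * (60 * (376 * (ε * P / r) / r / r)) := by gcongr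
      _ = _ := by field_simp; ring
  intro c b a k
  refine (hqB c b a k).trans ?_
  -- Here 22560 = 60·376, and ε ≤ 1/45120 makes the coefficient of B at most ½.
  have : 22560 * ε * B ≤ 1 / 2 * B := by gcongr; linarith
  rw [hP] at hB1
  nlinarith

end ThirdOrder

/-! ### The third-order estimate for nearly flat data -/

section NearFlat

open Filter Topology

/-- Bounds on the derivatives of an inverse square root. -/
lemma JetBound.inv_sqrt {r b : ℝ} {d D : E3 → ℂ} {y : E3} (hr : 0 < r) (hb : 1 ≤ b)
    (cd : ContDiffAt ℝ ∞ d y) (cD : ContDiffAt ℝ ∞ D y) (hD : JetBound 2 r b D y)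
    (hd : ‖d y‖ ≤ 2) (h : ∀ᶠ z in 𝓝 y, d z * d z * D z = 1) :
    JetBound 2 r (2 ^ 29 * b ^ 4) d y := by
  -- Differentiating d²D = 1 and multiplying by d gives ∂d = −½ d³ ∂D, so derivatives of d are
  -- bounded through lower-order ones without dividing.
  have key : ∀ i, pd i d =ᶠ[𝓝 y] fun z => (-(1 / 2) : ℂ) * (d z * (d z * d z) * pd i D z) := by
    intro i
    have h0 : (fun z => (d z * d z) * D z) =ᶠ[𝓝 y] fun _ => 1 := h
    have h1 := pd_congr h0 i
    have h2 := pd_mul (cd.mul cd) cD i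
    have h3 := pd_mul cd cd i
    filter_upwards [h, h1, h2, h3] with z e0 e1 e2 e3
    rw [e2] at e1
    rw [show pd i (fun _ : E3 => (1 : ℂ)) z = 0 by rw [pd_const], e3] at e1
    linear_combination (-(pd i d z)) * e0 + (1 / 2) * d z * e1
  have cd2 := cd.mul cd
  have cd3 : ContDiffAt ℝ ∞ (fun z => d z * (d z * d z)) y := cd.mul cd2
  have cpD : ∀ i, ContDiffAt ℝ ∞ (pd i D) y := fun i => pd_contDiffAt cD i
  have step : ∀ N c, 2 ≤ c → N ≤ 1 → JetBound N r c d y →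
      JetBound (N + 1) r (max c (32 * c ^ 3 * b)) d y := by
    intro N c hc hN hcd
    refine ⟨(hd.trans hc).trans (le_max_left _ _), fun i => ?_⟩
    have hDi : JetBound N r (b / r) (pd i D) y := by
      have := hD.2 i
      interval_cases N
      · exact this.pred
      · exact this
    refine JetBound.congr ?_ (key i)
    refine (((hcd.mul hr cd cd2 (hcd.mul hr cd cd hcd)).mul hr cd3 (cpD i) hDi).const_mul _
      (cd3.mul (cpD i))).mono hr ?_
    have e : (2 : ℝ) ^ N ≤ 2 := by interval_cases N <;> norm_num
    have hn : ‖(-(1 / 2) : ℂ)‖ = 1 / 2 := by norm_num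
    rw [hn]
    calc 1 / 2 * (2 ^ N * (2 ^ N * (c * (2 ^ N * (c * c))) * (b / r)))
        ≤ 1 / 2 * (2 * (2 * (c * (2 * (c * c))) * (b / r))) := by gcongr
      _ ≤ 32 * c ^ 3 * b / r := by
          have : 0 ≤ c ^ 3 * b / r := by positivity
          calc _ = 4 * (c ^ 3 * b / r) := by ring
            _ ≤ 32 * (c ^ 3 * b / r) := by linarith
            _ = _ := by ring
      _ ≤ _ := by gcongr; exact le_max_right _ _
  have s0 : JetBound 0 r 2 d y := hd
  -- Starting from |d| ≤ 2, the map c ↦ 32c³b gives 256b and then 2²⁹b⁴.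
  have s1 := (step 0 2 le_rfl (by norm_num) s0).mono (B := 256 * b) hr
    (max_le (by linarith) (by linarith))
  refine (step 1 (256 * b) (by linarith) le_rfl s1).mono hr (max_le ?_ (le_of_eq (by ring)))
  have : b ^ 1 ≤ b ^ 4 := pow_le_pow_right₀ hb (by norm_num)
  nlinarith

/-- The coefficients of the Killing form besides those of the derivatives. -/
lemma JetBound.cross {r ε b : ℝ} {y : E3} {G : Fin 3 → Fin 3 → E3 → ℂ} {d : E3 → ℂ}
    {k : Fin 3 → Fin 3 → E3 → ℂ} (hr : 0 < r)
    (cG : ∀ i j, ContDiffAt ℝ ∞ (G i j) y) (cd : ContDiffAt ℝ ∞ d y)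
    (ck : ∀ i j, ContDiffAt ℝ ∞ (k i j) y) (hG : ∀ i j, JetBound 2 r 2 (G i j) y)
    (hd : JetBound 2 r b d y) (hk : ∀ i j, JetBound 2 r (ε / r) (k i j) y) (i j p : Fin 3) :
    ContDiffAt ℝ ∞ (fun z => ∑ m, ∑ n, (levi i m p : ℂ) * (d z * (G (n + 1) (m + 1) z *
      G (n + 2) (m + 2) z - G (n + 1) (m + 2) z * G (n + 2) (m + 1) z) * k j n z)) y ∧
    JetBound 2 r (4608 * b * (ε / r)) (fun z => ∑ m, ∑ n, (levi i m p : ℂ) * (d z *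
      (G (n + 1) (m + 1) z * G (n + 2) (m + 2) z - G (n + 1) (m + 2) z * G (n + 2) (m + 1) z)
        * k j n z)) y := by
  have c1 : ∀ m n, ContDiffAt ℝ ∞ (fun z => G (n + 1) (m + 1) z * G (n + 2) (m + 2) z -
      G (n + 1) (m + 2) z * G (n + 2) (m + 1) z) y := fun m n =>
    ((cG _ _).mul (cG _ _)).sub ((cG _ _).mul (cG _ _))
  have c2 : ∀ m n, ContDiffAt ℝ ∞ (fun z => d z * (G (n + 1) (m + 1) z * G (n + 2) (m + 2) z -
      G (n + 1) (m + 2) z * G (n + 2) (m + 1) z) * k j n z) y := fun m n =>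
    (cd.mul (c1 m n)).mul (ck _ _)
  have c3 : ∀ m, ContDiffAt ℝ ∞ (fun z => ∑ n, (levi i m p : ℂ) * (d z * (G (n + 1) (m + 1) z *
      G (n + 2) (m + 2) z - G (n + 1) (m + 2) z * G (n + 2) (m + 1) z) * k j n z)) y := fun m =>
    ContDiffAt.sum fun n _ => contDiffAt_const.mul (c2 m n)
  refine ⟨ContDiffAt.sum fun m _ => c3 m, ?_⟩
  have hl : ∀ m, ‖(levi i m p : ℂ)‖ ≤ 1 := by
    intro m
    fin_cases i <;> fin_cases m <;> fin_cases p <;> simp [levi]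
  have e0 := (hk 0 0).nonneg
  have b0 := hd.nonneg
  refine (JetBound.sum c3 fun m => JetBound.sum (fun n => contDiffAt_const.mul (c2 m n)) fun n =>
    ((((hd.mul hr cd (c1 m n) (((hG _ _).mul hr (cG _ _) (cG _ _) (hG _ _)).sub
      ((cG _ _).mul (cG _ _)) ((cG _ _).mul (cG _ _)) ((hG _ _).mul hr (cG _ _) (cG _ _) (hG _ _)))).mul
      hr (cd.mul (c1 m n)) (ck j n) (hk j n)).const_mul _ (c2 m n)).mono hr
      (mul_le_of_le_one_left (by positivity) (hl m)))).mono hr (le_of_eq ?_)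
  ring

lemma det_near_one {G : Fin 3 → Fin 3 → ℝ}
    (h : ∀ i j, |G i j - (if i = j then 1 else 0)| ≤ 1 / 100) : 1 / 4 ≤ (Matrix.of G).det := by
  have hd : ∀ i, 99 / 100 ≤ G i i := fun i => by
    have := h i i; simp only [if_true] at this; linarith [(abs_le.1 this).1]
  have hd' : ∀ i, |G i i| ≤ 2 := fun i => by
    have := h i i; simp only [if_true] at this; rw [abs_le] at this ⊢; constructor <;> linarith
  have ho : ∀ i j, i ≠ j → |G i j| ≤ 1 / 100 := fun i j hij => by
    have := h i j; simpa [hij] using this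
  have m3 : ∀ {x y z a b c : ℝ}, |x| ≤ a → |y| ≤ b → |z| ≤ c → |x * y * z| ≤ a * b * c := by
    intro x y z a b c hx hy hz
    rw [abs_mul, abs_mul]
    have := (abs_nonneg x).trans hx
    have := (abs_nonneg y).trans hy
    gcongr
  have t0 : (99 / 100 : ℝ) * (99 / 100) * (99 / 100) ≤ G 0 0 * G 1 1 * G 2 2 := by
    have := hd 0; have := hd 1; have := hd 2
    gcongr
  have t1 := abs_le.1 (m3 (hd' 0) (ho 1 2 (by decide)) (ho 2 1 (by decide)))
  have t2 := abs_le.1 (m3 (ho 0 1 (by decide)) (ho 1 0 (by decide)) (hd' 2))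
  have t3 := abs_le.1 (m3 (ho 0 1 (by decide)) (ho 1 2 (by decide)) (ho 2 0 (by decide)))
  have t4 := abs_le.1 (m3 (ho 0 2 (by decide)) (ho 1 0 (by decide)) (ho 2 1 (by decide)))
  have t5 := abs_le.1 (m3 (ho 0 2 (by decide)) (hd' 1) (ho 2 0 (by decide)))
  rw [Matrix.det_fin_three]
  simp only [Matrix.of_apply]
  linarith [t1.1, t1.2, t2.1, t2.2, t3.1, t3.2, t4.1, t4.2, t5.1, t5.2]

lemma JetBound.det {r : ℝ} {y : E3} {G : Fin 3 → Fin 3 → E3 → ℂ} (hr : 0 < r)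
    (cG : ∀ i j, ContDiffAt ℝ ∞ (G i j) y) (hG : ∀ i j, JetBound 2 r 2 (G i j) y) :
    ContDiffAt ℝ ∞ (fun z => (Matrix.of fun i j => G i j z).det) y ∧
      JetBound 2 r 768 (fun z => (Matrix.of fun i j => G i j z).det) y := by
  have c3 : ∀ i j k, ContDiffAt ℝ ∞ (fun z => G 0 i z * G 1 j z * G 2 k z) y := fun i j k =>
    ((cG _ _).mul (cG _ _)).mul (cG _ _)
  have b3 : ∀ i j k, JetBound 2 r 128 (fun z => G 0 i z * G 1 j z * G 2 k z) y := fun i j k =>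
    (((hG _ _).mul hr (cG _ _) (cG _ _) (hG _ _)).mul hr ((cG _ _).mul (cG _ _)) (cG _ _)
      (hG _ _)).mono hr (by norm_num)
  have e : (fun z => (Matrix.of fun i j => G i j z).det) = fun z =>
      ((G 0 0 z * G 1 1 z * G 2 2 z + G 0 1 z * G 1 2 z * G 2 0 z) + G 0 2 z * G 1 0 z * G 2 1 z)
      - ((G 0 0 z * G 1 2 z * G 2 1 z + G 0 1 z * G 1 0 z * G 2 2 z)
        + G 0 2 z * G 1 1 z * G 2 0 z) := by
    funext z
    rw [Matrix.det_fin_three]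
    simp only [Matrix.of_apply]
    ring
  rw [e]
  have k1 := ((c3 0 1 2).add (c3 1 2 0)).add (c3 2 0 1)
  have k2 := ((c3 0 2 1).add (c3 1 0 2)).add (c3 2 1 0)
  refine ⟨k1.sub k2, ?_⟩
  have j1 := ((b3 0 1 2).add (c3 0 1 2) (c3 1 2 0) (b3 1 2 0)).add
    ((c3 0 1 2).add (c3 1 2 0)) (c3 2 0 1) (b3 2 0 1)
  have j2 := ((b3 0 2 1).add (c3 0 2 1) (c3 1 0 2) (b3 1 0 2)).add
    ((c3 0 2 1).add (c3 1 0 2)) (c3 2 1 0) (b3 2 1 0)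
  exact (j1.sub k1 k2 j2).mono hr (by norm_num)

variable {S : Type*} [TopologicalSpace S] [ChartedSpace E3 S] [IsManifold (𝓡 3) ∞ S]
  [RiemannianBundle (fun x : S => TangentSpace (𝓡 3) x)]

/-- The data are `ε`-close to the flat ones at scale `r` about the point with coordinates `y`. -/
def IsNearFlat (K : TwoTensor S) (φ : OpenPartialHomeomorph S E3) (r ε : ℝ) (y : E3) : Prop :=
  (∀ i j, ∀ l ≤ 3, r ^ l * ‖iteratedFDeriv ℝ l
    (fun y => metricCoeff φ i j y - (-(if i = j then 1 else 0))) y‖ ≤ ε) ∧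
  ∀ i j, ∀ l ≤ 2, r ^ l * ‖iteratedFDeriv ℝ l (tensorCoeff K φ i j) y‖ ≤ ε / r

lemma JetBound.ofReal {N : ℕ} {r B : ℝ} {f : E3 → ℝ} {y : E3} (hr : 0 < r)
    (hf : ContDiffAt ℝ ∞ f y) (h : ∀ j ≤ N, r ^ j * ‖iteratedFDeriv ℝ j f y‖ ≤ B) :
    JetBound N r B (fun z => (f z : ℂ)) y := by
  refine JetBound.of_iteratedFDeriv hr (contDiffAt_ofReal hf) fun j hj => ?_
  refine le_trans ?_ (h j hj)
  gcongr
  have := Complex.ofRealLI.norm_iteratedFDeriv_comp_left (i := j) (n := ∞) hf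
    (by exact_mod_cast le_top)
  exact this.le

variable [hR : IsContMDiffRiemannianBundle (𝓡 3) ∞ E3 (fun x : S => TangentSpace (𝓡 3) x)]
  {ι : Type*} {𝔰 : SpinStructure S ι} {φ : OpenPartialHomeomorph S E3}

/-- The third derivatives of a spatial Killing spinor are controlled by its second order jet, with
a small constant where the data are nearly flat. -/
theorem norm_chartZ_three_le : ∃ ε₀ > 0, ∃ C : ℝ, 0 ≤ C ∧ ∀ {K : TwoTensor S}
    {φ : OpenPartialHomeomorph S E3} (_ : φ ∈ IsManifold.maximalAtlas (𝓡 3) ∞ S)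
    (_ : IsAsymptoticallyEuclidean K) (ν : SpinorField 𝔰 2) (_ : ν.IsSpatialKilling K)
    {y : E3} (_ : y ∈ φ.target) {r ε n : ℝ} (_ : 0 < r) (_ : ε ≤ ε₀) (_ : IsNearFlat K φ r ε y)
    (_ : ∀ m, JetBound 2 r n (chartZ ν φ m) y),
    ∀ c b a k, r ^ 3 * ‖pd c (pd b (pd a (chartZ ν φ k))) y‖ ≤ C * ε * n := by
  -- b bounds the frame determinant through `JetBound.inv_sqrt`, 768 being the bound on det G from
  -- `JetBound.det`. Q below collects the zeroth-order coefficients A: one derivative of the metric,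
  -- and two cross terms of size 4608·b each.
  set b : ℝ := 2 ^ 29 * 768 ^ 4 with hb
  set Q : ℝ := 1 + 2 * (4608 * b) with hQ
  have hb0 : 0 < b := by positivity
  have hQ1 : 1 ≤ Q := by rw [hQ]; linarith
  refine ⟨1 / 45120 / Q, by positivity, 45120 * Q, by positivity, ?_⟩
  intro K φ hφ hK ν hν y hy r ε n hr hε hflat hZ
  have hε0 : 0 ≤ ε := le_trans (by positivity) (hflat.1 0 0 0 (by norm_num))
  have hQε : Q * ε ≤ 1 / 45120 := by rwa [le_div_iff₀ (by positivity), mul_comm] at hε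
  have hε1 : ε ≤ 1 / 45120 := le_trans (le_mul_of_one_le_left hε0 hQ1) hQε
  set δ : Fin 3 → Fin 3 → ℝ := fun i j => if i = j then 1 else 0 with hδ
  have cg : ∀ i j, ContDiffAt ℝ ∞ (metricCoeff φ i j) y := metricCoeff_contDiffAt hφ hy
  have cH' : ∀ i j, ContDiffAt ℝ ∞ (fun z => metricCoeff φ i j z - (-δ i j)) y := fun i j =>
    (cg i j).sub contDiffAt_const
  set H : Fin 3 → Fin 3 → E3 → ℂ := fun i j z => -((metricCoeff φ i j z - (-δ i j) : ℝ) : ℂ) with hH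
  have cH : ∀ i j, ContDiffAt ℝ ∞ (H i j) y := fun i j => (contDiffAt_ofReal (cH' i j)).neg
  have bH3 : ∀ i j, JetBound 3 r ε (H i j) y := fun i j =>
    (JetBound.ofReal hr (cH' i j) (hflat.1 i j)).neg (contDiffAt_ofReal (cH' i j))
  set G : Fin 3 → Fin 3 → E3 → ℂ := fun i j z => (δ i j : ℂ) + H i j z with hG
  have hGm : ∀ i j z, G i j z = ((-metricCoeff φ i j z : ℝ) : ℂ) := fun i j z => by
    simp only [hG, hH]; push_cast; ring
  have cG : ∀ i j, ContDiffAt ℝ ∞ (G i j) y := fun i j => contDiffAt_const.add (cH i j)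
  have hδn : ∀ i j, ‖(δ i j : ℂ)‖ ≤ 1 := fun i j => by simp only [hδ]; split_ifs <;> simp
  have bG : ∀ i j, JetBound 2 r 2 (G i j) y := fun i j =>
    ((JetBound.const (δ i j : ℂ) hr).add contDiffAt_const (cH i j) (bH3 i j).pred).mono hr
      (by linarith [hδn i j])
  set d : E3 → ℂ := fun z => (chartDet 𝔰 φ z : ℂ) with hd
  have cd : ContDiffAt ℝ ∞ d y := contDiffAt_ofReal (chartDet_contDiffAt hφ hy)
  have hdet := JetBound.det hr cG bG
  have hnear : ∀ᶠ z in 𝓝 y, z ∈ φ.target := φ.open_target.mem_nhds hy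
  have hdD : ∀ᶠ z in 𝓝 y, d z * d z * (Matrix.of fun i j => G i j z).det = 1 := by
    filter_upwards [hnear] with z hz
    have := chartDet_sq (𝔰 := 𝔰) hφ hz
    rw [Matrix.det_fin_three] at this ⊢
    simp only [Matrix.of_apply, hGm, hd] at this ⊢
    rw [← sq]
    exact_mod_cast this
  have hd2 : ‖d y‖ ≤ 2 := by
    have h1 := chartDet_sq (𝔰 := 𝔰) hφ hy
    -- The metric determinant is at least 1/4, which forces the frame determinant to be at most 2 in
    -- absolute value.
    have h2 := det_near_one (G := fun k l => -metricCoeff φ k l y) fun i j => by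
      have h3 := hflat.1 i j 0 (by norm_num)
      simp only [pow_zero, one_mul, norm_iteratedFDeriv_zero, Real.norm_eq_abs] at h3
      rw [← abs_neg]
      refine le_trans (le_of_eq ?_) (h3.trans (hε1.trans (by norm_num)))
      congr 1
      ring
    simp only [hd, Complex.norm_real, Real.norm_eq_abs]
    refine abs_le_of_sq_le_sq (by nlinarith [sq_nonneg (chartDet 𝔰 φ y)]) (by norm_num)
  have bd : JetBound 2 r b d y := JetBound.inv_sqrt hr (by norm_num) cd hdet.1 hdet.2 hd2 hdD
  set k : Fin 3 → Fin 3 → E3 → ℂ := fun i j z => (tensorCoeff K φ i j z : ℂ) with hk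
  have ck' : ∀ i j, ContDiffAt ℝ ∞ (tensorCoeff K φ i j) y := tensorCoeff_contDiffAt hφ hK hy
  have ck : ∀ i j, ContDiffAt ℝ ∞ (k i j) y := fun i j => contDiffAt_ofReal (ck' i j)
  have bk : ∀ i j, JetBound 2 r (ε / r) (k i j) y := fun i j =>
    JetBound.ofReal hr (ck' i j) (hflat.2 i j)
  set X : Fin 3 → Fin 3 → Fin 3 → E3 → ℂ := fun i j p z => ∑ m, ∑ n, (levi i m p : ℂ) * (d z *
    (G (n + 1) (m + 1) z * G (n + 2) (m + 2) z - G (n + 1) (m + 2) z * G (n + 2) (m + 1) z)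
      * k j n z) with hX
  have hXb := fun i j p => JetBound.cross hr cG cd ck bG bd bk i j p
  have cX : ∀ i j p, ContDiffAt ℝ ∞ (X i j p) y := fun i j p => (hXb i j p).1
  set A : Fin 3 → Fin 3 → Fin 3 → E3 → ℂ := fun i j p z =>
    pd p (H i j) z - beta * (X i j p z + X j i p z) with hA
  have cXX : ∀ i j p, ContDiffAt ℝ ∞ (fun z => X i j p z + X j i p z) y := fun i j p =>
    (cX i j p).add (cX j i p)
  have hβ : ‖beta‖ ≤ 1 := by
    rw [beta, norm_mul, Complex.norm_I, one_mul, norm_inv, Complex.norm_real,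
      Real.norm_of_nonneg (Real.sqrt_nonneg _)]
    exact inv_le_one_of_one_le₀ (by rw [Real.one_le_sqrt]; norm_num)
  have bA : ∀ i j p, JetBound 2 r (Q * ε / r) (A i j p) y := by
    intro i j p
    have e1 := ((hXb i j p).2.add (cX i j p) (cX j i p) (hXb j i p).2).const_mul beta (cXX i j p)
    refine (((bH3 i j).2 p).sub (pd_contDiffAt (cH i j) p)
      (contDiffAt_const.mul (cXX i j p)) e1).mono hr ?_
    calc _ ≤ ε / r + 1 * (4608 * b * (ε / r) + 4608 * b * (ε / r)) := by gcongr
      _ = _ := by rw [hQ]; ring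
  have main := norm_pd_three_le (r := r) (ε := Q * ε) (n := n) (y := y) (H := H) (A := A)
    (Z := chartZ ν φ) hr (by positivity) hQε cH
    (fun i j p => (pd_contDiffAt (cH i j) p).sub (contDiffAt_const.mul (cXX i j p)))
    (chartZ_contDiffAt hφ hy ν)
    (fun i j => (bH3 i j).pred.mono hr (le_mul_of_one_le_left hε0 hQ1)) bA hZ ?_
  · intro c b' a k'
    refine (main c b' a k').trans (le_of_eq ?_)
    ring
  filter_upwards [hnear] with z hz
  obtain ⟨t, ht⟩ := chartKillForm_eq_of_killFrame_eq_zero hφ hz (𝔰.mem_indexAt _) K ν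
    (killFrame_eq_zero hν (𝔰.mem_indexAt (φ.symm z)))
  refine ⟨t, fun i j => ?_⟩
  have hδc : ∀ i j, (if i = j then (1 : ℂ) else 0) = (δ i j : ℂ) := fun i j => by
    simp only [hδ]; split_ifs <;> simp
  simp only [hδc]
  have hpd : ∀ i j p, pd p (H i j) z
      = ((-fderiv ℝ (metricCoeff φ i j) z (EuclideanSpace.single p 1) : ℝ) : ℂ) := by
    intro i j p
    have h1 : DifferentiableAt ℝ (metricCoeff φ i j) z :=
      (metricCoeff_contDiffAt hφ hz i j).differentiableAt (by simp)
    have h2 := ((h1.hasFDerivAt.sub_const (-δ i j)).neg)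
    have h3 := (Complex.ofRealCLM.hasFDerivAt).comp z h2
    have h4 : H i j = Complex.ofRealCLM ∘ (-fun z => metricCoeff φ i j z - (-δ i j)) := by
      funext w; simp [hH]
    rw [pd, h4, h3.fderiv]
    rfl
  have hcross : ∀ i j, crossTerm (fun k l => -metricCoeff φ k l z) (chartDet 𝔰 φ z)
      (fun k l => tensorCoeff K φ k l z) (fun m => chartZ ν φ m z) i j
      = ∑ p, X i j p z * chartZ ν φ p z := by
    intro i j
    simp only [crossTerm, adjugate_cyclic, hX, Finset.sum_mul]
    rw [Finset.sum_comm]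
    refine Finset.sum_congr rfl fun p _ => Finset.sum_congr rfl fun m _ =>
      Finset.sum_congr rfl fun n _ => ?_
    simp only [hGm, hd, hk]
    push_cast
    ring
  have h5 := ht i j
  rw [chartKillForm, killForm, hcross, hcross] at h5
  have h6 : (δ i j : ℂ) + H i j z = ((-metricCoeff φ i j z : ℝ) : ℂ) := hGm i j z
  rw [h6, ← h5]
  have h7 : ∀ i j, (δ i j : ℂ) + H i j z = ((-metricCoeff φ i j z : ℝ) : ℂ) := fun i j => hGm i j z
  simp only [h7, hA, hpd]
  simp only [pd, Fin.sum_univ_three]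
  ring

end NearFlat

/-! ### Second order jets along lines -/

section Jets

open Filter Topology

/-- The space of second order jets of vector fields. -/
abbrev Jet2 : Type := (Fin 3 → ℂ) × (Fin 3 → Fin 3 → ℂ) × (Fin 3 → Fin 3 → Fin 3 → ℂ)

/-- The weighted second order jet of a vector field. -/
def jet2 (r : ℝ) (Z : Fin 3 → E3 → ℂ) (y : E3) : Jet2 :=
  (fun m => Z m y, fun m a => r * pd a (Z m) y, fun m a b => r ^ 2 * pd b (pd a (Z m)) y)

lemma norm_jet2_le_iff {r n : ℝ} (hr : 0 < r) (hn : 0 ≤ n) {Z : Fin 3 → E3 → ℂ} {y : E3} :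
    ‖jet2 r Z y‖ ≤ n ↔ (∀ m, ‖Z m y‖ ≤ n) ∧ (∀ m a, r * ‖pd a (Z m) y‖ ≤ n) ∧
      ∀ m a b, r ^ 2 * ‖pd b (pd a (Z m)) y‖ ≤ n := by
  simp only [jet2, Prod.norm_def, sup_le_iff, pi_norm_le_iff_of_nonneg hn, norm_mul, norm_pow,
    Complex.norm_real, Real.norm_of_nonneg hr.le]

lemma jetBound_jet2 {r : ℝ} (hr : 0 < r) {Z : Fin 3 → E3 → ℂ} {y : E3} (m : Fin 3) :
    JetBound 2 r ‖jet2 r Z y‖ (Z m) y := by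
  obtain ⟨h0, h1, h2⟩ := (norm_jet2_le_iff hr (norm_nonneg (jet2 r Z y))).1 le_rfl
  refine ⟨h0 m, fun a => ⟨?_, fun b => ?_⟩⟩
  · rw [le_div_iff₀ hr, mul_comm]; exact h1 m a
  · show _ ≤ _
    rw [div_div, le_div_iff₀ (by positivity), mul_comm, ← sq]; exact h2 m a b

lemma hasDerivAt_line {f : E3 → ℂ} {x v : E3} {t : ℝ} (hf : ContDiffAt ℝ ∞ f (x + t • v)) :
    HasDerivAt (fun t : ℝ => f (x + t • v)) (∑ p, (v p : ℂ) * pd p f (x + t • v)) t := by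
  have h1 := (hf.differentiableAt (by simp)).hasFDerivAt
  have h2 : HasDerivAt (fun t : ℝ => x + t • v) v t := by
    simpa using ((hasDerivAt_id t).smul_const v).const_add x
  have h3 := h1.comp_hasDerivAt t h2
  rw [clm_apply_eq_sum] at h3
  simp only [Complex.real_smul] at h3
  exact h3

lemma norm_sum_pd_le {f : E3 → ℂ} {v y : E3} {B : ℝ} (h : ∀ p, ‖pd p f y‖ ≤ B) :
    ‖∑ p, (v p : ℂ) * pd p f y‖ ≤ 3 * ‖v‖ * B := by
  refine (norm_sum_le _ _).trans ?_
  calc _ ≤ ∑ p : Fin 3, ‖v‖ * B := Finset.sum_le_sum fun p _ => by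
        rw [norm_mul, Complex.norm_real]
        exact mul_le_mul (PiLp.norm_apply_le v p) (h p) (norm_nonneg _) (norm_nonneg _)
    _ = _ := by simp; ring

/-- Jets along a line grow at most exponentially. -/
lemma norm_jet2_le_exp {r : ℝ} (hr : 0 < r) {Z : Fin 3 → E3 → ℂ} {x v : E3}
    (hZ : ∀ t ∈ Set.Icc (0 : ℝ) 1, ∀ m, ContDiffAt ℝ ∞ (Z m) (x + t • v))
    (h3 : ∀ t ∈ Set.Icc (0 : ℝ) 1, ∀ c b a k,
      r ^ 3 * ‖pd c (pd b (pd a (Z k))) (x + t • v)‖ ≤ ‖jet2 r Z (x + t • v)‖) :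
    ‖jet2 r Z (x + v)‖ ≤ ‖jet2 r Z x‖ * Real.exp (3 * ‖v‖ / r) := by
  set f' : ℝ → Jet2 := fun t => (fun m => ∑ p, (v p : ℂ) * pd p (Z m) (x + t • v),
    fun m a => r * ∑ p, (v p : ℂ) * pd p (pd a (Z m)) (x + t • v),
    fun m a b => r ^ 2 * ∑ p, (v p : ℂ) * pd p (pd b (pd a (Z m))) (x + t • v)) with hf'
  have hd : ∀ t ∈ Set.Icc (0 : ℝ) 1, HasDerivAt (fun t : ℝ => jet2 r Z (x + t • v)) (f' t) t := by
    intro t ht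
    refine HasDerivAt.prodMk ?_ (HasDerivAt.prodMk ?_ ?_)
    · exact hasDerivAt_pi.2 fun m => hasDerivAt_line (hZ t ht m)
    · exact hasDerivAt_pi.2 fun m => hasDerivAt_pi.2 fun a =>
        (hasDerivAt_line (pd_contDiffAt (hZ t ht m) a)).const_mul _
    · exact hasDerivAt_pi.2 fun m => hasDerivAt_pi.2 fun a => hasDerivAt_pi.2 fun b =>
        (hasDerivAt_line (pd_contDiffAt (pd_contDiffAt (hZ t ht m) a) b)).const_mul _
  have hb : ∀ t ∈ Set.Icc (0 : ℝ) 1, ‖f' t‖ ≤ 3 * ‖v‖ / r * ‖jet2 r Z (x + t • v)‖ := by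
    intro t ht
    set n := ‖jet2 r Z (x + t • v)‖ with hn
    obtain ⟨-, k1, k2⟩ := (norm_jet2_le_iff hr (norm_nonneg (jet2 r Z (x + t • v)))).1 le_rfl
    have hn0 : 0 ≤ 3 * ‖v‖ / r * n := by positivity
    simp only [hf', Prod.norm_def, sup_le_iff, pi_norm_le_iff_of_nonneg hn0, norm_mul, norm_pow,
      Complex.norm_real, Real.norm_of_nonneg hr.le]
    refine ⟨fun m => ?_, fun m a => ?_, fun m a b => ?_⟩
    · refine (norm_sum_pd_le (B := n / r) fun p => ?_).trans_eq (by ring)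
      rw [le_div_iff₀ hr, mul_comm]; exact k1 m p
    · refine (mul_le_mul_of_nonneg_left (norm_sum_pd_le (B := n / r ^ 2) fun p => ?_) hr.le).trans_eq
        (by field_simp)
      rw [le_div_iff₀ (by positivity), mul_comm]; exact k2 m a p
    · refine (mul_le_mul_of_nonneg_left (norm_sum_pd_le (B := n / r ^ 3) fun p => ?_)
        (by positivity)).trans_eq (by field_simp)
      rw [le_div_iff₀ (by positivity), mul_comm]; exact h3 t ht p b a m
  have := norm_le_gronwallBound_of_norm_deriv_right_le (a := 0) (b := 1) (ε := 0)
    (K := 3 * ‖v‖ / r) (δ := ‖jet2 r Z x‖)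
    (fun t ht => (hd t ht).continuousAt.continuousWithinAt)
    (fun t ht => (hd t ⟨ht.1, ht.2.le⟩).hasDerivWithinAt) (by simp)
    (fun t ht => by simpa using hb t ⟨ht.1, ht.2.le⟩) 1 (by simp)
  simpa [gronwallBound_ε0] using this

lemma norm_le_of_deriv_unit {F F' : ℝ → ℂ} {η : ℝ} (h0 : F 0 = 0)
    (hF : ∀ t ∈ Set.Icc (0 : ℝ) 1, HasDerivAt F (F' t) t)
    (hb : ∀ t ∈ Set.Icc (0 : ℝ) 1, ‖F' t‖ ≤ η) : ∀ t ∈ Set.Icc (0 : ℝ) 1, ‖F t‖ ≤ η := by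
  intro t ht
  have hη : 0 ≤ η := (norm_nonneg _).trans (hb 0 (by simp))
  have := norm_image_sub_le_of_norm_deriv_le_segment' (a := 0) (b := 1) (f := F) (C := η)
    (fun s hs => (hF s hs).hasDerivWithinAt) (fun s hs => hb s ⟨hs.1, hs.2.le⟩) t ht
  rw [h0, sub_zero, sub_zero] at this
  exact this.trans (mul_le_of_le_one_right hη ht.2)

/-- Landau-type inequality: first and second derivatives from three values. -/
lemma landau_unit {g g₁ g₂ g₃ : ℝ → ℂ} {η M : ℝ}
    (h1 : ∀ t ∈ Set.Icc (0 : ℝ) 1, HasDerivAt g (g₁ t) t)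
    (h2 : ∀ t ∈ Set.Icc (0 : ℝ) 1, HasDerivAt g₁ (g₂ t) t)
    (h3 : ∀ t ∈ Set.Icc (0 : ℝ) 1, HasDerivAt g₂ (g₃ t) t)
    (hb : ∀ t ∈ Set.Icc (0 : ℝ) 1, ‖g₃ t‖ ≤ η)
    (m0 : ‖g 0‖ ≤ M) (m1 : ‖g (1 / 2)‖ ≤ M) (m2 : ‖g 1‖ ≤ M) :
    ‖g₁ 0‖ ≤ 10 * M + 7 * η ∧ ‖g₂ 0‖ ≤ 16 * M + 12 * η := by
  have k3 := norm_le_of_deriv_unit (F := fun t => g₂ t - g₂ 0) (by simp)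
    (fun t ht => (h3 t ht).sub_const _) hb
  have hl : ∀ (c : ℂ) (t : ℝ), HasDerivAt (fun t : ℝ => (t : ℂ) * c) c t := fun c t => by
    simpa using (Complex.ofRealCLM.hasDerivAt (x := t)).mul_const c
  have hq : ∀ (c : ℂ) (t : ℝ), HasDerivAt (fun t : ℝ => (t : ℂ) * t * c) (2 * (t * c)) t :=
    fun c t => by
      have := ((Complex.ofRealCLM.hasDerivAt (x := t)).mul
        (Complex.ofRealCLM.hasDerivAt (x := t))).mul_const c
      refine this.congr_deriv ?_
      simp
      ring
  have k2 := norm_le_of_deriv_unit (F := fun t => (g₁ t - g₁ 0) - t * g₂ 0) (by simp)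
    (fun t ht => ((h2 t ht).sub_const _).sub (hl (g₂ 0) t)) k3
  have k1 := norm_le_of_deriv_unit (F := fun t => (g t - g 0) - t * g₁ 0 - t * t * (g₂ 0 / 2))
    (by simp) (fun t ht => ((((h1 t ht).sub_const _).sub (hl (g₁ 0) t)).sub (hq (g₂ 0 / 2) t)))
    (fun t ht => by
      have := k2 t ht
      rwa [show g₁ t - g₁ 0 - 2 * (t * (g₂ 0 / 2)) = (g₁ t - g₁ 0) - t * g₂ 0 by ring])
  have e1 := k1 1 (by simp)
  have e2 := k1 (1 / 2) (by constructor <;> norm_num)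
  -- Second-order Taylor remainders at 1 and 1/2, both at most η. They give two linear equations for
  -- the first and second derivatives at 0.
  set R1 := g 1 - g 0 - ((1 : ℝ) : ℂ) * g₁ 0 - ((1 : ℝ) : ℂ) * ((1 : ℝ) : ℂ) * (g₂ 0 / 2) with hR1
  set R2 := g (1 / 2) - g 0 - ((1 / 2 : ℝ) : ℂ) * g₁ 0
    - ((1 / 2 : ℝ) : ℂ) * ((1 / 2 : ℝ) : ℂ) * (g₂ 0 / 2) with hR2
  have f2 : g₂ 0 = 4 * ((g 1 + g 0) - 2 * g (1 / 2) - (R1 - 2 * R2)) := by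
    rw [hR1, hR2]; push_cast; ring
  have f1 : g₁ 0 = (g 1 - g 0) - (1 / 2) * g₂ 0 - R1 := by
    rw [hR1]; push_cast; ring
  have b2 : ‖g₂ 0‖ ≤ 16 * M + 12 * η := by
    rw [f2, norm_mul]
    have n1 := norm_sub_le ((g 1 + g 0) - 2 * g (1 / 2)) (R1 - 2 * R2)
    have n2 := norm_sub_le (g 1 + g 0) (2 * g (1 / 2))
    have n3 := norm_add_le (g 1) (g 0)
    have n4 := norm_sub_le R1 (2 * R2)
    rw [norm_mul] at n2 n4
    norm_num at n2 n4 ⊢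
    norm_num at m1
    linarith
  refine ⟨?_, b2⟩
  rw [f1]
  have n1 := norm_sub_le ((g 1 - g 0) - (1 / 2) * g₂ 0) R1
  have n2 := norm_sub_le (g 1 - g 0) ((1 / 2) * g₂ 0)
  have n3 := norm_sub_le (g 1) (g 0)
  rw [norm_mul] at n2
  norm_num at n2
  norm_num at n1
  linarith

end Jets

/-! ### Interior estimates for the second-order jet -/

section Interior

open Filter Topology

/-- The steps used to sample a vector field near a point. -/
def sampleStep (r : ℝ) (i j : Fin 3) : E3 :=
  (r / 8) • (EuclideanSpace.single i (1 : ℝ) + EuclideanSpace.single j (1 : ℝ))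

lemma norm_sampleStep_le {r : ℝ} (hr : 0 < r) (i j : Fin 3) : ‖sampleStep r i j‖ ≤ r / 4 := by
  rw [sampleStep, norm_smul, Real.norm_of_nonneg (by positivity)]
  have := norm_add_le (EuclideanSpace.single i (1 : ℝ) : E3) (EuclideanSpace.single j (1 : ℝ))
  simp only [EuclideanSpace.norm_single, norm_one] at this
  nlinarith

lemma hasDerivAt_sampleStep {f : E3 → ℂ} {x : E3} {r t : ℝ} {i j : Fin 3}
    (hf : ContDiffAt ℝ ∞ f (x + t • sampleStep r i j)) :
    HasDerivAt (fun t : ℝ => f (x + t • sampleStep r i j))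
      (((r / 8 : ℝ) : ℂ) * (pd i f (x + t • sampleStep r i j) + pd j f (x + t • sampleStep r i j))) t := by
  refine (hasDerivAt_line hf).congr_deriv ?_
  have e : ∀ p, ((sampleStep r i j) p : ℂ)
      = ((r / 8 : ℝ) : ℂ) * ((if p = i then 1 else 0) + (if p = j then 1 else 0)) := by
    intro p
    simp only [sampleStep, PiLp.smul_apply, PiLp.add_apply, PiLp.single_apply, smul_eq_mul]
    push_cast
    split_ifs <;> simp
  simp only [e, mul_assoc, ← Finset.mul_sum, add_mul, Finset.sum_add_distrib, ite_mul, one_mul,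
    zero_mul, Finset.sum_ite_eq', Finset.mem_univ, if_true]

/-- The second order jet is controlled by finitely many values nearby. -/
lemma norm_jet2_le_of_samples {r κ M : ℝ} (hr : 0 < r) (hκ : κ ≤ 1 / 3456)
    {Z : Fin 3 → E3 → ℂ} {x : E3}
    (hZ : ∀ y, ‖y - x‖ ≤ r / 4 → ∀ m, ContDiffAt ℝ ∞ (Z m) y)
    (h3 : ∀ y, ‖y - x‖ ≤ r / 4 → ∀ c b a k,
      r ^ 3 * ‖pd c (pd b (pd a (Z k))) y‖ ≤ κ * ‖jet2 r Z y‖)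
    (hM : ∀ m i j (s : Fin 3), ‖Z m (x + ((s : ℝ) / 2) • sampleStep r i j)‖ ≤ M) :
    ‖jet2 r Z x‖ ≤ 1536 * M := by
  set n := ‖jet2 r Z x‖ with hn
  have hn0 : 0 ≤ n := norm_nonneg _
  have hM0 : 0 ≤ M := (norm_nonneg _).trans (hM 0 0 0 0)
  have hline : ∀ i j, ∀ t ∈ Set.Icc (0 : ℝ) 1,
      ‖x + t • sampleStep r i j - x‖ ≤ r / 4 := by
    intro i j t ht
    rw [add_sub_cancel_left, norm_smul, Real.norm_of_nonneg ht.1]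
    exact (mul_le_of_le_one_left (norm_nonneg _) ht.2).trans (norm_sampleStep_le hr i j)
  have hκ1 : κ ≤ 1 := hκ.trans (by norm_num)
  -- Gronwall along a segment of length at most r/4: the growth factor is at most exp(3/4), hence at
  -- most 3.
  have hgrow : ∀ i j, ∀ t ∈ Set.Icc (0 : ℝ) 1, ‖jet2 r Z (x + t • sampleStep r i j)‖ ≤ 3 * n := by
    intro i j t ht
    have hsub : ∀ s ∈ Set.Icc (0 : ℝ) 1, ‖x + s • t • sampleStep r i j - x‖ ≤ r / 4 := by
      intro s hs
      rw [smul_smul]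
      exact hline i j _ ⟨mul_nonneg hs.1 ht.1, mul_le_one₀ hs.2 ht.1 ht.2⟩
    have := norm_jet2_le_exp hr (Z := Z) (x := x) (v := t • sampleStep r i j)
      (fun s hs m => hZ _ (hsub s hs) m)
      (fun s hs c b a k => (h3 _ (hsub s hs) c b a k).trans
        (mul_le_of_le_one_left (norm_nonneg _) hκ1))
    refine this.trans ?_
    rw [mul_comm]
    refine mul_le_mul_of_nonneg_right ?_ hn0
    have h1 : 3 * ‖t • sampleStep r i j‖ / r ≤ 1 := by
      have := hline i j t ht
      rw [add_sub_cancel_left] at this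
      rw [div_le_one hr]
      linarith
    calc Real.exp _ ≤ Real.exp 1 := Real.exp_le_exp.2 h1
      _ ≤ 3 := Real.exp_one_lt_three.le
  -- The third derivatives along the sampling segments are at most η. In the bound n ≤ 768M + 576η
  -- obtained below, 576η = n/2, which is absorbed; this is what κ ≤ 1/3456 is for.
  set η := 3 * n / 3456 with hη
  have hη0 : 0 ≤ η := by positivity
  have h3' : ∀ i j, ∀ t ∈ Set.Icc (0 : ℝ) 1, ∀ c b a k,
      r ^ 3 * ‖pd c (pd b (pd a (Z k))) (x + t • sampleStep r i j)‖ ≤ η := by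
    intro i j t ht c b a k
    refine (h3 _ (hline i j t ht) c b a k).trans ?_
    have := hgrow i j t ht
    calc κ * _ ≤ 1 / 3456 * ‖jet2 r Z (x + t • sampleStep r i j)‖ := by gcongr
      _ ≤ 1 / 3456 * (3 * n) := by gcongr
      _ = η := by rw [hη]; ring
  set ρ : ℂ := ((r / 8 : ℝ) : ℂ) with hρ
  have hρn : ‖ρ‖ = r / 8 := by rw [hρ, Complex.norm_real, Real.norm_of_nonneg (by positivity)]
  have landau : ∀ m i j, ‖ρ * (pd i (Z m) x + pd j (Z m) x)‖ ≤ 10 * M + 7 * η ∧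
      ‖ρ * (ρ * (pd i (pd i (Z m)) x + pd j (pd i (Z m)) x)
        + ρ * (pd i (pd j (Z m)) x + pd j (pd j (Z m)) x))‖ ≤ 16 * M + 12 * η := by
    intro m i j
    set w := sampleStep r i j with hw
    have c0 : ∀ t ∈ Set.Icc (0 : ℝ) 1, ContDiffAt ℝ ∞ (Z m) (x + t • w) := fun t ht =>
      hZ _ (hline i j t ht) m
    have c1 : ∀ a, ∀ t ∈ Set.Icc (0 : ℝ) 1, ContDiffAt ℝ ∞ (pd a (Z m)) (x + t • w) :=
      fun a t ht => pd_contDiffAt (c0 t ht) a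
    have c2 : ∀ b a, ∀ t ∈ Set.Icc (0 : ℝ) 1, ContDiffAt ℝ ∞ (pd b (pd a (Z m))) (x + t • w) :=
      fun b a t ht => pd_contDiffAt (c1 a t ht) b
    have hb : ∀ t ∈ Set.Icc (0 : ℝ) 1, ∀ b a, ‖ρ * (pd i (pd b (pd a (Z m))) (x + t • w)
        + pd j (pd b (pd a (Z m))) (x + t • w))‖ ≤ (r / 8) * (2 * (η / r ^ 3)) := by
      intro t ht b a
      rw [norm_mul, hρn]
      refine mul_le_mul_of_nonneg_left ((norm_add_le _ _).trans ?_) (by positivity)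
      have e1 := h3' i j t ht i b a m
      have e2 := h3' i j t ht j b a m
      rw [mul_comm, ← le_div_iff₀ (by positivity)] at e1 e2
      linarith
    have := landau_unit (g := fun t : ℝ => Z m (x + t • w))
      (g₁ := fun t => ρ * (pd i (Z m) (x + t • w) + pd j (Z m) (x + t • w)))
      (g₂ := fun t => ρ * (ρ * (pd i (pd i (Z m)) (x + t • w) + pd j (pd i (Z m)) (x + t • w))
        + ρ * (pd i (pd j (Z m)) (x + t • w) + pd j (pd j (Z m)) (x + t • w))))
      (g₃ := fun t => ρ * (ρ * (ρ * (pd i (pd i (pd i (Z m))) (x + t • w)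
          + pd j (pd i (pd i (Z m))) (x + t • w))
          + ρ * (pd i (pd j (pd i (Z m))) (x + t • w) + pd j (pd j (pd i (Z m))) (x + t • w)))
        + ρ * (ρ * (pd i (pd i (pd j (Z m))) (x + t • w) + pd j (pd i (pd j (Z m))) (x + t • w))
          + ρ * (pd i (pd j (pd j (Z m))) (x + t • w) + pd j (pd j (pd j (Z m))) (x + t • w)))))
      (η := η) (M := M)
      (fun t ht => hasDerivAt_sampleStep (c0 t ht))
      (fun t ht => ((hasDerivAt_sampleStep (c1 i t ht)).add
        (hasDerivAt_sampleStep (c1 j t ht))).const_mul ρ)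
      (fun t ht => ((((hasDerivAt_sampleStep (c2 i i t ht)).add
        (hasDerivAt_sampleStep (c2 j i t ht))).const_mul ρ).add
        (((hasDerivAt_sampleStep (c2 i j t ht)).add
        (hasDerivAt_sampleStep (c2 j j t ht))).const_mul ρ)).const_mul ρ)
      (fun t ht => by
        set X := (r / 8) * (2 * (η / r ^ 3)) with hX
        have q1 := hb t ht i i
        have q2 := hb t ht j i
        have q3 := hb t ht i j
        have q4 := hb t ht j j
        have s1 := (norm_add_le _ _).trans (add_le_add q1 q2)
        have s2 := (norm_add_le _ _).trans (add_le_add q3 q4)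
        have t1 := mul_le_mul_of_nonneg_left s1 (norm_nonneg ρ)
        have t2 := mul_le_mul_of_nonneg_left s2 (norm_nonneg ρ)
        rw [← norm_mul] at t1 t2
        have t3 := mul_le_mul_of_nonneg_left ((norm_add_le _ _).trans (add_le_add t1 t2))
          (norm_nonneg ρ)
        rw [← norm_mul] at t3
        refine t3.trans ?_
        rw [hρn, hX]
        have : r / 8 * (r / 8 * (r / 8 * (2 * (η / r ^ 3)) + r / 8 * (2 * (η / r ^ 3)))
          + r / 8 * (r / 8 * (2 * (η / r ^ 3)) + r / 8 * (2 * (η / r ^ 3)))) = η / 64 := by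
          field_simp
          ring
        rw [this]
        linarith)
      (by simpa using hM m i j 0) (by simpa using hM m i j 1) (by simpa using hM m i j 2)
    simpa using this
  have cx : ∀ m, ContDiffAt ℝ ∞ (Z m) x := hZ x (by simp; positivity)
  have hfin : n ≤ 768 * M + 576 * η := by
    refine (norm_jet2_le_iff hr (by positivity)).2 ⟨fun m => ?_, fun m a => ?_, fun m a b => ?_⟩
    · have := hM m 0 0 0
      simp at this
      linarith
    · have h := (landau m a a).1
      rw [norm_mul, hρn, ← two_mul, norm_mul, Complex.norm_two] at h
      linarith
    · have k : ∀ i j, ‖((r : ℂ) ^ 2) * (pd i (pd i (Z m)) x + 2 * pd j (pd i (Z m)) x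
          + pd j (pd j (Z m)) x)‖ ≤ 64 * (16 * M + 12 * η) := by
        intro i j
        have h := (landau m i j).2
        rw [pd_comm ((cx m).of_le ENat.LEInfty.out) i j] at h
        have e : (r : ℂ) ^ 2 * (pd i (pd i (Z m)) x + 2 * pd j (pd i (Z m)) x + pd j (pd j (Z m)) x)
          = 64 * (ρ * (ρ * (pd i (pd i (Z m)) x + pd j (pd i (Z m)) x)
            + ρ * (pd j (pd i (Z m)) x + pd j (pd j (Z m)) x))) := by
          rw [hρ]; push_cast; ring
        rw [e, norm_mul, show ‖(64 : ℂ)‖ = 64 by norm_num]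
        linarith
      -- Polarisation: the second derivative along e_a + e_b, minus a quarter of those along 2e_a
      -- and 2e_b, leaves the mixed derivative. This is why the sampling directions are sums of two
      -- basis vectors.
      set La := (r : ℂ) ^ 2 * (pd a (pd a (Z m)) x + 2 * pd a (pd a (Z m)) x
          + pd a (pd a (Z m)) x) with hLa
      set Lb := (r : ℂ) ^ 2 * (pd b (pd b (Z m)) x + 2 * pd b (pd b (Z m)) x
          + pd b (pd b (Z m)) x) with hLb
      set Lab := (r : ℂ) ^ 2 * (pd a (pd a (Z m)) x + 2 * pd b (pd a (Z m)) x
          + pd b (pd b (Z m)) x) with hLab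
      have e : (r : ℂ) ^ 2 * pd b (pd a (Z m)) x = (1 / 2) * (Lab - (1 / 4) * La - (1 / 4) * Lb) := by
        rw [hLa, hLb, hLab]; ring
      have e' : r ^ 2 * ‖pd b (pd a (Z m)) x‖ = ‖(r : ℂ) ^ 2 * pd b (pd a (Z m)) x‖ := by
        rw [norm_mul, norm_pow, Complex.norm_real, Real.norm_of_nonneg hr.le]
      rw [e', e, norm_mul]
      have n1 := norm_sub_le (Lab - (1 / 4) * La) ((1 / 4) * Lb)
      have n2 := norm_sub_le Lab ((1 / 4) * La)
      rw [norm_mul (1 / 4 : ℂ), show ‖(1 / 4 : ℂ)‖ = 1 / 4 by norm_num] at n1 n2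
      have k1 : ‖La‖ ≤ _ := k a a
      have k2 : ‖Lb‖ ≤ _ := k b b
      have k3 : ‖Lab‖ ≤ _ := k a b
      rw [show ‖(1 / 2 : ℂ)‖ = 1 / 2 by norm_num]
      linarith
  rw [hη] at hfin
  linarith

/-- Interior estimate: the second order jet is controlled by the local `L²` norm. -/
lemma ofReal_norm_jet2_sq_le {r κ : ℝ} (hr : 0 < r) (hκ : κ ≤ 1 / 3456)
    {Z : Fin 3 → E3 → ℂ} {x : E3}
    (hZ : ∀ y, ‖y - x‖ ≤ r / 2 → ∀ m, ContDiffAt ℝ ∞ (Z m) y)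
    (h3 : ∀ y, ‖y - x‖ ≤ r / 2 → ∀ c b a k,
      r ^ 3 * ‖pd c (pd b (pd a (Z k))) y‖ ≤ κ * ‖jet2 r Z y‖) :
    ENNReal.ofReal (‖jet2 r Z x‖ ^ 2) * volume (Metric.closedBall x (r / 4)) ≤
      ENNReal.ofReal (9 * 1536 ^ 2 * 81 * 27) *
        ∫⁻ y in Metric.closedBall x (r / 2), ENNReal.ofReal (∑ m, ‖Z m y‖ ^ 2) := by
  set n := ‖jet2 r Z x‖ with hn
  -- 9 is the square of the Gronwall factor between x and y, 1536 the constant of the sampling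
  -- estimate, and 81 the number of sampled values (27 steps, three components) in Cauchy–Schwarz.
  -- The last factor 27 of the statement counts the translates.
  set c : ℝ := 9 * 1536 ^ 2 * 81 with hc
  set w : Fin 3 × Fin 3 × Fin 3 → E3 := fun q => ((q.2.2 : ℝ) / 2) • sampleStep r q.1 q.2.1 with hw
  have hwn : ∀ q, ‖w q‖ ≤ r / 4 := by
    intro q
    rw [hw, norm_smul, Real.norm_of_nonneg (by positivity)]
    have h1 : ((q.2.2 : ℕ) : ℝ) ≤ 2 := by exact_mod_cast Nat.lt_succ_iff.1 q.2.2.2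
    exact (mul_le_of_le_one_left (norm_nonneg _) (by linarith)).trans (norm_sampleStep_le hr _ _)
  set F : E3 → ℝ≥0∞ := fun y => ENNReal.ofReal (∑ m, ‖Z m y‖ ^ 2) with hF
  have hpt : ∀ y ∈ Metric.closedBall x (r / 4), ENNReal.ofReal (n ^ 2) ≤
      ENNReal.ofReal c * ∑ q, F (y + w q) := by
    intro y hy
    rw [mem_closedBall_iff_norm] at hy
    have hy2 : ∀ z, ‖z - y‖ ≤ r / 4 → ‖z - x‖ ≤ r / 2 := fun z hz => by
      have := norm_add_le (z - y) (y - x)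
      rw [sub_add_sub_cancel] at this
      linarith
    set M := ∑ p : (Fin 3 × Fin 3 × Fin 3) × Fin 3, ‖Z p.2 (y + w p.1)‖ with hM
    have h1 := norm_jet2_le_of_samples hr hκ (M := M) (fun z hz => hZ z (hy2 z hz))
      (fun z hz => h3 z (hy2 z hz)) (fun m i j s =>
        Finset.single_le_sum (f := fun p : (Fin 3 × Fin 3 × Fin 3) × Fin 3 => ‖Z p.2 (y + w p.1)‖)
          (fun _ _ => norm_nonneg _) (Finset.mem_univ ((i, j, s), m)))
    have hseg : ∀ t ∈ Set.Icc (0 : ℝ) 1, ‖y + t • (x - y) - x‖ ≤ r / 2 := by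
      intro t ht
      have e : y + t • (x - y) - x = (1 - t) • (y - x) := by module
      rw [e, norm_smul, Real.norm_of_nonneg (by linarith [ht.2])]
      nlinarith [ht.1, ht.2, norm_nonneg (y - x)]
    have h2 : n ≤ ‖jet2 r Z y‖ * 3 := by
      have := norm_jet2_le_exp hr (Z := Z) (x := y) (v := x - y)
        (fun t ht m => hZ _ (hseg t ht) m)
        (fun t ht c b a k => (h3 _ (hseg t ht) c b a k).trans
          (mul_le_of_le_one_left (norm_nonneg _) (hκ.trans (by norm_num))))
      rw [add_sub_cancel] at this
      refine this.trans ?_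
      refine mul_le_mul_of_nonneg_left ?_ (norm_nonneg _)
      have h1 : 3 * ‖x - y‖ / r ≤ 1 := by
        rw [div_le_one hr, norm_sub_rev]
        linarith
      exact (Real.exp_le_exp.2 h1).trans Real.exp_one_lt_three.le
    have h4 : M ^ 2 ≤ 81 * ∑ q, ∑ m, ‖Z m (y + w q)‖ ^ 2 := by
      have := sq_sum_le_card_mul_sum_sq (s := (Finset.univ : Finset ((Fin 3 × Fin 3 × Fin 3) × Fin 3)))
        (f := fun p => ‖Z p.2 (y + w p.1)‖)
      rw [Fintype.sum_prod_type (f := fun p : (Fin 3 × Fin 3 × Fin 3) × Fin 3 =>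
        ‖Z p.2 (y + w p.1)‖ ^ 2)] at this
      simpa using this
    have hM0 : 0 ≤ M := Finset.sum_nonneg fun _ _ => norm_nonneg _
    have h5 : n ^ 2 ≤ c * ∑ q, ∑ m, ‖Z m (y + w q)‖ ^ 2 := by
      have h6 : n ≤ 3 * 1536 * M := by linarith
      calc n ^ 2 ≤ (3 * 1536 * M) ^ 2 := by gcongr
        _ = 9 * 1536 ^ 2 * M ^ 2 := by ring
        _ ≤ 9 * 1536 ^ 2 * (81 * ∑ q, ∑ m, ‖Z m (y + w q)‖ ^ 2) := by gcongr
        _ = _ := by rw [hc]; ring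
    refine (ENNReal.ofReal_le_ofReal h5).trans ?_
    rw [ENNReal.ofReal_mul (by rw [hc]; positivity), ENNReal.ofReal_sum_of_nonneg]
    intro q _
    exact Finset.sum_nonneg fun _ _ => by positivity
  have hshift : ∀ q, ∫⁻ y in Metric.closedBall x (r / 4), F (y + w q) ≤
      ∫⁻ y in Metric.closedBall x (r / 2), F y := by
    intro q
    rw [← lintegral_indicator measurableSet_closedBall, ← lintegral_indicator measurableSet_closedBall]
    rw [← lintegral_add_right_eq_self (fun y => (Metric.closedBall x (r / 2)).indicator F y) (w q)]
    refine lintegral_mono fun y => ?_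
    by_cases hy : y ∈ Metric.closedBall x (r / 4)
    · have hy' : y + w q ∈ Metric.closedBall x (r / 2) := by
        rw [mem_closedBall_iff_norm] at hy ⊢
        have := norm_add_le (y - x) (w q)
        rw [show y - x + w q = y + w q - x by abel] at this
        linarith [hwn q]
      simp only [Set.indicator_of_mem hy, Set.indicator_of_mem hy', le_refl]
    · simp [Set.indicator_of_notMem hy]
  have hFc : ContinuousOn F (Metric.closedBall x (r / 2)) := by
    intro y hy
    rw [mem_closedBall_iff_norm] at hy
    refine (ENNReal.continuous_ofReal.continuousAt.comp ?_).continuousWithinAt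
    exact tendsto_finsetSum _ fun m _ => ((hZ y hy m).continuousAt.norm.pow 2)
  have hm : ∀ q, AEMeasurable (fun y => F (y + w q)) (volume.restrict (Metric.closedBall x (r / 4))) := by
    intro q
    refine ContinuousOn.aemeasurable (hFc.comp (by fun_prop) fun y hy => ?_) measurableSet_closedBall
    rw [mem_closedBall_iff_norm] at hy ⊢
    have := norm_add_le (y - x) (w q)
    rw [show y - x + w q = y + w q - x by abel] at this
    linarith [hwn q]
  calc ENNReal.ofReal (n ^ 2) * volume (Metric.closedBall x (r / 4))
      = ∫⁻ y in Metric.closedBall x (r / 4), ENNReal.ofReal (n ^ 2) := by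
        rw [setLIntegral_const]
    _ ≤ ∫⁻ y in Metric.closedBall x (r / 4), ENNReal.ofReal c * ∑ q, F (y + w q) :=
        setLIntegral_mono' measurableSet_closedBall hpt
    _ = ENNReal.ofReal c * ∑ q, ∫⁻ y in Metric.closedBall x (r / 4), F (y + w q) := by
        rw [lintegral_const_mul'' _ (Finset.aemeasurable_fun_sum _ fun q _ => hm q),
          lintegral_finsetSum' _ fun q _ => hm q]
    _ ≤ ENNReal.ofReal c * ∑ q : Fin 3 × Fin 3 × Fin 3,
        ∫⁻ y in Metric.closedBall x (r / 2), F y := by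
        exact mul_le_mul_right (Finset.sum_le_sum fun q _ => hshift q) _
    _ = _ := by
        have hc0 : 0 ≤ c := by rw [hc]; positivity
        rw [Finset.sum_const, Finset.card_univ, nsmul_eq_mul, ← mul_assoc,
          show (9 * 1536 ^ 2 * 81 * 27 : ℝ) = c * 27 by rw [hc], ENNReal.ofReal_mul hc0]
        simp

end Interior

/-! ### Decay and vanishing on an exterior domain -/

section Decay

open Filter Topology

/-- A function tending to zero is bounded by the integral of a decaying bound on its derivative. -/
lemma norm_le_of_deriv_decay {f f' : ℝ → ℂ} {s₀ A p : ℝ} (hs₀ : 0 < s₀) (hp : 0 < p)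
    (hf : ∀ s, s₀ ≤ s → HasDerivAt f (f' s) s) (hb : ∀ s, s₀ ≤ s → ‖f' s‖ ≤ A * s ^ (-p - 1))
    (h0 : Tendsto f atTop (𝓝 0)) {s : ℝ} (hs : s₀ ≤ s) : ‖f s‖ ≤ A / p * s ^ (-p) := by
  have hA : 0 ≤ A := by
    have := (norm_nonneg _).trans (hb s₀ le_rfl)
    exact nonneg_of_mul_nonneg_left this (Real.rpow_pos_of_pos hs₀ _)
  have hT : ∀ T, s ≤ T → ‖f T - f s‖ ≤ A / p * s ^ (-p) := by
    intro T hT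
    have := image_norm_le_of_norm_deriv_right_le_deriv_boundary' (a := s) (b := T)
      (f := fun t => f t - f s) (f' := f') (B := fun t => A / p * (s ^ (-p) - t ^ (-p)))
      (B' := fun t => A * t ^ (-p - 1))
      (fun t ht => ((hf t (hs.trans ht.1)).continuousAt.sub continuousAt_const).continuousWithinAt)
      (fun t ht => ((hf t (hs.trans ht.1)).sub_const _).hasDerivWithinAt) (by simp)
      (fun t ht => ?_) (fun t ht => ?_) (fun t ht => hb t (hs.trans ht.1)) (Set.right_mem_Icc.2 hT)
    · refine this.trans ?_
      have h1 : 0 ≤ T ^ (-p) := Real.rpow_nonneg ((hs₀.le.trans hs).trans hT) _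
      gcongr
      linarith
    · have ht0 : t ≠ 0 := ((hs₀.trans_le hs).trans_le ht.1).ne'
      have h1 : ContinuousAt (fun t : ℝ => A / p * (s ^ (-p) - t ^ (-p))) t :=
        (((Real.continuousAt_rpow_const t (-p) (Or.inl ht0))).const_sub _).const_mul (A / p)
      exact h1.continuousWithinAt
    · have ht0 : t ≠ 0 := ((hs₀.trans_le hs).trans_le ht.1).ne'
      have h1 := (((Real.hasDerivAt_rpow_const (p := -p) (Or.inl ht0)).const_sub (s ^ (-p))).const_mul
        (A / p)).hasDerivWithinAt (s := Set.Ici t)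
      refine h1.congr_deriv ?_
      field_simp
  have h1 : Tendsto (fun T => ‖f T - f s‖) atTop (𝓝 ‖0 - f s‖) := (h0.sub_const _).norm
  have h2 := le_of_tendsto h1 (eventually_atTop.2 ⟨s, hT⟩)
  simpa using h2

/-- A decaying vector field on an exterior domain whose third derivatives are controlled by the
second order jet with a small constant vanishes. -/
lemma jet2_eq_zero_of_decay {Z : Fin 3 → E3 → ℂ} {s₀ A κ : ℝ} (hs₀ : 0 < s₀) (hκ0 : 0 ≤ κ)
    (hκ : κ ≤ 1 / 30)
    (hZ : ∀ y, s₀ ≤ ‖y‖ → ∀ m, ContDiffAt ℝ ∞ (Z m) y)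
    (h3 : ∀ y, s₀ ≤ ‖y‖ → ∀ c b a k,
      ‖y‖ ^ 3 * ‖pd c (pd b (pd a (Z k))) y‖ ≤ κ * ‖jet2 ‖y‖ Z y‖)
    (hA : ∀ y, s₀ ≤ ‖y‖ → ‖jet2 ‖y‖ Z y‖ ≤ A * ‖y‖ ^ (-(1 / 2) : ℝ)) :
    ∀ y, s₀ ≤ ‖y‖ → jet2 ‖y‖ Z y = 0 := by
  -- Starting from third derivatives of size κB r^{−7/2}, three integrations inwards along rays,
  -- each bringing a factor 3 for the sum over components and division by 5/2, 3/2, 1/2, give the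
  -- constants 6/5, 12/5 and 72/5 times κB. With κ ≤ 1/30 all are below B/2.
  have step : ∀ B, (∀ y, s₀ ≤ ‖y‖ → ‖jet2 ‖y‖ Z y‖ ≤ B * ‖y‖ ^ (-(1 / 2) : ℝ)) →
      ∀ y, s₀ ≤ ‖y‖ → ‖jet2 ‖y‖ Z y‖ ≤ B / 2 * ‖y‖ ^ (-(1 / 2) : ℝ) := by
    intro B hB y hy
    have hy0 : 0 < ‖y‖ := hs₀.trans_le hy
    set u : E3 := ‖y‖⁻¹ • y with hu
    have hun : ‖u‖ = 1 := by rw [hu, norm_smul, norm_inv, norm_norm, inv_mul_cancel₀ hy0.ne']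
    have hray : ∀ s, s₀ ≤ s → ‖(0 : E3) + s • u‖ = s := fun s hs => by
      rw [zero_add, norm_smul, hun, mul_one, Real.norm_of_nonneg (hs₀.le.trans hs)]
    have hyu : (0 : E3) + ‖y‖ • u = y := by
      rw [zero_add, hu, smul_smul, mul_inv_cancel₀ hy0.ne', one_smul]
    have hB0 : 0 ≤ B := nonneg_of_mul_nonneg_left ((norm_nonneg _).trans (hB y hy))
      (Real.rpow_pos_of_pos hy0 _)
    have hc : ∀ s, s₀ ≤ s → ∀ m, ContDiffAt ℝ ∞ (Z m) ((0 : E3) + s • u) := fun s hs m =>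
      hZ _ (by rw [hray s hs]; exact hs) m
    have hn : ∀ s, s₀ ≤ s → ‖jet2 s Z ((0 : E3) + s • u)‖ ≤ B * s ^ (-(1 / 2) : ℝ) := fun s hs => by
      have := hB ((0 : E3) + s • u) (by rw [hray s hs]; exact hs)
      rwa [hray s hs] at this
    have hpow : ∀ {s : ℝ} {k : ℕ} {x p : ℝ} {q : ℝ}, s₀ ≤ s → s ^ k * x ≤ p * s ^ q →
        x ≤ p * s ^ (q - k) := by
      intro s k x p q hs h
      have hs0 := hs₀.trans_le hs
      rw [Real.rpow_sub hs0, Real.rpow_natCast, mul_div_assoc', le_div_iff₀ (by positivity), mul_comm]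
      exact h
    have hlim : ∀ {f : ℝ → ℂ} {q : ℝ}, 0 < q → (∀ s, s₀ ≤ s → ‖f s‖ ≤ B * s ^ (-q)) →
        Tendsto f atTop (𝓝 0) := by
      intro f q hq hf
      have h1 : Tendsto (fun s : ℝ => B * s ^ (-q)) atTop (𝓝 (B * 0)) :=
        (tendsto_rpow_neg_atTop hq).const_mul B
      rw [mul_zero] at h1
      exact squeeze_zero_norm' (eventually_atTop.2 ⟨s₀, hf⟩) h1
    have hall : ∀ s, ∀ hs : s₀ ≤ s, _ := fun s hs =>
      (norm_jet2_le_iff (hs₀.trans_le hs) (mul_nonneg hB0 (Real.rpow_nonneg (hs₀.le.trans hs) _))).1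
        (hn s hs)
    have hd2 : ∀ m a b s, s₀ ≤ s → ‖pd b (pd a (Z m)) ((0 : E3) + s • u)‖ ≤
        (6 / 5 * κ * B) * s ^ (-(5 / 2) : ℝ) := by
      intro m a b s hs
      have := norm_le_of_deriv_decay (p := 5 / 2) (A := 3 * (κ * B)) hs₀ (by norm_num)
        (fun t ht => hasDerivAt_line (pd_contDiffAt (pd_contDiffAt (hc t ht m) a) b))
        (fun t ht => (norm_sum_pd_le (B := κ * B * t ^ (-(5 / 2) - 1 : ℝ)) fun p => ?_).trans_eq
          (by rw [hun]; ring))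
        (hlim (q := 5 / 2) (by norm_num) fun t ht => ?_) hs
      · refine this.trans_eq ?_
        ring_nf
      · have e := h3 ((0 : E3) + t • u) (by rw [hray t ht]; exact ht) p b a m
        rw [hray t ht] at e
        have e2 := e.trans (mul_le_mul_of_nonneg_left (hn t ht) hκ0)
        rw [← mul_assoc] at e2
        have e3 := hpow ht e2
        convert e3 using 3
        norm_num
      · have e3 := hpow ht ((hall t ht).2.2 m a b)
        convert e3 using 3
        norm_num
    have hd1 : ∀ m a s, s₀ ≤ s → ‖pd a (Z m) ((0 : E3) + s • u)‖ ≤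
        (12 / 5 * κ * B) * s ^ (-(3 / 2) : ℝ) := by
      intro m a s hs
      have := norm_le_of_deriv_decay (p := 3 / 2) (A := 3 * (6 / 5 * κ * B)) hs₀ (by norm_num)
        (fun t ht => hasDerivAt_line (pd_contDiffAt (hc t ht m) a))
        (fun t ht => (norm_sum_pd_le (B := (6 / 5 * κ * B) * t ^ (-(3 / 2) - 1 : ℝ)) fun p => ?_).trans_eq
          (by rw [hun]; ring))
        (hlim (q := 3 / 2) (by norm_num) fun t ht => ?_) hs
      · refine this.trans_eq ?_
        ring_nf
      · convert hd2 m a p t ht using 3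
        norm_num
      · have e0 : t ^ 1 * ‖pd a (Z m) ((0 : E3) + t • u)‖ ≤ B * t ^ (-(1 / 2) : ℝ) := by
          rw [pow_one]; exact (hall t ht).2.1 m a
        have e3 := hpow ht e0
        convert e3 using 3
        norm_num
    have hd0 : ∀ m s, s₀ ≤ s → ‖Z m ((0 : E3) + s • u)‖ ≤
        (72 / 5 * κ * B) * s ^ (-(1 / 2) : ℝ) := by
      intro m s hs
      have := norm_le_of_deriv_decay (p := 1 / 2) (A := 3 * (12 / 5 * κ * B)) hs₀ (by norm_num)
        (fun t ht => hasDerivAt_line (hc t ht m))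
        (fun t ht => (norm_sum_pd_le (B := (12 / 5 * κ * B) * t ^ (-(1 / 2) - 1 : ℝ)) fun p => ?_).trans_eq
          (by rw [hun]; ring))
        (hlim (q := 1 / 2) (by norm_num) fun t ht => ?_) hs
      · refine this.trans_eq ?_
        ring_nf
      · convert hd1 m p t ht using 3
        norm_num
      · exact (hall t ht).1 m
    have hκB : κ * B ≤ 1 / 30 * B := mul_le_mul_of_nonneg_right hκ hB0
    have hr1 := Real.rpow_nonneg hy0.le (-(1 / 2) : ℝ)
    have hback : ∀ {k : ℕ} {x p q : ℝ}, x ≤ p * ‖y‖ ^ q → ‖y‖ ^ k * x ≤ p * ‖y‖ ^ (q + k) := by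
      intro k x p q h
      rw [Real.rpow_add hy0, Real.rpow_natCast, ← mul_assoc, mul_comm]
      exact mul_le_mul_of_nonneg_right h (by positivity)
    refine (norm_jet2_le_iff hy0 (by positivity)).2 ⟨fun m => ?_, fun m a => ?_, fun m a b => ?_⟩
    · have := hd0 m ‖y‖ hy
      rw [hyu] at this
      refine this.trans (mul_le_mul_of_nonneg_right ?_ hr1)
      linarith
    · have := hd1 m a ‖y‖ hy
      rw [hyu] at this
      have := hback (k := 1) this
      rw [pow_one, show (-(3 / 2) + (1 : ℕ) : ℝ) = -(1 / 2) by norm_num] at this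
      refine this.trans (mul_le_mul_of_nonneg_right ?_ hr1)
      linarith
    · have := hd2 m a b ‖y‖ hy
      rw [hyu] at this
      have := hback (k := 2) this
      rw [show (-(5 / 2) + (2 : ℕ) : ℝ) = -(1 / 2) by norm_num] at this
      refine this.trans (mul_le_mul_of_nonneg_right ?_ hr1)
      linarith
  intro y hy
  have hk : ∀ k : ℕ, ∀ y, s₀ ≤ ‖y‖ → ‖jet2 ‖y‖ Z y‖ ≤ A * (1 / 2) ^ k * ‖y‖ ^ (-(1 / 2) : ℝ) := by
    intro k
    induction k with
    | zero => simpa using hA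
    | succ k ih =>
      intro y hy
      refine (step _ ih y hy).trans_eq ?_
      ring
  have h1 : Tendsto (fun k : ℕ => A * (1 / 2 : ℝ) ^ k * ‖y‖ ^ (-(1 / 2) : ℝ)) atTop
      (𝓝 (A * 0 * ‖y‖ ^ (-(1 / 2) : ℝ))) :=
    ((tendsto_pow_atTop_nhds_zero_of_lt_one (by norm_num) (by norm_num)).const_mul A).mul_const _
  rw [mul_zero, zero_mul] at h1
  exact norm_le_zero_iff.1 (ge_of_tendsto' h1 fun k => hk k y hy)

/-- Pointwise decay of the jet from a weighted `L²` bound. -/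
lemma norm_jet2_decay {Z : Fin 3 → E3 → ℂ} {s₀ κ : ℝ} (hs₀ : 0 < s₀) (hκ : κ ≤ 1 / 3456)
    (hZ : ∀ y, s₀ < ‖y‖ → ∀ m, ContDiffAt ℝ ∞ (Z m) y)
    (h3 : ∀ r y, s₀ < ‖y‖ → 0 < r → ‖y‖ ≤ 2 * r → r ≤ 2 * ‖y‖ → ∀ c b a k,
      r ^ 3 * ‖pd c (pd b (pd a (Z k))) y‖ ≤ κ * ‖jet2 r Z y‖)
    (hI : ∫⁻ y in {y : E3 | s₀ < ‖y‖}, ENNReal.ofReal (∑ m, ‖Z m y‖ ^ 2 * (‖y‖ ^ 2)⁻¹) < ⊤) :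
    ∃ A : ℝ, ∀ y, 2 * s₀ < ‖y‖ → ‖jet2 ‖y‖ Z y‖ ≤ A * ‖y‖ ^ (-(1 / 2) : ℝ) := by
  set I := ∫⁻ y in {y : E3 | s₀ < ‖y‖}, ENNReal.ofReal (∑ m, ‖Z m y‖ ^ 2 * (‖y‖ ^ 2)⁻¹) with hIdef
  set v : ℝ := (volume (Metric.ball (0 : E3) 1)).toReal with hv
  have hvpos : 0 < v := ENNReal.toReal_pos
    (Metric.measure_ball_pos volume (0 : E3) one_pos).ne' measure_ball_lt_top.ne
  set c : ℝ := 9 * 1536 ^ 2 * 81 * 27 with hc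
  refine ⟨Real.sqrt (c * (9 / 4) * I.toReal * 64 / v), fun x hx => ?_⟩
  have hr : 0 < ‖x‖ := by linarith
  set r := ‖x‖ with hrdef
  have hball : ∀ y, ‖y - x‖ ≤ r / 2 → s₀ < ‖y‖ ∧ ‖y‖ ≤ 3 / 2 * r ∧ r / 2 ≤ ‖y‖ := by
    intro y hy
    have e1 := norm_sub_norm_le x y
    have e2 := norm_sub_norm_le y x
    rw [norm_sub_rev] at e1
    refine ⟨by linarith, by linarith, by linarith⟩
  have h1 := ofReal_norm_jet2_sq_le hr hκ (x := x) (fun y hy => hZ y (hball y hy).1)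
    (fun y hy => h3 r y (hball y hy).1 hr (by linarith [(hball y hy).2.1])
      (by linarith [(hball y hy).2.2]))
  -- On this ball |y| ≤ 3r/2, so the weight |y|^{−2} is at least 4/(9r²). Dividing r² by the volume,
  -- of order r³, leaves r^{−1} for the squared jet, that is, decay r^{−1/2}.
  have h2 : ∫⁻ y in Metric.closedBall x (r / 2), ENNReal.ofReal (∑ m, ‖Z m y‖ ^ 2) ≤
      ENNReal.ofReal (9 / 4 * r ^ 2) * I := by
    calc _ ≤ ∫⁻ y in Metric.closedBall x (r / 2), ENNReal.ofReal (9 / 4 * r ^ 2) *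
          ENNReal.ofReal (∑ m, ‖Z m y‖ ^ 2 * (‖y‖ ^ 2)⁻¹) := by
          refine setLIntegral_mono' measurableSet_closedBall fun y hy => ?_
          rw [mem_closedBall_iff_norm] at hy
          obtain ⟨q1, q2, q3⟩ := hball y hy
          rw [← ENNReal.ofReal_mul (by positivity)]
          refine ENNReal.ofReal_le_ofReal ?_
          rw [← Finset.sum_mul]
          have hy0 : 0 < ‖y‖ := by linarith
          rw [mul_comm, mul_assoc]
          refine le_mul_of_one_le_right (Finset.sum_nonneg fun _ _ => by positivity) ?_
          rw [inv_mul_eq_div, one_le_div (by positivity)]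
          nlinarith
      _ = ENNReal.ofReal (9 / 4 * r ^ 2) * ∫⁻ y in Metric.closedBall x (r / 2),
          ENNReal.ofReal (∑ m, ‖Z m y‖ ^ 2 * (‖y‖ ^ 2)⁻¹) := by
          rw [lintegral_const_mul' _ _ ENNReal.ofReal_ne_top]
      _ ≤ _ := by
          refine mul_le_mul_right (lintegral_mono_set fun y hy => ?_) _
          rw [mem_closedBall_iff_norm] at hy
          exact (hball y hy).1
  have h3 := h1.trans (mul_le_mul_right h2 _)
  have hvol : volume (Metric.closedBall x (r / 4)) = ENNReal.ofReal ((r / 4) ^ 3 * v) := by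
    rw [Measure.addHaar_closedBall _ _ (by positivity), ENNReal.ofReal_mul (by positivity),
      hv, ENNReal.ofReal_toReal measure_ball_lt_top.ne]
    simp
  rw [hvol, ← ENNReal.ofReal_mul (by positivity), ← ENNReal.ofReal_toReal hI.ne,
    ← ENNReal.ofReal_mul (by positivity), ← ENNReal.ofReal_mul (by positivity),
    ENNReal.ofReal_le_ofReal_iff (by positivity)] at h3
  have h4 : ‖jet2 r Z x‖ ^ 2 ≤ c * (9 / 4) * I.toReal * 64 / v * r⁻¹ := by
    rw [← div_eq_mul_inv, le_div_iff₀ hr, le_div_iff₀ hvpos]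
    have h5 : ‖jet2 r Z x‖ ^ 2 * r * v * (r ^ 2 / 64) ≤ c * (9 / 4) * I.toReal * 64 * (r ^ 2 / 64) := by
      nlinarith [h3]
    exact le_of_mul_le_mul_right h5 (by positivity)
  have e : (r ^ (-(1 / 2) : ℝ)) = Real.sqrt r⁻¹ := by
    rw [Real.sqrt_eq_rpow, Real.rpow_neg hr.le, Real.inv_rpow hr.le]
  rw [e, ← Real.sqrt_mul (by positivity)]
  exact Real.le_sqrt_of_sq_le h4

end Decay

/-! ### Vanishing of Killing spinors far out in an end -/

section AsymptoticFlatness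

variable {S : Type*} [TopologicalSpace S] [ChartedSpace E3 S] [IsManifold (𝓡 3) ∞ S]
  [RiemannianBundle (fun x : S => TangentSpace (𝓡 3) x)]
  [hR : IsContMDiffRiemannianBundle (𝓡 3) ∞ E3 (fun x : S => TangentSpace (𝓡 3) x)]

/-- Far out in an end the data are nearly flat at the scale of the distance. -/
lemma IsAsymptoticEnd.nearFlat {K : TwoTensor S} {φ : OpenPartialHomeomorph S E3}
    (hK : IsAsymptoticallyEuclidean K) (hφ : IsAsymptoticEnd K φ) {ε : ℝ} (hε : 0 < ε) :
    ∃ s₀ > 0, (∀ y : E3, s₀ ≤ ‖y‖ → y ∈ φ.target) ∧ ∀ r (y : E3), s₀ ≤ ‖y‖ → 0 < r →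
      ‖y‖ ≤ 2 * r → r ≤ 2 * ‖y‖ → IsNearFlat K φ r ε y := by
  obtain ⟨hmax, R, ρ, hR0, hRρ, htar, hm, hk⟩ := hφ
  have hmem : ∀ y : E3, R < ‖y‖ ↔ y ∈ φ.target := fun y => by
    rw [htar]; simp
  have hmc : ∀ i j, ContDiffOn ℝ ∞ (fun y => metricCoeff φ i j y - (-(if i = j then 1 else 0)))
      {y : E3 | R < ‖y‖} := fun i j y hy =>
    ((metricCoeff_contDiffAt hmax ((hmem y).1 hy) i j).sub contDiffAt_const).contDiffWithinAt
  have hkc : ∀ i j, ContDiffOn ℝ ∞ (tensorCoeff K φ i j) {y : E3 | R < ‖y‖} := fun i j y hy =>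
    (tensorCoeff_contDiffAt hmax hK ((hmem y).1 hy) i j).contDiffWithinAt
  choose a ha0 ha using fun i j k => decays_pointwise hR0 hRρ (hmc i j) (hm i j) k
  choose b hb0 hb using fun i j k => decays_pointwise hR0 hRρ (hkc i j) (hk i j) k
  set C : ℝ := ∑ i, ∑ j, ∑ k ∈ Finset.range 4, (a i j k + b i j k) with hC
  have hC0 : 0 ≤ C := Finset.sum_nonneg fun i _ => Finset.sum_nonneg fun j _ =>
    Finset.sum_nonneg fun k _ => add_nonneg (ha0 i j k) (hb0 i j k)
  have hle : ∀ i j, ∀ k ≤ 3, a i j k + b i j k ≤ C := by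
    intro i j k hk
    have hn := fun i j k => add_nonneg (ha0 i j k) (hb0 i j k)
    refine (Finset.single_le_sum (f := fun k => a i j k + b i j k) (fun k _ => hn i j k)
      (Finset.mem_range.2 (by omega : k < 4))).trans ?_
    refine (Finset.single_le_sum (f := fun j => ∑ k ∈ Finset.range 4, (a i j k + b i j k))
      (fun j _ => Finset.sum_nonneg fun k _ => hn i j k) (Finset.mem_univ j)).trans ?_
    exact Finset.single_le_sum (f := fun i => ∑ j, ∑ k ∈ Finset.range 4, (a i j k + b i j k))
      (fun i _ => Finset.sum_nonneg fun j _ => Finset.sum_nonneg fun k _ => hn i j k)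
      (Finset.mem_univ i)
  have hρ0 : 0 < ρ := hR0.trans hRρ
  -- Chosen so that 16C|y|^{−1/2} ≤ ε. The 16 is 2³, from r^l ≤ 8|y|^l, times the further factor 2
  -- in r ≤ 2|y| that the bound on K needs.
  set s₀ : ℝ := max (4 * ρ) ((16 * C / ε) ^ 2) with hs₀
  have hs₀0 : 0 < s₀ := lt_max_of_lt_left (by positivity)
  refine ⟨s₀, hs₀0, fun y hy => (hmem y).1 ?_, fun r y hy hr h1 h2 => ?_⟩
  · have := (le_max_left _ _).trans hy
    linarith
  have hy4 : 4 * ρ ≤ ‖y‖ := (le_max_left _ _).trans hy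
  have hy0 : 0 < ‖y‖ := hs₀0.trans_le hy
  have hsmall : 16 * C * ‖y‖ ^ (-(1 / 2) : ℝ) ≤ ε := by
    have h3 : 16 * C / ε ≤ Real.sqrt ‖y‖ := Real.le_sqrt_of_sq_le ((le_max_right _ _).trans hy)
    rw [Real.rpow_neg hy0.le, ← Real.sqrt_eq_rpow, ← div_eq_mul_inv,
      div_le_iff₀ (Real.sqrt_pos.2 hy0)]
    rw [div_le_iff₀ hε] at h3
    linarith
  have hpw : ∀ l : ℕ, l ≤ 3 → ∀ q : ℝ, r ^ l * ‖y‖ ^ (q - l) ≤ 8 * ‖y‖ ^ q := by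
    intro l hl q
    have h4 : ‖y‖ ^ q = ‖y‖ ^ l * ‖y‖ ^ (q - l) := by
      rw [← Real.rpow_natCast, ← Real.rpow_add hy0]; ring_nf
    have h5 : r ^ l ≤ 8 * ‖y‖ ^ l := by
      calc r ^ l ≤ (2 * ‖y‖) ^ l := by gcongr
        _ = 2 ^ l * ‖y‖ ^ l := mul_pow _ _ _
        _ ≤ 2 ^ 3 * ‖y‖ ^ l := by gcongr; norm_num
        _ = _ := by norm_num
    rw [h4, ← mul_assoc]
    exact mul_le_mul_of_nonneg_right h5 (Real.rpow_nonneg hy0.le _)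
  have hq := Real.rpow_nonneg hy0.le (-(1 / 2) : ℝ)
  refine ⟨fun i j l hl => ?_, fun i j l hl => ?_⟩
  · have h6 := ha i j l y hy4
    have h7 : a i j l ≤ C := by linarith [hle i j l hl, hb0 i j l]
    calc r ^ l * _ ≤ r ^ l * (a i j l * ‖y‖ ^ (-1 / 2 - (l : ℝ))) := by gcongr
      _ = a i j l * (r ^ l * ‖y‖ ^ (-1 / 2 - (l : ℝ))) := by ring
      _ ≤ C * (8 * ‖y‖ ^ (-1 / 2 : ℝ)) := mul_le_mul h7 (hpw l hl _) (by positivity) hC0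
      _ ≤ ε := by
          rw [show (-1 / 2 : ℝ) = -(1 / 2) by norm_num]
          nlinarith [mul_nonneg hC0 hq]
  · have h6 := hb i j l y hy4
    have h7 : b i j l ≤ C := by linarith [hle i j l (by omega), ha0 i j l]
    rw [le_div_iff₀ hr]
    have h8 : ‖y‖ ^ (-3 / 2 : ℝ) * r ≤ 2 * ‖y‖ ^ (-(1 / 2) : ℝ) := by
      have e : ‖y‖ ^ (-(1 / 2) : ℝ) = ‖y‖ ^ (-3 / 2 : ℝ) * ‖y‖ := by
        rw [← Real.rpow_add_one hy0.ne']; norm_num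
      rw [e]
      nlinarith [Real.rpow_nonneg hy0.le (-3 / 2 : ℝ)]
    calc r ^ l * _ * r ≤ r ^ l * (b i j l * ‖y‖ ^ (-3 / 2 - (l : ℝ))) * r := by gcongr
      _ = b i j l * (r ^ l * ‖y‖ ^ (-3 / 2 - (l : ℝ))) * r := by ring
      _ ≤ C * (8 * ‖y‖ ^ (-3 / 2 : ℝ)) * r := by
          refine mul_le_mul_of_nonneg_right ?_ hr.le
          exact mul_le_mul h7 (hpw l (by omega) _) (by positivity) hC0
      _ = 8 * C * (‖y‖ ^ (-3 / 2 : ℝ) * r) := by ring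
      _ ≤ 8 * C * (2 * ‖y‖ ^ (-(1 / 2) : ℝ)) := by gcongr
      _ ≤ ε := by linarith

variable {ι : Type*} {𝔰 : SpinStructure S ι}

/-- A spatial Killing spinor in a weighted `L²` space vanishes far out in an end. -/
theorem chartZ_eq_zero_of_end {K : TwoTensor S} {φ : OpenPartialHomeomorph S E3}
    (hK : IsAsymptoticallyEuclidean K) (hφ : IsAsymptoticEnd K φ) (ν : SpinorField 𝔰 2)
    (hν : ν.IsSpatialKilling K) {s₁ : ℝ}
    (hI : ∫⁻ y in {y : E3 | s₁ < ‖y‖},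
      ENNReal.ofReal (∑ m, ‖chartZ ν φ m y‖ ^ 2 * (‖y‖ ^ 2)⁻¹) < ⊤) :
    ∃ s₀ > 0, ∀ y : E3, s₀ ≤ ‖y‖ → y ∈ φ.target ∧ ∀ m, chartZ ν φ m y = 0 := by
  obtain ⟨ε₀, hε₀, C, hC, H⟩ := norm_chartZ_three_le (𝔰 := 𝔰)
  -- Makes the constant Cε of the third-order estimate meet the threshold 1/3456 of the interior
  -- estimate, which is below the 1/30 of the decay argument.
  set ε := min ε₀ (1 / 3456 / (C + 1)) with hε
  have hεpos : 0 < ε := lt_min hε₀ (by positivity)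
  have hκ : C * ε ≤ 1 / 3456 := by
    have h1 : ε ≤ 1 / 3456 / (C + 1) := min_le_right _ _
    rw [le_div_iff₀ (by positivity)] at h1
    nlinarith
  obtain ⟨s, hs, htar, hflat⟩ := IsAsymptoticEnd.nearFlat hK hφ hεpos
  set s' := max s s₁ with hs'
  have hs'0 : 0 < s' := lt_max_of_lt_left hs
  have hle : s ≤ s' := le_max_left _ _
  have hZ : ∀ y : E3, s' ≤ ‖y‖ → ∀ m, ContDiffAt ℝ ∞ (chartZ ν φ m) y := fun y hy m =>
    chartZ_contDiffAt hφ.1 (htar y (hle.trans hy)) ν m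
  have h3 : ∀ r (y : E3), s' ≤ ‖y‖ → 0 < r → ‖y‖ ≤ 2 * r → r ≤ 2 * ‖y‖ → ∀ c b a k,
      r ^ 3 * ‖pd c (pd b (pd a (chartZ ν φ k))) y‖ ≤ (C * ε) * ‖jet2 r (chartZ ν φ) y‖ :=
    fun r y hy hr h1 h2 => H hφ.1 hK ν hν (htar y (hle.trans hy)) hr (min_le_left _ _)
      (hflat r y (hle.trans hy) hr h1 h2) (jetBound_jet2 hr)
  obtain ⟨A, hA⟩ := norm_jet2_decay hs'0 hκ (fun y hy => hZ y hy.le)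
    (fun r y hy => h3 r y hy.le)
    (lt_of_le_of_lt (lintegral_mono_set fun y (hy : s' < ‖y‖) =>
      show s₁ < ‖y‖ from (le_max_right _ _).trans_lt hy) hI)
  have h4 := jet2_eq_zero_of_decay (s₀ := 3 * s') (A := A) (by positivity) (by positivity)
    (hκ.trans (by norm_num)) (fun y hy => hZ y (by linarith))
    (fun y hy => h3 ‖y‖ y (by linarith) (by linarith) (by linarith) (by linarith))
    (fun y hy => hA y (by linarith))
  refine ⟨3 * s', by positivity, fun y hy => ⟨htar y (by linarith), fun m => ?_⟩⟩
  have := congrArg (fun j : Jet2 => j.1 m) (h4 y hy)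
  exact this

end AsymptoticFlatness

/-! ### Coordinates orthonormal at a point -/

section Uniqueness

open Filter Topology

variable {S : Type*} [TopologicalSpace S] [ChartedSpace E3 S] [IsManifold (𝓡 3) ∞ S]

lemma trans_linear_mem_maximalAtlas {φ : OpenPartialHomeomorph S E3}
    (hφ : φ ∈ IsManifold.maximalAtlas (𝓡 3) ∞ S) (A : E3 ≃L[ℝ] E3) :
    φ.trans A.toHomeomorph.toOpenPartialHomeomorph ∈ IsManifold.maximalAtlas (𝓡 3) ∞ S := by
  have hA : A.toHomeomorph.toOpenPartialHomeomorph ∈ contDiffGroupoid ∞ (𝓡 3) := by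
    rw [contDiffGroupoid, mem_groupoid_of_pregroupoid]
    constructor
    · simp [contDiffPregroupoid, A.contDiff.contDiffOn]
    · simp [contDiffPregroupoid, A.symm.contDiff.contDiffOn]
  have hG := (contDiffGroupoid ∞ (𝓡 3) : StructureGroupoid E3).symm hA
  refine mem_maximalAtlas_iff.2 fun e he => ?_
  have he' := StructureGroupoid.subset_maximalAtlas (contDiffGroupoid ∞ (𝓡 3)) he
  constructor
  · rw [OpenPartialHomeomorph.trans_symm_eq_symm_trans_symm, OpenPartialHomeomorph.trans_assoc]
    exact (contDiffGroupoid ∞ (𝓡 3)).trans hG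
      (StructureGroupoid.compatible_of_mem_maximalAtlas hφ he')
  · rw [← OpenPartialHomeomorph.trans_assoc]
    exact (contDiffGroupoid ∞ (𝓡 3)).trans
      (StructureGroupoid.compatible_of_mem_maximalAtlas he' hφ) hA

variable [RiemannianBundle (fun x : S => TangentSpace (𝓡 3) x)]
  [hR : IsContMDiffRiemannianBundle (𝓡 3) ∞ E3 (fun x : S => TangentSpace (𝓡 3) x)]
  {ι : Type*} {𝔰 : SpinStructure S ι}

/-- Around every point there are coordinates that are orthonormal at that point. -/
lemma exists_adapted_chart (𝔰 : SpinStructure S ι) (x : S) :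
    ∃ φ ∈ IsManifold.maximalAtlas (𝓡 3) ∞ S, x ∈ φ.source ∧
      ∀ i j, metricCoeff φ i j (φ x) = -(if i = j then 1 else 0) := by
  obtain ⟨φ, hφ, y, hy, rfl⟩ := exists_chart_point x
  set a := 𝔰.indexAt (φ.symm y)
  have ha : φ.symm y ∈ 𝔰.dom a := 𝔰.mem_indexAt _
  set f : Fin 3 → E3 := fun i => frameField 𝔰 φ a i y with hf
  have hort := frameField_orth 𝔰 a hφ hy ha
  set B : E3 →ₗ[ℝ] E3 := ∑ i, (EuclideanSpace.proj i : E3 →L[ℝ] ℝ).toLinearMap.smulRight (f i) with hB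
  have hBv : ∀ v k, B v k = ∑ i, v i * f i k := by
    intro v k
    simp [hB]
  have hinj : Function.Injective B := by
    rw [injective_iff_map_eq_zero]
    intro v hv
    ext j
    have h1 : ∀ k, ∑ i, v i * f i k = 0 := fun k => by rw [← hBv, hv]; rfl
    -- Pairing Bv with the frame vector f_j under the metric recovers v_j, so B is injective.
    have h2 : ∑ i, v i * (if i = j then 1 else 0)
        = ∑ k, ∑ l, -metricCoeff φ k l y * (∑ i, v i * f i k) * f j l := by
      simp only [← hort, Fin.sum_univ_three, hf]
      ring
    simp only [h1, mul_zero, zero_mul, Finset.sum_const_zero] at h2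
    simpa using h2
  set A : E3 ≃L[ℝ] E3 := (LinearEquiv.ofInjectiveEndo B hinj).toContinuousLinearEquiv with hA
  have hAs : ∀ i, A (EuclideanSpace.single i 1) = f i := by
    intro i
    ext k
    change B (EuclideanSpace.single i 1) k = f i k
    rw [hBv]
    simp
  set ψ := φ.trans A.symm.toHomeomorph.toOpenPartialHomeomorph with hψ
  have hψm : ψ ∈ IsManifold.maximalAtlas (𝓡 3) ∞ S := trans_linear_mem_maximalAtlas hφ A.symm
  have hxs : φ.symm y ∈ ψ.source := by simp [hψ, φ.map_target hy]
  refine ⟨ψ, hψm, hxs, fun i j => ?_⟩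
  have hy' : A (ψ (φ.symm y)) = y := by
    change A (A.symm (φ (φ.symm y))) = y
    rw [A.apply_symm_apply, φ.right_inv hy]
  have hc : ∀ i, coordVec ψ i (ψ (φ.symm y))
      = ∑ k, f i k • coordVec φ k (A (ψ (φ.symm y))) := by
    intro i
    have d1 : MDifferentiableAt (𝓡 3) (𝓡 3) φ.symm (A (ψ (φ.symm y))) :=
      (chart_symm_contMDiffAt hφ (hy'.symm ▸ hy)).mdifferentiableAt (by simp)
    have d2 : HasMFDerivAt (𝓡 3) (𝓡 3) (A : E3 → E3) (ψ (φ.symm y)) (A : E3 →L[ℝ] E3) :=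
      A.hasFDerivAt.hasMFDerivAt
    have d3 := (d1.hasMFDerivAt.comp _ d2).mfderiv
    rw [← mfderiv_eq_sum, ← hAs]
    exact congrArg (fun L : E3 →L[ℝ] E3 => L (EuclideanSpace.single i (1 : ℝ))) d3
  have hG : metricCoeff ψ i j (ψ (φ.symm y))
      = ∑ k, ∑ l, metricCoeff φ k l (A (ψ (φ.symm y))) * f i k * f j l := by
    rw [metricCoeff, hc, hc]
    change -inner ℝ (∑ k, f i k • coordVec φ k (A (ψ (φ.symm y))))
      (∑ k, f j k • coordVec φ k (A (ψ (φ.symm y)))) = _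
    simp only [sum_inner, inner_sum, real_inner_smul_left, real_inner_smul_right, metricCoeff, ip,
      ← Finset.sum_neg_distrib]
    rw [Finset.sum_comm]
    exact Finset.sum_congr rfl fun k _ => Finset.sum_congr rfl fun l _ => by ring
  rw [hG, hy', ← hort i j]
  simp only [← Finset.sum_neg_distrib, neg_mul, neg_neg, hf]

/-- |ν|² is the Riemannian metric evaluated on the real and imaginary parts of Z. It carries
vanishing and integrability back and forth between the spinor and its coordinate components. -/
lemma vecNormSq_chart {φ : OpenPartialHomeomorph S E3} (hφ : φ ∈ IsManifold.maximalAtlas (𝓡 3) ∞ S)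
    {y : E3} (hy : y ∈ φ.target) {a : ι} (ha : φ.symm y ∈ 𝔰.dom a) (ν : SpinorField 𝔰 2) :
    vecNormSq ν a (φ.symm y) = ∑ k, ∑ l, -metricCoeff φ k l y *
      ((chartZ ν φ k y).re * (chartZ ν φ l y).re + (chartZ ν φ k y).im * (chartZ ν φ l y).im) := by
  have hort := frameField_orth 𝔰 a hφ hy ha
  simp only [chartZ_eq hφ hy ha, Complex.re_sum, Complex.im_sum, Complex.re_mul_ofReal,
    Complex.im_mul_ofReal]
  have h : ∀ w : ℂ, ‖w‖ ^ 2 = w.re * w.re + w.im * w.im := fun w => by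
    rw [← Complex.normSq_eq_norm_sq, Complex.normSq_apply]
  simp only [vecNormSq, h]
  set z := spinVec ν a (φ.symm y)
  calc ∑ i, ((z i).re * (z i).re + (z i).im * (z i).im)
      = ∑ i, ∑ j, (if i = j then 1 else 0) * ((z i).re * (z j).re + (z i).im * (z j).im) := by
        simp
    _ = _ := by
        simp only [← hort]
        simp only [Fin.sum_univ_three]
        ring

end Uniqueness

/-! ### Unique continuation -/

section Continuation

open Filter Topology

/-- The function r^m |D^l f| is continuous jointly in r and y, and vanishes at (0, y₀) under either
alternative. -/
lemma eventually_scaled_iteratedFDeriv_le {f : E3 → ℝ} {y₀ : E3} (hf : ContDiffAt ℝ ∞ f y₀)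
    (l m : ℕ) (h : 0 < m ∨ iteratedFDeriv ℝ l f y₀ = 0) {ε : ℝ} (hε : 0 < ε) :
    ∀ᶠ r : ℝ in 𝓝[>] 0, ∀ y ∈ Metric.closedBall y₀ r, r ^ m * ‖iteratedFDeriv ℝ l f y‖ ≤ ε := by
  have hc : ContinuousAt (iteratedFDeriv ℝ l f) y₀ :=
    (hf.iteratedFDeriv_right (m := 0) (by simp; exact_mod_cast le_top)).continuousAt
  have hc2 : ContinuousAt (fun p : ℝ × E3 => p.1 ^ m * ‖iteratedFDeriv ℝ l f p.2‖) (0, y₀) :=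
    (continuousAt_fst.pow m).mul
      (ContinuousAt.norm (ContinuousAt.comp (g := iteratedFDeriv ℝ l f) hc continuousAt_snd))
  have hz : (0 : ℝ) ^ m * ‖iteratedFDeriv ℝ l f y₀‖ = 0 := by
    rcases h with h | h
    · rw [zero_pow h.ne', zero_mul]
    · rw [h, norm_zero, mul_zero]
  have hev : ∀ᶠ p : ℝ × E3 in 𝓝 (0, y₀), p.1 ^ m * ‖iteratedFDeriv ℝ l f p.2‖ < ε :=
    hc2.eventually_lt_const (by simpa [hz] using hε)
  obtain ⟨δ, hδ, H⟩ := Metric.eventually_nhds_iff.1 hev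
  filter_upwards [Ioo_mem_nhdsGT hδ] with r hr y hy
  refine (H (y := (r, y)) ?_).le
  rw [Prod.dist_eq]
  refine max_lt ?_ (lt_of_le_of_lt hy hr.2)
  simpa [abs_of_pos hr.1] using hr.2

variable {S : Type*} [TopologicalSpace S] [ChartedSpace E3 S] [IsManifold (𝓡 3) ∞ S]
  [RiemannianBundle (fun x : S => TangentSpace (𝓡 3) x)]
  [hR : IsContMDiffRiemannianBundle (𝓡 3) ∞ E3 (fun x : S => TangentSpace (𝓡 3) x)]
  {ι : Type*} {𝔰 : SpinStructure S ι}

/-- Rescaling kills all derivatives of the metric by r^l and all terms in K by r^{l+1}. Only the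
undifferentiated metric carries no power of r, and there adaptedness of the coordinates at y₀ is
used. -/
lemma eventually_isNearFlat {K : TwoTensor S} (hK : IsAsymptoticallyEuclidean K)
    {φ : OpenPartialHomeomorph S E3} (hφ : φ ∈ IsManifold.maximalAtlas (𝓡 3) ∞ S) {y₀ : E3}
    (hy : y₀ ∈ φ.target) (h0 : ∀ i j, metricCoeff φ i j y₀ = -(if i = j then 1 else 0))
    {ε : ℝ} (hε : 0 < ε) :
    ∀ᶠ r : ℝ in 𝓝[>] 0, ∀ y ∈ Metric.closedBall y₀ r, IsNearFlat K φ r ε y := by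
  have h1 : ∀ i j, ∀ l ∈ Finset.range 4, ∀ᶠ r : ℝ in 𝓝[>] 0, ∀ y ∈ Metric.closedBall y₀ r,
      r ^ l * ‖iteratedFDeriv ℝ l
        (fun y => metricCoeff φ i j y - (-(if i = j then 1 else 0))) y‖ ≤ ε := fun i j l _ => by
    refine eventually_scaled_iteratedFDeriv_le
      ((metricCoeff_contDiffAt hφ hy i j).sub contDiffAt_const) l l ?_ hε
    rcases Nat.eq_zero_or_pos l with rfl | hl
    · right
      ext v
      simp [h0]
    · exact Or.inl hl
  have h2 : ∀ i j, ∀ l ∈ Finset.range 3, ∀ᶠ r : ℝ in 𝓝[>] 0, ∀ y ∈ Metric.closedBall y₀ r,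
      r ^ (l + 1) * ‖iteratedFDeriv ℝ l (tensorCoeff K φ i j) y‖ ≤ ε := fun i j l _ =>
    eventually_scaled_iteratedFDeriv_le
      (tensorCoeff_contDiffAt hφ hK hy i j) l (l + 1) (Or.inl l.succ_pos) hε
  have h1' := eventually_all.2 fun i => eventually_all.2 fun j =>
    (Finset.eventually_all (Finset.range 4)).2 (h1 i j)
  have h2' := eventually_all.2 fun i => eventually_all.2 fun j =>
    (Finset.eventually_all (Finset.range 3)).2 (h2 i j)
  filter_upwards [h1', h2', self_mem_nhdsWithin] with r H1 H2 hr y hyr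
  have hr : 0 < r := hr
  refine ⟨fun i j l hl => H1 i j l (Finset.mem_range.2 (by omega)) y hyr, fun i j l hl => ?_⟩
  rw [le_div_iff₀ hr]
  calc _ = r ^ (l + 1) * ‖iteratedFDeriv ℝ l (tensorCoeff K φ i j) y‖ := by ring
    _ ≤ ε := H2 i j l (Finset.mem_range.2 (by omega)) y hyr

lemma jet2_continuousAt {r : ℝ} {Z : Fin 3 → E3 → ℂ} {y : E3} (hZ : ∀ m, ContDiffAt ℝ ∞ (Z m) y) :
    ContinuousAt (jet2 r Z) y := by
  refine ContinuousAt.prodMk ?_ (ContinuousAt.prodMk ?_ ?_)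
  · exact continuousAt_pi.2 fun m => (hZ m).continuousAt
  · exact continuousAt_pi.2 fun m => continuousAt_pi.2 fun a =>
      continuousAt_const.mul (pd_contDiffAt (hZ m) a).continuousAt
  · exact continuousAt_pi.2 fun m => continuousAt_pi.2 fun a => continuousAt_pi.2 fun b =>
      continuousAt_const.mul (pd_contDiffAt (pd_contDiffAt (hZ m) a) b).continuousAt

lemma jet2_eq_zero_of_eventually {r : ℝ} {Z : Fin 3 → E3 → ℂ} {y : E3}
    (hZ : ∀ᶠ w in 𝓝 y, ∀ m, Z m w = 0) : jet2 r Z y = 0 := by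
  have h0 : ∀ m, Z m =ᶠ[𝓝 y] 0 := fun m => hZ.mono fun w hw => hw m
  have h1 : ∀ m a, pd a (Z m) =ᶠ[𝓝 y] 0 := fun m a => by
    filter_upwards [(h0 m).fderiv (𝕜 := ℝ)] with w hw
    simp [pd, hw]
  have h2 : ∀ m a b, pd b (pd a (Z m)) y = 0 := fun m a b => by
    simp [pd, ((h1 m a).fderiv (𝕜 := ℝ)).eq_of_nhds]
  refine Prod.ext ?_ (Prod.ext ?_ ?_)
  · ext m; exact (h0 m).eq_of_nhds
  · ext m a; simp [jet2, (h1 m a).eq_of_nhds]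
  · ext m a b; simp [jet2, h2]

/-- A Killing spinor whose 2-jet vanishes at the centre of adapted coordinates vanishes nearby. -/
lemma eventually_chartZ_eq_zero {K : TwoTensor S} (hK : IsAsymptoticallyEuclidean K)
    {φ : OpenPartialHomeomorph S E3} (hφ : φ ∈ IsManifold.maximalAtlas (𝓡 3) ∞ S) {y₀ : E3}
    (hy : y₀ ∈ φ.target) (h0 : ∀ i j, metricCoeff φ i j y₀ = -(if i = j then 1 else 0))
    (ν : SpinorField 𝔰 2) (hν : ν.IsSpatialKilling K)
    (hJ : ∀ r : ℝ, jet2 r (chartZ ν φ) y₀ = 0) :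
    ∀ᶠ y in 𝓝 y₀, ∀ m, chartZ ν φ m y = 0 := by
  obtain ⟨ε₀, hε₀, C, hC, H⟩ := norm_chartZ_three_le (𝔰 := 𝔰)
  set ε := min ε₀ (1 / (C + 1)) with hε
  have hεp : 0 < ε := lt_min hε₀ (by positivity)
  have hCε : C * ε ≤ 1 := by
    calc C * ε ≤ (C + 1) * (1 / (C + 1)) := by
          gcongr
          · linarith
          · exact min_le_right _ _
      _ = 1 := by field_simp
  have hball : ∀ᶠ r : ℝ in 𝓝[>] 0, Metric.closedBall y₀ r ⊆ φ.target := by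
    obtain ⟨δ, hδ, hb⟩ := Metric.isOpen_iff.1 φ.open_target y₀ hy
    filter_upwards [Ioo_mem_nhdsGT hδ] with r hr
    exact (Metric.closedBall_subset_ball hr.2).trans hb
  obtain ⟨r, ⟨hfl, hbt⟩, hr⟩ := (((eventually_isNearFlat hK hφ hy h0 hεp).and hball).and
    self_mem_nhdsWithin).exists
  have hr : 0 < r := hr
  filter_upwards [Metric.closedBall_mem_nhds y₀ hr] with y hyr m
  have hseg : ∀ t ∈ Set.Icc (0 : ℝ) 1, y₀ + t • (y - y₀) ∈ Metric.closedBall y₀ r := by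
    intro t ht
    rw [Metric.mem_closedBall, dist_eq_norm] at hyr ⊢
    rw [add_sub_cancel_left, norm_smul, Real.norm_of_nonneg ht.1]
    exact (mul_le_of_le_one_left (norm_nonneg _) ht.2).trans hyr
  have key := norm_jet2_le_exp (Z := chartZ ν φ) (x := y₀) (v := y - y₀) hr
    (fun t ht m => chartZ_contDiffAt hφ (hbt (hseg t ht)) ν m)
    (fun t ht c b a k => (H hφ hK ν hν (hbt (hseg t ht)) hr (min_le_left _ _)
      (hfl _ (hseg t ht)) (fun m => jetBound_jet2 hr m) c b a k).trans
        (mul_le_of_le_one_left (norm_nonneg _) hCε))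
  rw [hJ, norm_zero, zero_mul, add_sub_cancel] at key
  exact norm_le_zero_iff.1 (((norm_jet2_le_iff hr le_rfl).1 key).1 m)

omit hR in
lemma chartZ_eq_zero_of_vecNormSq {φ : OpenPartialHomeomorph S E3} (ν : SpinorField 𝔰 2) {y : E3}
    (h : vecNormSq ν (𝔰.indexAt (φ.symm y)) (φ.symm y) = 0) (m : Fin 3) : chartZ ν φ m y = 0 := by
  rw [vecNormSq, Finset.sum_eq_zero_iff_of_nonneg fun _ _ => by positivity] at h
  refine Finset.sum_eq_zero fun i hi => ?_
  have := h i hi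
  rw [sq_eq_zero_iff, norm_eq_zero] at this
  rw [this, zero_mul]

/-- Unique continuation for Killing spinors. -/
theorem isZero_of_chartZ_eq_zero [ConnectedSpace S] {K : TwoTensor S}
    (hK : IsAsymptoticallyEuclidean K)
    {φ : OpenPartialHomeomorph S E3} (hφ : φ ∈ IsManifold.maximalAtlas (𝓡 3) ∞ S) {y₀ : E3}
    (hy : y₀ ∈ φ.target) (ν : SpinorField 𝔰 2) (hν : ν.IsSpatialKilling K)
    (hZ : ∀ᶠ y in 𝓝 y₀, ∀ m, chartZ ν φ m y = 0) : ν.IsZero := by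
  set U := interior {x | vecNormSq ν (𝔰.indexAt x) x = 0} with hU
  have key : ∀ {ψ : OpenPartialHomeomorph S E3} (_ : ψ ∈ IsManifold.maximalAtlas (𝓡 3) ∞ S)
      {x : S} (_ : x ∈ ψ.source) (_ : ∀ᶠ y in 𝓝 (ψ x), ∀ m, chartZ ν ψ m y = 0), x ∈ U := by
    intro ψ hψ x hx h
    rw [hU, mem_interior_iff_mem_nhds]
    filter_upwards [(ψ.continuousAt hx).eventually h, ψ.open_source.mem_nhds hx] with z hz hzs
    have e := vecNormSq_chart hψ (ψ.map_source hzs) (𝔰.mem_indexAt (ψ.symm (ψ z))) ν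
    simp only [hz, Complex.zero_re, Complex.zero_im, mul_zero, add_zero,
      Finset.sum_const_zero] at e
    rw [ψ.left_inv hzs] at e
    exact e
  have hne : U.Nonempty :=
    ⟨φ.symm y₀, key hφ (φ.map_target hy) (by rwa [φ.right_inv hy])⟩
  have hcl : IsClosed U := by
    refine isClosed_of_closure_subset fun x hx => ?_
    obtain ⟨ψ, hψ, hxs, h0⟩ := exists_adapted_chart 𝔰 x
    refine key hψ hxs (eventually_chartZ_eq_zero hK hψ (ψ.map_source hxs) h0 ν hν fun r => ?_)
    -- The two-jet vanishes at every point of U in this chart, so by continuity it vanishes at the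
    -- limit point x; a nonzero jet would persist on a neighbourhood meeting U.
    by_contra hne
    have hc := (jet2_continuousAt (r := r) fun m =>
      chartZ_contDiffAt hψ (ψ.map_source hxs) ν m).eventually_ne hne
    obtain ⟨z, hzU, hz, hzs⟩ := ((mem_closure_iff_frequently.1 hx).and_eventually
      (((ψ.continuousAt hxs).eventually hc).and (ψ.open_source.mem_nhds hxs))).exists
    refine hz (jet2_eq_zero_of_eventually ?_)
    have hzt := ψ.map_source hzs
    have := (ψ.symm.continuousAt hzt).eventually (by
      rw [ψ.left_inv hzs]; exact isOpen_interior.mem_nhds hzU)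
    filter_upwards [this] with w hw m
    have hw' : ψ.symm w ∈ {x | vecNormSq ν (𝔰.indexAt x) x = 0} := interior_subset hw
    exact chartZ_eq_zero_of_vecNormSq ν hw' m
  have huniv : U = Set.univ := IsClopen.eq_univ ⟨hcl, isOpen_interior⟩ hne
  intro a x hx
  have h1 : x ∈ U := huniv ▸ Set.mem_univ x
  have h2 : x ∈ {x | vecNormSq ν (𝔰.indexAt x) x = 0} := interior_subset h1
  rw [Set.mem_setOf_eq] at h2
  rw [vecNormSq_change ν (𝔰.mem_indexAt x) hx, ← normSq_comp ν hx, normSq,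
    Finset.sum_eq_zero_iff_of_nonneg fun _ _ => by positivity] at h2
  funext c
  exact norm_eq_zero.1 (sq_eq_zero_iff.1 (h2 c (Finset.mem_univ c)))

end Continuation

/-! ### Flat ends: comparison with Euclidean space -/

section FlatEnd

open Filter Topology

lemma abs_sum_error_le {e : Fin 3 → Fin 3 → ℝ} (he : ∀ k l, |e k l| ≤ 1 / 10) (v : Fin 3 → ℝ) :
    |∑ k, ∑ l, e k l * (v k * v l)| ≤ 1 / 2 * ∑ k, v k ^ 2 := by
  calc _ ≤ ∑ k, ∑ l, 1 / 10 * (|v k| * |v l|) := by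
        refine (Finset.abs_sum_le_sum_abs _ _).trans (Finset.sum_le_sum fun k _ =>
          (Finset.abs_sum_le_sum_abs _ _).trans (Finset.sum_le_sum fun l _ => ?_))
        rw [abs_mul, abs_mul]
        exact mul_le_mul_of_nonneg_right (he k l) (by positivity)
    _ ≤ _ := by
        simp only [Fin.sum_univ_three, ← sq_abs (v 0), ← sq_abs (v 1), ← sq_abs (v 2)]
        nlinarith [sq_nonneg (|v 0| - |v 1|), sq_nonneg (|v 0| - |v 2|), sq_nonneg (|v 1| - |v 2|)]

lemma quadForm_bounds {g : Fin 3 → Fin 3 → ℝ}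
    (hg : ∀ k l, |g k l - (-(if k = l then 1 else 0))| ≤ 1 / 10) (v : Fin 3 → ℝ) :
    1 / 2 * ∑ k, v k ^ 2 ≤ ∑ k, ∑ l, -g k l * (v k * v l) ∧
      ∑ k, ∑ l, -g k l * (v k * v l) ≤ 2 * ∑ k, v k ^ 2 := by
  have h := abs_le.1 (abs_sum_error_le hg v)
  have e : ∑ k, ∑ l, (g k l - (-(if k = l then 1 else 0))) * (v k * v l)
      = ∑ k, v k ^ 2 - ∑ k, ∑ l, -g k l * (v k * v l) := by
    simp only [sub_mul, neg_mul, ite_mul, one_mul, zero_mul, Finset.sum_sub_distrib,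
      Finset.sum_neg_distrib, Finset.sum_ite_eq, Finset.mem_univ, if_true, sq]
    ring
  rw [e] at h
  have h0 : 0 ≤ ∑ k, v k ^ 2 := Finset.sum_nonneg fun _ _ => sq_nonneg _
  exact ⟨by linarith [h.2], by linarith [h.1]⟩

variable {S : Type*} [TopologicalSpace S] [ChartedSpace E3 S]
  [RiemannianBundle (fun x : S => TangentSpace (𝓡 3) x)]

lemma ip_mfderiv_bounds {φ : OpenPartialHomeomorph S E3} {y : E3}
    (hn : ∀ i j, |metricCoeff φ i j y - (-(if i = j then 1 else 0))| ≤ 1 / 10) (v : E3) :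
    1 / 2 * ‖v‖ ^ 2 ≤ ip (mfderiv (𝓡 3) (𝓡 3) φ.symm y v) (mfderiv (𝓡 3) (𝓡 3) φ.symm y v) ∧
      ip (mfderiv (𝓡 3) (𝓡 3) φ.symm y v) (mfderiv (𝓡 3) (𝓡 3) φ.symm y v) ≤ 2 * ‖v‖ ^ 2 := by
  have e : ip (mfderiv (𝓡 3) (𝓡 3) φ.symm y v) (mfderiv (𝓡 3) (𝓡 3) φ.symm y v)
      = ∑ k, ∑ l, -metricCoeff φ k l y * (v k * v l) := by
    rw [mfderiv_eq_sum]
    change inner ℝ (∑ k, v k • coordVec φ k y) (∑ k, v k • coordVec φ k y) = _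
    simp only [sum_inner, inner_sum, real_inner_smul_left, real_inner_smul_right, metricCoeff, ip]
    rw [Finset.sum_comm]
    exact Finset.sum_congr rfl fun k _ => Finset.sum_congr rfl fun l _ => by ring
  have hq := quadForm_bounds hn (v : Fin 3 → ℝ)
  rw [e, EuclideanSpace.norm_sq_eq]
  simpa using hq

variable [IsManifold (𝓡 3) ∞ S]

/-- Coordinates on `{s < ‖y‖}` in which the metric is uniformly close to the Euclidean one. -/
structure IsFlatEnd (φ : OpenPartialHomeomorph S E3) (s : ℝ) : Prop where
  mem_atlas : φ ∈ IsManifold.maximalAtlas (𝓡 3) ∞ S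
  pos : 0 < s
  mem_target : ∀ y : E3, y ∈ φ.target ↔ s < ‖y‖
  near : ∀ y : E3, s < ‖y‖ → ∀ i j, |metricCoeff φ i j y - (-(if i = j then 1 else 0))| ≤ 1 / 10

/-- The part of a chart domain where the coordinates are larger than `s`. -/
def outerChart (φ : OpenPartialHomeomorph S E3) (s : ℝ) : OpenPartialHomeomorph S E3 :=
  φ.restr (φ.source ∩ φ ⁻¹' {y | s < ‖y‖})

omit [ChartedSpace E3 S] [IsManifold (𝓡 3) ∞ S]
  [RiemannianBundle (fun x : S => TangentSpace (𝓡 3) x)] in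
lemma isOpen_outer (φ : OpenPartialHomeomorph S E3) (s : ℝ) :
    IsOpen (φ.source ∩ φ ⁻¹' {y | s < ‖y‖}) :=
  φ.isOpen_inter_preimage (isOpen_lt continuous_const continuous_norm)

omit [ChartedSpace E3 S] [IsManifold (𝓡 3) ∞ S]
  [RiemannianBundle (fun x : S => TangentSpace (𝓡 3) x)] in
lemma outerChart_source (φ : OpenPartialHomeomorph S E3) (s : ℝ) :
    (outerChart φ s).source = φ.source ∩ φ ⁻¹' {y | s < ‖y‖} := by
  rw [outerChart, φ.restr_source, (isOpen_outer φ s).interior_eq, ← Set.inter_assoc, Set.inter_self]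

omit [ChartedSpace E3 S] [IsManifold (𝓡 3) ∞ S]
  [RiemannianBundle (fun x : S => TangentSpace (𝓡 3) x)] in
lemma mem_outerChart_target (φ : OpenPartialHomeomorph S E3) (s : ℝ) (y : E3) :
    y ∈ (outerChart φ s).target ↔ y ∈ φ.target ∧ s < ‖y‖ := by
  constructor
  · intro hy
    have h := (outerChart φ s).map_target hy
    rw [outerChart_source] at h
    have h2 : φ ((outerChart φ s).symm y) = y := (outerChart φ s).right_inv hy
    refine ⟨by rw [← h2]; exact φ.map_source h.1, ?_⟩
    have h3 := h.2
    rw [Set.mem_preimage, h2] at h3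
    exact h3
  · rintro ⟨hy, hs⟩
    have h : φ.symm y ∈ (outerChart φ s).source := by
      rw [outerChart_source]
      refine ⟨φ.map_target hy, ?_⟩
      rw [Set.mem_preimage, φ.right_inv hy]
      exact hs
    have h2 := (outerChart φ s).map_source h
    rwa [show (outerChart φ s) (φ.symm y) = y from φ.right_inv hy] at h2

variable [hR : IsContMDiffRiemannianBundle (𝓡 3) ∞ E3 (fun x : S => TangentSpace (𝓡 3) x)]

lemma IsAsymptoticEnd.isFlatEnd {K : TwoTensor S} (hK : IsAsymptoticallyEuclidean K)
    {φ : OpenPartialHomeomorph S E3} (hφ : IsAsymptoticEnd K φ) :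
    ∃ s, 0 < s ∧ ∀ t, s ≤ t → IsFlatEnd (outerChart φ t) t := by
  obtain ⟨s, hs, htar, hn⟩ := hφ.nearFlat hK (ε := 1 / 10) (by norm_num)
  refine ⟨s, hs, fun t ht => ⟨?_, hs.trans_le ht, fun y => ?_, fun y hy i j => ?_⟩⟩
  · exact restr_mem_maximalAtlas _ hφ.1 (isOpen_outer φ t)
  · rw [mem_outerChart_target]
    exact ⟨fun h => h.2, fun h => ⟨htar y (ht.trans h.le), h⟩⟩
  · have h := (hn ‖y‖ y (ht.trans hy.le) (hs.trans_le (ht.trans hy.le)) (by linarith [norm_nonneg y])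
      (by linarith [norm_nonneg y])).1 i j 0 (by norm_num)
    rw [pow_zero, one_mul, norm_iteratedFDeriv_zero, Real.norm_eq_abs] at h
    exact h

namespace IsFlatEnd

variable {φ : OpenPartialHomeomorph S E3} {s : ℝ} (h : IsFlatEnd φ s)

include h

lemma sum_chartZ_le {ι : Type*} {𝔰 : SpinStructure S ι} (ν : SpinorField 𝔰 2) {y : E3}
    (hy : s < ‖y‖) :
    ∑ m, ‖chartZ ν φ m y‖ ^ 2 ≤ 2 * vecNormSq ν (𝔰.indexAt (φ.symm y)) (φ.symm y) := by
  have hw : ∀ w : ℂ, ‖w‖ ^ 2 = w.re ^ 2 + w.im ^ 2 := fun w => by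
    rw [← Complex.normSq_eq_norm_sq, Complex.normSq_apply]; ring
  have h1 := (quadForm_bounds (h.near y hy) fun k => (chartZ ν φ k y).re).1
  have h2 := (quadForm_bounds (h.near y hy) fun k => (chartZ ν φ k y).im).1
  rw [vecNormSq_chart h.mem_atlas ((h.mem_target y).2 hy) (𝔰.mem_indexAt _)]
  simp only [hw, mul_add, Finset.sum_add_distrib]
  linarith

omit hR in
lemma volDensity_bounds {y : E3} (hy : s < ‖y‖) : 1 / 2 ≤ volDensity φ y := by
  rw [volDensity]
  refine Real.le_sqrt_of_sq_le ?_
  have hn := h.near y hy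
  obtain ⟨a, ha⟩ : ∃ a : Fin 3 → Fin 3 → ℝ, ∀ i j, metricCoeff φ i j y
      = a i j - (if i = j then 1 else 0) := ⟨fun i j => metricCoeff φ i j y - (-(if i = j then 1 else 0)),
        fun i j => by ring⟩
  have hb : ∀ i j, |a i j| ≤ 1 / 10 := fun i j => by
    have := hn i j
    rwa [ha, sub_neg_eq_add, sub_add_cancel] at this
  rw [Matrix.det_fin_three]
  simp only [Matrix.of_apply, ha]
  have m2 : ∀ i j k l, |a i j * a k l| ≤ 1 / 100 := fun i j k l => by
    rw [abs_mul]
    calc _ ≤ (1 / 10 : ℝ) * (1 / 10) := mul_le_mul (hb _ _) (hb _ _) (abs_nonneg _) (by norm_num)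
      _ = _ := by norm_num
  have m3 : ∀ i j k l m n, |a i j * a k l * a m n| ≤ 1 / 1000 := fun i j k l m n => by
    rw [abs_mul]
    calc _ ≤ (1 / 100 : ℝ) * (1 / 10) := mul_le_mul (m2 _ _ _ _) (hb _ _) (abs_nonneg _) (by norm_num)
      _ = _ := by norm_num
  have b0 := abs_le.1 (hb 0 0)
  have b1 := abs_le.1 (hb 1 1)
  have b2 := abs_le.1 (hb 2 2)
  have c0 := abs_le.1 (m2 0 0 1 1)
  have c1 := abs_le.1 (m2 0 0 2 2)
  have c2 := abs_le.1 (m2 1 1 2 2)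
  have c3 := abs_le.1 (m2 0 1 1 0)
  have c4 := abs_le.1 (m2 0 2 2 0)
  have c5 := abs_le.1 (m2 1 2 2 1)
  have d0 := abs_le.1 (m3 0 0 1 1 2 2)
  have d1 := abs_le.1 (m3 0 0 1 2 2 1)
  have d2 := abs_le.1 (m3 0 1 1 0 2 2)
  have d3 := abs_le.1 (m3 0 1 1 2 2 0)
  have d4 := abs_le.1 (m3 0 2 1 0 2 1)
  have d5 := abs_le.1 (m3 0 2 1 1 2 0)
  rw [le_abs]
  right
  simp only [if_true, if_neg (show (0 : Fin 3) ≠ 1 by decide), if_neg (show (1 : Fin 3) ≠ 0 by decide),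
    if_neg (show (0 : Fin 3) ≠ 2 by decide), if_neg (show (2 : Fin 3) ≠ 0 by decide),
    if_neg (show (1 : Fin 3) ≠ 2 by decide), if_neg (show (2 : Fin 3) ≠ 1 by decide), sub_zero]
  linarith

/-- Radial segments in a flat end are at most twice as long as in Euclidean space. -/
lemma riemannianEDist_radial_le {t : ℝ} (ht : s < t) {y : E3} (hy : t ≤ ‖y‖) :
    Manifold.riemannianEDist (𝓡 3) (φ.symm ((t / ‖y‖) • y)) (φ.symm y)
      ≤ ENNReal.ofReal (2 * ‖y‖) := by
  have hy0 : 0 < ‖y‖ := (h.pos.trans ht).trans_le hy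
  set c : ℝ → E3 := fun τ => (τ / ‖y‖) • y with hc
  have hcn : ∀ τ ∈ Set.Icc t ‖y‖, s < ‖c τ‖ := by
    intro τ hτ
    have : 0 ≤ τ := (h.pos.trans ht).le.trans hτ.1
    rw [hc, norm_smul, norm_div, norm_norm, div_mul_cancel₀ _ hy0.ne', Real.norm_of_nonneg this]
    exact ht.trans_le hτ.1
  have hcd : ∀ τ, HasDerivAt c (‖y‖⁻¹ • y) τ := fun τ => by
    have := ((hasDerivAt_id τ).div_const ‖y‖).smul_const y
    simpa [hc, div_eq_mul_inv] using this
  have hcs : ContDiff ℝ ∞ c := by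
    have : ContDiff ℝ ∞ fun τ : ℝ => τ / ‖y‖ := contDiff_id.div_const _
    exact this.smul contDiff_const
  have hsm : ∀ τ ∈ Set.Icc t ‖y‖, ContMDiffAt 𝓘(ℝ, ℝ) (𝓡 3) ∞ (φ.symm ∘ c) τ := fun τ hτ =>
    (chart_symm_contMDiffAt h.mem_atlas ((h.mem_target _).2 (hcn τ hτ))).comp τ
      hcs.contMDiff.contMDiffAt
  refine (Manifold.riemannianEDist_le_pathELength (γ := φ.symm ∘ c) (a := t) (b := ‖y‖)
    (fun τ hτ => ((hsm τ hτ).of_le (by simp)).contMDiffWithinAt) rfl ?_ hy).trans ?_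
  · simp [hc, div_self hy0.ne']
  rw [Manifold.pathELength_eq_lintegral_mfderiv_Icc]
  -- The radial curve has unit Euclidean speed, and G(v, v) ≤ 2|v|² makes its Riemannian speed at
  -- most √2, bounded here by 2.
  calc _ ≤ ∫⁻ τ in Set.Icc t ‖y‖, ENNReal.ofReal 2 := by
        refine setLIntegral_mono' measurableSet_Icc fun τ hτ => ?_
        have d1 : MDifferentiableAt (𝓡 3) (𝓡 3) φ.symm (c τ) :=
          (chart_symm_contMDiffAt h.mem_atlas
            ((h.mem_target _).2 (hcn τ hτ))).mdifferentiableAt (by simp)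
        have d2 : HasMFDerivAt 𝓘(ℝ, ℝ) (𝓡 3) c τ (ContinuousLinearMap.toSpanSingleton ℝ (‖y‖⁻¹ • y)) :=
          (hcd τ).hasFDerivAt.hasMFDerivAt
        have d3 := (d1.hasMFDerivAt.comp τ d2).mfderiv
        have d4 : mfderiv 𝓘(ℝ, ℝ) (𝓡 3) (φ.symm ∘ c) τ (1 : ℝ)
            = mfderiv (𝓡 3) (𝓡 3) φ.symm (c τ) (‖y‖⁻¹ • y) := by
          refine (congrArg (fun L : ℝ →L[ℝ] E3 => L (1 : ℝ)) d3).trans ?_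
          refine congrArg (fun w : E3 => mfderiv (𝓡 3) (𝓡 3) φ.symm (c τ) w) ?_
          exact one_smul ℝ (‖y‖⁻¹ • y)
        have d5 := (ip_mfderiv_bounds (h.near _ (hcn τ hτ)) (‖y‖⁻¹ • y)).2
        have hn1 : ‖‖y‖⁻¹ • y‖ = 1 := by
          rw [norm_smul, norm_inv, norm_norm, inv_mul_cancel₀ hy0.ne']
        rw [hn1] at d5
        have d6 : ‖(mfderiv (𝓡 3) (𝓡 3) φ.symm (c τ) (‖y‖⁻¹ • y) :
            TangentSpace (𝓡 3) (φ.symm (c τ)))‖ ≤ 2 := by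
          rw [ip, real_inner_self_eq_norm_sq] at d5
          nlinarith [norm_nonneg (mfderiv (𝓡 3) (𝓡 3) φ.symm (c τ) (‖y‖⁻¹ • y) :
            TangentSpace (𝓡 3) (φ.symm (c τ)))]
        have d7 : ‖(mfderiv 𝓘(ℝ, ℝ) (𝓡 3) (φ.symm ∘ c) τ (1 : ℝ) :
            TangentSpace (𝓡 3) (φ.symm (c τ)))‖ ≤ 2 := by
          rw [d4]; exact d6
        rw [← ofReal_norm_eq_enorm]
        exact ENNReal.ofReal_le_ofReal d7
    _ ≤ _ := by
        rw [setLIntegral_const, Real.volume_Icc, ← ENNReal.ofReal_mul (by norm_num)]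
        refine ENNReal.ofReal_le_ofReal ?_
        linarith [h.pos]

end IsFlatEnd

end FlatEnd

/-! ### The weighted norm in a flat end -/

section WeightedEnd

open Filter Topology

variable {S : Type*} [TopologicalSpace S] [ChartedSpace E3 S] [IsManifold (𝓡 3) ∞ S]
  [RiemannianBundle (fun x : S => TangentSpace (𝓡 3) x)]
  [hR : IsContMDiffRiemannianBundle (𝓡 3) ∞ E3 (fun x : S => TangentSpace (𝓡 3) x)]

omit hR in
lemma toReal_riemannianEDist_le (O : S) {p q : S} {c : ℝ} (hc : 0 ≤ c)
    (h : Manifold.riemannianEDist (𝓡 3) p q ≤ ENNReal.ofReal c) :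
    (Manifold.riemannianEDist (𝓡 3) O q).toReal ≤ (Manifold.riemannianEDist (𝓡 3) O p).toReal + c := by
  have h1 : Manifold.riemannianEDist (𝓡 3) O q
      ≤ Manifold.riemannianEDist (𝓡 3) O p + ENNReal.ofReal c :=
    Manifold.riemannianEDist_triangle.trans (add_le_add le_rfl h)
  have h2 : Manifold.riemannianEDist (𝓡 3) O p
      ≤ Manifold.riemannianEDist (𝓡 3) O q + ENNReal.ofReal c := by
    refine Manifold.riemannianEDist_triangle.trans (add_le_add le_rfl ?_)
    rw [Manifold.riemannianEDist_comm]
    exact h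
  -- `toReal` sends ⊤ to 0, so an infinite distance makes the left side zero. If it is finite, the
  -- reverse triangle estimate `h2` shows that the distance to p is finite too, and real arithmetic
  -- applies.
  by_cases htop : Manifold.riemannianEDist (𝓡 3) O q = ⊤
  · rw [htop]
    simp only [ENNReal.toReal_top]
    positivity
  · have h3 : Manifold.riemannianEDist (𝓡 3) O p ≠ ⊤ :=
      (h2.trans_lt (ENNReal.add_lt_top.2 ⟨lt_top_iff_ne_top.2 htop, ENNReal.ofReal_lt_top⟩)).ne
    have h4 := ENNReal.toReal_mono (ENNReal.add_ne_top.2 ⟨h3, ENNReal.ofReal_ne_top⟩) h1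
    rwa [ENNReal.toReal_add h3 ENNReal.ofReal_ne_top, ENNReal.toReal_ofReal hc] at h4

/-- Each point has a neighbourhood within distance one of it; the bound passes to finite unions and
so to compact sets. -/
lemma exists_riemannianEDist_bound (O : S) {Q : Set S} (hQ : IsCompact Q) :
    ∃ M : ℝ, 0 ≤ M ∧ ∀ q ∈ Q, (Manifold.riemannianEDist (𝓡 3) O q).toReal ≤ M := by
  refine hQ.induction_on (p := fun Q => ∃ M : ℝ, 0 ≤ M ∧ ∀ q ∈ Q,
    (Manifold.riemannianEDist (𝓡 3) O q).toReal ≤ M) ⟨0, le_rfl, by simp⟩ ?_ ?_ ?_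
  · rintro s t hst ⟨M, hM, h⟩
    exact ⟨M, hM, fun q hq => h q (hst hq)⟩
  · rintro s t ⟨M, hM, h⟩ ⟨N, hN, h'⟩
    refine ⟨max M N, hM.trans (le_max_left _ _), fun q hq => ?_⟩
    rcases hq with hq | hq
    · exact (h q hq).trans (le_max_left _ _)
    · exact (h' q hq).trans (le_max_right _ _)
  · intro x _
    have : IsContinuousRiemannianBundle E3 (fun x : S => TangentSpace (𝓡 3) x) := by
      obtain ⟨g, hg, hg'⟩ := hR.exists_contMDiff
      exact ⟨g, hg.continuous, hg'⟩
    have hx := eventually_riemannianEDist_lt (𝓡 3) x (c := 1) one_pos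
    refine ⟨_, mem_nhdsWithin_of_mem_nhds hx,
      (Manifold.riemannianEDist (𝓡 3) O x).toReal + 1, by positivity, fun q hq => ?_⟩
    refine toReal_riemannianEDist_le O zero_le_one ?_
    rw [ENNReal.ofReal_one]
    exact le_of_lt hq

omit [IsManifold (𝓡 3) ∞ S] hR in
lemma weight_le (O x : S) : weight O x ≤ 1 + (Manifold.riemannianEDist (𝓡 3) O x).toReal := by
  refine Real.sqrt_le_iff.2 ⟨by positivity, ?_⟩
  nlinarith [ENNReal.toReal_nonneg (a := Manifold.riemannianEDist (𝓡 3) O x)]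

omit [IsManifold (𝓡 3) ∞ S] hR in
lemma weight_pos (O x : S) : 0 < weight O x := Real.sqrt_pos.2 (by positivity)

omit hR in
lemma IsFlatEnd.outer {φ : OpenPartialHomeomorph S E3} {s t : ℝ} (h : IsFlatEnd φ s) (ht : s ≤ t) :
    IsFlatEnd (outerChart φ t) t := by
  refine ⟨restr_mem_maximalAtlas _ h.mem_atlas (isOpen_outer φ t), h.pos.trans_le ht, fun y => ?_,
    fun y hy i j => h.near y (ht.trans_lt hy) i j⟩
  rw [mem_outerChart_target, h.mem_target]
  exact ⟨fun h => h.2, fun h => ⟨ht.trans_lt h, h⟩⟩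

/-- The weight at a far point is bounded by its value on the compact sphere of radius t plus the
length of a radial segment. Only this direction is needed: it yields r^{−2} ≤ C²σ^{−2}, so the
weighted bound controls ∫|ν|²/r². -/
lemma IsFlatEnd.weight_le {φ : OpenPartialHomeomorph S E3} {s t : ℝ} (h : IsFlatEnd φ s) (ht : s < t)
    (O : S) : ∃ C : ℝ, 0 < C ∧ ∀ y, t ≤ ‖y‖ → weight O (φ.symm y) ≤ C * ‖y‖ := by
  have ht0 : 0 < t := h.pos.trans ht
  have hsub : Metric.sphere (0 : E3) t ⊆ φ.target := fun y hy => by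
    rw [mem_sphere_zero_iff_norm] at hy
    rw [h.mem_target, hy]
    exact ht
  obtain ⟨M, hM, hb⟩ := exists_riemannianEDist_bound O
    ((isCompact_sphere (0 : E3) t).image_of_continuousOn (φ.continuousOn_symm.mono hsub))
  refine ⟨(1 + M) / t + 2, by positivity, fun y hy => ?_⟩
  have hy0 : 0 < ‖y‖ := ht0.trans_le hy
  have h1 := toReal_riemannianEDist_le O (by positivity) (h.riemannianEDist_radial_le ht hy)
  have h2 := hb _ ⟨(t / ‖y‖) • y, by
    rw [mem_sphere_zero_iff_norm, norm_smul, norm_div, norm_norm, div_mul_cancel₀ _ hy0.ne',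
      Real.norm_of_nonneg ht0.le], rfl⟩
  have h3 : 1 + M ≤ (1 + M) / t * ‖y‖ := by
    rw [div_mul_eq_mul_div, le_div_iff₀ ht0]
    gcongr
  linarith [KillingSpinor.weight_le O (φ.symm y)]

variable {ι : Type*} {𝔰 : SpinStructure S ι}

/-- The density `|ν|² / r²` in the domain of a chart. -/
def endDensity (ν : SpinorField 𝔰 2) (φ : OpenPartialHomeomorph S E3) (x : S) : ℝ :=
  vecNormSq ν (𝔰.indexAt x) x * (‖φ x‖ ^ 2)⁻¹

omit hR in
lemma vecNormSq_nonneg (ν : SpinorField 𝔰 2) (a : ι) (x : S) : 0 ≤ vecNormSq ν a x :=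
  Finset.sum_nonneg fun _ _ => sq_nonneg _

omit hR in
lemma endDensity_nonneg (ν : SpinorField 𝔰 2) (φ : OpenPartialHomeomorph S E3) (x : S) :
    0 ≤ endDensity ν φ x :=
  mul_nonneg (vecNormSq_nonneg ν _ _) (by positivity)

lemma endDensity_continuousOn (ν : SpinorField 𝔰 2) {φ : OpenPartialHomeomorph S E3} {s : ℝ}
    (h : IsFlatEnd φ s) : ContinuousOn (fun y => endDensity ν φ (φ.symm y)) φ.target := by
  have hZ : ∀ m, ContinuousOn (chartZ ν φ m) φ.target := fun m y hy =>
    (chartZ_contDiffAt h.mem_atlas hy ν m).continuousAt.continuousWithinAt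
  have hG : ∀ i j, ContinuousOn (metricCoeff φ i j) φ.target := fun i j y hy =>
    (metricCoeff_contDiffAt h.mem_atlas hy i j).continuousAt.continuousWithinAt
  have h1 : ContinuousOn (fun y => (∑ k, ∑ l, -metricCoeff φ k l y *
      ((chartZ ν φ k y).re * (chartZ ν φ l y).re + (chartZ ν φ k y).im * (chartZ ν φ l y).im))
      * (‖y‖ ^ 2)⁻¹) φ.target := by
    refine ContinuousOn.mul ?_ (ContinuousOn.inv₀ (by fun_prop) fun y hy => ?_)
    · refine continuousOn_finsetSum _ fun k _ => continuousOn_finsetSum _ fun l _ =>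
        (hG k l).neg.mul ((ContinuousOn.mul ?_ ?_).add (ContinuousOn.mul ?_ ?_))
      · exact Complex.continuous_re.comp_continuousOn (hZ k)
      · exact Complex.continuous_re.comp_continuousOn (hZ l)
      · exact Complex.continuous_im.comp_continuousOn (hZ k)
      · exact Complex.continuous_im.comp_continuousOn (hZ l)
    · exact pow_ne_zero 2 (h.pos.trans ((h.mem_target y).1 hy)).ne'
  refine h1.congr fun y hy => ?_
  simp only [endDensity]
  rw [vecNormSq_chart h.mem_atlas hy (𝔰.mem_indexAt _), φ.right_inv hy]

variable [MeasurableSpace S] [BorelSpace S] [SecondCountableTopology S]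

omit [BorelSpace S] [SecondCountableTopology S] in
-- The norm with s = 0: for δ = −1/2 the exponent −2δ − 3 is −2, and the square root in `derivNorm`
-- and the outer power 1/2 drop out.
lemma lintegral_weighted_lt_top {O : S} {ν : SpinorField 𝔰 2} (hν : ν.MemHInfty O (-1 / 2)) :
    ∫⁻ x, ENNReal.ofReal (vecNormSq ν (𝔰.indexAt x) x * (weight O x ^ 2)⁻¹) ∂(riemannianVolume S)
      < ⊤ := by
  have h := hν 0
  rw [SpinorField.sobolevNorm, zero_add, Finset.sum_range_one, weightedNorm,
    ENNReal.rpow_lt_top_iff_of_pos (by norm_num)] at h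
  refine lt_of_eq_of_lt (lintegral_congr fun x => ?_) h
  congr 2
  · have hn : normSq (ν.comp (𝔰.indexAt x) x) = vecNormSq ν (𝔰.indexAt x) x :=
      normSq_comp ν (𝔰.mem_indexAt x)
    rw [SpinorField.derivNorm, Real.sq_sqrt]
    · exact hn.symm
    · exact hn.symm ▸ vecNormSq_nonneg ν _ _
  · rw [show (-2 * (-1 / 2 - ((0 : ℕ) : ℝ)) - 3 : ℝ) = -((2 : ℕ) : ℝ) by norm_num,
      Real.rpow_neg (weight_pos O x).le, Real.rpow_natCast]

/-- The weighted `L²` condition in the coordinates of a flat end. -/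
lemma IsFlatEnd.lintegral_endDensity_lt_top {φ : OpenPartialHomeomorph S E3} {s t : ℝ}
    (h : IsFlatEnd φ s) (ht : s < t) {O : S} {ν : SpinorField 𝔰 2} (hν : ν.MemHInfty O (-1 / 2)) :
    ∫⁻ x in (outerChart φ t).source, ENNReal.ofReal (endDensity ν φ x) ∂(riemannianVolume S) < ⊤ := by
  obtain ⟨C, hC, hw⟩ := h.weight_le ht O
  calc _ ≤ ∫⁻ x in (outerChart φ t).source, ENNReal.ofReal (C ^ 2) *
        ENNReal.ofReal (vecNormSq ν (𝔰.indexAt x) x * (weight O x ^ 2)⁻¹) ∂(riemannianVolume S) := by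
        refine setLIntegral_mono' (outerChart φ t).open_source.measurableSet fun x hx => ?_
        rw [outerChart_source] at hx
        have h1 := hw (φ x) (le_of_lt hx.2)
        rw [φ.left_inv hx.1] at h1
        have h2 : 0 < ‖φ x‖ := (h.pos.trans ht).trans hx.2
        rw [← ENNReal.ofReal_mul (by positivity)]
        refine ENNReal.ofReal_le_ofReal ?_
        rw [endDensity, mul_left_comm]
        refine mul_le_mul_of_nonneg_left ?_ (vecNormSq_nonneg ν _ _)
        have hwp := weight_pos O x
        rw [← div_eq_mul_inv, inv_eq_one_div, div_le_div_iff₀ (by positivity) (by positivity), one_mul,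
          ← mul_pow]
        gcongr
    _ = ENNReal.ofReal (C ^ 2) * ∫⁻ x in (outerChart φ t).source,
        ENNReal.ofReal (vecNormSq ν (𝔰.indexAt x) x * (weight O x ^ 2)⁻¹) ∂(riemannianVolume S) :=
        lintegral_const_mul' _ _ ENNReal.ofReal_ne_top
    _ < ⊤ := ENNReal.mul_lt_top ENNReal.ofReal_lt_top
        ((setLIntegral_le_lintegral _ _).trans_lt (lintegral_weighted_lt_top hν))

lemma IsFlatEnd.integrableOn_endDensity {φ : OpenPartialHomeomorph S E3} {s t : ℝ}
    (h : IsFlatEnd φ s) (ht : s < t) {O : S} {ν : SpinorField 𝔰 2} (hν : ν.MemHInfty O (-1 / 2)) :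
    IntegrableOn (endDensity ν φ) (outerChart φ t).source (riemannianVolume S) := by
  have hm : AEStronglyMeasurable (endDensity ν φ)
      ((riemannianVolume S).restrict (outerChart φ t).source) :=
    ((continuousOn_source (endDensity_continuousOn ν (h.outer ht.le))).aemeasurable
      (outerChart φ t).open_source.measurableSet).aestronglyMeasurable
  refine ⟨hm, ?_⟩
  rw [hasFiniteIntegral_iff_ofReal (Eventually.of_forall fun x => endDensity_nonneg ν φ x)]
  exact h.lintegral_endDensity_lt_top ht hν

lemma IsFlatEnd.lintegral_chartZ_lt_top {φ : OpenPartialHomeomorph S E3} {s t : ℝ}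
    (h : IsFlatEnd φ s) (ht : s < t) {O : S} {ν : SpinorField 𝔰 2} (hν : ν.MemHInfty O (-1 / 2)) :
    ∫⁻ y in {y : E3 | t < ‖y‖}, ENNReal.ofReal (∑ m, ‖chartZ ν φ m y‖ ^ 2 * (‖y‖ ^ 2)⁻¹) < ⊤ := by
  have ho := h.outer ht.le
  have htar : {y : E3 | t < ‖y‖} = (outerChart φ t).target := by
    ext y; exact (ho.mem_target y).symm
  have h1 := h.lintegral_endDensity_lt_top ht hν
  have h2 : ∫⁻ x in (outerChart φ t).source, ENNReal.ofReal (endDensity ν φ x) ∂(riemannianVolume S)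
      = _ := lintegral_chart ho.mem_atlas (endDensity_continuousOn ν ho)
  rw [h2] at h1
  rw [htar]
  -- The 4 is 2 from |Z|² ≤ 2|ν|² times 2 from the volume density being at least ½.
  calc _ ≤ ∫⁻ y in (outerChart φ t).target, ENNReal.ofReal 4 *
        (ENNReal.ofReal (volDensity (outerChart φ t) y) *
          ENNReal.ofReal (endDensity ν (outerChart φ t) ((outerChart φ t).symm y))) := by
        refine setLIntegral_mono' (outerChart φ t).open_target.measurableSet fun y hy => ?_
        have hyt := (ho.mem_target y).1 hy
        have hv := ho.volDensity_bounds hyt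
        have hz := ho.sum_chartZ_le ν hyt
        have hN := vecNormSq_nonneg ν (𝔰.indexAt ((outerChart φ t).symm y)) ((outerChart φ t).symm y)
        rw [← ENNReal.ofReal_mul (by linarith), ← ENNReal.ofReal_mul (by norm_num)]
        refine ENNReal.ofReal_le_ofReal ?_
        rw [← Finset.sum_mul, endDensity, (outerChart φ t).right_inv hy, ← mul_assoc, ← mul_assoc]
        refine mul_le_mul_of_nonneg_right (hz.trans ?_) (by positivity)
        nlinarith
    _ = ENNReal.ofReal 4 * _ := lintegral_const_mul' _ _ ENNReal.ofReal_ne_top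
    _ < ⊤ := ENNReal.mul_lt_top ENNReal.ofReal_lt_top h1

end WeightedEnd

/-- A spatial Killing spinor in `H^∞_{-1/2}` vanishes. -/
theorem SpinorField.IsSpatialKilling.isZero {S : Type*} [TopologicalSpace S]
    [SecondCountableTopology S] [ConnectedSpace S] [ChartedSpace E3 S] [IsManifold (𝓡 3) ∞ S]
    [MeasurableSpace S] [BorelSpace S]
    [RiemannianBundle (fun x : S => TangentSpace (𝓡 3) x)]
    [IsContMDiffRiemannianBundle (𝓡 3) ∞ E3 (fun x : S => TangentSpace (𝓡 3) x)]
    {K : TwoTensor S} (hK : IsAsymptoticallyEuclidean K) {ι : Type*} {𝔰 : SpinStructure S ι} {O : S}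
    {ν : SpinorField 𝔰 2} (hν : ν.MemHInfty O (-1 / 2)) (h : ν.IsSpatialKilling K) : ν.IsZero := by
  -- One end suffices: vanishing there is spread by unique continuation.
  obtain ⟨-, φ, -, -, hφ, -⟩ := hK.ends
  obtain ⟨s, hs, hf⟩ := hφ.isFlatEnd hK
  obtain ⟨s₀, hs₀, h0⟩ := chartZ_eq_zero_of_end hK hφ ν h
    ((hf s le_rfl).lintegral_chartZ_lt_top (lt_add_one s) hν)
  set y₀ : E3 := EuclideanSpace.single 0 (s₀ + 1)
  have hy : s₀ < ‖y₀‖ := by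
    rw [EuclideanSpace.norm_single, Real.norm_of_nonneg (by positivity)]
    linarith
  refine isZero_of_chartZ_eq_zero hK hφ.1 (h0 y₀ hy.le).1 ν h ?_
  filter_upwards [continuous_norm.continuousAt.eventually_const_lt hy] with y hy m
  exact (h0 y hy.le).2 m

/-! ### Radial cutoffs, and closedness of the far region of an end -/

section Cutoff

open Filter Topology

/-- The radial function `f(‖y‖² / R²)`. -/
def radialBump {c : ℝ} (f : ContDiffBump c) (R : ℝ) (y : E3) : ℝ := f (‖y‖ ^ 2 / R ^ 2)

lemma radialBump_contDiff {c : ℝ} (f : ContDiffBump c) (R : ℝ) : ContDiff ℝ ∞ (radialBump f R) :=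
  f.contDiff.comp ((contDiff_norm_sq ℝ).div_const _)

/-- The gradient of a radial cutoff at scale `R` is `O(R⁻¹)`. -/
lemma exists_norm_fderiv_radialBump_le {c : ℝ} (f : ContDiffBump c) (hc : c + f.rOut ≤ 4) :
    ∃ B : ℝ, 0 ≤ B ∧ ∀ R : ℝ, 0 < R → ∀ y v, |fderiv ℝ (radialBump f R) y v| ≤ B / R * ‖v‖ := by
  obtain ⟨L, hL⟩ := (f.contDiff (n := 1)).lipschitzWith_of_hasCompactSupport f.hasCompactSupport
    one_ne_zero
  refine ⟨L * 4, by positivity, fun R hR y v => ?_⟩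
  -- In terms of |y|²/R² the profile vanishes beyond c + rOut ≤ 4, that is, beyond |y| = 2R. Within
  -- that radius the gradient of |y|²/R² is at most 4/R.
  by_cases hy : ‖y‖ ≤ 2 * R
  · have h1 : HasFDerivAt (fun y : E3 => ‖y‖ ^ 2 / R ^ 2) ((R ^ 2)⁻¹ • (2 • innerSL ℝ y)) y := by
      have := (hasStrictFDerivAt_norm_sq y).hasFDerivAt.const_mul ((R ^ 2)⁻¹)
      simpa [div_eq_mul_inv, mul_comm] using this
    have h2 : DifferentiableAt ℝ f (‖y‖ ^ 2 / R ^ 2) :=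
      (f.contDiff (n := 1)).differentiable one_ne_zero _
    have h3 := (h2.hasFDerivAt.comp y h1).fderiv
    rw [show radialBump f R = f ∘ fun y : E3 => ‖y‖ ^ 2 / R ^ 2 from rfl, h3]
    have h4 : ‖fderiv ℝ f (‖y‖ ^ 2 / R ^ 2)‖ ≤ L := norm_fderiv_le_of_lipschitz ℝ hL
    have h5 : |((R ^ 2)⁻¹ • (2 • innerSL ℝ y)) v| ≤ 4 / R * ‖v‖ := by
      have h6 := abs_real_inner_le_norm y v
      have h7 : ((R ^ 2)⁻¹ • (2 • innerSL ℝ y)) v = (R ^ 2)⁻¹ * (2 * inner ℝ y v) := by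
        simp
      rw [h7, abs_mul, abs_mul, abs_of_pos (by positivity : (0:ℝ) < (R ^ 2)⁻¹), abs_two]
      calc (R ^ 2)⁻¹ * (2 * |inner ℝ y v|) ≤ (R ^ 2)⁻¹ * (2 * (2 * R * ‖v‖)) := by
            gcongr
            exact h6.trans (by gcongr)
        _ = 4 / R * ‖v‖ := by field_simp; ring
    calc _ ≤ ‖fderiv ℝ f (‖y‖ ^ 2 / R ^ 2)‖ * ‖((R ^ 2)⁻¹ • (2 • innerSL ℝ y)) v‖ :=
          (fderiv ℝ f (‖y‖ ^ 2 / R ^ 2)).le_opNorm _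
      _ ≤ L * (4 / R * ‖v‖) := mul_le_mul h4 h5 (norm_nonneg _) L.2
      _ = _ := by ring
  · have h0 : radialBump f R =ᶠ[𝓝 y] fun _ => 0 := by
      filter_upwards [continuous_norm.continuousAt.eventually_const_lt (not_le.1 hy)] with z hz
      refine f.zero_of_le_dist ?_
      have h4 : 4 ≤ ‖z‖ ^ 2 / R ^ 2 := by
        rw [le_div_iff₀ (by positivity)]
        nlinarith
      rw [Real.dist_eq]
      exact (by linarith : f.rOut ≤ ‖z‖ ^ 2 / R ^ 2 - c).trans (le_abs_self _)
    rw [h0.fderiv_eq]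
    simp only [fderiv_fun_const, Pi.zero_apply, ContinuousLinearMap.zero_apply, abs_zero]
    positivity

variable {S : Type*} [TopologicalSpace S]

open Classical in
/-- The function `g` of the coordinates, continued by the constant `k`. -/
def chartExtend (φ : OpenPartialHomeomorph S E3) (g : E3 → ℝ) (k : ℝ) (x : S) : ℝ :=
  if x ∈ φ.source then g (φ x) else k

lemma chartExtend_of_mem {φ : OpenPartialHomeomorph S E3} {x : S} (hx : x ∈ φ.source) (g : E3 → ℝ)
    (k : ℝ) : chartExtend φ g k x = g (φ x) := if_pos hx

lemma chartExtend_of_notMem {φ : OpenPartialHomeomorph S E3} {x : S} (hx : x ∉ φ.source) (g : E3 → ℝ)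
    (k : ℝ) : chartExtend φ g k x = k := if_neg hx

lemma isCompact_source_inter_preimage [T2Space S] {φ : OpenPartialHomeomorph S E3} {T : Set E3}
    (hT : IsCompact T) (hs : T ⊆ φ.target) : IsCompact (φ.source ∩ φ ⁻¹' T) := by
  rw [← φ.symm_image_eq_source_inter_preimage hs]
  exact hT.image_of_continuousOn (φ.continuousOn_symm.mono hs)

lemma chartExtend_eventuallyEq {φ : OpenPartialHomeomorph S E3} {T : Set E3}
    (hT : IsClosed (φ.source ∩ φ ⁻¹' T)) {g : E3 → ℝ} {k : ℝ} (hg : ∀ y, y ∉ T → g y = k) {x : S}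
    (hx : x ∉ φ.source ∩ φ ⁻¹' T) : chartExtend φ g k =ᶠ[𝓝 x] fun _ => k := by
  filter_upwards [hT.isOpen_compl.mem_nhds hx] with z hz
  by_cases hzs : z ∈ φ.source
  · rw [chartExtend_of_mem hzs]
    exact hg _ fun h => hz ⟨hzs, h⟩
  · exact chartExtend_of_notMem hzs g k

variable [ChartedSpace E3 S] [IsManifold (𝓡 3) ∞ S]

/-- Off the chart the extension is locally constant only if points outside the chart domain cannot
be approached by points where g ≠ k. That is the role of T, whose preimage is closed in the manifold
and not just in the chart domain. -/
lemma chartExtend_contMDiff {φ : OpenPartialHomeomorph S E3}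
    (hφ : φ ∈ IsManifold.maximalAtlas (𝓡 3) ∞ S) {T : Set E3} (hT : IsClosed (φ.source ∩ φ ⁻¹' T))
    {g : E3 → ℝ} {k : ℝ} (hg : ∀ y, y ∉ T → g y = k) (hgs : ContDiff ℝ ∞ g) :
    ContMDiff (𝓡 3) 𝓘(ℝ, ℝ) ∞ (chartExtend φ g k) := by
  intro x
  by_cases hx : x ∈ φ.source
  · have h1 : ContMDiffAt (𝓡 3) 𝓘(ℝ, ℝ) ∞ (g ∘ φ) x :=
      hgs.contMDiff.contMDiffAt.comp x (contMDiffAt_of_mem_maximalAtlas hφ hx)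
    refine h1.congr_of_eventuallyEq ?_
    filter_upwards [φ.open_source.mem_nhds hx] with z hz
    exact chartExtend_of_mem hz g k
  · exact contMDiffAt_const.congr_of_eventuallyEq
      (chartExtend_eventuallyEq hT hg fun h => hx h.1)

omit [IsManifold (𝓡 3) ∞ S] in
lemma realDeriv_eq_zero {u : S → ℝ} {k : ℝ} {x : S} (h : u =ᶠ[𝓝 x] fun _ => k)
    (X : TangentSpace (𝓡 3) x) : realDeriv u x X = 0 := by
  have h1 : HasMFDerivAt (𝓡 3) 𝓘(ℝ, ℝ) u x (0 : E3 →L[ℝ] ℝ) :=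
    (hasMFDerivAt_const (I := 𝓡 3) (I' := 𝓘(ℝ, ℝ)) k x).congr_of_eventuallyEq h
  exact congrArg (fun L : E3 →L[ℝ] ℝ => L X) h1.mfderiv

lemma realDeriv_mfderiv {φ : OpenPartialHomeomorph S E3} (hφ : φ ∈ IsManifold.maximalAtlas (𝓡 3) ∞ S)
    {y : E3} (hy : y ∈ φ.target) {u : S → ℝ} (hu : MDifferentiableAt (𝓡 3) 𝓘(ℝ, ℝ) u (φ.symm y))
    (v : E3) : realDeriv u (φ.symm y) (mfderiv (𝓡 3) (𝓡 3) φ.symm y v)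
      = fderiv ℝ (u ∘ φ.symm) y v := by
  have h := hu.hasMFDerivAt.comp y
    ((chart_symm_contMDiffAt hφ hy).mdifferentiableAt (by simp)).hasMFDerivAt
  have h3 := HasFDerivAt.fderiv (𝕜 := ℝ) (E := E3) (F := ℝ) h.hasFDerivAt
  rw [h3, realDeriv]
  rfl

variable [RiemannianBundle (fun x : S => TangentSpace (𝓡 3) x)]

namespace IsFlatEnd

variable {φ : OpenPartialHomeomorph S E3} {s : ℝ} (h : IsFlatEnd φ s)

include h

/-- Compares the coordinate gradient with the Riemannian one: ½|v|² ≤ |X|² gives |v| ≤ 2|X| for the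
coordinate vector v of X. -/
lemma abs_realDeriv_chartExtend_le {T : Set E3} (hT : IsClosed (φ.source ∩ φ ⁻¹' T))
    {g : E3 → ℝ} {k : ℝ} (hg : ∀ y, y ∉ T → g y = k) (hgs : ContDiff ℝ ∞ g) {A : ℝ} (hA : 0 ≤ A)
    (hb : ∀ y v, |fderiv ℝ g y v| ≤ A * ‖v‖) (x : S) (X : TangentSpace (𝓡 3) x) :
    |realDeriv (chartExtend φ g k) x X| ≤ 2 * A * Real.sqrt (ip X X) := by
  by_cases hx : x ∈ φ.source
  · obtain ⟨y, hy, rfl⟩ : ∃ y ∈ φ.target, φ.symm y = x := ⟨φ x, φ.map_source hx, φ.left_inv hx⟩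
    obtain ⟨L, hL⟩ := mfderiv_chart_symm_isInvertible h.mem_atlas hy
    obtain ⟨v, rfl⟩ : ∃ v : E3, mfderiv (𝓡 3) (𝓡 3) φ.symm y v = X := by
      refine ⟨L.symm X, ?_⟩
      rw [← hL]
      exact L.apply_symm_apply X
    rw [realDeriv_mfderiv h.mem_atlas hy
      ((chartExtend_contMDiff h.mem_atlas hT hg hgs).mdifferentiableAt (by simp))]
    have e : chartExtend φ g k ∘ φ.symm =ᶠ[𝓝 y] g := by
      filter_upwards [φ.open_target.mem_nhds hy] with z hz
      rw [Function.comp_apply, chartExtend_of_mem (φ.map_target hz), φ.right_inv hz]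
    rw [e.fderiv_eq]
    refine (hb y v).trans ?_
    rw [mul_comm 2 A, mul_assoc]
    refine mul_le_mul_of_nonneg_left ?_ hA
    have h1 := (ip_mfderiv_bounds (h.near y ((h.mem_target y).1 hy)) v).1
    have h2 : ‖v‖ / 2 ≤ Real.sqrt (ip (mfderiv (𝓡 3) (𝓡 3) φ.symm y v)
        (mfderiv (𝓡 3) (𝓡 3) φ.symm y v)) :=
      Real.le_sqrt_of_sq_le (by nlinarith [sq_nonneg ‖v‖])
    linarith
  · rw [realDeriv_eq_zero (chartExtend_eventuallyEq hT hg fun h => hx h.1), abs_zero]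
    positivity

variable [hR : IsContMDiffRiemannianBundle (𝓡 3) ∞ E3 (fun x : S => TangentSpace (𝓡 3) x)]

/-- The region far out in a flat end is closed. -/
lemma isClosed_outer [T2Space S] {ι : Type*} (𝔰 : SpinStructure S ι) {c : ℝ} (hc : 2 * s ≤ c) :
    IsClosed (φ.source ∩ φ ⁻¹' {y | c ≤ ‖y‖}) := by
  have hc0 : 0 < c := by linarith [h.pos]
  refine isClosed_of_closure_subset fun x₀ hx₀ => ?_
  by_cases hx : x₀ ∈ φ.source
  · refine ⟨hx, ?_⟩
    by_contra hlt
    have hlt : ‖φ x₀‖ < c := not_le.1 hlt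
    obtain ⟨z, hz, hz2⟩ := ((mem_closure_iff_frequently.1 hx₀).and_eventually
      (((φ.continuousAt hx).norm).eventually_lt_const hlt)).exists
    exact absurd hz.2 (not_le.2 hz2)
  · exfalso
    -- A limit point x₀ outside the chart domain is excluded by cutoffs with a uniform Lipschitz
    -- bound. For x in the far region with |φ(x)| = b, a bump concentrated near radius b is 1 at x
    -- and 0 at x₀, while its gradient is O(1/b) ≤ O(1/c). The mean value inequality in a chart
    -- around x₀ contradicts x being close to x₀.
    set β : ContDiffBump (1 : ℝ) := ⟨1 / 4, 1 / 2, by norm_num, by norm_num⟩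
    obtain ⟨B, hB, hb⟩ := exists_norm_fderiv_radialBump_le β
      (by change (1 : ℝ) + 1 / 2 ≤ 4; norm_num)
    obtain ⟨ψ, hψ, hxs, h0⟩ := exists_adapted_chart 𝔰 x₀
    have hnear : ∀ᶠ y in 𝓝 (ψ x₀), y ∈ ψ.target ∧
        ∀ i j, |metricCoeff ψ i j y - (-(if i = j then 1 else 0))| ≤ 1 / 10 := by
      refine (ψ.open_target.eventually_mem (ψ.map_source hxs)).and
        (eventually_all.2 fun i => eventually_all.2 fun j => ?_)
      have hcont := (metricCoeff_contDiffAt hψ (ψ.map_source hxs) i j).continuousAt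
      have hev := (hcont.sub_const (-(if i = j then (1 : ℝ) else 0))).abs.eventually_lt_const
        (u := 1 / 10) (by rw [h0]; norm_num)
      exact hev.mono fun _ => le_of_lt
    obtain ⟨r, hr, hball⟩ := Metric.eventually_nhds_iff_ball.1 hnear
    set A := 4 * (B / c) with hA
    have hA0 : 0 ≤ A := by positivity
    have hclose : ∀ᶠ x in 𝓝 x₀, x ∈ ψ.source ∧ ψ x ∈ Metric.ball (ψ x₀) (min r (1 / (A + 1))) :=
      (ψ.open_source.eventually_mem hxs).and
        ((ψ.continuousAt hxs).eventually (Metric.ball_mem_nhds _ (by positivity)))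
    obtain ⟨x, ⟨hxo, hxc⟩, hxψ, hxb⟩ :=
      ((mem_closure_iff_frequently.1 hx₀).and_eventually hclose).exists
    set b := ‖φ x‖ with hbdef
    have hcb : c ≤ b := hxc
    have hb0 : 0 < b := hc0.trans_le hcb
    -- The closed shell b/√2 ≤ |y| ≤ 2b contains the support of the bump. It is a compact part of
    -- the end because b ≥ c ≥ 2s puts its inner radius beyond s.
    set T : Set E3 := Metric.closedBall 0 (2 * b) ∩ {y | b ^ 2 / 2 ≤ ‖y‖ ^ 2} with hTdef
    have hTc : IsCompact T := (isCompact_closedBall 0 (2 * b)).inter_right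
      (isClosed_le continuous_const (continuous_norm.pow 2))
    have hTs : ∀ y ∈ T, s < ‖y‖ := by
      intro y hy
      have h1 : b ^ 2 / 2 ≤ ‖y‖ ^ 2 := hy.2
      refine lt_of_pow_lt_pow_left₀ 2 (norm_nonneg y) ?_
      nlinarith [h.pos]
    have hT := (isCompact_source_inter_preimage hTc
      fun y hy => (h.mem_target y).2 (hTs y hy)).isClosed
    have hg0 : ∀ y, y ∉ T → radialBump β b y = 0 := by
      intro y hy
      refine β.zero_of_le_dist ?_
      change (1 / 2 : ℝ) ≤ _
      rw [Real.dist_eq]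
      by_contra hlt
      have h2 := abs_lt.1 (not_le.1 hlt)
      refine hy ⟨?_, ?_⟩
      · rw [mem_closedBall_zero_iff]
        have h3 : ‖y‖ ^ 2 / b ^ 2 < 2 := by linarith [h2.2]
        rw [div_lt_iff₀ (by positivity)] at h3
        refine le_of_lt (lt_of_pow_lt_pow_left₀ 2 (by positivity) ?_)
        nlinarith
      · have h3 : 1 / 2 < ‖y‖ ^ 2 / b ^ 2 := by linarith [h2.1]
        rw [lt_div_iff₀ (by positivity)] at h3
        show b ^ 2 / 2 ≤ ‖y‖ ^ 2
        linarith
    set u := chartExtend φ (radialBump β b) 0 with hu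
    have hus : ContMDiff (𝓡 3) 𝓘(ℝ, ℝ) ∞ u :=
      chartExtend_contMDiff h.mem_atlas hT hg0 (radialBump_contDiff β b)
    have hder : ∀ y ∈ Metric.ball (ψ x₀) r, ‖fderiv ℝ (u ∘ ψ.symm) y‖ ≤ A := by
      intro y hy
      refine ContinuousLinearMap.opNorm_le_bound _ hA0 fun v => ?_
      rw [← realDeriv_mfderiv hψ (hball y hy).1 (hus.mdifferentiableAt (by simp)), Real.norm_eq_abs]
      refine (h.abs_realDeriv_chartExtend_le hT hg0 (radialBump_contDiff β b) (by positivity)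
        (hb b hb0) _ _).trans ?_
      have h1 := (ip_mfderiv_bounds (hball y hy).2 v).2
      have h2 : Real.sqrt (ip (mfderiv (𝓡 3) (𝓡 3) ψ.symm y v) (mfderiv (𝓡 3) (𝓡 3) ψ.symm y v))
          ≤ 2 * ‖v‖ := Real.sqrt_le_iff.2 ⟨by positivity, by nlinarith [sq_nonneg ‖v‖]⟩
      have h3 : B / b ≤ B / c := by gcongr
      calc _ ≤ 2 * (B / b) * (2 * ‖v‖) := by gcongr
        _ = 4 * (B / b) * ‖v‖ := by ring
        _ ≤ A * ‖v‖ := by rw [hA]; gcongr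
    have hdiff : ∀ y ∈ Metric.ball (ψ x₀) r, DifferentiableAt ℝ (u ∘ ψ.symm) y := fun y hy =>
      ((hus.contMDiffAt.comp y (chart_symm_contMDiffAt hψ (hball y hy).1)).mdifferentiableAt
        (by simp)).differentiableAt
    have hxb' := Metric.ball_subset_ball (min_le_left r (1 / (A + 1))) hxb
    have hmv := (convex_ball (ψ x₀) r).norm_image_sub_le_of_norm_fderiv_le hdiff hder
      (Metric.mem_ball_self hr) hxb'
    rw [Function.comp_apply, Function.comp_apply, ψ.left_inv hxψ, ψ.left_inv hxs, hu,
      chartExtend_of_notMem hx, chartExtend_of_mem hxo, sub_zero] at hmv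
    have h1 : radialBump β b (φ x) = 1 := by
      refine β.one_of_mem_closedBall ?_
      rw [← hbdef, div_self (by positivity)]
      exact Metric.mem_closedBall_self (by change (0 : ℝ) ≤ 1 / 4; norm_num)
    rw [h1, norm_one, ← dist_eq_norm] at hmv
    have h2 : dist (ψ x) (ψ x₀) < 1 / (A + 1) :=
      (Metric.mem_ball.1 hxb).trans_le (min_le_right _ _)
    rw [lt_div_iff₀ (by positivity)] at h2
    nlinarith [dist_nonneg (x := ψ x) (y := ψ x₀)]

end IsFlatEnd

end Cutoff

/-! ### The compact core -/

section Core

open Filter Topology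

lemma isPreconnected_shell {a b : ℝ} (ha : 0 ≤ a) :
    IsPreconnected {y : E3 | a < ‖y‖ ∧ ‖y‖ < b} := by
  have hs : IsPreconnected (Metric.sphere (0 : E3) 1) := by
    refine isPreconnected_sphere ?_ 0 1
    rw [← Module.finrank_eq_rank, finrank_euclideanSpace_fin]
    norm_num
  have himg := (isPreconnected_Ioo (a := a) (b := b)).prod hs
  have := himg.image (fun p : ℝ × E3 => p.1 • p.2) (by fun_prop)
  convert this using 1
  ext y
  simp only [Set.mem_setOf_eq, Set.mem_image, Set.mem_prod, Set.mem_Ioo, mem_sphere_zero_iff_norm,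
    Prod.exists]
  constructor
  · intro hy
    have hy0 : 0 < ‖y‖ := ha.trans_lt hy.1
    refine ⟨‖y‖, ‖y‖⁻¹ • y, ⟨hy, ?_⟩, ?_⟩
    · rw [norm_smul, norm_inv, norm_norm, inv_mul_cancel₀ hy0.ne']
    · rw [smul_smul, mul_inv_cancel₀ hy0.ne', one_smul]
  · rintro ⟨t, u, ⟨ht, hu⟩, rfl⟩
    rw [norm_smul, hu, mul_one, Real.norm_of_nonneg (ha.trans ht.1.le)]
    exact ht

variable {S : Type*} [TopologicalSpace S] [T2Space S]

lemma isCompact_closed_shell {φ : OpenPartialHomeomorph S E3} {R a b : ℝ}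
    (htar : ∀ y, y ∈ φ.target ↔ R < ‖y‖) (ha : R < a) :
    IsCompact (φ.source ∩ φ ⁻¹' {y | a ≤ ‖y‖ ∧ ‖y‖ ≤ b}) := by
  have hc : IsCompact {y : E3 | a ≤ ‖y‖ ∧ ‖y‖ ≤ b} := by
    have : {y : E3 | a ≤ ‖y‖ ∧ ‖y‖ ≤ b} = Metric.closedBall 0 b ∩ {y | a ≤ ‖y‖} := by
      ext y; simp [and_comm]
    rw [this]
    exact (isCompact_closedBall 0 b).inter_right (isClosed_le continuous_const continuous_norm)
  exact isCompact_source_inter_preimage hc fun y hy => (htar y).2 (ha.trans_le hy.1)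

/-- In a connected manifold that is compact apart from two ends, the inner part of an end is
relatively compact. -/
lemma exists_compact_inner [ConnectedSpace S] [LocallyCompactSpace S]
    {φ : OpenPartialHomeomorph S E3} {R c : ℝ} (hR : 0 < R)
    (htar : ∀ y, y ∈ φ.target ↔ R < ‖y‖) (hc : R < c)
    (hcl : IsClosed (φ.source ∩ φ ⁻¹' {y | c ≤ ‖y‖})) {V : Set S} (hV : IsOpen V)
    (hVne : V.Nonempty) (hdis : Disjoint φ.source V) (hK : IsCompact (φ.source ∪ V)ᶜ) :
    ∃ Q : Set S, IsCompact Q ∧ φ.source ∩ φ ⁻¹' {y | ‖y‖ ≤ c} ⊆ Q := by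
  -- N is a compact neighbourhood of the complement of both ends. Its frontier avoids that
  -- complement, so inside the first end the frontier is the frontier minus V, which is compact; the
  -- radius therefore has a minimum R' > R on it.
  obtain ⟨N, hN, hKN⟩ := exists_compact_superset hK
  have hfr : frontier N ⊆ N := hN.isClosed.frontier_subset
  have hD : IsCompact (frontier N ∩ φ.source) := by
    have : frontier N ∩ φ.source = frontier N ∩ Vᶜ := by
      ext x
      refine and_congr_right fun hx => ⟨fun h hxV => Set.disjoint_left.1 hdis h hxV, fun h => ?_⟩
      by_contra hxs
      have hxK : x ∈ interior N := hKN fun hu => hu.elim hxs h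
      exact hx.2 hxK
    rw [this]
    exact (hN.of_isClosed_subset isClosed_frontier hfr).inter_right hV.isClosed_compl
  obtain ⟨R', hR', hR'c, hmin⟩ : ∃ R' > R, R' ≤ c ∧ ∀ x ∈ frontier N ∩ φ.source, R' ≤ ‖φ x‖ := by
    rcases (frontier N ∩ φ.source).eq_empty_or_nonempty with he | hne
    · exact ⟨c, hc, le_rfl, fun x hx => by rw [he] at hx; exact hx.elim⟩
    · obtain ⟨x, hx, hxm⟩ := hD.exists_isMinOn hne
        ((φ.continuousOn.mono Set.inter_subset_right).norm)
      exact ⟨min ‖φ x‖ c, lt_min ((htar _).1 (φ.map_source hx.2)) hc, min_le_right _ _,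
        fun z hz => (min_le_left _ _).trans (hxm hz)⟩
  set Sh : Set S := φ.source ∩ φ ⁻¹' {y | R < ‖y‖ ∧ ‖y‖ < R'} with hSh
  have hShc : IsPreconnected Sh := by
    have hsub : {y : E3 | R < ‖y‖ ∧ ‖y‖ < R'} ⊆ φ.target := fun y hy => (htar y).2 hy.1
    rw [hSh, ← φ.symm_image_eq_source_inter_preimage hsub]
    exact (isPreconnected_shell hR.le).image _ (φ.continuousOn_symm.mono hsub)
  -- The connected shell R < |y| < R' misses the frontier of N, so it lies either inside N or
  -- outside N.
  have hcov : Sh ⊆ interior N ∪ Nᶜ := by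
    intro x hx
    by_contra hn
    rw [Set.mem_union, not_or, Set.notMem_compl_iff] at hn
    have hxf : x ∈ frontier N := ⟨subset_closure hn.2, hn.1⟩
    exact absurd (hmin x ⟨hxf, hx.1⟩) (not_le.2 hx.2.2)
  rcases hShc.subset_or_subset isOpen_interior hN.isClosed.isOpen_compl
    (Set.disjoint_compl_right_iff_subset.2 interior_subset) hcov with hin | hout
  · refine ⟨N ∪ φ.source ∩ φ ⁻¹' {y | R' ≤ ‖y‖ ∧ ‖y‖ ≤ c},
      hN.union (isCompact_closed_shell htar hR'), fun x hx => ?_⟩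
    by_cases hxR : ‖φ x‖ < R'
    · exact Or.inl (interior_subset (hin ⟨hx.1, (htar _).1 (φ.map_source hx.1), hxR⟩))
    · exact Or.inr ⟨hx.1, not_lt.1 hxR, hx.2⟩
  -- If the shell lies outside N, a limit point of the end not in the end would lie neither in V nor
  -- in the closed far region, hence in the interior of N with points of the shell nearby:
  -- impossible. Then the end is closed and open, hence everything, contradicting the presence of V.
  · exfalso
    have hcl' : IsClosed (φ.source ∩ φ ⁻¹' {y | R' ≤ ‖y‖}) := by
      have : φ.source ∩ φ ⁻¹' {y | R' ≤ ‖y‖} = φ.source ∩ φ ⁻¹' {y | R' ≤ ‖y‖ ∧ ‖y‖ ≤ c} ∪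
          φ.source ∩ φ ⁻¹' {y | c ≤ ‖y‖} := by
        ext x
        simp only [Set.mem_inter_iff, Set.mem_preimage, Set.mem_setOf_eq, Set.mem_union]
        constructor
        · rintro ⟨h1, h2⟩
          rcases le_total ‖φ x‖ c with h | h
          · exact Or.inl ⟨h1, h2, h⟩
          · exact Or.inr ⟨h1, h⟩
        · rintro (⟨h1, h2, -⟩ | ⟨h1, h2⟩)
          · exact ⟨h1, h2⟩
          · exact ⟨h1, hR'c.trans h2⟩
      rw [this]
      exact (isCompact_closed_shell htar hR').isClosed.union hcl
    have hsc : IsClosed φ.source := by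
      refine isClosed_of_closure_subset fun x hx => ?_
      by_contra hxs
      have hxV : x ∉ V := fun hxV =>
        Set.disjoint_left.1 (hdis.closure_left hV) hx hxV
      have hxN : x ∈ interior N := hKN fun hu => hu.elim hxs hxV
      obtain ⟨z, ⟨hzN, hzA⟩, hzs⟩ := mem_closure_iff.1 hx _ (isOpen_interior.inter hcl'.isOpen_compl)
        ⟨hxN, fun h => hxs h.1⟩
      have hzR : ‖φ z‖ < R' := not_le.1 fun h => hzA ⟨hzs, h⟩
      exact hout ⟨hzs, (htar _).1 (φ.map_source hzs), hzR⟩ (interior_subset hzN)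
    have hne : φ.source.Nonempty := by
      refine ⟨_, φ.map_target ((htar (EuclideanSpace.single 0 (R + 1))).2 ?_)⟩
      rw [EuclideanSpace.norm_single, Real.norm_of_nonneg (by positivity)]
      linarith
    have huniv := IsClopen.eq_univ ⟨hsc, φ.open_source⟩ hne
    obtain ⟨v, hv⟩ := hVne
    exact Set.disjoint_left.1 hdis (huniv ▸ Set.mem_univ v) hv

variable [ConnectedSpace S] [ChartedSpace E3 S] [IsManifold (𝓡 3) ∞ S]
  [RiemannianBundle (fun x : S => TangentSpace (𝓡 3) x)]
  [hR : IsContMDiffRiemannianBundle (𝓡 3) ∞ E3 (fun x : S => TangentSpace (𝓡 3) x)]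

/-- Asymptotically Euclidean data have a compact core with two flat ends attached. -/
lemma IsAsymptoticallyEuclidean.exists_ends {K : TwoTensor S} (hK : IsAsymptoticallyEuclidean K)
    {ι : Type*} (𝔰 : SpinStructure S ι) : ∃ (φ : Fin 2 → OpenPartialHomeomorph S E3) (s : ℝ),
    (∀ i, IsFlatEnd (φ i) s) ∧ Disjoint (φ 0).source (φ 1).source ∧
    (∀ i, ∀ c, 2 * s ≤ c → IsClosed ((φ i).source ∩ φ i ⁻¹' {y | c ≤ ‖y‖})) ∧
    ∀ c, 2 * s ≤ c → IsCompact {x | ∀ i, x ∈ (φ i).source → ‖φ i x‖ ≤ c} := by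
  have : LocallyCompactSpace S := Manifold.locallyCompact_of_finiteDimensional (𝓡 3)
  obtain ⟨C, φ₁, φ₂, hC, h₁, h₂, hdis, hcov⟩ := hK.ends
  obtain ⟨s₁, hs₁, hf₁⟩ := h₁.isFlatEnd hK
  obtain ⟨s₂, hs₂, hf₂⟩ := h₂.isFlatEnd hK
  obtain ⟨-, R₁, -, hR₁, -, ht₁, -⟩ := h₁
  obtain ⟨-, R₂, -, hR₂, -, ht₂, -⟩ := h₂
  have htar₁ : ∀ y, y ∈ φ₁.target ↔ R₁ < ‖y‖ := fun y => by rw [ht₁]; simp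
  have htar₂ : ∀ y, y ∈ φ₂.target ↔ R₂ < ‖y‖ := fun y => by rw [ht₂]; simp
  set s := max (max s₁ s₂) (max R₁ R₂) with hs
  have hs0 : 0 < s := hs₁.trans_le ((le_max_left _ _).trans (le_max_left _ _))
  have hg₁ := hf₁ s ((le_max_left _ _).trans (le_max_left _ _))
  have hg₂ := hf₂ s ((le_max_right _ _).trans (le_max_left _ _))
  have hRs₁ : R₁ ≤ s := (le_max_left _ _).trans (le_max_right _ _)
  have hRs₂ : R₂ ≤ s := (le_max_right _ _).trans (le_max_right _ _)
  have heq : ∀ (φ : OpenPartialHomeomorph S E3) (c : ℝ), 2 * s ≤ c →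
      (outerChart φ s).source ∩ outerChart φ s ⁻¹' {y | c ≤ ‖y‖}
        = φ.source ∩ φ ⁻¹' {y | c ≤ ‖y‖} := by
    intro φ c hc
    rw [outerChart_source]
    ext x
    refine ⟨fun h => ⟨h.1.1, h.2⟩, fun h => ⟨⟨h.1, ?_⟩, h.2⟩⟩
    exact (by linarith : s < c).trans_le h.2
  have hcl₁ := fun c hc => hg₁.isClosed_outer 𝔰 (c := c) hc
  have hcl₂ := fun c hc => hg₂.isClosed_outer 𝔰 (c := c) hc
  have hne : ∀ (φ : OpenPartialHomeomorph S E3) (R : ℝ), 0 < R → (∀ y, y ∈ φ.target ↔ R < ‖y‖) →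
      φ.source.Nonempty := by
    intro φ R hR h
    refine ⟨_, φ.map_target ((h (EuclideanSpace.single 0 (R + 1))).2 ?_)⟩
    rw [EuclideanSpace.norm_single, Real.norm_of_nonneg (by positivity)]
    linarith
  have hcore : IsCompact (φ₁.source ∪ φ₂.source)ᶜ := by
    refine hC.of_isClosed_subset (φ₁.open_source.union φ₂.open_source).isClosed_compl fun x hx => ?_
    have := hcov ▸ Set.mem_univ x
    rw [Set.union_assoc] at this
    exact this.resolve_right hx
  refine ⟨![outerChart φ₁ s, outerChart φ₂ s], s, ?_, ?_, ?_, fun c hc => ?_⟩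
  · exact Fin.forall_fin_two.2 ⟨hg₁, hg₂⟩
  · change Disjoint (outerChart φ₁ s).source (outerChart φ₂ s).source
    rw [outerChart_source, outerChart_source]
    exact hdis.mono Set.inter_subset_left Set.inter_subset_left
  · exact Fin.forall_fin_two.2 ⟨hcl₁, hcl₂⟩
  · obtain ⟨Q₁, hQ₁, hsub₁⟩ := exists_compact_inner hR₁ htar₁ (by linarith : R₁ < c)
      (heq φ₁ c hc ▸ hcl₁ c hc) φ₂.open_source (hne φ₂ R₂ hR₂ htar₂) hdis hcore
    obtain ⟨Q₂, hQ₂, hsub₂⟩ := exists_compact_inner hR₂ htar₂ (by linarith : R₂ < c)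
      (heq φ₂ c hc ▸ hcl₂ c hc) φ₁.open_source (hne φ₁ R₁ hR₁ htar₁) hdis.symm
      (by rwa [Set.union_comm])
    refine ((hcore.union hQ₁).union hQ₂).of_isClosed_subset ?_ fun x hx => ?_
    · have : {x | ∀ i, x ∈ ((![outerChart φ₁ s, outerChart φ₂ s] : Fin 2 → _) i).source →
          ‖(![outerChart φ₁ s, outerChart φ₂ s] : Fin 2 → OpenPartialHomeomorph S E3) i x‖ ≤ c}
          = ((outerChart φ₁ s).source ∩ outerChart φ₁ s ⁻¹' {y | c < ‖y‖})ᶜ ∩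
            ((outerChart φ₂ s).source ∩ outerChart φ₂ s ⁻¹' {y | c < ‖y‖})ᶜ := by
        ext x
        simp [Fin.forall_fin_two]
      rw [this]
      exact (isOpen_outer _ c).isClosed_compl.inter (isOpen_outer _ c).isClosed_compl
    · have hx' := Fin.forall_fin_two.1 hx
      have key : ∀ φ : OpenPartialHomeomorph S E3, x ∈ φ.source →
          (x ∈ (outerChart φ s).source → ‖outerChart φ s x‖ ≤ c) →
          x ∈ φ.source ∩ φ ⁻¹' {y | ‖y‖ ≤ c} := by
        intro φ hxs h
        refine ⟨hxs, ?_⟩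
        by_contra hlt
        have hlt : c < ‖φ x‖ := not_le.1 hlt
        refine absurd (h ?_) (not_le.2 hlt)
        rw [outerChart_source]
        exact ⟨hxs, (by linarith : s < c).trans hlt⟩
      by_cases hx₁ : x ∈ φ₁.source
      · exact Or.inl (Or.inr (hsub₁ (key φ₁ hx₁ hx'.1)))
      by_cases hx₂ : x ∈ φ₂.source
      · exact Or.inr (hsub₂ (key φ₂ hx₂ hx'.2))
      · exact Or.inl (Or.inl fun h => h.elim hx₁ hx₂)

end Core

/-! ### The energy estimate -/

section Energy

open Filter Topology

variable {S : Type*} [TopologicalSpace S] [ChartedSpace E3 S]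

lemma realDeriv_mul {u v : S → ℝ} {x : S} (hu : MDifferentiableAt (𝓡 3) 𝓘(ℝ, ℝ) u x)
    (hv : MDifferentiableAt (𝓡 3) 𝓘(ℝ, ℝ) v x) (X : TangentSpace (𝓡 3) x) :
    realDeriv (fun z => u z * v z) x X = u x * realDeriv v x X + v x * realDeriv u x X := by
  have h := (hu.hasMFDerivAt.mul hv.hasMFDerivAt).mfderiv
  exact congrArg (fun L : E3 →L[ℝ] ℝ => L X) h

variable [IsManifold (𝓡 3) ∞ S] [RiemannianBundle (fun x : S => TangentSpace (𝓡 3) x)]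
  {ι : Type*} {𝔰 : SpinStructure S ι}

lemma killNormSq_nonneg (K : TwoTensor S) (ν : SpinorField 𝔰 2) (a : ι) (x : S) :
    0 ≤ killNormSq K ν a x :=
  Finset.sum_nonneg fun _ _ => Finset.sum_nonneg fun _ _ => sq_nonneg _

/-- `|J|² ≤ |Φ(ν)|² |ν|²` for the flux `J`. -/
lemma ip_flux_le (K : TwoTensor S) (ν : SpinorField 𝔰 2) {a : ι} {x : S} (ha : x ∈ 𝔰.dom a) :
    ip (flux K ν a x) (flux K ν a x) ≤ killNormSq K ν a x * vecNormSq ν a x := by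
  have e : ip (flux K ν a x) (flux K ν a x) = ∑ i, fluxComp K ν a i x ^ 2 := by
    have h : ip (flux K ν a x) (flux K ν a x) = ∑ i, ∑ j, fluxComp K ν a i x * (fluxComp K ν a j x *
        ip (𝔰.frame a j x) (𝔰.frame a i x)) := by
      change inner ℝ (∑ i, fluxComp K ν a i x • 𝔰.frame a i x)
        (∑ i, fluxComp K ν a i x • 𝔰.frame a i x) = _
      simp only [sum_inner, inner_sum, real_inner_smul_left, real_inner_smul_right, ip]
    rw [h]
    simp only [𝔰.frame_orthonormal a x ha]
    simp [sq]
  rw [e, killNormSq, Finset.sum_mul]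
  refine Finset.sum_le_sum fun i _ => ?_
  have h1 : |fluxComp K ν a i x| ≤ ∑ j, ‖killFrame K ν a x i j‖ * ‖spinVec ν a x j‖ := by
    refine (Complex.abs_re_le_norm _).trans ((norm_sum_le _ _).trans_eq ?_)
    exact Finset.sum_congr rfl fun j _ => by rw [norm_mul, RCLike.norm_conj]
  calc fluxComp K ν a i x ^ 2 ≤ (∑ j, ‖killFrame K ν a x i j‖ * ‖spinVec ν a x j‖) ^ 2 := by
        rw [← sq_abs]
        gcongr
    _ ≤ _ := Finset.sum_mul_sq_le_sq_mul_sq _ _ _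

variable [hR : IsContMDiffRiemannianBundle (𝓡 3) ∞ E3 (fun x : S => TangentSpace (𝓡 3) x)]

lemma killNormSq_continuousOn {K : TwoTensor S} (hK : IsAsymptoticallyEuclidean K)
    (ν : SpinorField 𝔰 2) {ψ : OpenPartialHomeomorph S E3}
    (hψ : ψ ∈ IsManifold.maximalAtlas (𝓡 3) ∞ S) :
    ContinuousOn (fun y => killNormSq K ν (𝔰.indexAt (ψ.symm y)) (ψ.symm y)) ψ.target := by
  intro y hy
  have ha := 𝔰.mem_indexAt (ψ.symm y)
  have h1 : ContinuousAt (fun w => killNormSq K ν (𝔰.indexAt (ψ.symm y)) (ψ.symm w)) y := by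
    unfold killNormSq
    exact tendsto_finset_sum _ fun i _ => tendsto_finset_sum _ fun j _ =>
      ((killFrame_contDiffAt hψ hy ha hK ν i j).continuousAt.norm).pow 2
  refine (h1.congr ?_).continuousWithinAt
  filter_upwards [(ψ.symm.continuousAt hy).eventually ((𝔰.isOpen_dom _).mem_nhds ha)] with w hw
  exact killNormSq_change K ν hw (𝔰.mem_indexAt _)

/-- The arithmetic–geometric mean inequality with the coefficient ½ fixed in front of χ²q, so that
the cross term of Green's identity costs only half of the energy. -/
lemma weighted_amgm {χ β w q N : ℝ} (hχ : 0 ≤ χ) (hβ : 0 ≤ β) (hw : 0 ≤ w) (hq : 0 ≤ q) (hN : 0 ≤ N)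
    (h : w ^ 2 ≤ q * N) : 4 * χ * β * w ≤ 1 / 2 * (χ * χ) * q + 8 * β ^ 2 * N := by
  refine le_of_sq_le_sq ?_ (by positivity)
  calc (4 * χ * β * w) ^ 2 = 16 * (χ * β) ^ 2 * w ^ 2 := by ring
    _ ≤ 16 * (χ * β) ^ 2 * (q * N) := by gcongr
    _ ≤ _ := by nlinarith [sq_nonneg (1 / 2 * (χ * χ) * q - 8 * β ^ 2 * N)]

/-- The cutoff profile. -/
def cutoffProfile : ContDiffBump (0 : ℝ) := ⟨1, 4, one_pos, by norm_num⟩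

/-- A cutoff equal to one on `{r ≤ R}` and to zero on `{r ≥ 2R}` in an end. -/
def endCutoff (φ : OpenPartialHomeomorph S E3) (R : ℝ) : S → ℝ :=
  chartExtend φ (radialBump cutoffProfile R) 1

omit [ChartedSpace E3 S] [IsManifold (𝓡 3) ∞ S]
  [RiemannianBundle (fun x : S => TangentSpace (𝓡 3) x)] hR in
lemma endCutoff_mem_Icc (φ : OpenPartialHomeomorph S E3) (R : ℝ) (x : S) :
    0 ≤ endCutoff φ R x ∧ endCutoff φ R x ≤ 1 := by
  by_cases hx : x ∈ φ.source
  · rw [endCutoff, chartExtend_of_mem hx]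
    exact ⟨cutoffProfile.nonneg, cutoffProfile.le_one⟩
  · rw [endCutoff, chartExtend_of_notMem hx]
    exact ⟨zero_le_one, le_rfl⟩

lemma radialBump_cutoffProfile_eq_one {R : ℝ} (hR : 0 < R) {y : E3} (hy : ‖y‖ ≤ R) :
    radialBump cutoffProfile R y = 1 := by
  refine cutoffProfile.one_of_mem_closedBall ?_
  rw [mem_closedBall_zero_iff, Real.norm_of_nonneg (by positivity)]
  change _ ≤ (1 : ℝ)
  rw [div_le_one (by positivity)]
  gcongr

lemma radialBump_cutoffProfile_eq_zero {R : ℝ} (hR : 0 < R) {y : E3} (hy : 2 * R ≤ ‖y‖) :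
    radialBump cutoffProfile R y = 0 := by
  refine cutoffProfile.zero_of_le_dist ?_
  rw [dist_zero_right, Real.norm_of_nonneg (by positivity)]
  change (4 : ℝ) ≤ _
  rw [le_div_iff₀ (by positivity)]
  nlinarith

/-- The part of a chart domain where the coordinates are at least `R`. -/
def outerSet (φ : OpenPartialHomeomorph S E3) (R : ℝ) : Set S := φ.source ∩ φ ⁻¹' {y | R ≤ ‖y‖}

section

variable {φ : OpenPartialHomeomorph S E3} {s R : ℝ} (h : IsFlatEnd φ s) (hR0 : 0 < R)
  (hcl : IsClosed (outerSet φ R))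

include hR0

omit [ChartedSpace E3 S] [IsManifold (𝓡 3) ∞ S]
  [RiemannianBundle (fun x : S => TangentSpace (𝓡 3) x)] hR in
lemma endCutoff_eq_one {x : S} (hx : x ∉ outerSet φ R) : endCutoff φ R x = 1 := by
  by_cases hxs : x ∈ φ.source
  · rw [endCutoff, chartExtend_of_mem hxs]
    exact radialBump_cutoffProfile_eq_one hR0 (not_le.1 fun h => hx ⟨hxs, h⟩).le
  · exact chartExtend_of_notMem hxs _ _

omit [ChartedSpace E3 S] [IsManifold (𝓡 3) ∞ S]
  [RiemannianBundle (fun x : S => TangentSpace (𝓡 3) x)] hR in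
lemma endCutoff_eq_zero {x : S} (hx : x ∈ outerSet φ (2 * R)) : endCutoff φ R x = 0 := by
  rw [endCutoff, chartExtend_of_mem hx.1]
  exact radialBump_cutoffProfile_eq_zero hR0 hx.2

include hcl

omit hR in
lemma realDeriv_endCutoff_eq_zero {x : S} (hx : x ∉ outerSet φ R) (X : TangentSpace (𝓡 3) x) :
    realDeriv (endCutoff φ R) x X = 0 := by
  refine realDeriv_eq_zero (k := 1) (chartExtend_eventuallyEq hcl (fun y hy => ?_) hx) X
  exact radialBump_cutoffProfile_eq_one hR0 (not_le.1 hy).le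

include h

omit hR in
lemma endCutoff_contMDiff : ContMDiff (𝓡 3) 𝓘(ℝ, ℝ) ∞ (endCutoff φ R) :=
  chartExtend_contMDiff h.mem_atlas hcl
    (fun _ hy => radialBump_cutoffProfile_eq_one hR0 (not_le.1 hy).le) (radialBump_contDiff _ _)

omit hR in
lemma abs_realDeriv_endCutoff_le {B : ℝ} (hB : 0 ≤ B)
    (hb : ∀ y v, |fderiv ℝ (radialBump cutoffProfile R) y v| ≤ B / R * ‖v‖) (x : S)
    (X : TangentSpace (𝓡 3) x) :
    |realDeriv (endCutoff φ R) x X| ≤ 2 * (B / R) * Real.sqrt (ip X X) :=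
  h.abs_realDeriv_chartExtend_le hcl
    (fun _ hy => radialBump_cutoffProfile_eq_one hR0 (not_le.1 hy).le) (radialBump_contDiff _ _)
    (by positivity) hb x X

end

/-- The energy cutoff at scale `R`. -/
def coreCutoff (φ : Fin 2 → OpenPartialHomeomorph S E3) (R : ℝ) (x : S) : ℝ :=
  (endCutoff (φ 0) R x * endCutoff (φ 1) R x) * (endCutoff (φ 0) R x * endCutoff (φ 1) R x)

/-- The error term of the energy estimate at scale `R`. -/
def errorDensity (ν : SpinorField 𝔰 2) (φ : Fin 2 → OpenPartialHomeomorph S E3) (B R : ℝ) (x : S) : ℝ :=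
  ∑ i, (outerSet (φ i) R).indicator (fun x => 32 * B ^ 2 * endDensity ν (φ i) x) x

section

variable {φ : Fin 2 → OpenPartialHomeomorph S E3} {s R : ℝ} (h : ∀ i, IsFlatEnd (φ i) s)
  (hdis : Disjoint (φ 0).source (φ 1).source) (hR0 : 0 < R)
  (hcl : ∀ i, IsClosed (outerSet (φ i) R))

omit hR in
lemma errorDensity_nonneg (ν : SpinorField 𝔰 2) (φ : Fin 2 → OpenPartialHomeomorph S E3) (B R : ℝ)
    (x : S) : 0 ≤ errorDensity ν φ B R x :=
  Finset.sum_nonneg fun i _ => Set.indicator_nonneg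
    (fun x _ => mul_nonneg (by positivity) (endDensity_nonneg ν (φ i) x)) x

include h hR0 hcl

omit hR in
lemma coreCutoff_contMDiff : ContMDiff (𝓡 3) 𝓘(ℝ, ℝ) ∞ (coreCutoff φ R) := by
  have h0 := endCutoff_contMDiff (h 0) hR0 (hcl 0)
  have h1 := endCutoff_contMDiff (h 1) hR0 (hcl 1)
  exact (h0.mul h1).mul (h0.mul h1)

omit hR in
lemma realDeriv_coreCutoff (x : S) (X : TangentSpace (𝓡 3) x) :
    realDeriv (coreCutoff φ R) x X = 2 * (endCutoff (φ 0) R x * endCutoff (φ 1) R x) *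
      (endCutoff (φ 0) R x * realDeriv (endCutoff (φ 1) R) x X +
        endCutoff (φ 1) R x * realDeriv (endCutoff (φ 0) R) x X) := by
  have h0 := (endCutoff_contMDiff (h 0) hR0 (hcl 0)).mdifferentiableAt (x := x) (by simp)
  have h1 := (endCutoff_contMDiff (h 1) hR0 (hcl 1)).mdifferentiableAt (x := x) (by simp)
  have h01 : MDifferentiableAt (𝓡 3) 𝓘(ℝ, ℝ)
      (fun z => endCutoff (φ 0) R z * endCutoff (φ 1) R z) x := h0.mul h1
  have e := realDeriv_mul h01 h01 X
  rw [realDeriv_mul h0 h1] at e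
  refine Eq.trans e ?_
  ring

include hdis

omit hR in
/-- The pointwise energy estimate. -/
lemma half_coreCutoff_mul_le (K : TwoTensor S) (ν : SpinorField 𝔰 2) {B : ℝ} (hB : 0 ≤ B)
    (hb : ∀ y v, |fderiv ℝ (radialBump cutoffProfile R) y v| ≤ B / R * ‖v‖) (x : S) :
    1 / 2 * coreCutoff φ R x * killNormSq K ν (𝔰.indexAt x) x
      ≤ greenIntegrand K ν (coreCutoff φ R) x + errorDensity ν φ B R x := by
  set q := killNormSq K ν (𝔰.indexAt x) x with hq
  set N := vecNormSq ν (𝔰.indexAt x) x with hN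
  set J := flux K ν (𝔰.indexAt x) x with hJ
  have hq0 : 0 ≤ q := killNormSq_nonneg K ν _ x
  have hN0 : 0 ≤ N := vecNormSq_nonneg ν _ x
  have hw : Real.sqrt (ip J J) ^ 2 ≤ q * N := by
    rw [Real.sq_sqrt (by rw [ip]; exact real_inner_self_nonneg)]
    exact ip_flux_le K ν (𝔰.mem_indexAt x)
  have hc0 := endCutoff_mem_Icc (φ 0) R x
  have hc1 := endCutoff_mem_Icc (φ 1) R x
  set a := endCutoff (φ 0) R x
  set b := endCutoff (φ 1) R x
  have hf : coreCutoff φ R x = a * b * (a * b) := rfl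
  have hab : 0 ≤ a * b := mul_nonneg hc0.1 hc1.1
  have hin : ∀ i, x ∈ outerSet (φ i) R → 32 * B ^ 2 * endDensity ν (φ i) x ≤ errorDensity ν φ B R x := by
    intro i hi
    have := Finset.single_le_sum (f := fun i => (outerSet (φ i) R).indicator
      (fun x => 32 * B ^ 2 * endDensity ν (φ i) x) x) (fun i _ => Set.indicator_nonneg
        (fun x _ => mul_nonneg (by positivity) (endDensity_nonneg ν (φ i) x)) x) (Finset.mem_univ i)
    simp only [Set.indicator_of_mem hi] at this
    exact this
  -- Where χ has nonzero gradient and does not vanish, R ≤ r ≤ 2R. The gradient bound B/R is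
  -- therefore at most 2B/r, which turns 8(B/R)²|ν|² into 32B²|ν|²/r².
  have key : ∀ i, x ∈ outerSet (φ i) R → (x ∈ outerSet (φ i) (2 * R) → a * b = 0) →
      ∀ D, |D| ≤ 2 * (B / R) * Real.sqrt (ip J J) → 2 * (a * b) * |D|
        ≤ 1 / 2 * (a * b * (a * b)) * q + errorDensity ν φ B R x := by
    intro i hi hz D hD
    by_cases h2 : x ∈ outerSet (φ i) (2 * R)
    · rw [hz h2]
      simpa using errorDensity_nonneg ν φ B R x
    · have hlt : ‖φ i x‖ < 2 * R := not_le.1 fun h => h2 ⟨hi.1, h⟩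
      have hle : R ≤ ‖φ i x‖ := hi.2
      have hp : 0 < ‖φ i x‖ := hR0.trans_le hle
      have h3 := weighted_amgm hab (by positivity : 0 ≤ B / R) (Real.sqrt_nonneg (ip J J)) hq0 hN0 hw
      have h4 : 8 * (B / R) ^ 2 * N ≤ 32 * B ^ 2 * endDensity ν (φ i) x := by
        rw [endDensity, ← hN, div_pow, mul_comm N, ← mul_assoc]
        refine mul_le_mul_of_nonneg_right ?_ hN0
        rw [← mul_div_assoc, ← div_eq_mul_inv, div_le_div_iff₀ (by positivity) (by positivity)]
        have h5 : ‖φ i x‖ ^ 2 ≤ 4 * R ^ 2 := by nlinarith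
        nlinarith [mul_le_mul_of_nonneg_left h5 (by positivity : 0 ≤ 8 * B ^ 2)]
      calc 2 * (a * b) * |D| ≤ 2 * (a * b) * (2 * (B / R) * Real.sqrt (ip J J)) := by gcongr
        _ = 4 * (a * b) * (B / R) * Real.sqrt (ip J J) := by ring
        _ ≤ _ := by linarith [hin i hi]
  rw [greenIntegrand, realDeriv_coreCutoff h hR0 hcl, hf]
  change 1 / 2 * (a * b * (a * b)) * q ≤ 2 * (a * b) * (a * realDeriv (endCutoff (φ 1) R) x J +
    b * realDeriv (endCutoff (φ 0) R) x J) + a * b * (a * b) * q + errorDensity ν φ B R x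
  have hfq : 0 ≤ a * b * (a * b) * q := by positivity
  -- The ends are disjoint, so at most one of the two cutoffs varies at a given point and no cross
  -- terms arise.
  have hnot : ¬ (x ∈ outerSet (φ 0) R ∧ x ∈ outerSet (φ 1) R) := fun hx =>
    Set.disjoint_left.1 hdis hx.1.1 hx.2.1
  have hD : ∀ i, |realDeriv (endCutoff (φ i) R) x J| ≤ 2 * (B / R) * Real.sqrt (ip J J) := fun i =>
    abs_realDeriv_endCutoff_le (h i) hR0 (hcl i) hB hb x J
  have hterm : ∀ {c D : ℝ}, 0 ≤ c → c ≤ 1 → -(2 * (a * b) * |D|) ≤ 2 * (a * b) * (c * D) := by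
    intro c D hc hc1
    have h1 : -|D| ≤ c * D := by
      have h2 : |c * D| ≤ |D| := by
        rw [abs_mul, abs_of_nonneg hc]
        exact mul_le_of_le_one_left (abs_nonneg _) hc1
      exact (neg_le_neg h2).trans (neg_abs_le _)
    have := mul_le_mul_of_nonneg_left h1 (by positivity : 0 ≤ 2 * (a * b))
    linarith
  by_cases h0 : x ∈ outerSet (φ 0) R
  · have h1 : x ∉ outerSet (φ 1) R := fun h => hnot ⟨h0, h⟩
    rw [realDeriv_endCutoff_eq_zero hR0 (hcl 1) h1]
    have k := key 0 h0 (fun hx => by rw [show a = 0 from endCutoff_eq_zero hR0 hx, zero_mul]) _ (hD 0)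
    have t := hterm (D := realDeriv (endCutoff (φ 0) R) x J) hc1.1 hc1.2
    rw [mul_zero, zero_add]
    linarith
  · rw [realDeriv_endCutoff_eq_zero hR0 (hcl 0) h0]
    by_cases h1 : x ∈ outerSet (φ 1) R
    · have k := key 1 h1 (fun hx => by rw [show b = 0 from endCutoff_eq_zero hR0 hx, mul_zero]) _ (hD 1)
      have t := hterm (D := realDeriv (endCutoff (φ 1) R) x J) hc0.1 hc0.2
      rw [mul_zero, add_zero]
      linarith
    · rw [realDeriv_endCutoff_eq_zero hR0 (hcl 1) h1]
      have := errorDensity_nonneg ν φ B R x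
      rw [mul_zero, mul_zero, add_zero, mul_zero]
      linarith

end

end Energy

/-! ### From L(ν) = 0 to Φ(ν) = 0 -/

section ApproxKilling

open Filter Topology

variable {S : Type*} [TopologicalSpace S] [ChartedSpace E3 S] [IsManifold (𝓡 3) ∞ S]
  [RiemannianBundle (fun x : S => TangentSpace (𝓡 3) x)]
  [hR : IsContMDiffRiemannianBundle (𝓡 3) ∞ E3 (fun x : S => TangentSpace (𝓡 3) x)]
  [MeasurableSpace S] [BorelSpace S] [SecondCountableTopology S]
  {ι : Type*} {𝔰 : SpinStructure S ι}

/-- A continuous density with vanishing integral over an open set vanishes there. -/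
lemma killNormSq_eq_zero_of_lintegral {K : TwoTensor S} (hK : IsAsymptoticallyEuclidean K)
    (ν : SpinorField 𝔰 2) {W : Set S} (hW : IsOpen W)
    (h : ∫⁻ x in W, ENNReal.ofReal (killNormSq K ν (𝔰.indexAt x) x) ∂(riemannianVolume S) = 0)
    {x : S} (hx : x ∈ W) : killNormSq K ν (𝔰.indexAt x) x = 0 := by
  set ψ := (chartAt E3 x).restr W with hψ
  have hψm : ψ ∈ IsManifold.maximalAtlas (𝓡 3) ∞ S :=
    restr_mem_maximalAtlas _ (IsManifold.chart_mem_maximalAtlas x) hW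
  have hxs : x ∈ ψ.source := by
    rw [hψ, OpenPartialHomeomorph.restr_source, hW.interior_eq]
    exact ⟨mem_chart_source E3 x, hx⟩
  have hsW : ψ.source ⊆ W := by
    rw [hψ, OpenPartialHomeomorph.restr_source, hW.interior_eq]
    exact Set.inter_subset_right
  have hc := killNormSq_continuousOn hK ν hψm
  have h1 : ∫⁻ x in ψ.source, ENNReal.ofReal (killNormSq K ν (𝔰.indexAt x) x) ∂(riemannianVolume S) = 0 :=
    le_antisymm ((lintegral_mono_set hsW).trans_eq h) bot_le
  rw [lintegral_chart hψm (F := fun x => killNormSq K ν (𝔰.indexAt x) x) hc] at h1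
  have hprod := (volDensity_continuousOn hψm).mul hc
  have h2 : ∀ᵐ y ∂(volume.restrict ψ.target),
      volDensity ψ y * killNormSq K ν (𝔰.indexAt (ψ.symm y)) (ψ.symm y) = 0 := by
    have hm : AEMeasurable (fun y => ENNReal.ofReal (volDensity ψ y) *
        ENNReal.ofReal (killNormSq K ν (𝔰.indexAt (ψ.symm y)) (ψ.symm y))) (volume.restrict ψ.target) :=
      (((volDensity_continuousOn hψm).aemeasurable ψ.open_target.measurableSet).ennreal_ofReal).mul
        ((hc.aemeasurable ψ.open_target.measurableSet).ennreal_ofReal)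
    filter_upwards [(lintegral_eq_zero_iff' hm).1 h1] with y hy
    have hv : 0 ≤ volDensity ψ y := Real.sqrt_nonneg _
    rw [Pi.zero_apply, ← ENNReal.ofReal_mul hv, ENNReal.ofReal_eq_zero] at hy
    exact le_antisymm hy (mul_nonneg hv (killNormSq_nonneg K ν _ _))
  have h3 := Measure.eqOn_open_of_ae_eq h2 ψ.open_target hprod continuousOn_const
    (ψ.map_source hxs)
  have hpos : volDensity ψ (ψ x) ≠ 0 := by
    rw [volDensity_eq (𝔰 := 𝔰) hψm (ψ.map_source hxs)]
    exact inv_ne_zero (abs_ne_zero.2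
      (frameJet 𝔰 _ hψm (ψ.map_source hxs) (𝔰.mem_indexAt _)).det_ne_zero)
  have h4 := (mul_eq_zero.1 h3).resolve_left hpos
  rwa [ψ.left_inv hxs] at h4

/-- The error is a multiple of |ν|²/r² over the regions r ≥ R. This density is integrable in a flat
end, and the regions decrease to the empty set. -/
lemma tendsto_integral_errorDensity {ν : SpinorField 𝔰 2} {O : S} (hν : ν.MemHInfty O (-1 / 2))
    {φ : Fin 2 → OpenPartialHomeomorph S E3} {s : ℝ} (h : ∀ i, IsFlatEnd (φ i) s)
    (hcl : ∀ i, ∀ c, 2 * s ≤ c → IsClosed (outerSet (φ i) c)) (B : ℝ) :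
    (∀ n : ℕ, Integrable (errorDensity ν φ B (2 * s + n)) (riemannianVolume S)) ∧
    Tendsto (fun n : ℕ => ∫ x, errorDensity ν φ B (2 * s + n) x ∂(riemannianVolume S)) atTop (𝓝 0) := by
  have hs : 0 < s := (h 0).pos
  have hle : ∀ n : ℕ, 2 * s ≤ 2 * s + n := fun n => le_add_of_nonneg_right n.cast_nonneg
  have hsm : ∀ i (n : ℕ), MeasurableSet (outerSet (φ i) (2 * s + n)) := fun i n =>
    (hcl i _ (hle n)).measurableSet
  have hsub : ∀ i (n : ℕ), outerSet (φ i) (2 * s + n) ⊆ (outerChart (φ i) (3 / 2 * s)).source := by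
    intro i n x hx
    rw [outerChart_source]
    refine ⟨hx.1, ?_⟩
    have h1 : 2 * s + n ≤ ‖φ i x‖ := hx.2
    show 3 / 2 * s < ‖φ i x‖
    linarith [hle n]
  have hI : ∀ i (n : ℕ), IntegrableOn (fun x => 32 * B ^ 2 * endDensity ν (φ i) x)
      (outerSet (φ i) (2 * s + n)) (riemannianVolume S) := fun i n =>
    (((h i).integrableOn_endDensity (by linarith) hν).mono_set (hsub i n)).const_mul _
  have hind : ∀ i (n : ℕ), Integrable ((outerSet (φ i) (2 * s + n)).indicator
      (fun x => 32 * B ^ 2 * endDensity ν (φ i) x)) (riemannianVolume S) := fun i n =>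
    (hI i n).integrable_indicator (hsm i n)
  refine ⟨fun n => integrable_finsetSum _ fun i _ => hind i n, ?_⟩
  have hval : ∀ n : ℕ, ∫ x, errorDensity ν φ B (2 * s + n) x ∂(riemannianVolume S)
      = ∑ i, ∫ x in outerSet (φ i) (2 * s + n), 32 * B ^ 2 * endDensity ν (φ i) x
        ∂(riemannianVolume S) := by
    intro n
    refine (integral_finsetSum _ fun i _ => hind i n).trans ?_
    exact Finset.sum_congr rfl fun i _ => integral_indicator (hsm i n)
  simp only [hval]
  rw [show (0 : ℝ) = ∑ i : Fin 2, (0 : ℝ) by simp]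
  refine tendsto_finset_sum _ fun i _ => ?_
  have hanti : Antitone fun n : ℕ => outerSet (φ i) (2 * s + n) := by
    intro m n hmn x hx
    refine ⟨hx.1, ?_⟩
    have h1 : 2 * s + n ≤ ‖φ i x‖ := hx.2
    have h2 : (m : ℝ) ≤ n := by exact_mod_cast hmn
    show 2 * s + m ≤ ‖φ i x‖
    linarith
  have hlim := tendsto_setIntegral_of_antitone (hsm i) hanti ⟨0, hI i 0⟩
  have hempty : ⋂ n : ℕ, outerSet (φ i) (2 * s + n) = ∅ := by
    refine Set.eq_empty_of_forall_notMem fun x hx => ?_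
    obtain ⟨n, hn⟩ := exists_nat_gt ‖φ i x‖
    have h1 : 2 * s + n ≤ ‖φ i x‖ := (Set.mem_iInter.1 hx n).2
    linarith
  rwa [hempty, Measure.restrict_empty, integral_zero_measure] at hlim

/-- An approximate Killing spinor in `H^∞_{-1/2}` is a Killing spinor. -/
theorem SpinorField.IsApproxKilling.isSpatialKilling [T2Space S] [ConnectedSpace S]
    {K : TwoTensor S} (hK : IsAsymptoticallyEuclidean K) {ν : SpinorField 𝔰 2} {O : S}
    (hν : ν.MemHInfty O (-1 / 2)) (hL : ν.IsApproxKilling K) : ν.IsSpatialKilling K := by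
  obtain ⟨φ, s, hf, hdis, hcl, hcpt⟩ := hK.exists_ends 𝔰
  have hs : 0 < s := (hf 0).pos
  obtain ⟨B, hB, hb⟩ := exists_norm_fderiv_radialBump_le cutoffProfile
    (by change (0 : ℝ) + 4 ≤ 4; norm_num)
  obtain ⟨hint, hlim⟩ := tendsto_integral_errorDensity hν hf hcl B
  set R : ℕ → ℝ := fun n => 2 * s + n with hRdef
  have hRle : ∀ n, 2 * s ≤ R n := fun n => le_add_of_nonneg_right n.cast_nonneg
  have hR0 : ∀ n, 0 < R n := fun n => by linarith [hRle n]
  have hclR : ∀ n i, IsClosed (outerSet (φ i) (R n)) := fun n i => hcl i _ (hRle n)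
  set W : ℕ → Set S := fun n => (outerSet (φ 0) (R n))ᶜ ∩ (outerSet (φ 1) (R n))ᶜ with hW
  have hWo : ∀ n, IsOpen (W n) := fun n =>
    (hclR n 0).isOpen_compl.inter (hclR n 1).isOpen_compl
  have hfW : ∀ n, ∀ x ∈ W n, coreCutoff φ (R n) x = 1 := by
    intro n x hx
    rw [coreCutoff, endCutoff_eq_one (hR0 n) hx.1, endCutoff_eq_one (hR0 n) hx.2]
    norm_num
  have hsupp : ∀ n, HasCompactSupport (coreCutoff φ (R n)) := by
    intro n
    refine HasCompactSupport.intro (hcpt (2 * R n) (by linarith [hRle n, hR0 n])) fun x hx => ?_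
    rw [Set.mem_setOf_eq, not_forall] at hx
    obtain ⟨i, hi⟩ := hx
    rw [Classical.not_imp, not_le] at hi
    have h0 : endCutoff (φ i) (R n) x = 0 := endCutoff_eq_zero (hR0 n) ⟨hi.1, hi.2.le⟩
    fin_cases i
    · have h0 : endCutoff (φ 0) (R n) x = 0 := h0
      rw [coreCutoff, h0, zero_mul, zero_mul]
    · have h0 : endCutoff (φ 1) (R n) x = 0 := h0
      rw [coreCutoff, h0, mul_zero, zero_mul]
  -- Green's integral vanishes, so the integrated pointwise estimate leaves the error term alone.
  -- The sum of both integrands is nonnegative, which permits enlarging the domain from W n to the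
  -- whole manifold.
  have hen : ∀ n, ∫⁻ x in W n, ENNReal.ofReal (1 / 2 * killNormSq K ν (𝔰.indexAt x) x)
      ∂(riemannianVolume S)
      ≤ ENNReal.ofReal (∫ x, errorDensity ν φ B (R n) x ∂(riemannianVolume S)) := by
    intro n
    obtain ⟨hG, hG0⟩ := green_identity hK ν hL (coreCutoff_contMDiff hf (hR0 n) (hclR n)) (hsupp n)
    have hpt := half_coreCutoff_mul_le hf hdis (hR0 n) (hclR n) K ν hB (hb (R n) (hR0 n))
    have hnn : ∀ x, 0 ≤ greenIntegrand K ν (coreCutoff φ (R n)) x + errorDensity ν φ B (R n) x :=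
      fun x => (mul_nonneg (mul_nonneg (by norm_num) (mul_self_nonneg _))
        (killNormSq_nonneg K ν _ x)).trans (hpt x)
    calc _ ≤ ∫⁻ x in W n, ENNReal.ofReal (greenIntegrand K ν (coreCutoff φ (R n)) x +
          errorDensity ν φ B (R n) x) ∂(riemannianVolume S) := by
          refine setLIntegral_mono' (hWo n).measurableSet fun x hx => ENNReal.ofReal_le_ofReal ?_
          have := hpt x
          rwa [hfW n x hx, mul_one] at this
      _ ≤ ∫⁻ x, ENNReal.ofReal (greenIntegrand K ν (coreCutoff φ (R n)) x +
          errorDensity ν φ B (R n) x) ∂(riemannianVolume S) := setLIntegral_le_lintegral _ _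
      _ = ENNReal.ofReal (∫ x, (greenIntegrand K ν (coreCutoff φ (R n)) x +
          errorDensity ν φ B (R n) x) ∂(riemannianVolume S)) :=
          (ofReal_integral_eq_lintegral_ofReal (hG.add (hint n)) (Eventually.of_forall hnn)).symm
      _ = _ := by rw [integral_add hG (hint n), hG0, zero_add]
  have hmono : ∀ m n, m ≤ n → W m ⊆ W n := by
    intro m n hmn
    have hle : R m ≤ R n := by
      have : (m : ℝ) ≤ n := by exact_mod_cast hmn
      simp only [hRdef]
      linarith
    have h1 : ∀ i, outerSet (φ i) (R n) ⊆ outerSet (φ i) (R m) := fun i x hx =>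
      ⟨hx.1, hle.trans hx.2⟩
    exact Set.inter_subset_inter (Set.compl_subset_compl.2 (h1 0)) (Set.compl_subset_compl.2 (h1 1))
  have hzero : ∀ m, ∫⁻ x in W m, ENNReal.ofReal (killNormSq K ν (𝔰.indexAt x) x)
      ∂(riemannianVolume S) = 0 := by
    intro m
    have h1 : ∫⁻ x in W m, ENNReal.ofReal (1 / 2 * killNormSq K ν (𝔰.indexAt x) x)
        ∂(riemannianVolume S) = 0 := by
      -- The energy on a fixed region W m is bounded by the error at every larger scale n, and these
      -- errors tend to zero.
      refine le_antisymm ?_ bot_le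
      have hl := ENNReal.tendsto_ofReal hlim
      rw [ENNReal.ofReal_zero] at hl
      refine ge_of_tendsto hl ?_
      filter_upwards [eventually_ge_atTop m] with n hn
      exact (lintegral_mono_set (hmono m n hn)).trans (hen n)
    simp only [ENNReal.ofReal_mul (by norm_num : (0 : ℝ) ≤ 1 / 2)] at h1
    rw [lintegral_const_mul' _ _ ENNReal.ofReal_ne_top] at h1
    exact (mul_eq_zero.1 h1).resolve_left (by simp)
  have hex : ∀ x, ∃ n, x ∈ W n := by
    intro x
    obtain ⟨n, hn⟩ := exists_nat_gt (max ‖φ 0 x‖ ‖φ 1 x‖)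
    have hlt : ∀ i : Fin 2, ‖φ i x‖ < R n := by
      refine Fin.forall_fin_two.2 ⟨?_, ?_⟩ <;> simp only [hRdef]
      · linarith [le_max_left ‖φ 0 x‖ ‖φ 1 x‖]
      · linarith [le_max_right ‖φ 0 x‖ ‖φ 1 x‖]
    exact ⟨n, fun h => absurd h.2 (not_le.2 (hlt 0)), fun h => absurd h.2 (not_le.2 (hlt 1))⟩
  refine isSpatialKilling_of_killFrame fun a x hx => ?_
  obtain ⟨n, hn⟩ := hex x
  have hq := killNormSq_eq_zero_of_lintegral hK ν (hWo n) (hzero n) hn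
  rw [killNormSq_change K ν (𝔰.mem_indexAt x) hx, killNormSq,
    Finset.sum_eq_zero_iff_of_nonneg fun _ _ => Finset.sum_nonneg fun _ _ => sq_nonneg _] at hq
  funext i j
  have hi := hq i (Finset.mem_univ i)
  rw [Finset.sum_eq_zero_iff_of_nonneg fun _ _ => sq_nonneg _] at hi
  exact norm_eq_zero.1 (sq_eq_zero_iff.1 (hi j (Finset.mem_univ j)))

end ApproxKilling

end KillingSpinor

end

theorem mainTheorem7
    {S : Type*} [TopologicalSpace S] [T2Space S] [SecondCountableTopology S] [ConnectedSpace S]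
    [ChartedSpace (EuclideanSpace ℝ (Fin 3)) S] [IsManifold (𝓡 3) ∞ S]
    [MeasurableSpace S] [BorelSpace S]
    [RiemannianBundle (fun x : S => TangentSpace (𝓡 3) x)]
    [IsContMDiffRiemannianBundle (𝓡 3) ∞ (EuclideanSpace ℝ (Fin 3))
      (fun x : S => TangentSpace (𝓡 3) x)]
    (K : KillingSpinor.TwoTensor S) (hK : KillingSpinor.IsAsymptoticallyEuclidean K)
    {ι : Type*} (𝔰 : KillingSpinor.SpinStructure S ι) (O : S)
    (ν : KillingSpinor.SpinorField 𝔰 2) (hν : ν.MemHInfty O (-1 / 2)) :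
    (ν.IsSpatialKilling K → ν.IsZero) ∧ (ν.IsApproxKilling K → ν.IsZero) := by
  have h1 : ν.IsSpatialKilling K → ν.IsZero := fun h => h.isZero hK hν
  exact ⟨h1, fun h => h1 (h.isSpatialKilling hK hν)⟩
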